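/- Let $k$ be a field of characteristic zero. A modular graph of type $(g,n)$ is a finite connected graph $\gamma$ with legs labeled by $1,\dots,n$ and with a genus $g(v)\ge 0$ at every vertex, such that $2g(v)+n(v)\ge 3$ for all $v$ (where $n(v)$ is the number of half-edges at $v$) and $g=\beta_1(\gamma)+\sum_v g(v)$. Let $\mathfrak K(\gamma)$ be the top exterior power of the span of the set $E(\gamma)$ of edges, placed in degree $|E(\gamma)|$. For a family $A(g,n)$ of graded $S_n$-modules put $A(\gamma)=\bigotimes_v A(g(v),n(v))$. Let $H_\ast(\Gamma)=H_\ast(\mathsf{FT}(\Sigma^{-1}s\mathsf{Lie}))$ be the modular operad of Lie graph homology over $k$, i.e. the homology of the Feynman transform of the $\mathfrak K$-twisted modular operad $\Sigma^{-1}s\mathsf{Lie}$ obtained from the cyclic operad $\mathsf{Lie}$ by operadic desuspension, a shift, and extension by zero to positive genus. A weak ($A_\infty$-) modular operad with zero internal differential is a family $A$ of graded $S_n$-modules with operations $\mathfrak K(\gamma)\otimes A(\gamma)\to A(g,n)$ of degree $-1$, one for every modular graph $\gamma$ with at least one edge, which are compatible with isomorphisms of graphs and with the symmetric group actions, and such that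 for every modular graph $\gamma$ the signed sum of the twofold compositions $\mu_{\gamma/\delta}\circ\mu_\delta$ over all connected subgraphs $\delta\subset\gamma$ with $\emptyset\ne E(\delta)\ne E(\gamma)$ vanishes. It extends a modular operad if forgetting the operations of graphs with more than one edge gives that modular operad. Its weak Feynman transform is the cochain complex $$\mathsf{ft}(A)(g,n)=\bigoplus_\gamma A(\gamma)^\ast\otimes_{\mathrm{Aut}(\gamma)}\mathfrak K(\gamma),$$ the sum being over isomorphism classes of modular graphs of type $(g,n)$; its differential is the linear dual of the sum of all operations, and its cohomological degree is the number of edges plus the sum of the degrees of the vertex labels. Let $h_\ast(\Gamma)$ be any weak modular operad with zero internal differential that extends the modular operad $H_\ast(\Gamma)$. Call a vertex $v$ of a graph with homogeneous vertex labels an egg if the label of $v$ has degree $0$ and, moreover, $g(v)>0$ or there is a tadpole at $v$. For all $(g,n)$ let $Z(g,n)\subset \mathsf{ft}(h_\ast(\Gamma))(g,n)$ be the span of all graphs with homogeneous vertex labels that have at least one egg. Then, for all $(g,n)$, the graded vector space $Z(g,n)$ is a subcomplex of $\mathsf{ft}(h_\ast(\Gamma))(g,n)$, and it is acyclic: its cohomology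 vanishes in every degree. -/

import Mathlib

noncomputable section

/-!
# Graphs

Legs are labelled by a type `X`, which is finite in all uses; a graph of type `(g, n)` is a graph
of total genus `g` whose legs are labelled by `Fin n`.
-/

/-- A finite graph with vertex set `V`, edge set `E`, and half-edges `(E × Bool) ⊕ X`: the two
halves of the edge `e` are `(e, false)` and `(e, true)`, and the leg labelled by `x` is `x`. The map
`vert` sends a half-edge to the vertex to which it is adjacent, and `genus` labels the vertices. The
sets `V` and `E` are ordered: the order of `E` fixes a generator of the top exterior power of the
span of `E`, and that of `V` the order of the factors in tensor products over the vertices. -/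
structure MGraph (X : Type) : Type 1 where
  V : Type
  E : Type
  [fintypeV : Fintype V]
  [fintypeE : Fintype E]
  [orderV : LinearOrder V]
  [orderE : LinearOrder E]
  vert : (E × Bool) ⊕ X → V
  genus : V → ℕ

attribute [instance] MGraph.fintypeV MGraph.fintypeE MGraph.orderV MGraph.orderE

namespace MGraph

/-- The half-edges. -/
abbrev H {X : Type} (γ : MGraph X) : Type := (γ.E × Bool) ⊕ X

/-- The half-edges adjacent to the vertex `v`. -/
abbrev Flag {X : Type} (γ : MGraph X) (v : γ.V) : Type := {h : γ.H // γ.vert h = v}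

/-- The vertices `u` and `v` are joined by a path with edges in `S`. -/
def Joined {X : Type} (γ : MGraph X) (S : Finset γ.E) (u v : γ.V) : Prop :=
  Relation.ReflTransGen
    (fun a b => ∃ e ∈ S, ∃ c : Bool, γ.vert (Sum.inl (e, c)) = a ∧ γ.vert (Sum.inl (e, !c)) = b) u v

/-- The graph is nonempty and connected. -/
def Connected {X : Type} (γ : MGraph X) : Prop :=
  Nonempty γ.V ∧ ∀ u v : γ.V, γ.Joined Finset.univ u v

/-- The total genus of a connected graph: its first Betti number `|E| - |V| + 1` plus the sum of
the genera of its vertices. -/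
def totalGenus {X : Type} (γ : MGraph X) : ℕ :=
  Fintype.card γ.E + 1 - Fintype.card γ.V + ∑ v, γ.genus v

/-- A modular graph: connected, and stable at every vertex. -/
structure IsModular {X : Type} (γ : MGraph X) : Prop where
  finite_legs : Finite X
  connected : γ.Connected
  stable : ∀ v, 3 ≤ 2 * γ.genus v + Nat.card (γ.Flag v)

/-- The edge `e` is a tadpole at the vertex `v`. -/
def IsTadpoleAt {X : Type} (γ : MGraph X) (e : γ.E) (v : γ.V) : Prop :=
  ∀ c : Bool, γ.vert (Sum.inl (e, c)) = v

/-- Isomorphisms of graphs inducing the bijection `σ` on the labels of the legs. They need not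
preserve the orders of the vertices and of the edges, and may exchange the two halves of an
edge. -/
structure GIso {X Y : Type} (γ : MGraph X) (γ' : MGraph Y) (σ : X ≃ Y) where
  onV : γ.V ≃ γ'.V
  onE : γ.E ≃ γ'.E
  onEnds : γ.E × Bool ≃ γ'.E × Bool
  onEnds_fst : ∀ p, (onEnds p).1 = onE p.1
  vert_comm : ∀ h : γ.H, γ'.vert (Sum.map onEnds σ h) = onV (γ.vert h)
  genus_comm : ∀ v, γ'.genus (onV v) = γ.genus v

namespace GIso

variable {X Y : Type} {γ : MGraph X} {γ' : MGraph Y} {σ : X ≃ Y}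

/-- The bijection induced on the half-edges at a vertex. -/
def onFlag (f : GIso γ γ' σ) (v : γ.V) : γ.Flag v ≃ γ'.Flag (f.onV v) :=
  (Equiv.sumCongr f.onEnds σ).subtypeEquiv (fun h => by
    have := f.vert_comm h
    simp only [Equiv.sumCongr_apply, this, EmbeddingLike.apply_eq_iff_eq])

/-- The Koszul sign of the permutation of the vertices, for labels of degrees `d`. -/
def vertexSign (f : GIso γ γ' σ) (d : γ.V → ℕ) : ℤ :=
  (-1) ^ Nat.card {p : γ.V × γ.V // p.1 < p.2 ∧ f.onV p.2 < f.onV p.1 ∧ Odd (d p.1) ∧ Odd (d p.2)}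

/-- The sign of the permutation of the edges in `S`. -/
def edgeSign (f : GIso γ γ' σ) (S : Finset γ.E) : ℤ :=
  (-1) ^ Nat.card {p : γ.E × γ.E // p.1 ∈ S ∧ p.2 ∈ S ∧ p.1 < p.2 ∧ f.onE p.2 < f.onE p.1}

end GIso

/-!
## Subgraphs and their contraction
-/

section Contraction

variable {X : Type} (γ : MGraph X) (S : Finset γ.E)

/-- The vertex `v` is adjacent to an edge in `S`. -/
def Touched (v : γ.V) : Prop := ∃ e ∈ S, ∃ c : Bool, γ.vert (Sum.inl (e, c)) = v

/-- The edges in `S`, with their vertices, form a nonempty connected subgraph. -/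
def IsConnectedSubset : Prop :=
  S.Nonempty ∧ ∀ u v, γ.Touched S u → γ.Touched S v → γ.Joined S u v

/-- The half-edges that do not belong to edges in `S`. -/
abbrev Rest : Type := ({e : γ.E // e ∉ S} × Bool) ⊕ X

/-- The inclusion of these half-edges. -/
def restIncl : γ.Rest S → γ.H := Sum.map (Prod.map Subtype.val id) id

/-- The legs of the subgraph with edge set `S`. -/
abbrev SubLeg : Type := {h : γ.Rest S // γ.Touched S (γ.vert (γ.restIncl S h))}

open Classical in
/-- The subgraph with edge set `S`. Its vertices keep all their half-edges, and those that do not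
belong to edges in `S` become legs. -/
def sub : MGraph (γ.SubLeg S) where
  V := {v : γ.V // γ.Touched S v}
  E := {e : γ.E // e ∈ S}
  vert := Sum.elim (fun p => ⟨γ.vert (Sum.inl (p.1.1, p.2)), p.1.1, p.1.2, p.2, rfl⟩)
    (fun l => ⟨γ.vert (γ.restIncl S l.1), l.2⟩)
  genus v := γ.genus v.1

open Classical in
/-- The graph `γ / S` in which the subgraph with edge set `S` is contracted to one vertex `⊥`,
which comes first in the order of the vertices. -/
def contract : MGraph X where
  V := WithBot {v : γ.V // ¬ γ.Touched S v}
  E := {e : γ.E // e ∉ S}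
  fintypeV := inferInstanceAs (Fintype (Option {v : γ.V // ¬ γ.Touched S v}))
  vert h := if hv : γ.Touched S (γ.vert (γ.restIncl S h)) then ⊥ else
    ((⟨γ.vert (γ.restIncl S h), hv⟩ : {v : γ.V // ¬ γ.Touched S v}) :
      WithBot {v : γ.V // ¬ γ.Touched S v})
  genus := WithBot.recBotCoe (γ.sub S).totalGenus (fun v => γ.genus v.1)

theorem restIncl_injective : Function.Injective (γ.restIncl S) :=
  (Subtype.val_injective.prodMap Function.injective_id).sumMap Function.injective_id

/-- The half-edges at the new vertex are the legs of the contracted subgraph. -/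
def newFlag : γ.SubLeg S ≃ (γ.contract S).Flag (⊥ : WithBot {v : γ.V // ¬ γ.Touched S v}) :=
  Equiv.subtypeEquivRight (fun h => by
    by_cases hv : γ.Touched S (γ.vert (γ.restIncl S h)) <;> simp [contract, hv])

theorem contract_vert_eq_coe (v : {v : γ.V // ¬ γ.Touched S v}) (h : γ.Rest S) :
    (γ.contract S).vert h = (v : WithBot {v : γ.V // ¬ γ.Touched S v}) ↔
      γ.vert (γ.restIncl S h) = v.1 := by
  by_cases hv : γ.Touched S (γ.vert (γ.restIncl S h))
  · have hne : γ.vert (γ.restIncl S h) ≠ v.1 := fun h' => v.2 (h' ▸ hv)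
    simp [contract, hv, hne]
  · simp [contract, hv, Subtype.ext_iff]

/-- The half-edges at the other vertices do not change. -/
def oldFlag (v : {v : γ.V // ¬ γ.Touched S v}) :
    (γ.contract S).Flag (v : WithBot {v : γ.V // ¬ γ.Touched S v}) ≃ γ.Flag v.1 :=
  Equiv.ofBijective
    (fun h => ⟨γ.restIncl S h.1, (γ.contract_vert_eq_coe S v h.1).1 h.2⟩) (by
    constructor
    · intro h h' hh
      exact Subtype.ext (γ.restIncl_injective S (congrArg Subtype.val hh))
    · rintro ⟨h, hh⟩
      obtain ⟨h', rfl⟩ : ∃ h', γ.restIncl S h' = h := by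
        rcases h with ⟨e, c⟩ | x
        · have he : e ∉ S := fun he => v.2 ⟨e, he, c, hh⟩
          exact ⟨Sum.inl (⟨e, he⟩, c), rfl⟩
        · exact ⟨Sum.inr x, rfl⟩
      exact ⟨⟨h', (γ.contract_vert_eq_coe S v h').2 hh⟩, rfl⟩)

/-- The vertices of the subgraph keep all their half-edges. -/
def subFlag (v : {v : γ.V // γ.Touched S v}) : (γ.sub S).Flag v ≃ γ.Flag v.1 :=
  Equiv.ofBijective
    (fun h => ⟨Sum.elim (fun p => Sum.inl (p.1.1, p.2)) (fun l => γ.restIncl S l.1) h.1, by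
      obtain ⟨h | h, hh⟩ := h
      · exact congrArg Subtype.val hh
      · exact congrArg Subtype.val hh⟩) (by
    constructor
    · rintro ⟨⟨⟨e, he⟩, c⟩ | ⟨⟨⟨e, he⟩, c⟩ | x, hl⟩, hh⟩ ⟨⟨⟨e', he'⟩, c'⟩ | ⟨⟨⟨e', he'⟩, c'⟩ | x', hl'⟩, hh'⟩
        hyp <;> simp [restIncl] at hyp ⊢ <;> grind
    · rintro ⟨⟨e, c⟩ | x, hh⟩
      · by_cases he : e ∈ S
        · exact ⟨⟨Sum.inl (⟨e, he⟩, c), Subtype.ext hh⟩, rfl⟩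
        · exact ⟨⟨Sum.inr ⟨Sum.inl (⟨e, he⟩, c), hh ▸ v.2⟩, Subtype.ext hh⟩, rfl⟩
      · exact ⟨⟨Sum.inr ⟨Sum.inr x, hh ▸ v.2⟩, Subtype.ext hh⟩, rfl⟩)

/-- The degrees of the labels after contraction. An operation with `m` edges raises the degree
by `m - 1`. -/
def contractDeg (d : γ.V → ℕ) : (γ.contract S).V → ℕ :=
  WithBot.recBotCoe (∑ v : (γ.sub S).V, d v.1 + Fintype.card (γ.sub S).E - 1) (fun v => d v.1)

/-- The sign in front of the term of the differential that contracts `S`. The vertices and the edges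
of the subgraph are moved in front of the other ones (the first two exponents). If `e` and `e'` are
the products of the edges in `S` and of the other edges, then applying to
`(e ∧ e') ⊗ (a ⊗ a')` the operation of degree `-1` that sends `e ⊗ a` to `b` gives
`e' ⊗ (b ⊗ a')` with the sign given by the last exponent. -/
def contractSign (d : γ.V → ℕ) : ℤ :=
  (-1) ^ (Nat.card {p : γ.V × γ.V // ¬ γ.Touched S p.1 ∧ γ.Touched S p.2 ∧ p.1 < p.2 ∧
      Odd (d p.1) ∧ Odd (d p.2)} +
    Nat.card {p : γ.E × γ.E // p.1 ∉ S ∧ p.2 ∈ S ∧ p.1 < p.2} +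
    (Fintype.card γ.E - S.card) * (S.card - 1))

end Contraction

end MGraph

/-!
# Weak modular operads and their Feynman transform
-/

/-- A family of graded vector spaces `A g X i` (genus `g`, legs labelled by `X`, degree `i`) that is
functorial for bijections of `X`. Only finite `X` matter, and `A g (Fin n) i` is the degree `i`
part of `A(g,n)` with its action of the symmetric group. -/
structure ModularCollection (k : Type*) [Field k] where
  A : ℕ → Type → ℕ → Type*
  [addCommGroup : ∀ g X i, AddCommGroup (A g X i)]
  [module : ∀ g X i, Module k (A g X i)]
  map : ∀ {g : ℕ} {X Y : Type} {i : ℕ}, X ≃ Y → A g X i →ₗ[k] A g Y i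
  map_refl : ∀ (g : ℕ) (X : Type) (i : ℕ) (a : A g X i), map (Equiv.refl X) a = a
  map_trans : ∀ (g : ℕ) (X Y Z : Type) (i : ℕ) (σ : X ≃ Y) (τ : Y ≃ Z) (a : A g X i),
    map (σ.trans τ) a = map τ (map σ a)

attribute [instance] ModularCollection.addCommGroup ModularCollection.module

namespace ModularCollection

variable {k : Type*} [Field k] (P : ModularCollection k)

/-- `map`, along equalities of genera and of degrees. -/
def transport {g g' : ℕ} {X Y : Type} {i i' : ℕ} (hg : g = g') (σ : X ≃ Y) (hi : i = i')
    (a : P.A g X i) : P.A g' Y i' :=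
  hg ▸ hi ▸ P.map σ a

/-- Homogeneous labels of degrees `d` on the vertices of a graph. -/
abbrev Labels {X : Type} (γ : MGraph X) (d : γ.V → ℕ) :=
  ∀ v, P.A (γ.genus v) (γ.Flag v) (d v)

/-- The isomorphism `f` takes the labels `a` to the labels `a'`. -/
def LabelsMatch {X Y : Type} {γ : MGraph X} {γ' : MGraph Y} {σ : X ≃ Y} (f : γ.GIso γ' σ)
    {d : γ.V → ℕ} {d' : γ'.V → ℕ} (hd : ∀ v, d' (f.onV v) = d v)
    (a : P.Labels γ d) (a' : P.Labels γ' d') : Prop :=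
  ∀ v, a' (f.onV v) = P.transport (f.genus_comm v).symm (f.onFlag v) (hd v).symm (a v)

/-- For every graph an operation of degree `|E| - 1`, where the edges are ordered as in the graph.
The values at graphs without edges or that are not modular graphs do not matter. -/
abbrev Operations :=
  ∀ {X : Type} (γ : MGraph X) (d : γ.V → ℕ),
    MultilinearMap k (fun v => P.A (γ.genus v) (γ.Flag v) (d v))
      (P.A γ.totalGenus X (∑ v, d v + Fintype.card γ.E - 1))

variable {P}

/-- The labels of `γ / S` that are obtained from labels of `γ` by applying to the labels of the
subgraph its operation. -/
def contractLabels (μ : P.Operations) {X : Type} (γ : MGraph X) (S : Finset γ.E) (d : γ.V → ℕ)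
    (a : P.Labels γ d) : P.Labels (γ.contract S) (γ.contractDeg S d) :=
  WithBot.recBotCoe
    (C := fun v => P.A ((γ.contract S).genus v) ((γ.contract S).Flag v) (γ.contractDeg S d v))
    (P.map (γ.newFlag S)
      (μ (γ.sub S) (fun v => d v.1) (fun v => P.map (γ.subFlag S v).symm (a v.1))))
    (fun v => P.map (γ.oldFlag S v).symm (a v.1))

end ModularCollection

open Classical in
/-- A weak modular operad with vanishing internal differential: generating operations for all
modular graphs, which are compatible with isomorphisms of graphs (a reordering of the edges or of
the labels produces the usual sign) and whose two-fold compositions satisfy, for every modular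
graph, the quadratic relation analogous to that of `A_∞`-algebras. The relation is written in the
direct sum over all genera and degrees, although all its terms have the same genus and degree. -/
structure WeakModularOperad (k : Type*) [Field k] extends ModularCollection k where
  μ : toModularCollection.Operations
  equivariant : ∀ {X Y : Type} (γ : MGraph X) (γ' : MGraph Y) (σ : X ≃ Y) (f : γ.GIso γ' σ),
    γ.IsModular → Nonempty γ.E →
    ∀ (d : γ.V → ℕ) (d' : γ'.V → ℕ) (hd : ∀ v, d' (f.onV v) = d v)
      (a : toModularCollection.Labels γ d) (a' : toModularCollection.Labels γ' d'),
    toModularCollection.LabelsMatch f hd a a' →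
    ∀ (hg : γ.totalGenus = γ'.totalGenus)
      (hi : ∑ v, d v + Fintype.card γ.E - 1 = ∑ v, d' v + Fintype.card γ'.E - 1),
    μ γ' d' a' = (f.vertexSign d * f.edgeSign Finset.univ) •
      toModularCollection.transport hg σ hi (μ γ d a)
  relation : ∀ {X : Type} (γ : MGraph X), γ.IsModular → ∀ (d : γ.V → ℕ)
      (a : toModularCollection.Labels γ d),
    ∑ S ∈ Finset.univ.filter (fun S : Finset γ.E => γ.IsConnectedSubset S ∧ S ≠ Finset.univ),
      γ.contractSign S d • DirectSum.of (fun p : ℕ × ℕ => A p.1 X p.2)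
        ((γ.contract S).totalGenus,
          ∑ v, γ.contractDeg S d v + Fintype.card (γ.contract S).E - 1)
        (μ (γ.contract S) (γ.contractDeg S d)
          (ModularCollection.contractLabels μ γ S d a)) = 0

namespace WeakModularOperad

variable {k : Type*} [Field k] (W : WeakModularOperad k)

/-- Scalar functions of graphs with homogeneous vertex labels. -/
abbrev Cochain (X : Type) :=
  ∀ (γ : MGraph X) (d : γ.V → ℕ), W.toModularCollection.Labels γ d → k

/-- The part of degree `D` of the weak Feynman transform, for genus `g` and legs labelled by `X`.
An element is a family of linear functionals on the spaces `K(γ) ⊗ A(γ)`, for `γ` a modular graph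
of genus `g`, that is compatible with all isomorphisms of graphs; in other words, a linear functional
on the direct sum, over the isomorphism classes of `γ`, of the coinvariants
`(K(γ) ⊗ A(γ))_{Aut(γ)}`. In characteristic zero its component at `γ` is an element of
`K(γ) ⊗_{Aut(γ)} A(γ)^*`, since invariants and coinvariants of the finite group `Aut(γ)` agree
through the norm map. The degree is the number of edges plus the degrees of the labels. -/
def ft (g : ℕ) (X : Type) (D : ℤ) : Submodule k (W.Cochain X) where
  carrier := {φ |
    (∀ γ d, ∃ m : MultilinearMap k (fun v => W.A (γ.genus v) (γ.Flag v) (d v)) k,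
      ∀ a, φ γ d a = m a) ∧
    (∀ γ d a, φ γ d a ≠ 0 → γ.IsModular ∧ γ.totalGenus = g ∧
      (Fintype.card γ.E : ℤ) + ∑ v, (d v : ℤ) = D) ∧
    (∀ (γ γ' : MGraph X) (f : γ.GIso γ' (Equiv.refl X)) (d : γ.V → ℕ) (d' : γ'.V → ℕ)
      (hd : ∀ v, d' (f.onV v) = d v) (a : W.toModularCollection.Labels γ d)
      (a' : W.toModularCollection.Labels γ' d'),
      W.toModularCollection.LabelsMatch f hd a a' →
        φ γ' d' a' = (f.vertexSign d * f.edgeSign Finset.univ) • φ γ d a)}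
  zero_mem' := ⟨fun _ _ => ⟨0, fun _ => rfl⟩, fun _ _ _ h => absurd rfl h, fun _ _ _ _ _ _ _ _ _ => by
    simp⟩
  add_mem' := by
    rintro φ ψ ⟨h1, h2, h3⟩ ⟨h1', h2', h3'⟩
    refine ⟨fun γ d => ?_, fun γ d a h => ?_, fun γ γ' f d d' hd a a' h => ?_⟩
    · obtain ⟨m, hm⟩ := h1 γ d
      obtain ⟨m', hm'⟩ := h1' γ d
      exact ⟨m + m', fun a => by simp [hm, hm']⟩
    · by_cases h0 : φ γ d a = 0
      · exact h2' γ d a (by simpa [h0] using h)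
      · exact h2 γ d a h0
    · simp [h3 γ γ' f d d' hd a a' h, h3' γ γ' f d d' hd a a' h]
  smul_mem' := by
    rintro c φ ⟨h1, h2, h3⟩
    refine ⟨fun γ d => ?_, fun γ d a h => ?_, fun γ γ' f d d' hd a a' h => ?_⟩
    · obtain ⟨m, hm⟩ := h1 γ d
      exact ⟨c • m, fun a => by simp [hm]⟩
    · exact h2 γ d a (fun h0 => h (by simp [h0]))
    · simp [h3 γ γ' f d d' hd a a' h, mul_left_comm]

open Classical in
/-- The differential of the weak Feynman transform: the linear dual of the sum of all generating
operations, applied to all connected subgraphs with at least one edge of a modular graph `γ`. -/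
def differential (X : Type) : W.Cochain X →ₗ[k] W.Cochain X where
  toFun φ γ d a := ∑ S ∈ Finset.univ.filter
      (fun S : Finset γ.E => γ.IsModular ∧ γ.IsConnectedSubset S),
    γ.contractSign S d • φ (γ.contract S) (γ.contractDeg S d)
      (ModularCollection.contractLabels W.μ γ S d a)
  map_add' φ ψ := by
    funext γ d a
    simp [Finset.sum_add_distrib]
  map_smul' c φ := by
    funext γ d a
    simp [Finset.mul_sum, mul_left_comm]

end WeakModularOperad

/-- For a graph with labels of degrees `d`: the vertex `v` is an egg. -/
def MGraph.IsEgg {X : Type} (γ : MGraph X) (d : γ.V → ℕ) (v : γ.V) : Prop :=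
  d v = 0 ∧ (0 < γ.genus v ∨ ∃ e, γ.IsTadpoleAt e v)

/-- The part of degree `D` of `Z(g, X)`. The Feynman transform is the direct sum of the subspaces of
elements supported on one isomorphism class of pairs `(γ, d)`, and `Z` is the sum of those for which
`(γ, d)` has an egg. -/
def WeakModularOperad.eggs {k : Type*} [Field k] (W : WeakModularOperad k) (g : ℕ) (X : Type)
    (D : ℤ) : Submodule k (W.Cochain X) where
  carrier := {φ | φ ∈ W.ft g X D ∧ ∀ γ d a, (¬ ∃ v, γ.IsEgg d v) → φ γ d a = 0}
  zero_mem' := ⟨Submodule.zero_mem _, fun _ _ _ _ => rfl⟩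
  add_mem' := fun ⟨h1, h2⟩ ⟨h1', h2'⟩ =>
    ⟨Submodule.add_mem _ h1 h1', fun γ d a h => by simp [h2 γ d a h, h2' γ d a h]⟩
  smul_mem' := fun c _ ⟨h1, h2⟩ =>
    ⟨Submodule.smul_mem _ c h1, fun γ d a h => by simp [h2 γ d a h]⟩

/-!
# Lie graph homology

Let `B = Σ⁻¹ s Lie` be the `K`-twisted modular operad determined by the cyclic operad `Lie`. Recall
that `Lie((X))` is spanned by the trivalent trees with leaves labelled by `X` and a cyclic order at
every vertex, modulo the antisymmetry and the Jacobi (IHX) relations. Since a product of cyclic orders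
at the vertices of a trivalent tree `T` is the same as a generator of `det(E(T)) ⊗ det(X)`, the
twisted version `B(X)` is spanned by trivalent trees `T` with leaves labelled by `X` and an order of
the edges of `T`, where a permutation of the edges produces its sign, modulo the relations that the
sum of the three trees obtained from each other by changing the position of one edge is zero. The
composition of `B` along an edge is the grafting of trees, where the new edge of the tree comes
first.

The Feynman transform `FT(B)(g, X)` is the linear dual of the direct sum of the spaces
`B(γ)_{Aut(γ)}`, for `γ` of genus `g` with legs labelled by `X`, with the dual of the sum of all
one-edge contractions as differential. As `B` vanishes in positive genus, all vertices of `γ` have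
genus zero. Inserting trees into the vertices of `γ` produces a trivalent graph `G` with a
forest `Φ ⊆ E(G)` (the union of the edges of the trees) such that `γ = G / Φ`. Thus an
element of `FT(B)` is a function of pairs `(G, Φ)`, with an order of the edges of `Φ`, that is
compatible with isomorphisms and satisfies the Jacobi relations. The degree is the number of edges
of `Φ`, and the contraction of an edge of `γ` is its addition to `Φ`.
-/

namespace MGraph

/-- Every edge of `Φ` is a bridge of the graph with edges `Φ`. -/
def IsForest {X : Type} (G : MGraph X) (Φ : Finset G.E) : Prop :=
  ∀ e ∈ Φ, ¬ G.Joined (Φ.erase e) (G.vert (Sum.inl (e, false))) (G.vert (Sum.inl (e, true)))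

/-- Connected trivalent graphs whose vertices have genus zero. -/
structure IsTrivalent {X : Type} (G : MGraph X) : Prop where
  connected : G.Connected
  genus_zero : ∀ v, G.genus v = 0
  trivalent : ∀ v, Nat.card (G.Flag v) = 3

/-- Permute the half-edges of a graph, keeping the edges and the legs. -/
def rewire {X : Type} (G : MGraph X) (τ : Equiv.Perm G.H) : MGraph X :=
  { G with vert := fun h => G.vert (τ h) }

/-- Relabel the legs of a graph. -/
def relabel {X Y : Type} (G : MGraph Y) (σ : X ≃ Y) : MGraph X :=
  { G with vert := fun h => G.vert (Sum.map id σ h) }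

end MGraph

namespace LieGraph

variable (k : Type*) [Field k]

/-- Scalar functions of graphs with a distinguished set of edges. -/
abbrev Chain (X : Type) := ∀ G : MGraph X, Finset G.E → k

open Classical in
/-- The part of degree `i` of `FT(Σ⁻¹ s Lie)(g, X)`. The last condition is the Jacobi relation: if
`e ∈ Φ` joins a vertex with further half-edges `p, q` to a vertex with further half-edges `r, s`,
then the sum over the three positions `pq|rs`, `pr|qs`, `ps|qr` is zero. -/
def chains (g : ℕ) (X : Type) (i : ℕ) : Submodule k (Chain k X) where
  carrier := {ψ |
    (∀ G Φ, ψ G Φ ≠ 0 → G.IsTrivalent ∧ G.totalGenus = g ∧ G.IsForest Φ ∧ Φ.card = i) ∧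
    (∀ (G G' : MGraph X) (f : G.GIso G' (Equiv.refl X)) (Φ : Finset G.E),
      ψ G' (Φ.map f.onE.toEmbedding) = f.edgeSign Φ • ψ G Φ) ∧
    (∀ (G : MGraph X) (Φ : Finset G.E), G.IsTrivalent → G.IsForest Φ → ∀ e ∈ Φ, ∀ q r s : G.H,
      G.vert q = G.vert (Sum.inl (e, false)) → q ≠ Sum.inl (e, false) →
      G.vert r = G.vert (Sum.inl (e, true)) → r ≠ Sum.inl (e, true) →
      G.vert s = G.vert (Sum.inl (e, true)) → s ≠ Sum.inl (e, true) → r ≠ s →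
      ψ G Φ + ψ (G.rewire (Equiv.swap q r)) Φ + ψ (G.rewire (Equiv.swap q s)) Φ = 0)}
  zero_mem' := ⟨fun _ _ h => absurd rfl h, fun _ _ _ _ => by simp,
    fun G Φ _ _ _ _ _ _ _ _ _ _ _ _ _ _ => by
      change (0 : k) + 0 + 0 = 0
      simp⟩
  add_mem' := by
    rintro ψ ψ' ⟨h1, h2, h3⟩ ⟨h1', h2', h3'⟩
    refine ⟨fun G Φ h => ?_, fun G G' f Φ => ?_, fun G Φ hG hΦ e he q r s a b c d a' b' c' => ?_⟩
    · by_cases h0 : ψ G Φ = 0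
      · exact h1' G Φ (by simpa [h0] using h)
      · exact h1 G Φ h0
    · simp [h2, h2']
    · have h4 := h3 G Φ hG hΦ e he q r s a b c d a' b' c'
      have h5 := h3' G Φ hG hΦ e he q r s a b c d a' b' c'
      change (ψ G Φ + ψ' G Φ) + (ψ (G.rewire _) Φ + ψ' (G.rewire _) Φ) +
        (ψ (G.rewire _) Φ + ψ' (G.rewire _) Φ) = 0
      linear_combination h4 + h5
  smul_mem' := by
    rintro c ψ ⟨h1, h2, h3⟩
    refine ⟨fun G Φ h => ?_, fun G G' f Φ => ?_, fun G Φ hG hΦ e he q r s a b c' d a' b' e' => ?_⟩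
    · exact h1 G Φ (fun h0 => h (by simp [h0]))
    · simp [h2, mul_left_comm]
    · have h4 := h3 G Φ hG hΦ e he q r s a b c' d a' b' e'
      change c * ψ G Φ + c * ψ (G.rewire _) Φ + c * ψ (G.rewire _) Φ = 0
      linear_combination c * h4

/-- The differential of `FT(Σ⁻¹ s Lie)`, of degree `-1`: the sum over all edges outside `Φ` of their
additions to `Φ` (as the first edge). The terms with `Φ ∪ {e}` not a forest vanish, by definition of
`chains`. -/
def boundary (X : Type) : Chain k X →ₗ[k] Chain k X where
  toFun ψ G Φ := ∑ e ∈ Finset.univ \ Φ,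
    (-1 : ℤ) ^ (Φ.filter (fun f => f < e)).card • ψ G (insert e Φ)
  map_add' ψ ψ' := by
    funext G Φ
    simp [Finset.sum_add_distrib]
  map_smul' c ψ := by
    funext G Φ
    simp only [Pi.smul_apply, smul_comm _ c, ← Finset.smul_sum, RingHom.id_apply]

/-- The cycles of degree `i`. -/
def cycles (g : ℕ) (X : Type) (i : ℕ) : Submodule k (Chain k X) :=
  chains k g X i ⊓ LinearMap.ker (boundary k X)

/-- The boundaries of degree `i`. -/
def boundaries (g : ℕ) (X : Type) (i : ℕ) : Submodule k (Chain k X) :=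
  (chains k g X (i + 1)).map (boundary k X)

/-- Lie graph homology `H_i(Γ_{g,X}) = H_i(FT(Σ⁻¹ s Lie))(g, X)`. -/
abbrev Homology (g : ℕ) (X : Type) (i : ℕ) :=
  cycles k g X i ⧸ (boundaries k g X i).comap (cycles k g X i).subtype

variable {k}

/-- The chain `ψ` is a cycle that represents the homology class `c`. -/
def Represents {g : ℕ} {X : Type} {i : ℕ} (ψ : Chain k X) (c : Homology k g X i) : Prop :=
  ∃ h : ψ ∈ cycles k g X i, Submodule.Quotient.mk ⟨ψ, h⟩ = c

/-- The action of bijections between sets of labels. -/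
def mapChain {X Y : Type} (σ : X ≃ Y) (ψ : Chain k X) : Chain k Y :=
  fun G Φ => ψ (G.relabel σ) Φ

/-- A way to obtain `G` by grafting graphs `G_v`, for `v` a vertex of `δ`, along the edges of `δ`. Here
`edge` and `flip` say which half-edges of `G` correspond to those of `δ`, and `part` sends the
vertices of `G_v` to `v`. -/
structure Cut {X : Type} (δ G : MGraph X) where
  edge : δ.E → G.E
  edge_injective : Function.Injective edge
  flip : δ.E → Bool
  part : G.V → δ.V
  part_edge : ∀ f, (∀ e, edge e ≠ f) → ∀ c,
    part (G.vert (Sum.inl (f, c))) = part (G.vert (Sum.inl (f, false)))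
  part_end : ∀ e c, part (G.vert (Sum.inl (edge e, xor c (flip e)))) = δ.vert (Sum.inl (e, c))
  part_leg : ∀ x, part (G.vert (Sum.inr x)) = δ.vert (Sum.inr x)

/-- The half-edges of `G` that correspond to those of `δ`. -/
def Cut.halfEdge {X : Type} {δ G : MGraph X} (c : Cut δ G) : δ.H → G.H :=
  Sum.map (fun p => (c.edge p.1, xor p.2 (c.flip p.1))) id

theorem Cut.part_halfEdge {X : Type} {δ G : MGraph X} (c : Cut δ G) (h : δ.H) :
    c.part (G.vert (c.halfEdge h)) = δ.vert h := by
  rcases h with ⟨e, b⟩ | x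
  · exact c.part_end e b
  · exact c.part_leg x

open Classical in
/-- The graph `G_v`, with legs labelled by the half-edges of `δ` at `v`. -/
def Cut.piece {X : Type} {δ G : MGraph X} (c : Cut δ G) (v : δ.V) : MGraph (δ.Flag v) where
  V := {u : G.V // c.part u = v}
  E := {f : G.E // (∀ e, c.edge e ≠ f) ∧ c.part (G.vert (Sum.inl (f, false))) = v}
  vert := Sum.elim
    (fun p => ⟨G.vert (Sum.inl (p.1.1, p.2)), (c.part_edge p.1.1 p.1.2.1 p.2).trans p.1.2.2⟩)
    (fun h => ⟨G.vert (c.halfEdge h.1), (c.part_halfEdge h.1).trans h.2⟩)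
  genus u := G.genus u.1

open Classical in
/-- The modular operad structure of `FT(Σ⁻¹ s Lie)`: composition of `ψ_v`, for `v` a vertex of `δ`, is
given by the grafting of graphs along `δ`. The sign is that of the permutation which puts the edges
of `Φ` in the order given by the order of the vertices `v`. -/
def graft {X : Type} (δ : MGraph X) (ψ : ∀ v, Chain k (δ.Flag v)) : Chain k X :=
  fun G Φ => ∑ᶠ c : Cut δ G, if ∀ e, c.edge e ∉ Φ then
    (-1 : ℤ) ^ Nat.card {p : G.E × G.E // p.1 ∈ Φ ∧ p.2 ∈ Φ ∧ p.1 < p.2 ∧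
      c.part (G.vert (Sum.inl (p.2, false))) < c.part (G.vert (Sum.inl (p.1, false)))} •
      ∏ v, ψ v (c.piece v) (Finset.univ.filter (fun f => f.1 ∈ Φ))
    else 0

end LieGraph

/-- `W` is an extension of the modular operad of Lie graph homology to a weak modular operad:
forgetting the operations for graphs with more than one edge produces a modular operad that is
isomorphic to the homology of `FT(Σ⁻¹ s Lie)`. -/
def WeakModularOperad.ExtendsLieGraphHomology {k : Type*} [Field k] (W : WeakModularOperad k) :
    Prop :=
  ∃ iso : ∀ (g : ℕ) (X : Type) (i : ℕ), W.A g X i ≃ₗ[k] LieGraph.Homology k g X i,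
    (∀ (g : ℕ) (X Y : Type) (i : ℕ) (σ : X ≃ Y) (a : W.A g X i) (ψ : LieGraph.Chain k X),
      LieGraph.Represents ψ (iso g X i a) →
        LieGraph.Represents (LieGraph.mapChain σ ψ) (iso g Y i (W.map σ a))) ∧
    (∀ (X : Type) (δ : MGraph X), δ.IsModular → Fintype.card δ.E = 1 →
      ∀ (d : δ.V → ℕ) (a : W.toModularCollection.Labels δ d)
        (ψ : ∀ v, LieGraph.Chain k (δ.Flag v)),
        (∀ v, LieGraph.Represents (ψ v) (iso _ _ _ (a v))) →
          LieGraph.Represents (LieGraph.graft δ ψ) (iso _ _ _ (W.μ δ d a)))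

end

noncomputable section

/-! ### Signs as sums over pairs -/

/-! The point is that Lie graph homology is as small as possible in degree zero. For a finite set of
legs, `H_0` is spanned by the class of the function `LieGraph.one` that is constant on trivalent
graphs. Relabellings act trivially on it, and the operation of a tadpole graph takes a generator
with two extra legs to a generator of genus one higher, without losing it (`Generators`). So at a
vertex with a label of degree zero, a unit of genus and a tadpole carry the same information.

Degree zero homology. Chains of degree zero are invariant functions of trivalent graphs, and
boundaries come from functions of a graph with one distinguished edge that satisfy the Jacobi
relation. The edge Laplacian `laplace` sums the differences of the values at a graph and at its
Whitehead moves. It always satisfies the Jacobi relation, and it multiplies by 12 every function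
that satisfies this relation. As moves are reversible, its sum over all ways to attach the
half-edges to the vertices is zero. This gives a functional `total` that kills boundaries but not
`one`. By the maximum principle, and because trivalent graphs of a given type are connected by
Whitehead moves (`moves_connected`), the kernel of the Laplacian consists of constants. A dimension
count then identifies the image of the Laplacian with the kernel of `total` (`exists_sub_smul_one`).
Grafting along a tadpole gives functions with values in natural numbers up to a scalar, and such
functions are not boundaries unless they vanish.

The complex. In the square of the differential, contractions of two subgraphs without a common
vertex cancel in pairs. Nested contractions with the same union `T` add up to the quadratic relation
of the weak modular operad for the subgraph `T` (`differential_differential`).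

The subcomplex. Suppose that a graph without eggs acquires one by a contraction. Then the contracted
subgraph is one edge between two different vertices of genus zero and degree zero, and a parallel
edge becomes the tadpole. The exchange of the two parallel edges preserves all labels and is odd, so
every cochain vanishes at such a graph (`eq_zero_of_parallel`).

Acyclicity. The function `weight` strictly decreases under every contraction except that of a
tadpole at a vertex of degree zero (`weight_contract`). To leading order the differential therefore
only sees the operations that have just been determined. The homotopy evaluates a cochain at the
graphs in which a unit of genus of a degree zero vertex is replaced by a tadpole, and divides by the
number of eggs. On a cocycle, at the lowest weight of its support, differential after homotopy
counts the vertices of degree zero that have positive genus or a tadpole, hence it is the identity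
after normalization (`differential_homotopy`). In fixed genus and degree the weight is bounded on
both sides, so finitely many corrections produce a primitive (`exists_differential_eq`). -/

theorem neg_one_pow_eq_of_cast_eq {m n : ℕ} (h : (m : ZMod 2) = n) : (-1 : ℤ) ^ m = (-1) ^ n := by
  rw [neg_one_pow_eq_pow_mod_two, neg_one_pow_eq_pow_mod_two (n := n)]
  rw [(ZMod.natCast_eq_natCast_iff' m n 2).1 h]

theorem natCard_pairs_cast {α : Type*} [Fintype α] (r : α × α → Prop) [DecidablePred r] :
    (Nat.card {p : α × α // r p} : ZMod 2) = ∑ a, ∑ b, if r (a, b) then 1 else 0 := by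
  classical
  rw [Nat.card_eq_fintype_card, Fintype.card_subtype, Finset.card_filter, Fintype.sum_prod_type]
  push_cast
  rfl

theorem sum_pairs_eq_zero {α : Type*} [Fintype α] (F : α → α → ZMod 2)
    (hd : ∀ a, F a a = 0) (hs : ∀ a b, a ≠ b → F a b + F b a = 0) :
    ∑ a, ∑ b, F a b = 0 := by
  classical
  rw [← Fintype.sum_prod_type' (f := F)]
  refine Finset.sum_involution (fun p _ => p.swap) (fun p _ => ?_) (fun p _ hp h => ?_)
    (fun _ _ => Finset.mem_univ _) (fun _ _ => rfl)
  · rcases eq_or_ne p.1 p.2 with h | h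
    · simp [h, hd]
    · exact hs _ _ h
  · have : p.1 = p.2 := (congrArg Prod.snd h)
    exact hp (by rw [this]; exact hd _)

/-- Signs of permutations count inversions modulo two, so they are sums over ordered pairs. Two such
sums agree as soon as they agree on the diagonal and on every unordered pair, which reduces the
comparison to a case distinction. -/
theorem sum_pairs_congr {α : Type*} [Fintype α] {F G : α → α → ZMod 2}
    (hd : ∀ a, F a a = G a a) (hs : ∀ a b, a ≠ b → F a b + F b a = G a b + G b a) :
    ∑ a, ∑ b, F a b = ∑ a, ∑ b, G a b := by
  have h := sum_pairs_eq_zero (fun a b => F a b - G a b) (fun a => by simp [hd])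
    (fun a b hab => by have := hs a b hab; linear_combination this)
  simp only [Finset.sum_sub_distrib] at h
  exact sub_eq_zero.1 h

theorem Fintype.sum_withBot {α M : Type*} [AddCommMonoid M] [Fintype α] [Fintype (WithBot α)]
    (F : WithBot α → M) : ∑ a, F a = F ⊥ + ∑ a : α, F a :=
  (Fintype.sum_equiv (show WithBot α ≃ Option α from Equiv.refl _) F (fun a => F a)
    (fun _ => rfl)).trans (Fintype.sum_option _)

theorem Finset.sum_subtype_ite {α M : Type*} [AddCommMonoid M] [Fintype α] (p : α → Prop)
    [DecidablePred p] [Fintype {a // p a}] (F : α → M) :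
    ∑ a : {a // p a}, F a.1 = ∑ a, if p a then F a else 0 := by
  rw [← Finset.sum_filter, ← Finset.sum_subtype_eq_sum_filter]
  apply Finset.sum_congr ?_ (fun _ _ => rfl)
  ext x; simp

/-! ### Labels up to transport -/

namespace ModularCollection

variable {k : Type*} [Field k] {P : ModularCollection k}

/-- The bijection `σ` takes the label `a` to the label `b`. -/
def Rel {g g' : ℕ} {X Y : Type} {i i' : ℕ} (σ : X ≃ Y) (a : P.A g X i) (b : P.A g' Y i') : Prop :=
  ∃ (hg : g = g') (hi : i = i'), b = P.transport hg σ hi a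

/-- Labels on sets embedded in `Z` that agree up to a bijection over `Z`. -/
def SameLabel {Z : Type} {g g' : ℕ} {Y Y' : Type} {i i' : ℕ} (j : Y → Z) (a : P.A g Y i)
    (j' : Y' → Z) (b : P.A g' Y' i') : Prop :=
  ∃ σ : Y ≃ Y', (∀ y, j' (σ y) = j y) ∧ Rel σ a b

theorem Rel.map {g : ℕ} {X Y : Type} {i : ℕ} (σ : X ≃ Y) (a : P.A g X i) : Rel σ a (P.map σ a) :=
  ⟨rfl, rfl, rfl⟩

theorem Rel.refl {g : ℕ} {X : Type} {i : ℕ} (a : P.A g X i) : Rel (Equiv.refl X) a a :=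
  ⟨rfl, rfl, (P.map_refl _ _ _ a).symm⟩

theorem Rel.trans {g g' g'' : ℕ} {X Y Z : Type} {i i' i'' : ℕ} {σ : X ≃ Y} {τ : Y ≃ Z}
    {a : P.A g X i} {b : P.A g' Y i'} {c : P.A g'' Z i''} (h : Rel σ a b) (h' : Rel τ b c) :
    Rel (σ.trans τ) a c := by
  obtain ⟨rfl, rfl, rfl⟩ := h
  obtain ⟨rfl, rfl, rfl⟩ := h'
  exact ⟨rfl, rfl, (P.map_trans _ _ _ _ _ σ τ a).symm⟩

theorem Rel.symm {g g' : ℕ} {X Y : Type} {i i' : ℕ} {σ : X ≃ Y}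
    {a : P.A g X i} {b : P.A g' Y i'} (h : Rel σ a b) : Rel σ.symm b a := by
  obtain ⟨rfl, rfl, rfl⟩ := h
  refine ⟨rfl, rfl, ?_⟩
  change a = P.map σ.symm (P.map σ a)
  rw [← P.map_trans, Equiv.self_trans_symm, P.map_refl]

theorem Rel.smul {g g' : ℕ} {X Y : Type} {i i' : ℕ} {σ : X ≃ Y}
    {a : P.A g X i} {b : P.A g' Y i'} (h : Rel σ a b) (c : k) : Rel σ (c • a) (c • b) := by
  obtain ⟨rfl, rfl, rfl⟩ := h
  exact ⟨rfl, rfl, (map_smul (P.map σ) c a).symm⟩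

theorem Rel.zsmul {g g' : ℕ} {X Y : Type} {i i' : ℕ} {σ : X ≃ Y}
    {a : P.A g X i} {b : P.A g' Y i'} (h : Rel σ a b) (c : ℤ) : Rel σ (c • a) (c • b) := by
  obtain ⟨rfl, rfl, rfl⟩ := h
  exact ⟨rfl, rfl, (map_zsmul (P.map σ) c a).symm⟩

theorem Rel.eq {g g' : ℕ} {X Y : Type} {i i' : ℕ} {σ : X ≃ Y}
    {a : P.A g X i} {b b' : P.A g' Y i'} (h : Rel σ a b) (h' : Rel σ a b') : b = b' := by
  obtain ⟨rfl, rfl, rfl⟩ := h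
  obtain ⟨_, _, rfl⟩ := h'
  rfl

namespace SameLabel

variable {Z : Type} {g g' g'' : ℕ} {Y Y' Y'' : Type} {i i' i'' : ℕ} {j : Y → Z} {a : P.A g Y i}
  {j' : Y' → Z} {b : P.A g' Y' i'} {j'' : Y'' → Z} {c : P.A g'' Y'' i''}

theorem symm (h : SameLabel j a j' b) : SameLabel j' b j a := by
  obtain ⟨σ, h1, h2⟩ := h
  exact ⟨σ.symm, fun y => by rw [← h1, σ.apply_symm_apply], h2.symm⟩

theorem trans (h : SameLabel j a j' b) (h' : SameLabel j' b j'' c) : SameLabel j a j'' c := by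
  obtain ⟨σ, h1, h2⟩ := h
  obtain ⟨τ, h3, h4⟩ := h'
  exact ⟨σ.trans τ, fun y => by simp [h1, h3], h2.trans h4⟩

theorem map (σ : Y ≃ Y') (a : P.A g Y i) (h : ∀ y, j' (σ y) = j y) :
    SameLabel j a j' (P.map σ a) :=
  ⟨σ, h, Rel.map σ a⟩

theorem comp {Z' : Type} (f : Z → Z') (h : SameLabel j a j' b) :
    SameLabel (f ∘ j) a (f ∘ j') b := by
  obtain ⟨σ, h1, h2⟩ := h
  exact ⟨σ, fun y => congrArg f (h1 y), h2⟩

theorem zsmul (h : SameLabel j a j' b) (c : ℤ) : SameLabel j (c • a) j' (c • b) := by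
  obtain ⟨σ, h1, h2⟩ := h
  exact ⟨σ, h1, h2.zsmul c⟩

/-- Because `j'` is injective there is only one bijection over `Z`, so the one hidden in `SameLabel`
can be replaced by any bijection that is at hand. -/
theorem rel (h : SameLabel j a j' b) (hj : Function.Injective j') (τ : Y ≃ Y')
    (hτ : ∀ y, j' (τ y) = j y) : Rel τ a b := by
  obtain ⟨σ, h1, h2⟩ := h
  have : σ = τ := Equiv.ext fun y => hj ((h1 y).trans (hτ y).symm)
  exact this ▸ h2

theorem genus_eq (h : SameLabel j a j' b) : g = g' := h.choose_spec.2.choose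

theorem degree_eq (h : SameLabel j a j' b) : i = i' := h.choose_spec.2.choose_spec.choose

end SameLabel

/-- Labels of equal genus and degree, up to a cast. -/
theorem Rel.cast {g g' : ℕ} {X : Type} {i i' : ℕ} (hg : g = g') (hi : i = i') (a : P.A g X i) :
    Rel (Equiv.refl X) a (P.transport hg (Equiv.refl X) hi a) :=
  ⟨hg, hi, rfl⟩

end ModularCollection

/-! ### Isomorphisms of graphs -/

namespace MGraph.GIso

variable {X Y Z : Type} {γ : MGraph X} {γ' : MGraph Y} {γ'' : MGraph Z} {σ : X ≃ Y} {τ : Y ≃ Z}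

theorem totalGenus_eq (f : GIso γ γ' σ) : γ.totalGenus = γ'.totalGenus := by
  unfold totalGenus
  rw [Fintype.card_congr f.onE, Fintype.card_congr f.onV,
    ← Equiv.sum_comp f.onV γ'.genus]
  simp [f.genus_comm]

/-- The bijection of half-edges. -/
def onH (f : GIso γ γ' σ) : γ.H ≃ γ'.H := Equiv.sumCongr f.onEnds σ

theorem vert_onH (f : GIso γ γ' σ) (h : γ.H) : γ'.vert (f.onH h) = f.onV (γ.vert h) :=
  f.vert_comm h

theorem onFlag_val (f : GIso γ γ' σ) (v : γ.V) (h : γ.Flag v) :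
    (f.onFlag v h).1 = f.onH h.1 := rfl

/-- An isomorphism may flip an edge, but it is injective on the two halves, so opposite halves stay
opposite. -/
theorem onEnds_not (f : GIso γ γ' σ) (e : γ.E) (c : Bool) :
    f.onEnds (e, !c) = (f.onE e, !(f.onEnds (e, c)).2) := by
  have h1 := f.onEnds_fst (e, !c)
  have h2 := f.onEnds_fst (e, c)
  have h3 : f.onEnds (e, !c) ≠ f.onEnds (e, c) := by
    intro h; have := f.onEnds.injective h; simp at this
  ext
  · exact h1
  · rcases hx : f.onEnds (e, !c) with ⟨a, b⟩
    rcases hy : f.onEnds (e, c) with ⟨a', b'⟩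
    rw [hx, hy] at h3
    rw [hx] at h1; rw [hy] at h2
    simp only at h1 h2
    subst h1; subst h2
    cases b <;> cases b' <;> simp_all

/-- The inverse isomorphism. -/
def symm (f : GIso γ γ' σ) : GIso γ' γ σ.symm where
  onV := f.onV.symm
  onE := f.onE.symm
  onEnds := f.onEnds.symm
  onEnds_fst p := by
    rw [Equiv.eq_symm_apply, ← f.onEnds_fst, Equiv.apply_symm_apply]
  vert_comm h := by
    rw [Equiv.eq_symm_apply, ← f.vert_comm]
    congr 1
    rcases h with p | x <;> simp
  genus_comm v := by rw [← f.genus_comm, Equiv.apply_symm_apply]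

theorem joined (f : GIso γ γ' σ) {S : Finset γ.E} {S' : Finset γ'.E}
    (hS : ∀ e ∈ S, f.onE e ∈ S') {u v : γ.V} (h : γ.Joined S u v) :
    γ'.Joined S' (f.onV u) (f.onV v) := by
  refine Relation.ReflTransGen.lift f.onV ?_ _ _ h
  rintro a b ⟨e, he, c, ha, hb⟩
  refine ⟨f.onE e, hS e he, (f.onEnds (e, c)).2, ?_, ?_⟩
  · rw [← ha, ← f.vert_comm]
    congr 1
    simp only [Sum.map_inl, Sum.inl.injEq]
    exact Prod.ext (f.onEnds_fst (e, c)).symm rfl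
  · rw [← hb, ← f.vert_comm]
    congr 1
    simp only [Sum.map_inl, f.onEnds_not]

theorem connected (f : GIso γ γ' σ) (h : γ.Connected) : γ'.Connected := by
  refine ⟨h.1.map f.onV, fun u v => ?_⟩
  have := f.joined (S := Finset.univ) (S' := Finset.univ) (by simp) (h.2 (f.onV.symm u) (f.onV.symm v))
  simpa using this

theorem isModular (f : GIso γ γ' σ) (h : γ.IsModular) : γ'.IsModular := by
  have := h.finite_legs
  refine ⟨Finite.of_equiv _ σ, f.connected h.connected, fun v => ?_⟩
  have h1 := h.stable (f.onV.symm v)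
  have h2 := Nat.card_congr (f.onFlag (f.onV.symm v))
  rw [← f.genus_comm, Equiv.apply_symm_apply] at h1
  rw [h2, Equiv.apply_symm_apply] at h1
  exact h1

theorem edgeSign_eq_one (f : GIso γ γ' σ) (S : Finset γ.E) (h : StrictMono f.onE) :
    f.edgeSign S = 1 := by
  unfold edgeSign
  have : IsEmpty {p : γ.E × γ.E // p.1 ∈ S ∧ p.2 ∈ S ∧ p.1 < p.2 ∧ f.onE p.2 < f.onE p.1} :=
    ⟨fun p => absurd (h p.2.2.2.1) (not_lt.2 p.2.2.2.2.le)⟩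
  simp

theorem vertexSign_eq_one (f : GIso γ γ' σ) (d : γ.V → ℕ)
    (h : ∀ u v, u < v → Odd (d u) → Odd (d v) → f.onV u < f.onV v) : f.vertexSign d = 1 := by
  unfold vertexSign
  have : IsEmpty {p : γ.V × γ.V //
      p.1 < p.2 ∧ f.onV p.2 < f.onV p.1 ∧ Odd (d p.1) ∧ Odd (d p.2)} :=
    ⟨fun p => absurd (h _ _ p.2.1 p.2.2.2.1 p.2.2.2.2) (not_lt.2 p.2.2.1.le)⟩
  simp

end MGraph.GIso


/-! ### Subquotients of graphs -/

/-- A graph `β` whose half-edges are half-edges of `γ`, and whose vertices are disjoint sets of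
vertices of `γ`. -/
structure SubQuotient {Y X : Type} (β : MGraph Y) (γ : MGraph X) where
  cell : β.V → γ.V → Prop
  emb : β.E → γ.E
  ends : β.E × Bool → γ.E × Bool
  leg : Y → γ.H
  ends_fst : ∀ p, (ends p).1 = emb p.1
  injective : Function.Injective (Sum.elim (Sum.inl ∘ ends) leg : β.H → γ.H)
  vert_mem : ∀ h : β.H, cell (β.vert h) (γ.vert ((Sum.elim (Sum.inl ∘ ends) leg : β.H → γ.H) h))
  disjoint : ∀ v w x, cell v x → cell w x → v = w

namespace SubQuotient

variable {X Y Y' Z : Type} {α : MGraph Z} {β : MGraph Y} {β' : MGraph Y'} {γ : MGraph X}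

/-- The embedding of the half-edges. -/
def ι (b : SubQuotient β γ) : β.H → γ.H := Sum.elim (Sum.inl ∘ b.ends) b.leg

/-- The embedding of the half-edges at a vertex. -/
abbrev flag (b : SubQuotient β γ) (v : β.V) : β.Flag v → γ.H := fun h => b.ι h.1

theorem ι_injective (b : SubQuotient β γ) : Function.Injective b.ι := b.injective

theorem flag_injective (b : SubQuotient β γ) (v : β.V) : Function.Injective (b.flag v) :=
  b.ι_injective.comp Subtype.val_injective

theorem leg_injective (b : SubQuotient β γ) : Function.Injective b.leg := fun x y h => by
  have : (Sum.inr x : β.H) = Sum.inr y := b.ι_injective h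
  simpa using this

theorem ends_injective (b : SubQuotient β γ) : Function.Injective b.ends := fun x y h => by
  have : (Sum.inl x : β.H) = Sum.inl y := b.ι_injective (congrArg Sum.inl h)
  simpa using this

theorem ends_not (b : SubQuotient β γ) (e : β.E) (c : Bool) :
    b.ends (e, !c) = (b.emb e, !(b.ends (e, c)).2) := by
  have h1 := b.ends_fst (e, !c)
  have h2 := b.ends_fst (e, c)
  have h3 : b.ends (e, !c) ≠ b.ends (e, c) := by
    intro h; have := b.ends_injective h; simp at this
  rcases hx : b.ends (e, !c) with ⟨x, y⟩
  rcases hy : b.ends (e, c) with ⟨x', y'⟩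
  rw [hx, hy] at h3
  rw [hx] at h1; rw [hy] at h2
  simp only at h1 h2
  subst h1; subst h2
  cases y <;> cases y' <;> simp_all

/-- An edge of `γ` has only two halves, and the images of the two halves of `f` already exhaust
them. A half of another edge with the same image would contradict the injectivity of `ends`. -/
theorem emb_injective (b : SubQuotient β γ) : Function.Injective b.emb := fun e f h => by
  have h1 := b.ends_fst (e, false)
  have h2 := b.ends_fst (f, false)
  have h3 := b.ends_fst (f, true)
  have h4 := b.ends_not f false
  rcases hx : b.ends (e, false) with ⟨x, y⟩
  rcases hy : b.ends (f, false) with ⟨x', y'⟩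
  rw [hx] at h1
  rw [hy] at h2 h4
  simp only at h1 h2
  have : b.ends (e, false) = b.ends (f, false) ∨ b.ends (e, false) = b.ends (f, true) := by
    rw [show true = !false from rfl, h4, hx, hy]
    rw [h1, h2, h]
    cases y <;> cases y' <;> simp
  rcases this with h5 | h5
  · exact congrArg Prod.fst (b.ends_injective h5)
  · exact congrArg Prod.fst (b.ends_injective h5)

theorem mem_range_ends (b : SubQuotient β γ) (q : γ.E × Bool) :
    q ∈ Set.range b.ends ↔ q.1 ∈ Set.range b.emb := by
  constructor
  · rintro ⟨p, rfl⟩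
    exact ⟨p.1, (b.ends_fst p).symm⟩
  · rintro ⟨e, he⟩
    obtain ⟨q, c⟩ := q
    simp only at he
    subst he
    by_cases h : (b.ends (e, false)).2 = c
    · exact ⟨(e, false), Prod.ext (b.ends_fst _) h⟩
    · refine ⟨(e, !false), ?_⟩
      rw [b.ends_not]
      congr 1
      cases c <;> simp_all

/-- A graph is a subquotient of an isomorphic graph. -/
def ofIso {σ : Y ≃ X} (f : MGraph.GIso β γ σ) : SubQuotient β γ where
  cell v x := f.onV v = x
  emb := f.onE
  ends := f.onEnds
  leg y := Sum.inr (σ y)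
  ends_fst := f.onEnds_fst
  injective := by
    have : (Sum.elim (Sum.inl ∘ f.onEnds) (fun y => Sum.inr (σ y)) : β.H → γ.H) = f.onH := by
      funext h; rcases h with p | y <;> rfl
    rw [this]; exact f.onH.injective
  vert_mem h := by
    have := f.vert_comm h
    rw [← this]
    rcases h with p | y <;> rfl
  disjoint v w x h h' := f.onV.injective (h.trans h'.symm)

/-- A graph is a subquotient of itself. -/
def refl (γ : MGraph X) : SubQuotient γ γ where
  cell v x := v = x
  emb := id
  ends := id
  leg := Sum.inr
  ends_fst _ := rfl
  injective := by
    have : (Sum.elim (Sum.inl ∘ id) Sum.inr : γ.H → γ.H) = id := by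
      funext h; rcases h with p | y <;> rfl
    rw [this]; exact Function.injective_id
  vert_mem h := by rcases h with p | y <;> rfl
  disjoint v w x h h' := h.trans h'.symm

theorem refl_ι (γ : MGraph X) : (refl γ).ι = id := by
  funext h; rcases h with p | y <;> rfl

theorem refl_flag (γ : MGraph X) (v : γ.V) : (refl γ).flag v = Subtype.val := by
  funext h; simp [flag, refl_ι]

theorem trans_aux (b : SubQuotient α β) (b' : SubQuotient β γ) :
    (Sum.elim (Sum.inl ∘ b'.ends ∘ b.ends) (b'.ι ∘ b.leg) : α.H → γ.H) = b'.ι ∘ b.ι := by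
  funext h; rcases h with p | y <;> rfl

/-- Composition of subquotients. -/
def trans (b : SubQuotient α β) (b' : SubQuotient β γ) : SubQuotient α γ where
  cell v x := ∃ u, b.cell v u ∧ b'.cell u x
  emb := b'.emb ∘ b.emb
  ends := b'.ends ∘ b.ends
  leg := b'.ι ∘ b.leg
  ends_fst p := by simp [b'.ends_fst, b.ends_fst]
  injective := by rw [trans_aux]; exact b'.ι_injective.comp b.ι_injective
  vert_mem h := by
    rw [trans_aux]
    exact ⟨β.vert (b.ι h), b.vert_mem h, b'.vert_mem (b.ι h)⟩
  disjoint v w x := by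
    rintro ⟨u, h1, h2⟩ ⟨u', h3, h4⟩
    obtain rfl := b'.disjoint _ _ _ h2 h4
    exact b.disjoint _ _ _ h1 h3

theorem trans_ι (b : SubQuotient α β) (b' : SubQuotient β γ) : (b.trans b').ι = b'.ι ∘ b.ι :=
  trans_aux b b'

theorem trans_flag (b : SubQuotient α β) (b' : SubQuotient β γ) (v : α.V) :
    (b.trans b').flag v = b'.ι ∘ b.flag v := by
  funext h; simp [flag, trans_ι]

section Iso

variable (b : SubQuotient β γ) (b' : SubQuotient β' γ)

theorem exists_equiv {A B C : Type} {p : A → C} {q : B → C} (hp : Function.Injective p)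
    (hq : Function.Injective q) (h : Set.range p = Set.range q) : ∃ e : A ≃ B, ∀ x, q (e x) = p x :=
  ⟨(Equiv.ofInjective p hp).trans ((Equiv.setCongr h).trans (Equiv.ofInjective q hq).symm),
    fun x => by simp [Equiv.apply_ofInjective_symm hq]⟩

/-- Two subquotients with the same edges and legs, and with corresponding vertices, are
isomorphic. -/
theorem exists_iso (fV : β.V ≃ β'.V) (hV : ∀ v x, b.cell v x → b'.cell (fV v) x)
    (hE : Set.range b.emb = Set.range b'.emb) (σ : Y ≃ Y') (hσ : ∀ y, b'.leg (σ y) = b.leg y)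
    (hg : ∀ v, β'.genus (fV v) = β.genus v) :
    ∃ f : MGraph.GIso β β' σ, f.onV = fV ∧ (∀ e, b'.emb (f.onE e) = b.emb e) ∧
      ∀ h, b'.ι (f.onH h) = b.ι h := by
  obtain ⟨fE, hfE⟩ := exists_equiv b.emb_injective b'.emb_injective hE
  have hends : Set.range b.ends = Set.range b'.ends := by
    ext q; rw [mem_range_ends, mem_range_ends, hE]
  obtain ⟨fs, hfs⟩ := exists_equiv b.ends_injective b'.ends_injective hends
  have hι : ∀ h, b'.ι (Sum.map fs σ h) = b.ι h := by
    rintro (p | y)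
    · exact congrArg Sum.inl (hfs p)
    · exact hσ y
  refine ⟨⟨fV, fE, fs, fun p => ?_, fun h => ?_, hg⟩, rfl, hfE, hι⟩
  · apply b'.emb_injective
    rw [← b'.ends_fst, hfs, hfE, b.ends_fst]
  -- Both candidate vertices of `β'` have a cell that contains the vertex of `γ` at this half-edge,
  -- and different cells are disjoint.
  · have h1 := b'.vert_mem (Sum.map fs σ h)
    have h2 := hV _ _ (b.vert_mem h)
    have h3 := hι h
    simp only [ι] at h3
    rw [h3] at h1
    exact b'.disjoint _ _ _ h1 h2

end Iso

end SubQuotient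

/-! ### Vertices and edges of subgraphs and contractions -/

namespace MGraph

variable {X : Type} (γ : MGraph X) (S : Finset γ.E)

/-- The vertex of the contraction that replaces the subgraph. -/
def cBot : (γ.contract S).V := (⊥ : WithBot {v : γ.V // ¬ γ.Touched S v})

/-- The other vertices of the contraction. -/
def cCoe (x : γ.V) (h : ¬ γ.Touched S x) : (γ.contract S).V :=
  ((⟨x, h⟩ : {v : γ.V // ¬ γ.Touched S v}) : WithBot {v : γ.V // ¬ γ.Touched S v})

/-- The vertices of a subgraph. -/
def sV (x : γ.V) (h : γ.Touched S x) : (γ.sub S).V := (⟨x, h⟩ : {v : γ.V // γ.Touched S v})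

/-- The underlying vertex. -/
def sVal (v : (γ.sub S).V) : γ.V := Subtype.val (p := γ.Touched S) v

theorem sVal_sV (x : γ.V) (h : γ.Touched S x) : γ.sVal S (γ.sV S x h) = x := rfl

theorem sVal_touched (v : (γ.sub S).V) : γ.Touched S (γ.sVal S v) := Subtype.property v

theorem sVal_injective : Function.Injective (γ.sVal S) := Subtype.val_injective

theorem sVal_lt {u v : (γ.sub S).V} : γ.sVal S u < γ.sVal S v ↔ u < v := Iff.rfl

theorem contract_cases (v : (γ.contract S).V) : v = γ.cBot S ∨ ∃ x h, v = γ.cCoe S x h := by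
  change WithBot {v : γ.V // ¬ γ.Touched S v} at v
  induction v using WithBot.recBotCoe with
  | bot => exact Or.inl rfl
  | coe v => exact Or.inr ⟨v.1, v.2, rfl⟩

theorem cBot_ne_cCoe {x : γ.V} {h : ¬ γ.Touched S x} : γ.cBot S ≠ γ.cCoe S x h := WithBot.bot_ne_coe

theorem cCoe_inj {x y : γ.V} {h : ¬ γ.Touched S x} {h' : ¬ γ.Touched S y} :
    γ.cCoe S x h = γ.cCoe S y h' ↔ x = y :=
  WithBot.coe_inj.trans Subtype.ext_iff

theorem cBot_lt_cCoe {x : γ.V} {h : ¬ γ.Touched S x} : γ.cBot S < γ.cCoe S x h := WithBot.bot_lt_coe _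

theorem not_lt_cBot (v : (γ.contract S).V) : ¬ v < γ.cBot S :=
  WithBot.not_lt_bot (α := {v : γ.V // ¬ γ.Touched S v}) v

theorem cCoe_lt_cCoe {x y : γ.V} {h : ¬ γ.Touched S x} {h' : ¬ γ.Touched S y} :
    γ.cCoe S x h < γ.cCoe S y h' ↔ x < y :=
  WithBot.coe_lt_coe

open Classical in
/-- The contraction on the vertices. -/
def cproj (x : γ.V) : (γ.contract S).V :=
  if hv : γ.Touched S x then γ.cBot S else γ.cCoe S x hv

theorem cproj_of_touched {x : γ.V} (h : γ.Touched S x) : γ.cproj S x = γ.cBot S := dif_pos h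

theorem cproj_of_not_touched {x : γ.V} (h : ¬ γ.Touched S x) : γ.cproj S x = γ.cCoe S x h :=
  dif_neg h

theorem cproj_eq_cBot {x : γ.V} : γ.cproj S x = γ.cBot S ↔ γ.Touched S x := by
  by_cases h : γ.Touched S x
  · simp [cproj_of_touched _ _ h, h]
  · simp [cproj_of_not_touched _ _ h, h, (γ.cBot_ne_cCoe S).symm]

theorem cproj_eq_cCoe {x y : γ.V} {hy : ¬ γ.Touched S y} : γ.cproj S x = γ.cCoe S y hy ↔ x = y := by
  by_cases h : γ.Touched S x
  · simp only [cproj_of_touched _ _ h, γ.cBot_ne_cCoe S, false_iff]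
    rintro rfl; exact hy h
  · rw [cproj_of_not_touched _ _ h, cCoe_inj]

open Classical in
theorem sum_contract {M : Type*} [AddCommMonoid M] (F : (γ.contract S).V → M) :
    ∑ v, F v = F (γ.cBot S) + ∑ x : {x : γ.V // ¬ γ.Touched S x}, F (γ.cCoe S x.1 x.2) :=
  Fintype.sum_withBot (α := {x : γ.V // ¬ γ.Touched S x}) F

open Classical in
theorem sum_contract_ite {M : Type*} [AddCommMonoid M] (F : (γ.contract S).V → M) (G : γ.V → M)
    (h : ∀ x hx, F (γ.cCoe S x hx) = G x) :
    ∑ v, F v = F (γ.cBot S) + ∑ x, if γ.Touched S x then 0 else G x := by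
  rw [sum_contract]
  congr 1
  rw [Fintype.sum_congr _ (fun x => G x.1) (fun x => h x.1 x.2), Finset.sum_subtype_ite]
  refine Finset.sum_congr rfl fun x _ => ?_
  by_cases hx : γ.Touched S x <;> simp [hx]

open Classical in
theorem sum_sub_ite {M : Type*} [AddCommMonoid M] (F : (γ.sub S).V → M) (G : γ.V → M)
    (h : ∀ x hx, F (γ.sV S x hx) = G x) :
    ∑ v, F v = ∑ x, if γ.Touched S x then G x else 0 := by
  rw [← Finset.sum_subtype_ite]
  exact Fintype.sum_congr (α := {x // γ.Touched S x}) _ (fun x => G x.1) (fun x => h x.1 x.2)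

theorem genus_cBot : (γ.contract S).genus (γ.cBot S) = (γ.sub S).totalGenus := rfl

theorem genus_cCoe (x : γ.V) (h : ¬ γ.Touched S x) :
    (γ.contract S).genus (γ.cCoe S x h) = γ.genus x := rfl

theorem contractDeg_cBot (d : γ.V → ℕ) : γ.contractDeg S d (γ.cBot S)
    = ∑ v : (γ.sub S).V, d (γ.sVal S v) + Fintype.card (γ.sub S).E - 1 := rfl

theorem contractDeg_cCoe (d : γ.V → ℕ) (x : γ.V) (h : ¬ γ.Touched S x) :
    γ.contractDeg S d (γ.cCoe S x h) = d x := rfl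

/-- Edges of the contraction. -/
def cE (e : γ.E) (h : e ∉ S) : (γ.contract S).E := (⟨e, h⟩ : {e : γ.E // e ∉ S})

/-- The underlying edge. -/
def cEVal (e : (γ.contract S).E) : γ.E := Subtype.val (p := fun e => e ∉ S) e

/-- Edges of a subgraph. -/
def sE (e : γ.E) (h : e ∈ S) : (γ.sub S).E := (⟨e, h⟩ : {e : γ.E // e ∈ S})

/-- The underlying edge. -/
def sEVal (e : (γ.sub S).E) : γ.E := Subtype.val (p := fun e => e ∈ S) e

theorem cEVal_notMem (e : (γ.contract S).E) : γ.cEVal S e ∉ S := Subtype.property e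

theorem sEVal_mem (e : (γ.sub S).E) : γ.sEVal S e ∈ S := Subtype.property e

theorem cEVal_lt {e f : (γ.contract S).E} : γ.cEVal S e < γ.cEVal S f ↔ e < f := Iff.rfl

theorem sEVal_lt {e f : (γ.sub S).E} : γ.sEVal S e < γ.sEVal S f ↔ e < f := Iff.rfl

theorem card_sub_E : Fintype.card (γ.sub S).E = S.card :=
  (Fintype.card_congr' (by rfl)).trans (Fintype.card_coe S)

theorem card_contract_E : Fintype.card (γ.contract S).E = Fintype.card γ.E - S.card := by
  classical
  have h : Fintype.card (γ.contract S).E = Fintype.card {e : γ.E // e ∉ S} := by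
    rw [← Nat.card_eq_fintype_card, ← Nat.card_eq_fintype_card]; rfl
  rw [h, Fintype.card_subtype_compl, Fintype.card_coe]

/-- The subgraph as a subquotient. -/
def subSQ : SubQuotient (γ.sub S) γ where
  cell v x := x = γ.sVal S v
  emb := γ.sEVal S
  ends p := (γ.sEVal S p.1, p.2)
  leg l := γ.restIncl S l.1
  ends_fst _ := rfl
  injective := by
    rintro (⟨⟨e, he⟩, c⟩ | ⟨⟨⟨e, he⟩, c⟩ | x, hl⟩) (⟨⟨e', he'⟩, c'⟩ | ⟨⟨⟨e', he'⟩, c'⟩ | x', hl'⟩) hyp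
      <;> simp [restIncl, sEVal] at hyp ⊢ <;> grind
  vert_mem h := by rcases h with p | l <;> rfl
  disjoint v w x h h' := γ.sVal_injective S (h.symm.trans h')

/-- The contraction as a subquotient. -/
def contractSQ : SubQuotient (γ.contract S) γ where
  cell v x := γ.cproj S x = v
  emb := γ.cEVal S
  ends p := (γ.cEVal S p.1, p.2)
  leg := Sum.inr
  ends_fst _ := rfl
  injective := by
    have : (Sum.elim (Sum.inl ∘ fun p : {e : γ.E // e ∉ S} × Bool => (p.1.1, p.2)) Sum.inr :
      γ.Rest S → γ.H) = γ.restIncl S := by funext h; rcases h with p | y <;> rfl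
    exact Eq.mpr (congrArg Function.Injective this) (γ.restIncl_injective S)
  vert_mem h := by
    rcases h with p | y <;> rfl
  disjoint v w x h h' := h.symm.trans h'

theorem contractSQ_ι : (γ.contractSQ S).ι = γ.restIncl S := by
  funext h; rcases h with p | y <;> rfl

theorem range_subSQ_emb : Set.range (γ.subSQ S).emb = {e | e ∈ S} := Subtype.range_coe

theorem range_contractSQ_emb : Set.range (γ.contractSQ S).emb = {e | e ∉ S} := Subtype.range_coe

theorem subSQ_ι_subFlag (v : (γ.sub S).V) (h : (γ.sub S).Flag v) :
    (γ.subSQ S).ι h.1 = (γ.subFlag S v h).1 := rfl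

end MGraph

/-! ### Labels of subgraphs and contractions -/

namespace ModularCollection

variable {k : Type*} [Field k] {P : ModularCollection k} {X : Type}

/-- The labels of a subgraph. -/
def subLabels (γ : MGraph X) (S : Finset γ.E) (d : γ.V → ℕ) (a : P.Labels γ d) :
    P.Labels (γ.sub S) (fun v => d (γ.sVal S v)) :=
  fun v => P.map (γ.subFlag S v).symm (a (γ.sVal S v))

theorem subLabels_same (γ : MGraph X) (S : Finset γ.E) (d : γ.V → ℕ) (a : P.Labels γ d)
    (x : γ.V) (hx : γ.Touched S x) :
    SameLabel (Subtype.val : γ.Flag x → γ.H) (a x) ((γ.subSQ S).flag (γ.sV S x hx))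
      (subLabels γ S d a (γ.sV S x hx)) :=
  SameLabel.map (g := γ.genus x) (γ.subFlag S ⟨x, hx⟩).symm (a x) (fun y => by
    refine (γ.subSQ_ι_subFlag S _ _).trans ?_
    exact congrArg Subtype.val ((γ.subFlag S ⟨x, hx⟩).apply_symm_apply y))

theorem contractLabels_cCoe (μ : P.Operations) (γ : MGraph X) (S : Finset γ.E) (d : γ.V → ℕ)
    (a : P.Labels γ d) (x : γ.V) (hx : ¬ γ.Touched S x) :
    SameLabel (Subtype.val : γ.Flag x → γ.H) (a x) ((γ.contractSQ S).flag (γ.cCoe S x hx))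
      (contractLabels μ γ S d a (γ.cCoe S x hx)) :=
  SameLabel.map (g := γ.genus x) (γ.oldFlag S ⟨x, hx⟩).symm (a x) (fun y => by
    have : ∀ h, (γ.contractSQ S).flag (γ.cCoe S x hx) h
        = (γ.oldFlag S ⟨x, hx⟩ h).1 := fun h =>
      congrFun (γ.contractSQ_ι S) h.1
    refine (this _).trans ?_
    exact congrArg Subtype.val ((γ.oldFlag S ⟨x, hx⟩).apply_symm_apply y))

theorem contractLabels_cBot (μ : P.Operations) (γ : MGraph X) (S : Finset γ.E) (d : γ.V → ℕ)
    (a : P.Labels γ d) :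
    SameLabel (γ.subSQ S).leg (μ (γ.sub S) (fun v => d (γ.sVal S v)) (subLabels γ S d a))
      ((γ.contractSQ S).flag (γ.cBot S)) (contractLabels μ γ S d a (γ.cBot S)) :=
  SameLabel.map (g := (γ.sub S).totalGenus) (γ.newFlag S)
    (μ (γ.sub S) (fun v => d (γ.sVal S v)) (subLabels γ S d a)) (fun y =>
    congrFun (γ.contractSQ_ι S) y.1)

/-- Isomorphic subquotients with the same labels. -/
theorem exists_iso_labels {Y Y' : Type} {β : MGraph Y} {β' : MGraph Y'} {γ : MGraph X}
    (b : SubQuotient β γ) (b' : SubQuotient β' γ) (fV : β.V ≃ β'.V)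
    (hV : ∀ v x, b.cell v x → b'.cell (fV v) x)
    (hE : Set.range b.emb = Set.range b'.emb) (σ : Y ≃ Y') (hσ : ∀ y, b'.leg (σ y) = b.leg y)
    {d : β.V → ℕ} {d' : β'.V → ℕ} (a : P.Labels β d) (a' : P.Labels β' d')
    (ha : ∀ v, SameLabel (b.flag v) (a v) (b'.flag (fV v)) (a' (fV v))) :
    ∃ f : MGraph.GIso β β' σ, f.onV = fV ∧ (∀ e, b'.emb (f.onE e) = b.emb e) ∧
      ∃ hd : ∀ v, d' (f.onV v) = d v, P.LabelsMatch f hd a a' := by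
  obtain ⟨f, rfl, h2, h3⟩ := b.exists_iso b' fV hV hE σ hσ (fun v => (ha v).genus_eq.symm)
  refine ⟨f, rfl, h2, fun v => (ha v).degree_eq.symm, fun v => ?_⟩
  obtain ⟨_, _, h⟩ := (ha v).rel (b'.flag_injective _) (f.onFlag v) (fun y => h3 y.1)
  exact h

end ModularCollection

/-! ### Comparison of cochains and operations at isomorphic subquotients -/

namespace WeakModularOperad

variable {k : Type*} [Field k] {W : WeakModularOperad k} {X : Type}

open ModularCollection

/-- This is how terms of the differential and of its square are compared. Two iterated contractions
of one graph are recognized as isomorphic inside that graph, and the isomorphism is returned because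
the sign depends on how it permutes vertices and edges. -/
theorem ft_apply_eq {g : ℕ} {D : ℤ} {φ : W.Cochain X} (hφ : φ ∈ W.ft g X D) {Z : Type}
    {β β' : MGraph X} {γ : MGraph Z} (b : SubQuotient β γ) (b' : SubQuotient β' γ)
    (fV : β.V ≃ β'.V) (hV : ∀ v x, b.cell v x → b'.cell (fV v) x)
    (hE : Set.range b.emb = Set.range b'.emb) (hσ : ∀ y, b'.leg y = b.leg y)
    {d : β.V → ℕ} {d' : β'.V → ℕ} (a : W.toModularCollection.Labels β d)
    (a' : W.toModularCollection.Labels β' d')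
    (ha : ∀ v, SameLabel (b.flag v) (a v) (b'.flag (fV v)) (a' (fV v))) :
    ∃ f : MGraph.GIso β β' (Equiv.refl X), f.onV = fV ∧ (∀ e, b'.emb (f.onE e) = b.emb e) ∧
      φ β' d' a' = (f.vertexSign d * f.edgeSign Finset.univ) • φ β d a := by
  obtain ⟨f, h1, h2, hd, h⟩ := exists_iso_labels b b' fV hV hE (Equiv.refl X) hσ a a' ha
  exact ⟨f, h1, h2, hφ.2.2 β β' f d d' hd a a' h⟩

/-- The analogue of `ft_apply_eq` for the operations. The two leg sets may be different types, so
the outputs can only be compared over the half-edges of the ambient graph. -/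
theorem μ_same {Z Y Y' : Type} {β : MGraph Y} {β' : MGraph Y'} {γ : MGraph Z}
    (hβ : β.IsModular) (hne : Nonempty β.E) (b : SubQuotient β γ) (b' : SubQuotient β' γ)
    (fV : β.V ≃ β'.V) (hV : ∀ v x, b.cell v x → b'.cell (fV v) x)
    (hE : Set.range b.emb = Set.range b'.emb) (hL : Set.range b.leg = Set.range b'.leg)
    {d : β.V → ℕ} {d' : β'.V → ℕ} (a : W.toModularCollection.Labels β d)
    (a' : W.toModularCollection.Labels β' d')
    (ha : ∀ v, SameLabel (b.flag v) (a v) (b'.flag (fV v)) (a' (fV v))) :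
    ∃ (σ : Y ≃ Y') (f : MGraph.GIso β β' σ), f.onV = fV ∧ (∀ e, b'.emb (f.onE e) = b.emb e) ∧
      SameLabel b.leg ((f.vertexSign d * f.edgeSign Finset.univ) • W.μ β d a) b'.leg
        (W.μ β' d' a') := by
  obtain ⟨σ, hσ⟩ := SubQuotient.exists_equiv b.leg_injective b'.leg_injective hL
  obtain ⟨f, h1, h2, hd, h⟩ := exists_iso_labels b b' fV hV hE σ hσ a a' ha
  have hi : ∑ v, d v + Fintype.card β.E - 1 = ∑ v, d' v + Fintype.card β'.E - 1 := by
    rw [Fintype.card_congr f.onE, ← Equiv.sum_comp f.onV d']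
    simp [hd]
  refine ⟨σ, f, h1, h2, σ, hσ, ?_⟩
  have h3 := W.equivariant β β' σ f hβ hne d d' hd a a' h f.totalGenus_eq hi
  rw [h3]
  have : Rel σ (W.μ β d a) (W.toModularCollection.transport f.totalGenus_eq σ hi (W.μ β d a)) :=
    ⟨_, _, rfl⟩
  exact this.zsmul _

end WeakModularOperad


namespace MGraph

variable {X : Type} (γ : MGraph X)

/-! ### Connectedness -/

variable {γ} in
theorem Joined.mono {S T : Finset γ.E} (h : S ⊆ T) {u v : γ.V} (huv : γ.Joined S u v) :
    γ.Joined T u v :=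
  Relation.ReflTransGen.mono (fun _ _ ⟨e, he, c⟩ => ⟨e, h he, c⟩) _ _ huv

variable {γ} in
theorem Joined.trans {S : Finset γ.E} {u v w : γ.V} (h : γ.Joined S u v) (h' : γ.Joined S v w) :
    γ.Joined S u w := Relation.ReflTransGen.trans h h'

theorem Joined.refl (S : Finset γ.E) (u : γ.V) : γ.Joined S u u := Relation.ReflTransGen.refl

variable {γ} in
theorem joined_edge {S : Finset γ.E} {e : γ.E} (he : e ∈ S) (c c' : Bool) :
    γ.Joined S (γ.vert (Sum.inl (e, c))) (γ.vert (Sum.inl (e, c'))) := by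
  rcases Bool.eq_or_eq_not c' c with rfl | rfl
  · exact Joined.refl _ _ _
  · exact Relation.ReflTransGen.single ⟨e, he, c, rfl, rfl⟩

variable {γ} in
/-- An equivalence relation that contains the ends of all edges in `S` contains `Joined S`. -/
theorem Joined.rec_on {S : Finset γ.E} {r : γ.V → γ.V → Prop} (hr : ∀ u, r u u)
    (ht : ∀ u v w, r u v → r v w → r u w)
    (he : ∀ e ∈ S, ∀ c, r (γ.vert (Sum.inl (e, c))) (γ.vert (Sum.inl (e, !c)))) {u v : γ.V}
    (h : γ.Joined S u v) : r u v := by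
  induction h with
  | refl => exact hr _
  | tail _ h' ih =>
    obtain ⟨e, hS, c, rfl, rfl⟩ := h'
    exact ht _ _ _ ih (he e hS c)

variable {γ} in
theorem Joined.symm {S : Finset γ.E} {u v : γ.V} (h : γ.Joined S u v) : γ.Joined S v u :=
  Joined.rec_on (r := fun u v => γ.Joined S v u) (fun u => Joined.refl _ _ u)
    (fun _ _ _ h1 h2 => h2.trans h1) (fun _ he c => joined_edge he (!c) c) h

/-- The underlying simple graph. -/
def simple : SimpleGraph γ.V where
  Adj u v := u ≠ v ∧ ∃ e c, γ.vert (Sum.inl (e, c)) = u ∧ γ.vert (Sum.inl (e, !c)) = v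
  symm := ⟨fun u v ⟨h, e, c, h1, h2⟩ => ⟨h.symm, e, !c, h2, by simpa using h1⟩⟩
  loopless := ⟨fun u h => h.1 rfl⟩

theorem simple_connected (h : γ.Connected) : γ.simple.Connected := by
  have := h.1
  refine ⟨fun u v => ?_⟩
  refine Joined.rec_on (r := γ.simple.Reachable) (fun u => SimpleGraph.Reachable.refl u)
    (fun _ _ _ => SimpleGraph.Reachable.trans) (fun e _ c => ?_) (h.2 u v)
  by_cases hne : γ.vert (Sum.inl (e, c)) = γ.vert (Sum.inl (e, !c))
  · rw [hne]
  · exact SimpleGraph.Adj.reachable ⟨hne, e, c, rfl, rfl⟩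

/-- A connected graph has a spanning tree. -/
theorem exists_spanning (h : γ.Connected) :
    ∃ F : Finset γ.E, F.card + 1 = Fintype.card γ.V ∧ ∀ u v, γ.Joined F u v := by
  classical
  obtain ⟨T, hT, hTree⟩ := (γ.simple_connected h).exists_isTree_le
  have hc : ∀ x : T.edgeSet, ∃ e : γ.E, s(γ.vert (Sum.inl (e, false)), γ.vert (Sum.inl (e, true)))
      = x.1 := by
    rintro ⟨x, hx⟩
    induction x with
    | _ u v =>
      obtain ⟨-, e, c, rfl, rfl⟩ := hT hx
      refine ⟨e, ?_⟩
      cases c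
      · rfl
      · exact Sym2.eq_swap
  choose f hf using hc
  have hinj : Function.Injective f := fun x y hxy => Subtype.ext (by rw [← hf x, ← hf y, hxy])
  refine ⟨Finset.univ.image f, ?_, fun u v => ?_⟩
  · rw [Finset.card_image_of_injective _ hinj, Finset.card_univ, ← hTree.card_edgeFinset]
    congr 1
    rw [SimpleGraph.edgeFinset_card]
  · obtain ⟨w⟩ := hTree.connected.preconnected u v
    induction w with
    | nil => exact Joined.refl _ _ _
    | cons hadj _ ih =>
      refine Joined.trans ?_ ih
      have h1 := hf ⟨s(_, _), hadj⟩
      have h2 : f ⟨s(_, _), hadj⟩ ∈ Finset.univ.image f := Finset.mem_image_of_mem _ (Finset.mem_univ _)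
      generalize f ⟨s(_, _), hadj⟩ = e at h1 h2
      rcases Sym2.eq_iff.1 h1 with ⟨ha, hb⟩ | ⟨ha, hb⟩
      · rw [← ha, ← hb]; exact joined_edge h2 _ _
      · rw [← ha, ← hb]; exact joined_edge h2 _ _

theorem card_V_le (h : γ.Connected) : Fintype.card γ.V ≤ Fintype.card γ.E + 1 := by
  obtain ⟨F, h1, -⟩ := γ.exists_spanning h
  have := Finset.card_le_univ F
  omega

/-- The subtraction of natural numbers in `totalGenus` is not truncated for a connected graph, since
a spanning tree has `|V| - 1` edges. -/
theorem totalGenus_cast (h : γ.Connected) : (γ.totalGenus : ℤ)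
    = Fintype.card γ.E + 1 - Fintype.card γ.V + ∑ v, (γ.genus v : ℤ) := by
  unfold totalGenus
  have := γ.card_V_le h
  push_cast [Nat.cast_sub this]
  ring

/-! ### Half-edges -/

theorem sum_card_flag [Finite X] :
    ∑ v, Nat.card (γ.Flag v) = 2 * Fintype.card γ.E + Nat.card X := by
  classical
  have := Fintype.ofFinite X
  rw [← Nat.card_sigma, Nat.card_congr (Equiv.sigmaFiberEquiv γ.vert), Nat.card_sum, Nat.card_prod]
  simp [mul_comm]

theorem finite_flag [Finite X] (v : γ.V) : Finite (γ.Flag v) := by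
  have := Fintype.ofFinite X
  infer_instance

/-! ### Subgraphs -/

variable (S : Finset γ.E)

variable {S} in
theorem touched_of_mem {e : γ.E} (he : e ∈ S) (c : Bool) : γ.Touched S (γ.vert (Sum.inl (e, c))) :=
  ⟨e, he, c, rfl⟩

/-- A path with edges in `R ⊆ S` that starts at a vertex of the subgraph never leaves it, because
both ends of each of its edges are touched by `S`. -/
theorem sub_joined {S' : Finset (γ.sub S).E} {R : Finset γ.E} (h : ∀ e, e ∈ S' ↔ γ.sEVal S e ∈ R)
    (hR : R ⊆ S) {u v : γ.V} (hu : γ.Touched S u) (hv : γ.Touched S v) :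
    (γ.sub S).Joined S' (γ.sV S u hu) (γ.sV S v hv) ↔ γ.Joined R u v := by
  constructor
  · refine Relation.ReflTransGen.lift (γ.sVal S) ?_ _ _
    rintro a b ⟨e, he, c, rfl, rfl⟩
    exact ⟨γ.sEVal S e, (h e).1 he, c, rfl, rfl⟩
  · intro huv
    have key : ∀ v, γ.Joined R u v → ∃ hv, (γ.sub S).Joined S' (γ.sV S u hu) (γ.sV S v hv) := by
      intro v hv
      induction hv with
      | refl => exact ⟨hu, Joined.refl _ _ _⟩
      | tail _ h' ih =>
        obtain ⟨e, he, c, rfl, rfl⟩ := h'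
        obtain ⟨h1, h2⟩ := ih
        refine ⟨γ.touched_of_mem (hR he) _, Relation.ReflTransGen.tail h2 ?_⟩
        exact ⟨γ.sE S e (hR he), (h _).2 he, c, rfl, rfl⟩
    exact (key v huv).2

theorem sub_touched {S' : Finset (γ.sub S).E} {R : Finset γ.E} (h : ∀ e, e ∈ S' ↔ γ.sEVal S e ∈ R)
    (hR : R ⊆ S) {u : γ.V} (hu : γ.Touched S u) :
    (γ.sub S).Touched S' (γ.sV S u hu) ↔ γ.Touched R u := by
  constructor
  · rintro ⟨e, he, c, hc⟩
    exact ⟨γ.sEVal S e, (h e).1 he, c, congrArg (γ.sVal S) hc⟩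
  · rintro ⟨e, he, c, rfl⟩
    exact ⟨γ.sE S e (hR he), (h _).2 he, c, rfl⟩

theorem sub_isConnectedSubset {S' : Finset (γ.sub S).E} {R : Finset γ.E}
    (h : ∀ e, e ∈ S' ↔ γ.sEVal S e ∈ R) (hR : R ⊆ S) :
    (γ.sub S).IsConnectedSubset S' ↔ γ.IsConnectedSubset R := by
  have ht : ∀ {x}, γ.Touched R x → γ.Touched S x := fun ⟨e, he, c⟩ => ⟨e, hR he, c⟩
  constructor
  · rintro ⟨⟨e, he⟩, h2⟩
    refine ⟨⟨_, (h e).1 he⟩, fun u v hu hv => ?_⟩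
    have := h2 (γ.sV S u (ht hu)) (γ.sV S v (ht hv)) ((γ.sub_touched S h hR _).2 hu)
      ((γ.sub_touched S h hR _).2 hv)
    exact (γ.sub_joined S h hR _ _).1 this
  · rintro ⟨⟨e, he⟩, h2⟩
    refine ⟨⟨γ.sE S e (hR he), (h _).2 he⟩, fun u v hu hv => ?_⟩
    have hu' := (γ.sub_touched S h hR (γ.sVal_touched S u)).1 hu
    have hv' := (γ.sub_touched S h hR (γ.sVal_touched S v)).1 hv
    exact (γ.sub_joined S h hR (γ.sVal_touched S u) (γ.sVal_touched S v)).2 (h2 _ _ hu' hv')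

theorem sub_connected (h : γ.IsConnectedSubset S) : (γ.sub S).Connected := by
  obtain ⟨⟨e, he⟩, h2⟩ := h
  refine ⟨⟨γ.sV S _ (γ.touched_of_mem he false)⟩, fun u v => ?_⟩
  exact (γ.sub_joined S (S' := Finset.univ) (R := S) (fun e => by simp [γ.sEVal_mem S e])
    subset_rfl (γ.sVal_touched S u) (γ.sVal_touched S v)).2 (h2 _ _ (γ.sVal_touched S u)
    (γ.sVal_touched S v))

theorem sub_isModular (hγ : γ.IsModular) (h : γ.IsConnectedSubset S) : (γ.sub S).IsModular := by
  have := hγ.finite_legs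
  have : Finite γ.H := by infer_instance
  refine ⟨Finite.of_injective _ (γ.subSQ S).leg_injective, γ.sub_connected S h, fun v => ?_⟩
  have h1 := hγ.stable (γ.sVal S v)
  have h2 : Nat.card ((γ.sub S).Flag v) = _ := Nat.card_congr (γ.subFlag S v)
  rw [h2]
  exact h1

/-! ### Contractions -/

variable {S} in
-- A fibre of the contraction is a single vertex or the vertex set of the contracted subgraph, which
-- is connected.
theorem joined_of_cproj_eq (h : γ.IsConnectedSubset S) {u v : γ.V}
    (huv : γ.cproj S u = γ.cproj S v) : γ.Joined S u v := by
  by_cases hv : γ.Touched S v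
  · rw [γ.cproj_of_touched S hv, cproj_eq_cBot] at huv
    exact h.2 _ _ huv hv
  · rw [γ.cproj_of_not_touched S hv, cproj_eq_cCoe] at huv
    rw [huv]; exact Joined.refl _ _ _

theorem contract_vert_cE (e : γ.E) (he : e ∉ S) (c : Bool) :
    (γ.contract S).vert (Sum.inl (γ.cE S e he, c)) = γ.cproj S (γ.vert (Sum.inl (e, c))) := rfl

theorem contract_vert_inl (e : (γ.contract S).E) (c : Bool) :
    (γ.contract S).vert (Sum.inl (e, c)) = γ.cproj S (γ.vert (Sum.inl (γ.cEVal S e, c))) := rfl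

theorem cproj_surjective (h : S.Nonempty) (v : (γ.contract S).V) : ∃ x, γ.cproj S x = v := by
  rcases γ.contract_cases S v with rfl | ⟨x, hx, rfl⟩
  · obtain ⟨e, he⟩ := h
    exact ⟨_, γ.cproj_of_touched S (γ.touched_of_mem he false)⟩
  · exact ⟨x, γ.cproj_of_not_touched S hx⟩

theorem contract_joined_of {R' : Finset (γ.contract S).E} {T : Finset γ.E}
    (hR : ∀ e (he : e ∉ S), e ∈ T → γ.cE S e he ∈ R') {u v : γ.V} (h : γ.Joined T u v) :
    (γ.contract S).Joined R' (γ.cproj S u) (γ.cproj S v) := by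
  refine Joined.rec_on (r := fun u v => (γ.contract S).Joined R' (γ.cproj S u) (γ.cproj S v))
    (fun u => Joined.refl _ _ _) (fun _ _ _ => Joined.trans) (fun e he c => ?_) h
  by_cases heS : e ∈ S
  · rw [γ.cproj_of_touched S (γ.touched_of_mem heS c), γ.cproj_of_touched S (γ.touched_of_mem heS _)]
    exact Joined.refl _ _ _
  · exact joined_edge (hR e heS he) c (!c)

theorem joined_of_contract_joined (hS : γ.IsConnectedSubset S) {R' : Finset (γ.contract S).E}
    {T : Finset γ.E} (hST : S ⊆ T) (hR : ∀ e ∈ R', γ.cEVal S e ∈ T) {u v : γ.V}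
    (h : (γ.contract S).Joined R' (γ.cproj S u) (γ.cproj S v)) : γ.Joined T u v := by
  have key : ∀ a b, (γ.contract S).Joined R' a b →
      ∀ u v, γ.cproj S u = a → γ.cproj S v = b → γ.Joined T u v := by
    intro a b hab
    refine Joined.rec_on (γ := γ.contract S) (S := R')
      (r := fun a b => ∀ u v, γ.cproj S u = a → γ.cproj S v = b → γ.Joined T u v)
      (fun a u v hu hv => ?_) (fun a b c h1 h2 u v hu hv => ?_) (fun e he c u v hu hv => ?_) hab
    · exact (γ.joined_of_cproj_eq hS (hu.trans hv.symm)).mono hST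
    · obtain ⟨w, hw⟩ := γ.cproj_surjective S hS.1 b
      exact (h1 u w hu hw).trans (h2 w v hw hv)
    · have h1 : γ.Joined T u (γ.vert (Sum.inl (γ.cEVal S e, c))) :=
        (γ.joined_of_cproj_eq hS hu).mono hST
      have h2 : γ.Joined T v (γ.vert (Sum.inl (γ.cEVal S e, !c))) :=
        (γ.joined_of_cproj_eq hS hv).mono hST
      exact h1.trans ((joined_edge (hR e he) c (!c)).trans h2.symm)
  exact key _ _ h u v rfl rfl

theorem contract_connected (hγ : γ.Connected) (hS : γ.IsConnectedSubset S) :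
    (γ.contract S).Connected := by
  refine ⟨⟨γ.cBot S⟩, fun u v => ?_⟩
  obtain ⟨x, rfl⟩ := γ.cproj_surjective S hS.1 u
  obtain ⟨y, rfl⟩ := γ.cproj_surjective S hS.1 v
  exact γ.contract_joined_of S (T := Finset.univ) (fun _ _ _ => Finset.mem_univ _) (hγ.2 x y)

open Classical in
theorem card_sub_V : Fintype.card (γ.sub S).V = ∑ x, if γ.Touched S x then 1 else 0 := by
  have := γ.sum_sub_ite S (fun _ => 1) (fun _ => 1) (fun _ _ => rfl)
  simpa using this

open Classical in
theorem card_contract_V :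
    Fintype.card (γ.contract S).V = 1 + ∑ x, if γ.Touched S x then 0 else 1 := by
  have := γ.sum_contract_ite S (fun _ => 1) (fun _ => 1) (fun _ _ => rfl)
  simpa using this

theorem card_contract_V_add : Fintype.card (γ.contract S).V + Fintype.card (γ.sub S).V
    = Fintype.card γ.V + 1 := by
  classical
  rw [card_sub_V, card_contract_V, add_assoc, ← Finset.sum_add_distrib, add_comm]
  congr 1
  rw [Fintype.card_eq_sum_ones]
  refine Finset.sum_congr rfl fun x _ => ?_
  split_ifs <;> rfl

/-- The new vertex carries the genus of the subgraph, and this compensates the loss of `|S|` edges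
and of all but one of the touched vertices. -/
theorem totalGenus_contract (hγ : γ.Connected) (hS : γ.IsConnectedSubset S) :
    (γ.contract S).totalGenus = γ.totalGenus := by
  classical
  zify
  rw [totalGenus_cast _ hγ, totalGenus_cast _ (γ.contract_connected S hγ hS),
    γ.sum_contract_ite S (fun v => ((γ.contract S).genus v : ℤ)) (fun v => (γ.genus v : ℤ))
    (fun _ _ => rfl), genus_cBot, totalGenus_cast _ (γ.sub_connected S hS),
    γ.sum_sub_ite S (fun v => ((γ.sub S).genus v : ℤ)) (fun v => (γ.genus v : ℤ))
    (fun _ _ => rfl), card_sub_E, card_contract_E, Nat.cast_sub (Finset.card_le_univ S)]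
  have h1 := γ.card_contract_V_add S
  have h2 : ∑ x, (if γ.Touched S x then (γ.genus x : ℤ) else 0)
      + ∑ x, (if γ.Touched S x then 0 else (γ.genus x : ℤ)) = ∑ x, (γ.genus x : ℤ) := by
    rw [← Finset.sum_add_distrib]
    refine Finset.sum_congr rfl fun x _ => ?_
    split_ifs <;> simp
  zify at h1
  linarith

/-- Summing the stability condition over the vertices and counting half-edges gives `|V| + 2 ≤ 2g +
|X|`. Applied to a subgraph, this is the stability of the new vertex of a contraction. -/
theorem two_mul_totalGenus_add [Finite X] (hγ : γ.Connected)
    (h : ∀ v, 3 ≤ 2 * γ.genus v + Nat.card (γ.Flag v)) : 3 ≤ 2 * γ.totalGenus + Nat.card X := by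
  have h1 := γ.sum_card_flag
  have h2 := γ.totalGenus_cast hγ
  have h3 : ∑ v : γ.V, 3 ≤ ∑ v, (2 * γ.genus v + Nat.card (γ.Flag v)) :=
    Finset.sum_le_sum fun v _ => h v
  rw [Finset.sum_add_distrib, ← Finset.mul_sum, h1] at h3
  simp only [Finset.sum_const, Finset.card_univ, smul_eq_mul] at h3
  have h4 : 0 < Fintype.card γ.V := Fintype.card_pos_iff.2 hγ.1
  zify at h3 h4 ⊢
  linarith

theorem contract_isModular (hγ : γ.IsModular) (hS : γ.IsConnectedSubset S) :
    (γ.contract S).IsModular := by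
  have := hγ.finite_legs
  refine ⟨hγ.finite_legs, γ.contract_connected S hγ.connected hS, fun v => ?_⟩
  rcases γ.contract_cases S v with rfl | ⟨x, hx, rfl⟩
  · have h1 := γ.sub_isModular S hγ hS
    have := h1.finite_legs
    have h2 := (γ.sub S).two_mul_totalGenus_add h1.connected h1.stable
    have h3 : Nat.card (γ.SubLeg S) = _ := Nat.card_congr (γ.newFlag S)
    rw [h3] at h2
    exact h2
  · have h1 := hγ.stable x
    have h3 : Nat.card ((γ.contract S).Flag (γ.cCoe S x hx)) = _ :=
      Nat.card_congr (γ.oldFlag S ⟨x, hx⟩)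
    rw [h3]
    exact h1

/-- The edges in `R` outside `S`, as edges of the contraction. -/
def resC (R : Finset γ.E) : Finset (γ.contract S).E :=
  by classical exact Finset.univ.filter (fun e => γ.cEVal S e ∈ R)

/-- The edges in `R` and `S`, as edges of the subgraph. -/
def resS (R : Finset γ.E) : Finset (γ.sub S).E :=
  by classical exact Finset.univ.filter (fun e => γ.sEVal S e ∈ R)

theorem mem_resC {R : Finset γ.E} {e : (γ.contract S).E} : e ∈ γ.resC S R ↔ γ.cEVal S e ∈ R := by
  simp [resC]

theorem mem_resS {R : Finset γ.E} {e : (γ.sub S).E} : e ∈ γ.resS S R ↔ γ.sEVal S e ∈ R := by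
  simp [resS]

theorem card_resC {R : Finset γ.E} (h : Disjoint S R) : (γ.resC S R).card = R.card := by
  classical
  have : (γ.resC S R).map ⟨γ.cEVal S, (γ.contractSQ S).emb_injective⟩ = R := by
    ext e
    simp only [Finset.mem_map, mem_resC]
    constructor
    · rintro ⟨f, hf, rfl⟩; exact hf
    · intro he
      exact ⟨γ.cE S e (fun h' => Finset.disjoint_left.1 h h' he), he, rfl⟩
  rw [← Finset.card_map ⟨γ.cEVal S, (γ.contractSQ S).emb_injective⟩, this]

theorem card_resS {R : Finset γ.E} (h : R ⊆ S) : (γ.resS S R).card = R.card := by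
  classical
  have : (γ.resS S R).map ⟨γ.sEVal S, (γ.subSQ S).emb_injective⟩ = R := by
    ext e
    simp only [Finset.mem_map, mem_resS]
    constructor
    · rintro ⟨f, hf, rfl⟩; exact hf
    · intro he
      exact ⟨γ.sE S e (h he), he, rfl⟩
  rw [← Finset.card_map ⟨γ.sEVal S, (γ.subSQ S).emb_injective⟩, this]

theorem contract_touched {R : Finset γ.E} (h : Disjoint S R) {v : (γ.contract S).V} :
    (γ.contract S).Touched (γ.resC S R) v ↔ ∃ x, γ.cproj S x = v ∧ γ.Touched R x := by
  constructor
  · rintro ⟨e, he, c, rfl⟩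
    exact ⟨_, rfl, γ.touched_of_mem ((γ.mem_resC S).1 he) c⟩
  · rintro ⟨x, rfl, e, he, c, rfl⟩
    exact ⟨γ.cE S e (fun h' => Finset.disjoint_left.1 h h' he), (γ.mem_resC S).2 he, c, rfl⟩

theorem contract_touched_cBot {R : Finset γ.E} (h : Disjoint S R) :
    (γ.contract S).Touched (γ.resC S R) (γ.cBot S) ↔ ∃ x, γ.Touched S x ∧ γ.Touched R x := by
  rw [contract_touched _ _ h]; simp only [cproj_eq_cBot]

theorem contract_touched_cCoe {R : Finset γ.E} (h : Disjoint S R) {x : γ.V}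
    {hx : ¬ γ.Touched S x} :
    (γ.contract S).Touched (γ.resC S R) (γ.cCoe S x hx) ↔ γ.Touched R x := by
  rw [contract_touched _ _ h]; simp only [cproj_eq_cCoe, exists_eq_left]

theorem touched_union [DecidableEq γ.E] {R : Finset γ.E} {x : γ.V} :
    γ.Touched (S ∪ R) x ↔ γ.Touched S x ∨ γ.Touched R x := by
  constructor
  · rintro ⟨e, he, c, rfl⟩
    rcases Finset.mem_union.1 he with h | h
    · exact Or.inl (γ.touched_of_mem h c)
    · exact Or.inr (γ.touched_of_mem h c)
  · rintro (⟨e, he, c, rfl⟩ | ⟨e, he, c, rfl⟩)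
    · exact γ.touched_of_mem (Finset.mem_union_left _ he) c
    · exact γ.touched_of_mem (Finset.mem_union_right _ he) c

/-- Connected subsets of the contraction at the new vertex. -/
theorem contract_connected_touching [DecidableEq γ.E] {R : Finset γ.E} (h : Disjoint S R)
    (hS : γ.IsConnectedSubset S) :
    ((γ.contract S).IsConnectedSubset (γ.resC S R) ∧
      (γ.contract S).Touched (γ.resC S R) (γ.cBot S)) ↔
    (γ.IsConnectedSubset (S ∪ R) ∧ R.Nonempty) := by
  have hmem : ∀ e (he : e ∉ S), e ∈ S ∪ R → γ.cE S e he ∈ γ.resC S R := fun e he h' =>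
    (γ.mem_resC S).2 ((Finset.mem_union.1 h').resolve_left he)
  have hj : ∀ u v, (γ.contract S).Joined (γ.resC S R) (γ.cproj S u) (γ.cproj S v) →
      γ.Joined (S ∪ R) u v := fun u v =>
    γ.joined_of_contract_joined S hS Finset.subset_union_left
      (fun e he => Finset.mem_union_right _ ((γ.mem_resC S).1 he))
  constructor
  · rintro ⟨⟨⟨e, he⟩, h2⟩, h3⟩
    have ht : ∀ u, γ.Touched (S ∪ R) u → (γ.contract S).Touched (γ.resC S R) (γ.cproj S u) := by
      intro u hu
      by_cases hu' : γ.Touched S u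
      · rw [γ.cproj_of_touched S hu']; exact h3
      · exact (γ.contract_touched S h).2
          ⟨u, rfl, ((γ.touched_union S).1 hu).resolve_left hu'⟩
    exact ⟨⟨hS.1.mono Finset.subset_union_left, fun u v hu hv => hj u v (h2 _ _ (ht u hu) (ht v hv))⟩,
      ⟨_, (γ.mem_resC S).1 he⟩⟩
  · rintro ⟨⟨-, h2⟩, ⟨e, he⟩⟩
    have hc : ∀ u v, γ.Touched (S ∪ R) u → γ.Touched (S ∪ R) v →
        (γ.contract S).Joined (γ.resC S R) (γ.cproj S u) (γ.cproj S v) := fun u v hu hv =>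
      γ.contract_joined_of S hmem (h2 u v hu hv)
    refine ⟨⟨⟨γ.cE S e (fun h' => Finset.disjoint_left.1 h h' he), (γ.mem_resC S).2 he⟩,
      fun u v hu hv => ?_⟩, ?_⟩
    · obtain ⟨x, rfl, hx⟩ := (γ.contract_touched S h).1 hu
      obtain ⟨y, rfl, hy⟩ := (γ.contract_touched S h).1 hv
      exact hc x y ((γ.touched_union S).2 (Or.inr hx)) ((γ.touched_union S).2 (Or.inr hy))
    · obtain ⟨f, hf⟩ := hS.1
      have hfT := γ.touched_of_mem hf false
      have heT := γ.touched_of_mem he false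
      have := hc _ _ ((γ.touched_union S).2 (Or.inr heT)) ((γ.touched_union S).2 (Or.inl hfT))
      rw [γ.cproj_of_touched S hfT] at this
      -- A path to the new vertex is either trivial or ends with an edge of `R` at that vertex. In
      -- both cases `R` touches it.
      rcases Relation.ReflTransGen.cases_tail this with h5 | ⟨_, _, e', he', c, _, hc⟩
      · exact (γ.contract_touched S h).2 ⟨_, h5.symm, heT⟩
      · exact ⟨e', he', _, hc⟩

/-- Connected subsets of the contraction away from the new vertex. -/
theorem contract_connected_not_touching {R : Finset γ.E} (h : Disjoint S R) :
    ((γ.contract S).IsConnectedSubset (γ.resC S R) ∧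
      ¬ (γ.contract S).Touched (γ.resC S R) (γ.cBot S)) ↔
    (γ.IsConnectedSubset R ∧ ∀ x, ¬ (γ.Touched S x ∧ γ.Touched R x)) := by
  rw [γ.contract_touched_cBot S h, not_exists]
  refine and_congr_left fun hd => ?_
  have hcp : ∀ {x}, γ.Touched R x → ¬ γ.Touched S x := fun hx hS => hd _ ⟨hS, hx⟩
  constructor
  · rintro ⟨⟨e, he⟩, h2⟩
    refine ⟨⟨_, (γ.mem_resC S).1 he⟩, fun u v hu hv => ?_⟩
    have h3 := h2 (γ.cproj S u) (γ.cproj S v) ((γ.contract_touched S h).2 ⟨u, rfl, hu⟩)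
      ((γ.contract_touched S h).2 ⟨v, rfl, hv⟩)
    -- No edge of `R` meets `S`, so the steps of a path lift to `γ` one by one and the lift stays
    -- away from the contracted subgraph.
    have key : ∀ a b, (γ.contract S).Joined (γ.resC S R) a b →
        ∀ u, γ.cproj S u = a → ¬ γ.Touched S u →
          ∃ w, γ.cproj S w = b ∧ ¬ γ.Touched S w ∧ γ.Joined R u w := by
      intro a b hab
      refine Joined.rec_on (γ := γ.contract S) (S := γ.resC S R)
        (r := fun a b => ∀ u, γ.cproj S u = a → ¬ γ.Touched S u →
          ∃ w, γ.cproj S w = b ∧ ¬ γ.Touched S w ∧ γ.Joined R u w)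
        (fun a u hu hu' => ⟨u, hu, hu', Joined.refl _ _ _⟩)
        (fun a b c h1 h2 u hu hu' => ?_) (fun e he c u hu hu' => ?_) hab
      · obtain ⟨w, hw1, hw2, hw3⟩ := h1 u hu hu'
        obtain ⟨w', h1', h2', h3'⟩ := h2 w hw1 hw2
        exact ⟨w', h1', h2', hw3.trans h3'⟩
      · have heR := (γ.mem_resC S).1 he
        rw [contract_vert_inl, γ.cproj_of_not_touched S (hcp (γ.touched_of_mem heR c)),
          cproj_eq_cCoe] at hu
        exact ⟨_, rfl, hcp (γ.touched_of_mem heR _), hu ▸ joined_edge heR c (!c)⟩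
    obtain ⟨w, hw1, -, hw3⟩ := key _ _ h3 u rfl (hcp hu)
    rw [γ.cproj_of_not_touched S (hcp hv), cproj_eq_cCoe] at hw1
    exact hw1 ▸ hw3
  · rintro ⟨⟨e, he⟩, h2⟩
    refine ⟨⟨γ.cE S e (fun h' => Finset.disjoint_left.1 h h' he), (γ.mem_resC S).2 he⟩,
      fun u v hu hv => ?_⟩
    obtain ⟨x, rfl, hx⟩ := (γ.contract_touched S h).1 hu
    obtain ⟨y, rfl, hy⟩ := (γ.contract_touched S h).1 hv
    exact γ.contract_joined_of S (fun e he h' => (γ.mem_resC S).2 h') (h2 x y hx hy)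

end MGraph


/-! ### Signs of contractions and isomorphisms -/

/-- Inversions of `f` between two elements of `T`, or between two elements outside `T`, are those of
the induced permutations of the blocks. For a pair with one element in each block, being inverted
means that exactly one of the two orders requires a transposition when `T` is moved to the front. -/
theorem inversions_block {α β : Type*} [Fintype α] [LinearOrder α] [LinearOrder β] (f : α ≃ β)
    (T o : α → Prop) [DecidablePred T] [DecidablePred o] :
    (∑ a, ∑ b, if ¬ T a ∧ T b ∧ f a < f b ∧ o a ∧ o b then 1 else 0 : ZMod 2)
      + (∑ a, if T a then 0 else ∑ b, if T b then 0 else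
          if a < b ∧ f b < f a ∧ o a ∧ o b then 1 else 0)
      + (∑ a, if T a then ∑ b, if T b then
          if a < b ∧ f b < f a ∧ o a ∧ o b then 1 else 0 else 0 else 0)
    = (∑ a, ∑ b, if a < b ∧ f b < f a ∧ o a ∧ o b then 1 else 0)
      + (∑ a, ∑ b, if ¬ T a ∧ T b ∧ a < b ∧ o a ∧ o b then 1 else 0) := by
  have h1 : ∀ (a : α) (F : α → ZMod 2), (if T a then 0 else ∑ b, F b)
      = ∑ b, if T a then 0 else F b := fun a F => by split_ifs <;> simp
  have h2 : ∀ (a : α) (F : α → ZMod 2), (if T a then ∑ b, F b else 0)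
      = ∑ b, if T a then F b else 0 := fun a F => by split_ifs <;> simp
  simp only [h1, h2, ← Finset.sum_add_distrib]
  apply sum_pairs_congr
  · intro a; simp
  · intro a b hab
    have hf : f a ≠ f b := fun h => hab (f.injective h)
    have e1 : (1 : ZMod 2) + 1 = 0 := rfl
    by_cases ha : T a <;> by_cases hb : T b <;> by_cases oa : o a <;> by_cases ob : o b <;>
      rcases lt_or_gt_of_ne hab with h | h <;> rcases lt_or_gt_of_ne hf with h' | h' <;>
      simp [ha, hb, oa, ob, h, h', h.not_gt, h'.not_gt, e1]

namespace MGraph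

variable {X Y : Type} {γ : MGraph X} {γ' : MGraph Y} {σ : X ≃ Y}

open Classical in
theorem sum_sub_E_ite {M : Type*} [AddCommMonoid M] (γ : MGraph X) (S : Finset γ.E)
    (F : (γ.sub S).E → M) (G : γ.E → M) (h : ∀ e, F e = G (γ.sEVal S e)) :
    ∑ e, F e = ∑ e, if e ∈ S then G e else 0 := by
  rw [← Finset.sum_subtype_ite]
  exact Fintype.sum_congr (α := {x // x ∈ S}) _ (fun x => G x.1) h

open Classical in
theorem sum_contract_E_ite {M : Type*} [AddCommMonoid M] (γ : MGraph X) (S : Finset γ.E)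
    (F : (γ.contract S).E → M) (G : γ.E → M) (h : ∀ e, F e = G (γ.cEVal S e)) :
    ∑ e, F e = ∑ e, if e ∈ S then 0 else G e := by
  have h1 : ∑ e, F e = ∑ e : {e // e ∉ S}, G e.1 := by
    refine Finset.sum_equiv (Equiv.refl {e // e ∉ S}) ?_ ?_
    · simp
    · intro e _; exact h e
  rw [h1, Finset.sum_subtype_ite]
  refine Finset.sum_congr rfl fun x _ => ?_
  by_cases hx : x ∈ S <;> simp [hx]

open Classical in
-- The conditions `True ∧ True` give the edge term the same shape as the vertex term. The
-- combinatorial identities can then be used twice, once for the vertices of odd degree and once for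
-- all edges.
theorem contractSign_eq (γ : MGraph X) (S : Finset γ.E) (d : γ.V → ℕ) :
    ∃ n : ℕ, γ.contractSign S d = (-1) ^ n ∧ (n : ZMod 2) =
      (∑ a, ∑ b, if ¬ γ.Touched S a ∧ γ.Touched S b ∧ a < b ∧ Odd (d a) ∧ Odd (d b) then 1 else 0)
      + (∑ a, ∑ b, if ¬ a ∈ S ∧ b ∈ S ∧ a < b ∧ True ∧ True then 1 else 0)
      + (((Fintype.card γ.E - S.card) * (S.card - 1) : ℕ) : ZMod 2) := by
  refine ⟨_, rfl, ?_⟩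
  push_cast
  rw [natCard_pairs_cast, natCard_pairs_cast]
  simp only [and_true]

open Classical in
theorem GIso.vertexSign_eq (f : GIso γ γ' σ) (d : γ.V → ℕ) :
    ∃ n : ℕ, f.vertexSign d = (-1) ^ n ∧ (n : ZMod 2) =
      ∑ a, ∑ b, if a < b ∧ f.onV b < f.onV a ∧ Odd (d a) ∧ Odd (d b) then 1 else 0 :=
  ⟨_, rfl, natCard_pairs_cast _⟩

open Classical in
theorem GIso.edgeSign_eq (f : GIso γ γ' σ) :
    ∃ n : ℕ, f.edgeSign Finset.univ = (-1) ^ n ∧ (n : ZMod 2) =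
      ∑ a, ∑ b, if a < b ∧ f.onE b < f.onE a ∧ True ∧ True then 1 else 0 := by
  refine ⟨_, rfl, ?_⟩
  rw [natCard_pairs_cast]
  simp only [Finset.mem_univ, true_and, and_true]

namespace GIso

variable (f : GIso γ γ' σ) {S : Finset γ.E} {S' : Finset γ'.E}

theorem touched_iff (hS : ∀ e, e ∈ S ↔ f.onE e ∈ S') (x : γ.V) :
    γ.Touched S x ↔ γ'.Touched S' (f.onV x) := by
  constructor
  · rintro ⟨e, he, c, rfl⟩
    refine ⟨f.onE e, (hS e).1 he, (f.onEnds (e, c)).2, ?_⟩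
    rw [← f.vert_comm]
    exact congrArg _ (congrArg Sum.inl (Prod.ext (f.onEnds_fst (e, c)).symm rfl))
  · rintro ⟨e, he, c, hc⟩
    obtain ⟨⟨e', c'⟩, h⟩ := f.onEnds.surjective (e, c)
    have h1 := f.onEnds_fst (e', c')
    rw [h] at h1
    simp only at h1
    subst h1
    refine ⟨e', (hS _).2 he, c', f.onV.injective ?_⟩
    rw [← hc, ← f.vert_comm]
    exact congrArg _ (congrArg Sum.inl h)

theorem isConnectedSubset (hS : ∀ e, e ∈ S ↔ f.onE e ∈ S') (h : γ.IsConnectedSubset S) :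
    γ'.IsConnectedSubset S' := by
  obtain ⟨⟨e, he⟩, h2⟩ := h
  refine ⟨⟨_, (hS e).1 he⟩, fun u v hu hv => ?_⟩
  obtain ⟨u, rfl⟩ := f.onV.surjective u
  obtain ⟨v, rfl⟩ := f.onV.surjective v
  exact f.joined (fun e => (hS e).1)
    (h2 u v ((f.touched_iff hS u).2 hu) ((f.touched_iff hS v).2 hv))

/-- The bijection on the vertices of a subgraph. -/
def subV (hS : ∀ e, e ∈ S ↔ f.onE e ∈ S') : (γ.sub S).V ≃ (γ'.sub S').V :=
  f.onV.subtypeEquiv (f.touched_iff hS)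

/-- The bijection on the vertices of a contraction. -/
def contractV (hS : ∀ e, e ∈ S ↔ f.onE e ∈ S') : (γ.contract S).V ≃ (γ'.contract S').V :=
  Equiv.optionCongr (f.onV.subtypeEquiv (fun x => not_congr (f.touched_iff hS x)))

theorem contractV_cBot (hS : ∀ e, e ∈ S ↔ f.onE e ∈ S') :
    f.contractV hS (γ.cBot S) = γ'.cBot S' := rfl

theorem contractV_cCoe (hS : ∀ e, e ∈ S ↔ f.onE e ∈ S') (x : γ.V) (hx : ¬ γ.Touched S x) :
    f.contractV hS (γ.cCoe S x hx)
      = γ'.cCoe S' (f.onV x) (fun h => hx ((f.touched_iff hS x).2 h)) := rfl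

theorem contractV_cproj (hS : ∀ e, e ∈ S ↔ f.onE e ∈ S') (x : γ.V) :
    f.contractV hS (γ.cproj S x) = γ'.cproj S' (f.onV x) := by
  by_cases hx : γ.Touched S x
  · rw [γ.cproj_of_touched S hx, contractV_cBot, cproj_of_touched _ _ ((f.touched_iff hS x).1 hx)]
  · rw [γ.cproj_of_not_touched S hx, contractV_cCoe, cproj_of_not_touched]


open Classical in
-- Moving the subgraph to the front and then permuting the two blocks is the same as permuting first
-- and moving afterwards, so `inversions_block` applies to vertices and to edges. The new vertex is
-- the first one in both contractions and takes part in no inversion, and the last exponent of the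
-- sign depends only on cardinalities.
theorem contractSign_mul (hS : ∀ e, e ∈ S ↔ f.onE e ∈ S') {d : γ.V → ℕ} {d' : γ'.V → ℕ}
    (hd : ∀ v, d' (f.onV v) = d v) {τ : γ.SubLeg S ≃ γ'.SubLeg S'}
    (f1 : GIso (γ.sub S) (γ'.sub S') τ) (f2 : GIso (γ.contract S) (γ'.contract S') σ)
    (h1 : f1.onV = f.subV hS) (h1' : ∀ e, γ'.sEVal S' (f1.onE e) = f.onE (γ.sEVal S e))
    (h2 : f2.onV = f.contractV hS) (h2' : ∀ e, γ'.cEVal S' (f2.onE e) = f.onE (γ.cEVal S e)) :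
    γ'.contractSign S' d' * ((f2.vertexSign (γ.contractDeg S d) * f2.edgeSign Finset.univ) *
      (f1.vertexSign (fun v => d (γ.sVal S v)) * f1.edgeSign Finset.univ))
      = (f.vertexSign d * f.edgeSign Finset.univ) * γ.contractSign S d := by
  obtain ⟨n1, e1, c1⟩ := γ'.contractSign_eq S' d'
  obtain ⟨n2, e2, c2⟩ := f2.vertexSign_eq (γ.contractDeg S d)
  obtain ⟨n3, e3, c3⟩ := f2.edgeSign_eq
  obtain ⟨n4, e4, c4⟩ := f1.vertexSign_eq (fun v => d (γ.sVal S v))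
  obtain ⟨n5, e5, c5⟩ := f1.edgeSign_eq
  obtain ⟨n6, e6, c6⟩ := f.vertexSign_eq d
  obtain ⟨n7, e7, c7⟩ := f.edgeSign_eq
  obtain ⟨n8, e8, c8⟩ := γ.contractSign_eq S d
  rw [e1, e2, e3, e4, e5, e6, e7, e8]
  simp only [← pow_add]
  apply neg_one_pow_eq_of_cast_eq
  push_cast
  have hv := inversions_block f.onV (γ.Touched S) (fun x => Odd (d x))
  have he := inversions_block f.onE (· ∈ S) (fun _ => True)
  have hcard : S'.card = S.card := by
    rw [← Finset.card_map f.onE.toEmbedding]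
    congr 1
    ext e
    obtain ⟨e, rfl⟩ := f.onE.surjective e
    simp [hS]
  have k1v : (∑ a, ∑ b, if ¬ γ'.Touched S' a ∧ γ'.Touched S' b ∧ a < b ∧ Odd (d' a) ∧ Odd (d' b)
      then 1 else 0 : ZMod 2) = ∑ a, ∑ b, if ¬ γ.Touched S a ∧ γ.Touched S b ∧ f.onV a < f.onV b ∧
        Odd (d a) ∧ Odd (d b) then 1 else 0 := by
    rw [← Equiv.sum_comp f.onV]
    refine Finset.sum_congr rfl fun a _ => ?_
    rw [← Equiv.sum_comp f.onV]
    simp only [hd, f.touched_iff hS]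
  have k1e : (∑ a, ∑ b, if ¬ a ∈ S' ∧ b ∈ S' ∧ a < b ∧ True ∧ True
      then 1 else 0 : ZMod 2) = ∑ a, ∑ b, if ¬ a ∈ S ∧ b ∈ S ∧ f.onE a < f.onE b ∧
        True ∧ True then 1 else 0 := by
    rw [← Equiv.sum_comp f.onE]
    refine Finset.sum_congr rfl fun a _ => ?_
    rw [← Equiv.sum_comp f.onE]
    simp only [hS]
  have k2 : (∑ a, ∑ b, if a < b ∧ f2.onV b < f2.onV a ∧ Odd (γ.contractDeg S d a) ∧
      Odd (γ.contractDeg S d b) then 1 else 0 : ZMod 2) =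
      ∑ a, if γ.Touched S a then 0 else ∑ b, if γ.Touched S b then 0 else
          if a < b ∧ f.onV b < f.onV a ∧ Odd (d a) ∧ Odd (d b) then 1 else 0 := by
    rw [h2, γ.sum_contract_ite S _ (fun a => ∑ b, if γ.Touched S b then 0 else
          if a < b ∧ f.onV b < f.onV a ∧ Odd (d a) ∧ Odd (d b) then 1 else 0)]
    · rw [Finset.sum_eq_zero, zero_add]
      intro v _
      rw [contractV_cBot, if_neg]
      exact fun h => γ'.not_lt_cBot S' _ h.2.1
    · intro x hx
      rw [γ.sum_contract_ite S _ (fun b => if x < b ∧ f.onV b < f.onV x ∧ Odd (d x) ∧ Odd (d b)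
        then 1 else 0)]
      · rw [if_neg (fun h => γ.not_lt_cBot S _ h.1), zero_add]
      · intro y hy
        simp only [contractV_cCoe, cCoe_lt_cCoe, contractDeg_cCoe]
  have k3 : (∑ a, ∑ b, if a < b ∧ f2.onE b < f2.onE a ∧ True ∧ True then 1 else 0 : ZMod 2) =
      ∑ a, if a ∈ S then 0 else ∑ b, if b ∈ S then 0 else
          if a < b ∧ f.onE b < f.onE a ∧ True ∧ True then 1 else 0 := by
    rw [γ.sum_contract_E_ite S _ (fun a => ∑ b, if b ∈ S then 0 else
          if a < b ∧ f.onE b < f.onE a ∧ True ∧ True then 1 else 0)]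
    intro x
    rw [γ.sum_contract_E_ite S _ (fun b => if γ.cEVal S x < b ∧ f.onE b < f.onE (γ.cEVal S x) ∧
      True ∧ True then 1 else 0)]
    intro y
    simp only [← h2', cEVal_lt]
  have k4 : (∑ a, ∑ b, if a < b ∧ f1.onV b < f1.onV a ∧ Odd (d (γ.sVal S a)) ∧
      Odd (d (γ.sVal S b)) then 1 else 0 : ZMod 2) =
      ∑ a, if γ.Touched S a then ∑ b, if γ.Touched S b then
          if a < b ∧ f.onV b < f.onV a ∧ Odd (d a) ∧ Odd (d b) then 1 else 0 else 0 else 0 := by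
    rw [h1, γ.sum_sub_ite S _ (fun a => ∑ b, if γ.Touched S b then
          if a < b ∧ f.onV b < f.onV a ∧ Odd (d a) ∧ Odd (d b) then 1 else 0 else 0)]
    intro x hx
    rw [γ.sum_sub_ite S _ (fun b => if x < b ∧ f.onV b < f.onV x ∧ Odd (d x) ∧ Odd (d b)
        then 1 else 0)]
    intro y hy
    rfl
  have k5 : (∑ a, ∑ b, if a < b ∧ f1.onE b < f1.onE a ∧ True ∧ True then 1 else 0 : ZMod 2) =
      ∑ a, if a ∈ S then ∑ b, if b ∈ S then
          if a < b ∧ f.onE b < f.onE a ∧ True ∧ True then 1 else 0 else 0 else 0 := by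
    rw [γ.sum_sub_E_ite S _ (fun a => ∑ b, if b ∈ S then
          if a < b ∧ f.onE b < f.onE a ∧ True ∧ True then 1 else 0 else 0)]
    intro x
    rw [γ.sum_sub_E_ite S _ (fun b => if γ.sEVal S x < b ∧ f.onE b < f.onE (γ.sEVal S x) ∧
      True ∧ True then 1 else 0)]
    intro y
    simp only [← h1', sEVal_lt]
  rw [c1, c2, c3, c4, c5, c6, c7, c8, k1v, k1e, k2, k3, k4, k5, hcard, ← Fintype.card_congr f.onE]
  linear_combination hv + he

end GIso

end MGraph

/-! ### Multilinearity of the labels of a contraction -/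

namespace ModularCollection

variable {k : Type*} [Field k] {P : ModularCollection k} {X Y : Type}

theorem LabelsMatch.same {γ : MGraph X} {γ' : MGraph Y} {σ : X ≃ Y} {f : γ.GIso γ' σ}
    {d : γ.V → ℕ} {d' : γ'.V → ℕ} {hd : ∀ v, d' (f.onV v) = d v} {a : P.Labels γ d}
    {a' : P.Labels γ' d'} (h : P.LabelsMatch f hd a a') (v : γ.V) :
    SameLabel (f.onH ∘ Subtype.val) (a v) Subtype.val (a' (f.onV v)) :=
  ⟨f.onFlag v, fun _ => rfl, _, _, h v⟩

/-- The labels of a subgraph, as a linear map. -/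
def subMap (γ : MGraph X) (S : Finset γ.E) (d : γ.V → ℕ) (v : γ.V) (hv : γ.Touched S v) :
    P.A (γ.genus v) (γ.Flag v) (d v) →ₗ[k] P.A ((γ.sub S).genus (γ.sV S v hv))
      ((γ.sub S).Flag (γ.sV S v hv)) (d (γ.sVal S (γ.sV S v hv))) :=
  P.map (γ.subFlag S ⟨v, hv⟩).symm

/-- The labels of a contraction at the other vertices, as a linear map. -/
def oldMap (γ : MGraph X) (S : Finset γ.E) (d : γ.V → ℕ) (v : γ.V) (hv : ¬ γ.Touched S v) :
    P.A (γ.genus v) (γ.Flag v) (d v) →ₗ[k] P.A ((γ.contract S).genus (γ.cCoe S v hv))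
      ((γ.contract S).Flag (γ.cCoe S v hv)) (γ.contractDeg S d (γ.cCoe S v hv)) :=
  P.map (γ.oldFlag S ⟨v, hv⟩).symm

/-- The label of a contraction at the new vertex, as a linear map. -/
def newMap (γ : MGraph X) (S : Finset γ.E) (d : γ.V → ℕ) :
    P.A (γ.sub S).totalGenus (γ.SubLeg S)
      (∑ v : (γ.sub S).V, d (γ.sVal S v) + Fintype.card (γ.sub S).E - 1) →ₗ[k]
    P.A ((γ.contract S).genus (γ.cBot S)) ((γ.contract S).Flag (γ.cBot S))
      (γ.contractDeg S d (γ.cBot S)) :=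
  P.map (γ.newFlag S)

theorem subLabels_sV (γ : MGraph X) (S : Finset γ.E) (d : γ.V → ℕ) (a : P.Labels γ d) (v : γ.V)
    (hv : γ.Touched S v) : subLabels γ S d a (γ.sV S v hv) = subMap γ S d v hv (a v) := rfl

theorem contractLabels_cCoe_eq (μ : P.Operations) (γ : MGraph X) (S : Finset γ.E) (d : γ.V → ℕ)
    (a : P.Labels γ d) (v : γ.V) (hv : ¬ γ.Touched S v) :
    contractLabels μ γ S d a (γ.cCoe S v hv) = oldMap γ S d v hv (a v) := rfl

theorem contractLabels_cBot_eq (μ : P.Operations) (γ : MGraph X) (S : Finset γ.E) (d : γ.V → ℕ)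
    (a : P.Labels γ d) : contractLabels μ γ S d a (γ.cBot S)
      = newMap γ S d (μ (γ.sub S) (fun v => d (γ.sVal S v)) (subLabels γ S d a)) := rfl

theorem subLabels_update {γ : MGraph X} (S : Finset γ.E) (d : γ.V → ℕ)
    [DecidableEq γ.V] [DecidableEq (γ.sub S).V] (a : P.Labels γ d) (v : γ.V) (hv : γ.Touched S v)
    (x : P.A (γ.genus v) (γ.Flag v) (d v)) :
    subLabels γ S d (Function.update a v x)
      = Function.update (subLabels γ S d a) (γ.sV S v hv) (subMap γ S d v hv x) := by
  funext u
  obtain ⟨w, hw⟩ := u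
  change subLabels γ S d (Function.update a v x) (γ.sV S w hw)
    = Function.update (subLabels γ S d a) (γ.sV S v hv) (subMap γ S d v hv x) (γ.sV S w hw)
  by_cases h : w = v
  · subst h
    rw [Function.update_self, subLabels_sV, Function.update_self]
  · rw [Function.update_of_ne, subLabels_sV, subLabels_sV, Function.update_of_ne h]
    intro h'; exact h (congrArg (γ.sVal S) h')

theorem subLabels_update_of_not {γ : MGraph X} (S : Finset γ.E) (d : γ.V → ℕ)
    [DecidableEq γ.V] (a : P.Labels γ d) (v : γ.V) (hv : ¬ γ.Touched S v)
    (x : P.A (γ.genus v) (γ.Flag v) (d v)) :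
    subLabels γ S d (Function.update a v x) = subLabels γ S d a := by
  funext u
  obtain ⟨w, hw⟩ := u
  change subLabels γ S d (Function.update a v x) (γ.sV S w hw)
    = subLabels γ S d a (γ.sV S w hw)
  rw [subLabels_sV, subLabels_sV, Function.update_of_ne]
  rintro rfl; exact hv hw

theorem contractLabels_update_cCoe (μ : P.Operations) {γ : MGraph X} (S : Finset γ.E)
    (d : γ.V → ℕ) [DecidableEq γ.V] [DecidableEq (γ.contract S).V] (a : P.Labels γ d) (v : γ.V)
    (hv : ¬ γ.Touched S v) (x : P.A (γ.genus v) (γ.Flag v) (d v)) :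
    contractLabels μ γ S d (Function.update a v x) = Function.update (contractLabels μ γ S d a)
      (γ.cCoe S v hv) (oldMap γ S d v hv x) := by
  funext u
  rcases γ.contract_cases S u with rfl | ⟨y, hy, rfl⟩
  · rw [Function.update_of_ne (γ.cBot_ne_cCoe S), contractLabels_cBot_eq, contractLabels_cBot_eq,
      subLabels_update_of_not S d a v hv]
  · by_cases h : y = v
    · subst h
      rw [Function.update_self, contractLabels_cCoe_eq, Function.update_self]
    · rw [Function.update_of_ne, contractLabels_cCoe_eq, contractLabels_cCoe_eq,
        Function.update_of_ne h]
      rwa [Ne, MGraph.cCoe_inj]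

theorem contractLabels_update_touched (μ : P.Operations) {γ : MGraph X} (S : Finset γ.E)
    (d : γ.V → ℕ) [DecidableEq γ.V] [DecidableEq (γ.contract S).V] [DecidableEq (γ.sub S).V]
    (a : P.Labels γ d) (v : γ.V)
    (hv : γ.Touched S v) (x : P.A (γ.genus v) (γ.Flag v) (d v)) :
    contractLabels μ γ S d (Function.update a v x) = Function.update (contractLabels μ γ S d a)
      (γ.cBot S) (newMap γ S d (μ (γ.sub S) (fun v => d (γ.sVal S v))
        (Function.update (subLabels γ S d a) (γ.sV S v hv) (subMap γ S d v hv x)))) := by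
  funext u
  rcases γ.contract_cases S u with rfl | ⟨y, hy, rfl⟩
  · rw [Function.update_self, ← subLabels_update, contractLabels_cBot_eq]
  · rw [Function.update_of_ne (γ.cBot_ne_cCoe S).symm, contractLabels_cCoe_eq,
      contractLabels_cCoe_eq, Function.update_of_ne]
    rintro rfl; exact hy hv

/-- A multilinear function of the labels of a contraction is multilinear in the labels. -/
def contractMultilinear (μ : P.Operations) (γ : MGraph X) (S : Finset γ.E) (d : γ.V → ℕ)
    (m : MultilinearMap k (fun v => P.A ((γ.contract S).genus v) ((γ.contract S).Flag v)
      (γ.contractDeg S d v)) k) :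
    MultilinearMap k (fun v => P.A (γ.genus v) (γ.Flag v) (d v)) k where
  toFun a := m (contractLabels μ γ S d a)
  map_update_add' a v x y := by
    classical
    by_cases hv : γ.Touched S v
    · simp only [contractLabels_update_touched μ S d a v hv, map_add, MultilinearMap.map_update_add]
    · simp only [contractLabels_update_cCoe μ S d a v hv, map_add, MultilinearMap.map_update_add]
  map_update_smul' a v c x := by
    classical
    by_cases hv : γ.Touched S v
    · simp only [contractLabels_update_touched μ S d a v hv, map_smul,
        MultilinearMap.map_update_smul]
    · simp only [contractLabels_update_cCoe μ S d a v hv, map_smul, MultilinearMap.map_update_smul]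

end ModularCollection

namespace SubQuotient

theorem ofIso_ι {X Y : Type} {β : MGraph Y} {γ : MGraph X} {σ : Y ≃ X} (f : MGraph.GIso β γ σ) :
    (ofIso f).ι = f.onH := by
  funext h; rcases h with p | y <;> rfl

end SubQuotient

theorem SubQuotient.trans_leg {X Y Z : Type} {α : MGraph Z} {β : MGraph Y} {γ : MGraph X}
    (b : SubQuotient α β) (b' : SubQuotient β γ) : (b.trans b').leg = b'.ι ∘ b.leg := rfl

namespace MGraph

variable {X : Type} (γ : MGraph X) (S : Finset γ.E)

theorem mem_range_subSQ_leg (z : γ.H) : z ∈ Set.range (γ.subSQ S).leg ↔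
    γ.Touched S (γ.vert z) ∧ ∀ e c, z = Sum.inl (e, c) → e ∉ S := by
  constructor
  · rintro ⟨⟨y, hy⟩, rfl⟩
    refine ⟨hy, fun e c h => ?_⟩
    rcases y with ⟨e', c'⟩ | y
    · have h' : (e'.1, c') = (e, c) := Sum.inl_injective h
      obtain ⟨rfl, rfl⟩ := Prod.ext_iff.1 h'
      exact e'.2
    · exact absurd h (by simp [subSQ, restIncl])
  · rintro ⟨h1, h2⟩
    rcases z with ⟨e, c⟩ | z
    · exact ⟨⟨Sum.inl (⟨e, h2 e c rfl⟩, c), h1⟩, rfl⟩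
    · exact ⟨⟨Sum.inr z, h1⟩, rfl⟩

/-- The contraction removes `|S|` edges and the operation adds `|S| - 1` to the degrees of the
labels, so the total degree drops by one. Nonemptiness of `S` keeps the subtraction in the degree
from being truncated. -/
theorem contract_degree (hS : S.Nonempty) (d : γ.V → ℕ) :
    Fintype.card (γ.contract S).E + ∑ v, γ.contractDeg S d v + 1
      = Fintype.card γ.E + ∑ v, d v := by
  classical
  rw [γ.sum_contract_ite S _ d (fun _ _ => rfl), contractDeg_cBot, card_contract_E, card_sub_E,
    γ.sum_sub_ite S _ d (fun _ _ => rfl)]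
  have h1 := Finset.card_le_univ S
  have h2 := hS.card_pos
  have h3 : ∑ x, (if γ.Touched S x then d x else 0) + ∑ x, (if γ.Touched S x then 0 else d x)
      = ∑ x, d x := by
    rw [← Finset.sum_add_distrib]
    refine Finset.sum_congr rfl fun x _ => ?_
    split_ifs <;> simp
  omega

end MGraph

/-! ### The differential preserves the Feynman transform -/

namespace WeakModularOperad

variable {k : Type*} [Field k] {W : WeakModularOperad k} {X : Type}

open ModularCollection

theorem ft_update_zsmul {g : ℕ} {D : ℤ} {φ : W.Cochain X} (hφ : φ ∈ W.ft g X D)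
    (γ : MGraph X) (d : γ.V → ℕ) [DecidableEq γ.V] (a : W.toModularCollection.Labels γ d) (v : γ.V)
    (s : ℤ) : φ γ d (Function.update a v (s • a v)) = s • φ γ d a := by
  obtain ⟨m, hm⟩ := hφ.1 γ d
  rw [hm, hm, ← Int.cast_smul_eq_zsmul k, MultilinearMap.map_update_smul, Function.update_eq_self,
    Int.cast_smul_eq_zsmul]

/-- A variant of `ft_apply_eq` for the case that the labels at one vertex agree only up to a sign.
That sign is produced by the equivariance of an operation at the new vertex, and it comes out by
multilinearity. -/
theorem ft_apply_eq_of_smul {g : ℕ} {D : ℤ} {φ : W.Cochain X} (hφ : φ ∈ W.ft g X D) {Z : Type}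
    {β β' : MGraph X} {γ : MGraph Z} (b : SubQuotient β γ) (b' : SubQuotient β' γ)
    (fV : β.V ≃ β'.V) (hV : ∀ v x, b.cell v x → b'.cell (fV v) x)
    (hE : Set.range b.emb = Set.range b'.emb) (hσ : ∀ y, b'.leg y = b.leg y)
    {d : β.V → ℕ} {d' : β'.V → ℕ} (a : W.toModularCollection.Labels β d)
    (a' : W.toModularCollection.Labels β' d') (v₀ : β.V) (s : ℤ)
    (ha₀ : SameLabel (b.flag v₀) (s • a v₀) (b'.flag (fV v₀)) (a' (fV v₀)))
    (ha : ∀ v, v ≠ v₀ → SameLabel (b.flag v) (a v) (b'.flag (fV v)) (a' (fV v))) :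
    ∃ f : MGraph.GIso β β' (Equiv.refl X), f.onV = fV ∧ (∀ e, b'.emb (f.onE e) = b.emb e) ∧
      φ β' d' a' = (f.vertexSign d * f.edgeSign Finset.univ * s) • φ β d a := by
  classical
  obtain ⟨f, h1, h2, h3⟩ := ft_apply_eq hφ b b' fV hV hE hσ (Function.update a v₀ (s • a v₀)) a'
    (fun v => by
      by_cases h : v = v₀
      · subst h; rw [Function.update_self]; exact ha₀
      · rw [Function.update_of_ne h]; exact ha v h)
  refine ⟨f, h1, h2, ?_⟩
  rw [h3, ft_update_zsmul hφ, mul_smul _ s]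

/-- The isomorphism `f` restricts to the subgraphs and descends to the contractions. The sign of the
restriction appears at the new vertex, and `contractSign_mul` combines it with the sign of the
descended isomorphism. -/
theorem contract_term_eq {g : ℕ} {D : ℤ} {φ : W.Cochain X} (hφ : φ ∈ W.ft g X D)
    {γ γ' : MGraph X} (f : γ.GIso γ' (Equiv.refl X)) (hγ : γ.IsModular) {S : Finset γ.E}
    {S' : Finset γ'.E} (hSc : γ.IsConnectedSubset S) (hS : ∀ e, e ∈ S ↔ f.onE e ∈ S')
    {d : γ.V → ℕ} {d' : γ'.V → ℕ} {hd : ∀ v, d' (f.onV v) = d v}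
    {a : W.toModularCollection.Labels γ d} {a' : W.toModularCollection.Labels γ' d'}
    (h : W.toModularCollection.LabelsMatch f hd a a') :
    γ'.contractSign S' d' • φ (γ'.contract S') (γ'.contractDeg S' d')
        (contractLabels W.μ γ' S' d' a')
      = (f.vertexSign d * f.edgeSign Finset.univ) • γ.contractSign S d •
        φ (γ.contract S) (γ.contractDeg S d) (contractLabels W.μ γ S d a) := by
  have hflag : ∀ {Z : Type} (β : MGraph Z) (b : SubQuotient β γ) (v : β.V),
      (b.trans (SubQuotient.ofIso f)).flag v = f.onH ∘ b.flag v := fun β b v => by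
    rw [SubQuotient.trans_flag, SubQuotient.ofIso_ι]
  obtain ⟨τ, f1, h1, h1', hl1⟩ := μ_same (W := W) (γ.sub_isModular S hγ hSc)
    (by obtain ⟨e, he⟩ := hSc.1; exact ⟨γ.sE S e he⟩)
    ((γ.subSQ S).trans (SubQuotient.ofIso f)) (γ'.subSQ S') (f.subV hS)
    (by rintro v x ⟨u, rfl, rfl⟩; rfl)
    (by
      ext e
      obtain ⟨e, rfl⟩ := f.onE.surjective e
      rw [γ'.range_subSQ_emb, Set.mem_ofPred, ← hS]
      constructor
      · rintro ⟨e', he'⟩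
        rw [← f.onE.injective he']; exact γ.sEVal_mem S e'
      · intro he; exact ⟨γ.sE S e he, rfl⟩)
    (by
      ext x
      obtain ⟨z, rfl⟩ := f.onH.surjective x
      rw [γ'.mem_range_subSQ_leg, SubQuotient.trans_leg, SubQuotient.ofIso_ι, Set.range_comp,
        f.onH.injective.mem_set_image, γ.mem_range_subSQ_leg, f.vert_onH, ← f.touched_iff hS]
      refine and_congr_right fun _ => ?_
      rcases z with ⟨e, c⟩ | z
      · have h1 := f.onEnds_fst (e, c)
        constructor
        · rintro h2 e' c' h3
          have h4 : f.onEnds (e, c) = (e', c') := Sum.inl_injective h3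
          rw [h4] at h1
          simp only at h1
          rw [h1, ← hS]; exact h2 e c rfl
        · rintro h2 e' c' h3
          obtain ⟨rfl, rfl⟩ := Prod.ext_iff.1 (Sum.inl_injective h3)
          rw [hS]
          exact h2 _ (f.onEnds (e, c)).2 (congrArg Sum.inl (Prod.ext h1 rfl))
      · exact ⟨fun _ _ _ h => absurd h (by simp [MGraph.GIso.onH]), fun _ _ _ h => absurd h (by simp)⟩)
    (subLabels γ S d a) (subLabels γ' S' d' a')
    (fun v => by
      rw [hflag]
      obtain ⟨x, hx⟩ := v
      exact (((subLabels_same γ S d a x hx).symm.comp f.onH).trans (h.same x)).trans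
        (subLabels_same γ' S' d' a' (f.onV x) ((f.touched_iff hS x).1 hx)))
  obtain ⟨f2, h2, h2', h3⟩ := ft_apply_eq_of_smul hφ
    ((γ.contractSQ S).trans (SubQuotient.ofIso f)) (γ'.contractSQ S') (f.contractV hS)
    (by rintro v x ⟨u, rfl, rfl⟩; exact (f.contractV_cproj hS u).symm)
    (by
      ext e
      obtain ⟨e, rfl⟩ := f.onE.surjective e
      rw [γ'.range_contractSQ_emb, Set.mem_ofPred, ← hS]
      constructor
      · rintro ⟨e', he'⟩
        rw [← f.onE.injective he']; exact γ.cEVal_notMem S e'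
      · intro he; exact ⟨γ.cE S e he, rfl⟩)
    (fun y => rfl) (contractLabels W.μ γ S d a) (contractLabels W.μ γ' S' d' a') (γ.cBot S)
    (f1.vertexSign (fun v => d (γ.sVal S v)) * f1.edgeSign Finset.univ)
    (by
      rw [hflag]
      refine (((contractLabels_cBot W.μ γ S d a).symm.comp f.onH).zsmul _).trans ?_
      have h8 : ((γ.subSQ S).trans (SubQuotient.ofIso f)).leg = f.onH ∘ (γ.subSQ S).leg := by
        rw [← SubQuotient.ofIso_ι]; rfl
      rw [h8] at hl1
      exact hl1.trans (contractLabels_cBot W.μ γ' S' d' a'))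
    (fun v hv => by
      rw [hflag]
      rcases γ.contract_cases S v with rfl | ⟨x, hx, rfl⟩
      · exact absurd rfl hv
      · exact (((contractLabels_cCoe W.μ γ S d a x hx).symm.comp f.onH).trans (h.same x)).trans
          (contractLabels_cCoe W.μ γ' S' d' a' (f.onV x) _))
  rw [h3, smul_smul, smul_smul, ← f.contractSign_mul hS hd f1 f2 h1 h1' h2 h2']

theorem differential_mem_ft {g : ℕ} {D : ℤ} {φ : W.Cochain X} (hφ : φ ∈ W.ft g X D) :
    W.differential X φ ∈ W.ft g X (D + 1) := by
  classical
  refine ⟨fun γ d => ?_, fun γ d a ha => ?_, fun γ γ' f d d' hd a a' h => ?_⟩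
  · choose m hm using hφ.1
    refine ⟨∑ S ∈ Finset.univ.filter (fun S : Finset γ.E => γ.IsModular ∧ γ.IsConnectedSubset S),
      γ.contractSign S d • contractMultilinear W.μ γ S d (m _ _), fun a => ?_⟩
    rw [sum_apply]
    refine Finset.sum_congr (by congr!) fun S _ => ?_
    rw [smul_apply, hm]; rfl
  · obtain ⟨S, hS, hne⟩ := Finset.exists_ne_zero_of_sum_ne_zero ha
    obtain ⟨-, hγ, hSc⟩ := Finset.mem_filter.1 hS
    have hne' : φ (γ.contract S) (γ.contractDeg S d) (contractLabels W.μ γ S d a) ≠ 0 :=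
      fun h => hne (by rw [h, smul_zero])
    obtain ⟨-, h1, h2⟩ := hφ.2.1 _ _ _ hne'
    refine ⟨hγ, by rw [← h1, γ.totalGenus_contract S hγ.connected hSc], ?_⟩
    have h3 := γ.contract_degree S hSc.1 d
    zify at h3
    linarith
  · by_cases hγ : γ.IsModular
    · have hγ' := f.isModular hγ
      change ∑ S ∈ _, _ = _ • ∑ S ∈ _, _
      rw [Finset.smul_sum]
      symm
      refine Finset.sum_equiv f.onE.finsetCongr (fun S => ?_) (fun S hS => ?_)
      · simp only [Finset.mem_filter, Finset.mem_univ, true_and, hγ, hγ']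
        constructor
        · exact fun hS => f.isConnectedSubset (by simp) hS
        · intro hS
          refine f.symm.isConnectedSubset (S := f.onE.finsetCongr S) (fun e => ?_) hS
          simp [MGraph.GIso.symm, Equiv.finsetCongr_apply, Finset.mem_map_equiv]
      · exact (contract_term_eq hφ f hγ (Finset.mem_filter.1 hS).2.2 (by simp) h).symm
    · have hγ' : ¬ γ'.IsModular := fun h' => hγ (f.symm.isModular h')
      have h1 : W.differential X φ γ d a = 0 :=
        Finset.sum_eq_zero fun S hS => absurd (Finset.mem_filter.1 hS).2.1 hγ
      have h2 : W.differential X φ γ' d' a' = 0 :=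
        Finset.sum_eq_zero fun S hS => absurd (Finset.mem_filter.1 hS).2.1 hγ'
      rw [h1, h2, smul_zero]

end WeakModularOperad

namespace MGraph

variable {X : Type} (γ : MGraph X) (S : Finset γ.E)

/-! ### Half-edges of subgraphs and contractions -/

/-- The half-edge `z` belongs to an edge in `S`. -/
def IsHalf (z : γ.H) : Prop := ∃ e ∈ S, ∃ c, z = Sum.inl (e, c)

theorem range_subSQ_leg : Set.range (γ.subSQ S).leg
    = {z | γ.Touched S (γ.vert z) ∧ ¬ γ.IsHalf S z} := by
  ext z
  rw [mem_range_subSQ_leg]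
  refine and_congr_right fun _ => ?_
  constructor
  · rintro h ⟨e, he, c, hz⟩; exact h e c hz he
  · exact fun h e c hz he => h ⟨e, he, c, hz⟩

theorem subSQ_vert (w : (γ.sub S).H) :
    γ.sVal S ((γ.sub S).vert w) = γ.vert ((γ.subSQ S).ι w) := by
  rcases w with p | l <;> rfl

theorem contractSQ_vert (w : (γ.contract S).H) :
    (γ.contract S).vert w = γ.cproj S (γ.vert ((γ.contractSQ S).ι w)) := by
  rcases w with p | l <;> rfl

theorem range_subSQ_ι : Set.range (γ.subSQ S).ι = {z | γ.Touched S (γ.vert z)} := by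
  ext z
  constructor
  · rintro ⟨w, rfl⟩
    rw [Set.mem_ofPred, ← subSQ_vert]; exact γ.sVal_touched S _
  · intro hz
    by_cases h : γ.IsHalf S z
    · obtain ⟨e, he, c, rfl⟩ := h
      exact ⟨Sum.inl (γ.sE S e he, c), rfl⟩
    · obtain ⟨l, hl⟩ : z ∈ Set.range (γ.subSQ S).leg := by rw [range_subSQ_leg]; exact ⟨hz, h⟩
      exact ⟨Sum.inr l, hl⟩

theorem range_contractSQ_ι : Set.range (γ.contractSQ S).ι = {z | ¬ γ.IsHalf S z} := by
  ext z
  constructor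
  · rintro ⟨w, rfl⟩ ⟨e, he, c, h⟩
    rcases w with ⟨e', c'⟩ | y
    · have h' : (γ.cEVal S e', c') = (e, c) := Sum.inl_injective h
      obtain ⟨rfl, rfl⟩ := Prod.ext_iff.1 h'
      exact γ.cEVal_notMem S e' he
    · exact absurd h (by simp [contractSQ, SubQuotient.ι])
  · intro hz
    rcases z with ⟨e, c⟩ | y
    · exact ⟨Sum.inl (γ.cE S e (fun he => hz ⟨e, he, c, rfl⟩), c), rfl⟩
    · exact ⟨Sum.inr y, rfl⟩

theorem isHalf_subSQ_ι {R : Finset γ.E} (hR : R ⊆ S) (w : (γ.sub S).H) :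
    γ.IsHalf R ((γ.subSQ S).ι w) ↔ (γ.sub S).IsHalf (γ.resS S R) w := by
  constructor
  · rintro ⟨e, he, c, h⟩
    refine ⟨γ.sE S e (hR he), (γ.mem_resS S).2 he, c, (γ.subSQ S).ι_injective ?_⟩
    rw [h]; rfl
  · rintro ⟨e, he, c, rfl⟩
    exact ⟨_, (γ.mem_resS S).1 he, c, rfl⟩

theorem isHalf_contractSQ_ι {R : Finset γ.E} (hR : Disjoint S R) (w : (γ.contract S).H) :
    γ.IsHalf R ((γ.contractSQ S).ι w) ↔ (γ.contract S).IsHalf (γ.resC S R) w := by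
  constructor
  · rintro ⟨e, he, c, h⟩
    refine ⟨γ.cE S e (fun h' => Finset.disjoint_left.1 hR h' he), (γ.mem_resC S).2 he, c,
      (γ.contractSQ S).ι_injective ?_⟩
    rw [h]; rfl
  · rintro ⟨e, he, c, rfl⟩
    exact ⟨_, (γ.mem_resC S).1 he, c, rfl⟩

theorem isHalf_union [DecidableEq γ.E] {R : Finset γ.E} {z : γ.H} :
    γ.IsHalf (S ∪ R) z ↔ γ.IsHalf S z ∨ γ.IsHalf R z := by
  unfold IsHalf
  constructor
  · rintro ⟨e, he, c⟩
    rcases Finset.mem_union.1 he with h | h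
    · exact Or.inl ⟨e, h, c⟩
    · exact Or.inr ⟨e, h, c⟩
  · rintro (⟨e, he, c⟩ | ⟨e, he, c⟩)
    · exact ⟨e, Finset.mem_union_left _ he, c⟩
    · exact ⟨e, Finset.mem_union_right _ he, c⟩

theorem subSQ_emb_strictMono : StrictMono (γ.subSQ S).emb := fun _ _ h => h

end MGraph

/-! ### Operations on iterated subgraphs and contractions -/

namespace WeakModularOperad

variable {k : Type*} [Field k] {W : WeakModularOperad k} {X : Type}

open ModularCollection

theorem onE_strictMono {Z Y Y' : Type} {β : MGraph Y} {β' : MGraph Y'} {γ : MGraph Z}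
    (b : SubQuotient β γ) (b' : SubQuotient β' γ) {σ : Y ≃ Y'} (f : MGraph.GIso β β' σ)
    (h : ∀ e, b'.emb (f.onE e) = b.emb e)
    (hb : StrictMono b.emb) (hb' : StrictMono b'.emb) : StrictMono f.onE := fun e e' he => by
  rw [← hb'.lt_iff_lt, h, h]; exact hb he

/-- Iterated subgraphs and contractions inherit their orders from `γ`. When the comparison
isomorphism respects these orders, the equivariance of the operations produces no sign. -/
theorem μ_same_of_mono {Z Y Y' : Type} {β : MGraph Y} {β' : MGraph Y'} {γ : MGraph Z}
    (hβ : β.IsModular) (hne : Nonempty β.E) (b : SubQuotient β γ) (b' : SubQuotient β' γ)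
    (hb : StrictMono b.emb) (hb' : StrictMono b'.emb) (fV : β.V ≃ β'.V)
    (hmono : ∀ u v, u < v → fV u < fV v) (hV : ∀ v x, b.cell v x → b'.cell (fV v) x)
    (hE : Set.range b.emb = Set.range b'.emb) (hL : Set.range b.leg = Set.range b'.leg)
    {d : β.V → ℕ} {d' : β'.V → ℕ} (a : W.toModularCollection.Labels β d)
    (a' : W.toModularCollection.Labels β' d')
    (ha : ∀ v, SameLabel (b.flag v) (a v) (b'.flag (fV v)) (a' (fV v))) :
    SameLabel b.leg (W.μ β d a) b'.leg (W.μ β' d' a') := by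
  obtain ⟨σ, f, h1, h2, h3⟩ := μ_same hβ hne b b' fV hV hE hL a a' ha
  rw [f.vertexSign_eq_one d (fun u v h _ _ => by rw [h1]; exact hmono u v h),
    f.edgeSign_eq_one _ (onE_strictMono b b' f h2 hb hb'), one_mul, one_smul] at h3
  exact h3

section

variable {γ : MGraph X} (d : γ.V → ℕ) (a : W.toModularCollection.Labels γ d)

/-- A subgraph of a subgraph is a subgraph of the whole graph. -/
theorem sub_sub_same (hγ : γ.IsModular) {S T : Finset γ.E} (hS : γ.IsConnectedSubset S)
    (hT : γ.IsConnectedSubset T) (hST : S ⊆ T) :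
    SameLabel (((γ.sub T).subSQ (γ.resS T S)).trans (γ.subSQ T)).leg
      (W.μ ((γ.sub T).sub (γ.resS T S))
        (fun v => d (γ.sVal T ((γ.sub T).sVal (γ.resS T S) v)))
        (subLabels (γ.sub T) (γ.resS T S) (fun v => d (γ.sVal T v)) (subLabels γ T d a)))
      (γ.subSQ S).leg (W.μ (γ.sub S) (fun v => d (γ.sVal S v)) (subLabels γ S d a)) := by
  have hmem : ∀ e, e ∈ γ.resS T S ↔ γ.sEVal T e ∈ S := fun e => γ.mem_resS T
  have hTt : ∀ {x}, γ.Touched S x → γ.Touched T x := fun ⟨e, he, c⟩ => ⟨e, hST he, c⟩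
  have hconn := (γ.sub_isConnectedSubset T hmem hST).2 hS
  have ht : ∀ {x} (hx : γ.Touched T x), (γ.sub T).Touched (γ.resS T S) (γ.sV T x hx)
      ↔ γ.Touched S x := fun hx => γ.sub_touched T hmem hST hx
  let F : ((γ.sub T).sub (γ.resS T S)).V → (γ.sub S).V := fun v =>
    γ.sV S (γ.sVal T ((γ.sub T).sVal _ v))
      ((ht (γ.sVal_touched T _)).1 ((γ.sub T).sVal_touched _ v))
  have hF : Function.Bijective F := by
    constructor
    · intro u v h
      exact (γ.sub T).sVal_injective _ (γ.sVal_injective T (congrArg (γ.sVal S) h))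
    · rintro ⟨x, hx⟩
      exact ⟨(γ.sub T).sV _ (γ.sV T x (hTt hx)) ((ht _).2 hx), rfl⟩
  refine μ_same_of_mono ((γ.sub T).sub_isModular _ (γ.sub_isModular T hγ hT) hconn) ?_ _ _
    (fun _ _ h => h) (γ.subSQ_emb_strictMono S) (Equiv.ofBijective F hF) (fun _ _ h => h)
    ?_ ?_ ?_ _ _ ?_
  · obtain ⟨e, he⟩ := hconn.1
    exact ⟨(γ.sub T).sE _ e he⟩
  · rintro v x ⟨u, rfl, rfl⟩; rfl
  · rw [γ.range_subSQ_emb]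
    ext e
    constructor
    · rintro ⟨e', rfl⟩
      exact (hmem _).1 ((γ.sub T).sEVal_mem _ e')
    · intro he
      exact ⟨(γ.sub T).sE _ (γ.sE T e (hST he)) ((hmem _).2 he), rfl⟩
  · rw [SubQuotient.trans_leg, Set.range_comp, MGraph.range_subSQ_leg, γ.range_subSQ_leg]
    ext z
    constructor
    · rintro ⟨w, ⟨h1, h2⟩, rfl⟩
      refine ⟨?_, fun h => h2 ((γ.isHalf_subSQ_ι T hST w).1 h)⟩
      rw [← γ.subSQ_vert]
      exact (ht (γ.sVal_touched T _)).1 h1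
    · rintro ⟨h1, h2⟩
      obtain ⟨w, rfl⟩ : z ∈ Set.range (γ.subSQ T).ι := by
        rw [γ.range_subSQ_ι]; exact hTt h1
      refine ⟨w, ⟨?_, fun h => h2 ((γ.isHalf_subSQ_ι T hST w).2 h)⟩, rfl⟩
      rw [← γ.subSQ_vert] at h1
      exact (ht (γ.sVal_touched T _)).2 h1
  · rintro ⟨⟨x, hx⟩, hx'⟩
    have hxS := (ht hx).1 hx'
    refine SameLabel.trans ?_ (subLabels_same γ S d a x hxS)
    have h := ((subLabels_same (γ.sub T) (γ.resS T S) _ (subLabels γ T d a) (γ.sV T x hx) hx').symm.comp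
      (γ.subSQ T).ι).trans (subLabels_same γ T d a x hx).symm
    rw [← SubQuotient.trans_flag] at h
    exact h

/-- A subgraph without vertices in common with `S` is not affected by the contraction of `S`. -/
theorem sub_contract_same (hγ : γ.IsModular) {S R : Finset γ.E}
    (hR : γ.IsConnectedSubset R) (hSR : Disjoint S R)
    (hd : ∀ x, ¬ (γ.Touched S x ∧ γ.Touched R x)) :
    SameLabel (γ.subSQ R).leg (W.μ (γ.sub R) (fun v => d (γ.sVal R v)) (subLabels γ R d a))
      (((γ.contract S).subSQ (γ.resC S R)).trans (γ.contractSQ S)).leg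
      (W.μ ((γ.contract S).sub (γ.resC S R))
        (fun v => γ.contractDeg S d ((γ.contract S).sVal (γ.resC S R) v))
        (subLabels (γ.contract S) (γ.resC S R) (γ.contractDeg S d)
          (contractLabels W.μ γ S d a))) := by
  have hcp : ∀ {x}, γ.Touched R x → ¬ γ.Touched S x := fun hx hS => hd _ ⟨hS, hx⟩
  have ht : ∀ {x} (hx : ¬ γ.Touched S x), (γ.contract S).Touched (γ.resC S R) (γ.cCoe S x hx)
      ↔ γ.Touched R x := fun hx => γ.contract_touched_cCoe S hSR
  let F : (γ.sub R).V → ((γ.contract S).sub (γ.resC S R)).V := fun v =>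
    (γ.contract S).sV _ (γ.cCoe S (γ.sVal R v) (hcp (γ.sVal_touched R v)))
      ((ht _).2 (γ.sVal_touched R v))
  have hF : Function.Bijective F := by
    constructor
    · intro u v h
      exact γ.sVal_injective R ((γ.cCoe_inj S).1 (congrArg ((γ.contract S).sVal _) h))
    · rintro ⟨x, hx⟩
      rcases γ.contract_cases S x with rfl | ⟨y, hy, rfl⟩
      · obtain ⟨x, h1, h2⟩ := (γ.contract_touched_cBot S hSR).1 hx
        exact absurd ⟨h1, h2⟩ (hd x)
      · exact ⟨γ.sV R y ((ht hy).1 hx), rfl⟩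
  refine μ_same_of_mono (γ.sub_isModular R hγ hR) ?_ _ _ (γ.subSQ_emb_strictMono R)
    (fun _ _ h => h) (Equiv.ofBijective F hF) (fun _ _ h => (γ.cCoe_lt_cCoe S).2 h)
    ?_ ?_ ?_ _ _ ?_
  · obtain ⟨e, he⟩ := hR.1
    exact ⟨γ.sE R e he⟩
  · rintro v x rfl
    exact ⟨_, rfl, γ.cproj_of_not_touched S (hcp (γ.sVal_touched R v))⟩
  · rw [γ.range_subSQ_emb]
    ext e
    constructor
    · intro he
      exact ⟨(γ.contract S).sE _ (γ.cE S e (fun h' => Finset.disjoint_left.1 hSR h' he))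
        ((γ.mem_resC S).2 he), rfl⟩
    · rintro ⟨e', rfl⟩
      exact (γ.mem_resC S).1 ((γ.contract S).sEVal_mem _ e')
  · rw [SubQuotient.trans_leg, Set.range_comp, γ.range_subSQ_leg, MGraph.range_subSQ_leg]
    ext z
    constructor
    · rintro ⟨h1, h2⟩
      obtain ⟨w, rfl⟩ : z ∈ Set.range (γ.contractSQ S).ι := by
        rw [γ.range_contractSQ_ι]
        rintro ⟨e, he, c, rfl⟩
        exact hcp h1 (γ.touched_of_mem he c)
      refine ⟨w, ⟨?_, fun h => h2 ((γ.isHalf_contractSQ_ι S hSR w).2 h)⟩, rfl⟩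
      rw [γ.contractSQ_vert, γ.cproj_of_not_touched S (hcp h1)]
      exact (ht _).2 h1
    · rintro ⟨w, ⟨h1, h2⟩, rfl⟩
      refine ⟨?_, fun h => h2 ((γ.isHalf_contractSQ_ι S hSR w).1 h)⟩
      rw [γ.contractSQ_vert] at h1
      by_cases h3 : γ.Touched S (γ.vert ((γ.contractSQ S).ι w))
      · rw [γ.cproj_of_touched S h3] at h1
        obtain ⟨x, h1, h2⟩ := (γ.contract_touched_cBot S hSR).1 h1
        exact absurd ⟨h1, h2⟩ (hd x)
      · rw [γ.cproj_of_not_touched S h3] at h1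
        exact (ht _).1 h1
  · rintro ⟨x, hx⟩
    refine (subLabels_same γ R d a x hx).symm.trans ?_
    rw [SubQuotient.trans_flag]
    refine (contractLabels_cCoe W.μ γ S d a x (hcp hx)).trans ?_
    exact (subLabels_same (γ.contract S) (γ.resC S R) _ (contractLabels W.μ γ S d a)
      (γ.cCoe S x (hcp hx)) ((ht _).2 hx)).comp (γ.contractSQ S).ι

/-- Both graphs are the subquotient of `γ` with edge set `R` in which `S` has become one vertex:
contraction inside the subgraph `S ∪ R` is the same as the subgraph `R` inside the contraction. The
new vertex is the first one in both, so the bijection `F` is monotone. -/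
theorem contract_sub_same (hγ : γ.IsModular) [DecidableEq γ.E] {S R : Finset γ.E}
    (hS : γ.IsConnectedSubset S) (hSR : Disjoint S R) (hR : R.Nonempty)
    (hT : γ.IsConnectedSubset (S ∪ R)) :
    SameLabel (γ.subSQ (S ∪ R)).leg
      (W.μ ((γ.sub (S ∪ R)).contract (γ.resS (S ∪ R) S)) _
        (contractLabels W.μ (γ.sub (S ∪ R)) (γ.resS (S ∪ R) S) (fun v => d (γ.sVal (S ∪ R) v))
          (subLabels γ (S ∪ R) d a)))
      (((γ.contract S).subSQ (γ.resC S R)).trans (γ.contractSQ S)).leg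
      (W.μ ((γ.contract S).sub (γ.resC S R))
        (fun v => γ.contractDeg S d ((γ.contract S).sVal (γ.resC S R) v))
        (subLabels (γ.contract S) (γ.resC S R) (γ.contractDeg S d)
          (contractLabels W.μ γ S d a))) := by
  set T := S ∪ R with hTdef
  have hST : S ⊆ T := Finset.subset_union_left
  obtain ⟨-, hbot⟩ := (γ.contract_connected_touching S hSR hS).2 ⟨hT, hR⟩
  have hmem : ∀ e, e ∈ γ.resS T S ↔ γ.sEVal T e ∈ S := fun e => γ.mem_resS T
  have hTt : ∀ {x}, γ.Touched S x → γ.Touched T x := fun ⟨e, he, c⟩ => ⟨e, hST he, c⟩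
  have hRt : ∀ {x}, γ.Touched R x → γ.Touched T x := fun ⟨e, he, c⟩ =>
    ⟨e, Finset.mem_union_right _ he, c⟩
  have hconn := (γ.sub_isConnectedSubset T hmem hST).2 hS
  have htS : ∀ {x} (hx : γ.Touched T x), (γ.sub T).Touched (γ.resS T S) (γ.sV T x hx)
      ↔ γ.Touched S x := fun hx => γ.sub_touched T hmem hST hx
  have htR : ∀ {x} (hx : ¬ γ.Touched S x), (γ.contract S).Touched (γ.resC S R) (γ.cCoe S x hx)
      ↔ γ.Touched R x := fun hx => γ.contract_touched_cCoe S hSR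
  have htp : ∀ {x}, γ.Touched T x → (γ.contract S).Touched (γ.resC S R) (γ.cproj S x) := by
    intro x hx
    by_cases h : γ.Touched S x
    · rw [γ.cproj_of_touched S h]; exact hbot
    · rw [γ.cproj_of_not_touched S h]
      exact (htR h).2 (((γ.touched_union S).1 hx).resolve_left h)
  let F : ((γ.sub T).contract (γ.resS T S)).V → ((γ.contract S).sub (γ.resC S R)).V :=
    WithBot.recBotCoe ((γ.contract S).sV _ (γ.cBot S) hbot) (fun v =>
      (γ.contract S).sV _ (γ.cCoe S (γ.sVal T v.1) (fun h => v.2 ((htS (γ.sVal_touched T v.1)).2 h)))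
        ((htR _).2 (((γ.touched_union S).1 (γ.sVal_touched T v.1)).resolve_left
          (fun h => v.2 ((htS (γ.sVal_touched T v.1)).2 h)))))
  have hFp : ∀ x (hx : γ.Touched T x), F ((γ.sub T).cproj (γ.resS T S) (γ.sV T x hx))
      = (γ.contract S).sV _ (γ.cproj S x) (htp hx) := by
    intro x hx
    apply (γ.contract S).sVal_injective
    by_cases h : γ.Touched S x
    · rw [(γ.sub T).cproj_of_touched _ ((htS hx).2 h)]
      exact (γ.cproj_of_touched S h).symm
    · rw [(γ.sub T).cproj_of_not_touched _ (fun h' => h ((htS hx).1 h'))]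
      exact (γ.cproj_of_not_touched S h).symm
  have hmono : ∀ u v, u < v → F u < F v := by
    intro u v h
    rcases (γ.sub T).contract_cases _ v with rfl | ⟨⟨y, hy⟩, hy', rfl⟩
    · exact absurd h ((γ.sub T).not_lt_cBot _ u)
    · rcases (γ.sub T).contract_cases _ u with rfl | ⟨⟨x, hx⟩, hx', rfl⟩
      · exact γ.cBot_lt_cCoe S
      · exact (γ.cCoe_lt_cCoe S).2 (((γ.sub T).cCoe_lt_cCoe _).1 h)
  have hF : Function.Bijective F := by
    refine ⟨(show StrictMono F from fun u v h => hmono u v h).injective, ?_⟩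
    rintro ⟨v, hv⟩
    obtain ⟨x, hx, hx'⟩ : ∃ x, γ.cproj S x = v ∧ γ.Touched T x := by
      obtain ⟨x, h1, h2⟩ := (γ.contract_touched S hSR).1 hv
      exact ⟨x, h1, hRt h2⟩
    subst hx
    exact ⟨_, hFp x hx'⟩
  have h0 : (((γ.sub T).contractSQ (γ.resS T S)).trans (γ.subSQ T)).leg = (γ.subSQ T).leg := rfl
  rw [← h0]
  refine μ_same_of_mono ((γ.sub T).contract_isModular _ (γ.sub_isModular T hγ hT) hconn) ?_ _ _
    (fun _ _ h => h) (fun _ _ h => h) (Equiv.ofBijective F hF) hmono ?_ ?_ ?_ _ _ ?_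
  · obtain ⟨e, he⟩ := hR
    exact ⟨(γ.sub T).cE _ (γ.sE T e (Finset.mem_union_right _ he))
      (fun h => Finset.disjoint_left.1 hSR ((hmem _).1 h) he)⟩
  · rintro v x ⟨u, rfl, rfl⟩
    exact ⟨γ.cproj S (γ.sVal T u),
      (congrArg ((γ.contract S).sVal _) (hFp (γ.sVal T u) (γ.sVal_touched T u))).symm, rfl⟩
  · ext e
    constructor
    · rintro ⟨e', rfl⟩
      have h1 : γ.sEVal T ((γ.sub T).cEVal _ e') ∉ S := fun h =>
        (γ.sub T).cEVal_notMem _ e' ((hmem _).2 h)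
      exact ⟨(γ.contract S).sE _ (γ.cE S _ h1) ((γ.mem_resC S).2
        ((Finset.mem_union.1 (γ.sEVal_mem T ((γ.sub T).cEVal _ e'))).resolve_left h1)), rfl⟩
    · rintro ⟨e', rfl⟩
      have h1 := (γ.mem_resC S).1 ((γ.contract S).sEVal_mem _ e')
      have h2 := γ.cEVal_notMem S ((γ.contract S).sEVal _ e')
      exact ⟨(γ.sub T).cE _ (γ.sE T _ (Finset.mem_union_right _ h1)) (fun h => h2 ((hmem _).1 h)), rfl⟩
  · rw [h0, SubQuotient.trans_leg, Set.range_comp, γ.range_subSQ_leg, MGraph.range_subSQ_leg]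
    ext z
    constructor
    · rintro ⟨h1, h2⟩
      have h2' := fun h => h2 (((γ.isHalf_union S).2 h))
      obtain ⟨w, rfl⟩ : z ∈ Set.range (γ.contractSQ S).ι := by
        rw [γ.range_contractSQ_ι]
        exact fun h => h2' (Or.inl h)
      refine ⟨w, ⟨?_, fun h => h2' (Or.inr ((γ.isHalf_contractSQ_ι S hSR w).2 h))⟩, rfl⟩
      rw [γ.contractSQ_vert]; exact htp h1
    · rintro ⟨w, ⟨h1, h2⟩, rfl⟩
      have h3 : ¬ γ.IsHalf S ((γ.contractSQ S).ι w) := by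
        have : (γ.contractSQ S).ι w ∈ Set.range (γ.contractSQ S).ι := ⟨w, rfl⟩
        rwa [γ.range_contractSQ_ι] at this
      refine ⟨?_, fun h => ?_⟩
      · rw [γ.contractSQ_vert] at h1
        by_cases h3 : γ.Touched S (γ.vert ((γ.contractSQ S).ι w))
        · exact hTt h3
        · rw [γ.cproj_of_not_touched S h3] at h1
          exact hRt ((htR _).1 h1)
      · rcases (γ.isHalf_union S).1 h with h | h
        · exact h3 h
        · exact h2 ((γ.isHalf_contractSQ_ι S hSR w).1 h)
  · intro v
    rcases (γ.sub T).contract_cases _ v with rfl | ⟨⟨x, hx⟩, hx', rfl⟩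
    · rw [SubQuotient.trans_flag, SubQuotient.trans_flag]
      refine (((contractLabels_cBot W.μ (γ.sub T) (γ.resS T S) _ (subLabels γ T d a)).symm.comp
        (γ.subSQ T).ι).trans (sub_sub_same d a hγ hS hT hST)).trans ?_
      refine (contractLabels_cBot W.μ γ S d a).trans ?_
      exact (subLabels_same (γ.contract S) (γ.resC S R) _ (contractLabels W.μ γ S d a)
        (γ.cBot S) hbot).comp (γ.contractSQ S).ι
    · have hxS : ¬ γ.Touched S x := fun h => hx' ((htS hx).2 h)
      rw [SubQuotient.trans_flag, SubQuotient.trans_flag]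
      refine (((contractLabels_cCoe W.μ (γ.sub T) (γ.resS T S) _ (subLabels γ T d a)
        (γ.sV T x hx) hx').symm.comp (γ.subSQ T).ι).trans (subLabels_same γ T d a x hx).symm).trans ?_
      refine (contractLabels_cCoe W.μ γ S d a x hxS).trans ?_
      exact (subLabels_same (γ.contract S) (γ.resC S R) _ (contractLabels W.μ γ S d a)
        (γ.cCoe S x hxS) ((htR hxS).2 (((γ.touched_union S).1 hx).resolve_left hxS))).comp
          (γ.contractSQ S).ι

end

end WeakModularOperad

open Classical in
theorem ZMod.ite_odd (n : ℕ) : (if Odd n then 1 else 0 : ZMod 2) = n := by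
  split_ifs with h
  · exact ((ZMod.natCast_eq_one_iff_odd).2 h).symm
  · exact ((ZMod.natCast_eq_zero_iff_even).2 (Nat.not_odd_iff_even.1 h)).symm

/-- Surjections with the same fibres. -/
theorem Function.Surjective.exists_equiv {α β β' : Type*} {p : α → β} {q : α → β'}
    (hp : Function.Surjective p) (hq : Function.Surjective q) (h : ∀ x y, p x = p y ↔ q x = q y) :
    ∃ e : β ≃ β', ∀ x, e (p x) = q x := by
  have hs := Function.surjInv_eq hp
  refine ⟨Equiv.ofBijective (fun b => q (Function.surjInv hp b)) ⟨fun b b' hb => ?_, fun c => ?_⟩,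
    fun x => ?_⟩
  · have := (h _ _).2 hb
    rwa [hs, hs] at this
  · obtain ⟨x, rfl⟩ := hq c
    exact ⟨p x, (h _ _).1 (hs _)⟩
  · exact (h _ _).1 (hs _)

/-! ### Signs of two successive contractions -/

section Pairs

variable {α : Type*} [Fintype α] [LinearOrder α] (s r o : α → Prop)
  [DecidablePred s] [DecidablePred r] [DecidablePred o]

/-- Moving `S` to the front and then `R` to the front of the rest transposes the same pairs as
moving `S ∪ R` to the front and then `S` to the front inside it. Every transposed pair is counted
exactly once on both sides. -/
theorem nested_pairs :
    (∑ x, ∑ y, if ¬ s x ∧ s y ∧ x < y ∧ o x ∧ o y then 1 else 0 : ZMod 2)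
      + (∑ x, ∑ y, if ¬ s x ∧ ¬ s y ∧ ¬ r x ∧ r y ∧ x < y ∧ o x ∧ o y then 1 else 0)
    = (∑ x, ∑ y, if (s x ∨ r x) ∧ (s y ∨ r y) ∧ ¬ s x ∧ s y ∧ x < y ∧ o x ∧ o y then 1 else 0)
      + (∑ x, ∑ y, if ¬ (s x ∨ r x) ∧ (s y ∨ r y) ∧ x < y ∧ o x ∧ o y then 1 else 0) := by
  simp only [← Finset.sum_add_distrib]
  refine Finset.sum_congr rfl fun x _ => Finset.sum_congr rfl fun y _ => ?_
  by_cases h1 : s x <;> by_cases h2 : r x <;> by_cases h3 : s y <;> by_cases h4 : r y <;>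
    simp [h1, h2, h3, h4]

/-- The two ways of moving both blocks to the front differ by an exchange of the blocks, which costs
one sign for every pair consisting of an odd element of each. -/
theorem disjoint_pairs (hd : ∀ x, ¬ (s x ∧ r x)) :
    (∑ x, ∑ y, if ¬ s x ∧ s y ∧ x < y ∧ o x ∧ o y then 1 else 0 : ZMod 2)
      + (∑ x, ∑ y, if ¬ s x ∧ ¬ s y ∧ ¬ r x ∧ r y ∧ x < y ∧ o x ∧ o y then 1 else 0)
      + ((∑ x, ∑ y, if ¬ r x ∧ r y ∧ x < y ∧ o x ∧ o y then 1 else 0)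
      + (∑ x, ∑ y, if ¬ r x ∧ ¬ r y ∧ ¬ s x ∧ s y ∧ x < y ∧ o x ∧ o y then 1 else 0))
    = (∑ x, if r x ∧ o x then 1 else 0) * (∑ x, if s x ∧ o x then 1 else 0) := by
  rw [Finset.sum_mul_sum]
  have h : (∑ x, ∑ y, (if r x ∧ o x then 1 else 0) * (if s y ∧ o y then 1 else 0) : ZMod 2)
      = (∑ x, ∑ y, if r x ∧ s y ∧ x < y ∧ o x ∧ o y then 1 else 0)
        + (∑ x, ∑ y, if s x ∧ r y ∧ x < y ∧ o x ∧ o y then 1 else 0) := by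
    rw [Finset.sum_comm (f := fun x y => if s x ∧ r y ∧ x < y ∧ o x ∧ o y then (1 : ZMod 2) else 0)]
    simp only [← Finset.sum_add_distrib]
    refine Finset.sum_congr rfl fun x _ => Finset.sum_congr rfl fun y _ => ?_
    have hx := hd x
    rcases lt_trichotomy x y with hxy | rfl | hxy
    · have := hxy.not_gt
      by_cases h1 : r x <;> by_cases h3 : s y <;> by_cases h4 : o x <;> by_cases h5 : o y <;>
        simp_all
    · by_cases h1 : r x <;> by_cases h3 : s x <;> simp_all
    · have := hxy.not_gt
      by_cases h1 : r x <;> by_cases h3 : s y <;> by_cases h4 : o x <;> by_cases h5 : o y <;>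
        simp_all
  rw [h]
  simp only [← Finset.sum_add_distrib]
  refine Finset.sum_congr rfl fun x _ => Finset.sum_congr rfl fun y _ => ?_
  have hx := hd x
  have hy := hd y
  have h2 : (1 : ZMod 2) + 1 = 0 := by decide
  by_cases h5 : x < y ∧ o x ∧ o y
  · by_cases h1 : s x <;> by_cases h2 : r x <;> by_cases h3 : s y <;> by_cases h4 : r y <;>
      simp_all
  · simp [h5]

end Pairs

namespace MGraph

variable {X : Type} (γ : MGraph X) {S R : Finset γ.E} (d : γ.V → ℕ)

open Classical in
-- The first sum comes from the new vertex, which is the first one in the order. If `R` does not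
-- touch it, every vertex touched by `R` has to be moved past it. Otherwise it belongs to the second
-- subgraph and nothing moves past it.
theorem contractSign_contract (hSR : Disjoint S R) :
    ∃ n : ℕ, (γ.contract S).contractSign (γ.resC S R) (γ.contractDeg S d) = (-1) ^ n ∧
      (n : ZMod 2) =
      (∑ y, if (¬ ∃ x, γ.Touched S x ∧ γ.Touched R x) ∧ γ.Touched R y then
        ((γ.contractDeg S d (γ.cBot S) : ℕ) * (d y : ℕ) : ZMod 2) else 0)
      + (∑ a, ∑ b, if ¬ γ.Touched S a ∧ ¬ γ.Touched S b ∧ ¬ γ.Touched R a ∧ γ.Touched R b ∧ a < b ∧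
          Odd (d a) ∧ Odd (d b) then 1 else 0)
      + (∑ a, ∑ b, if ¬ a ∈ S ∧ ¬ b ∈ S ∧ ¬ a ∈ R ∧ b ∈ R ∧ a < b ∧ True ∧ True then 1 else 0)
      + (((Fintype.card γ.E - S.card - R.card) * (R.card - 1) : ℕ) : ZMod 2) := by
  obtain ⟨n, h1, h2⟩ := (γ.contract S).contractSign_eq (γ.resC S R) (γ.contractDeg S d)
  refine ⟨n, h1, ?_⟩
  rw [h2, card_contract_E, γ.card_resC S hSR]
  congr 1
  have hb : ∀ v, ¬ v < γ.cBot S := γ.not_lt_cBot S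
  congr 1
  · rw [γ.sum_contract_ite S _ (fun a => ∑ b, if ¬ γ.Touched S b ∧ ¬ γ.Touched R a ∧
      γ.Touched R b ∧ a < b ∧ Odd (d a) ∧ Odd (d b) then 1 else 0)]
    · congr 1
      · rw [γ.sum_contract_ite S _ (fun b => if (¬ ∃ x, γ.Touched S x ∧ γ.Touched R x) ∧
          γ.Touched R b ∧ Odd (γ.contractDeg S d (γ.cBot S)) ∧ Odd (d b) then 1 else 0)]
        · simp only [hb, false_and, and_false, if_false, zero_add]
          refine Finset.sum_congr rfl fun y _ => ?_
          rw [← ZMod.ite_odd, ← ZMod.ite_odd]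
          by_cases h5 : γ.Touched R y
          · by_cases h6 : γ.Touched S y
            · have : ∃ x, γ.Touched S x ∧ γ.Touched R x := ⟨y, h6, h5⟩
              simp [this, h6]
            · by_cases h7 : Odd (d y) <;> by_cases h8 : Odd (γ.contractDeg S d (γ.cBot S)) <;>
                simp [h5, h6, h7, h8]
          · simp [h5]
        · intro x hx
          simp only [γ.contract_touched_cBot S hSR, γ.contract_touched_cCoe S hSR,
            contractDeg_cCoe, γ.cBot_lt_cCoe S, true_and]
      · refine Finset.sum_congr rfl fun x _ => ?_
        by_cases h6 : γ.Touched S x <;> simp [h6]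
    · intro x hx
      rw [γ.sum_contract_ite S _ (fun b => if ¬ γ.Touched R x ∧
        γ.Touched R b ∧ x < b ∧ Odd (d x) ∧ Odd (d b) then 1 else 0)]
      · simp only [hb, false_and, and_false, if_false, zero_add]
        refine Finset.sum_congr rfl fun y _ => ?_
        by_cases h6 : γ.Touched S y <;> simp [h6]
      · intro y hy
        simp only [γ.contract_touched_cCoe S hSR, cCoe_lt_cCoe, contractDeg_cCoe]
  · rw [γ.sum_contract_E_ite S _ (fun a => ∑ b, if ¬ b ∈ S ∧ ¬ a ∈ R ∧ b ∈ R ∧ a < b ∧ True ∧ True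
      then 1 else 0)]
    · refine Finset.sum_congr rfl fun x _ => ?_
      by_cases h6 : x ∈ S <;> simp [h6]
    · intro e
      rw [γ.sum_contract_E_ite S _ (fun b => if ¬ γ.cEVal S e ∈ R ∧ b ∈ R ∧ γ.cEVal S e < b ∧
        True ∧ True then 1 else 0)]
      · refine Finset.sum_congr rfl fun x _ => ?_
        by_cases h6 : x ∈ S <;> simp [h6]
      · intro f
        simp only [mem_resC, cEVal_lt]

open Classical in
theorem contractSign_sub {T : Finset γ.E} (hST : S ⊆ T) :
    ∃ n : ℕ, (γ.sub T).contractSign (γ.resS T S) (fun v => d (γ.sVal T v)) = (-1) ^ n ∧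
      (n : ZMod 2) =
      (∑ a, ∑ b, if γ.Touched T a ∧ γ.Touched T b ∧ ¬ γ.Touched S a ∧ γ.Touched S b ∧ a < b ∧
          Odd (d a) ∧ Odd (d b) then 1 else 0)
      + (∑ a, ∑ b, if a ∈ T ∧ b ∈ T ∧ ¬ a ∈ S ∧ b ∈ S ∧ a < b ∧ True ∧ True then 1 else 0)
      + (((T.card - S.card) * (S.card - 1) : ℕ) : ZMod 2) := by
  obtain ⟨n, h1, h2⟩ := (γ.sub T).contractSign_eq (γ.resS T S) (fun v => d (γ.sVal T v))
  refine ⟨n, h1, ?_⟩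
  rw [h2, card_sub_E, γ.card_resS T hST]
  have ht : ∀ {x} (hx : γ.Touched T x), (γ.sub T).Touched (γ.resS T S) (γ.sV T x hx)
      ↔ γ.Touched S x := fun hx => γ.sub_touched T (fun e => γ.mem_resS T) hST hx
  congr 1
  congr 1
  · rw [γ.sum_sub_ite T _ (fun a => ∑ b, if γ.Touched T b ∧ ¬ γ.Touched S a ∧
      γ.Touched S b ∧ a < b ∧ Odd (d a) ∧ Odd (d b) then 1 else 0)]
    · refine Finset.sum_congr rfl fun x _ => ?_
      by_cases h6 : γ.Touched T x <;> simp [h6]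
    · intro x hx
      rw [γ.sum_sub_ite T _ (fun b => if ¬ γ.Touched S x ∧
        γ.Touched S b ∧ x < b ∧ Odd (d x) ∧ Odd (d b) then 1 else 0)]
      · refine Finset.sum_congr rfl fun y _ => ?_
        by_cases h6 : γ.Touched T y <;> simp [h6]
      · intro y hy
        simp only [ht, ← sVal_lt, sVal_sV]
  · rw [γ.sum_sub_E_ite T _ (fun a => ∑ b, if b ∈ T ∧ ¬ a ∈ S ∧ b ∈ S ∧ a < b ∧ True ∧ True
      then 1 else 0)]
    · refine Finset.sum_congr rfl fun x _ => ?_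
      by_cases h6 : x ∈ T <;> simp [h6]
    · intro e
      rw [γ.sum_sub_E_ite T _ (fun b => if ¬ γ.sEVal T e ∈ S ∧ b ∈ S ∧ γ.sEVal T e < b ∧
        True ∧ True then 1 else 0)]
      · refine Finset.sum_congr rfl fun x _ => ?_
        by_cases h6 : x ∈ T <;> simp [h6]
      · intro f
        simp only [mem_resS, sEVal_lt]

open Classical in
-- The factor `(-1)^(|E| - |S ∪ R|)` depends only on the union. When the union is kept fixed it can
-- be taken out of the sum, and the signs of the quadratic relation for the subgraph remain.
theorem contractSign_nested (hS : S.Nonempty) (hR : R.Nonempty) (hSR : Disjoint S R)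
    (ht : ∃ x, γ.Touched S x ∧ γ.Touched R x) :
    γ.contractSign S d * (γ.contract S).contractSign (γ.resC S R) (γ.contractDeg S d)
      = γ.contractSign (S ∪ R) d * (-1) ^ (Fintype.card γ.E - (S ∪ R).card) *
        (γ.sub (S ∪ R)).contractSign (γ.resS (S ∪ R) S) (fun v => d (γ.sVal (S ∪ R) v)) := by
  obtain ⟨n1, h1, h1'⟩ := γ.contractSign_eq S d
  obtain ⟨n2, h2, h2'⟩ := γ.contractSign_contract d hSR
  obtain ⟨n3, h3, h3'⟩ := γ.contractSign_eq (S ∪ R) d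
  obtain ⟨n4, h4, h4'⟩ := γ.contractSign_sub d (S := S) (T := S ∪ R) Finset.subset_union_left
  rw [h1, h2, h3, h4, ← pow_add, ← pow_add, ← pow_add]
  apply neg_one_pow_eq_of_cast_eq
  push_cast
  rw [h1', h2', h3', h4']
  have e1 := nested_pairs (γ.Touched S) (γ.Touched R) (fun v => Odd (d v))
  have e2 := nested_pairs (fun e => e ∈ S) (fun e => e ∈ R) (fun _ => True)
  simp only [touched_union, Finset.mem_union]
  -- The last exponents on the two sides, including the extra factor, differ by twice `|E| - |S ∪
  -- R|`, which disappears modulo two.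
  have e3 : (Fintype.card γ.E - S.card) * (S.card - 1)
      + (Fintype.card γ.E - S.card - R.card) * (R.card - 1) + 2 * (Fintype.card γ.E - (S ∪ R).card)
      = (Fintype.card γ.E - (S ∪ R).card) * ((S ∪ R).card - 1)
      + (Fintype.card γ.E - (S ∪ R).card)
      + ((S ∪ R).card - S.card) * (S.card - 1) := by
    rw [Finset.card_union_of_disjoint hSR]
    have h5 := Finset.card_le_univ (S ∪ R)
    rw [Finset.card_union_of_disjoint hSR] at h5
    obtain ⟨s, hs⟩ := Nat.exists_eq_add_of_lt hS.card_pos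
    obtain ⟨r, hr⟩ := Nat.exists_eq_add_of_lt hR.card_pos
    obtain ⟨m, hm⟩ := Nat.exists_eq_add_of_le h5
    rw [hm, hs, hr]
    have a1 : 0 + s + 1 + (0 + r + 1) + m - (0 + s + 1) = r + 1 + m := by omega
    have a2 : r + 1 + m - (0 + r + 1) = m := by omega
    have a3 : 0 + s + 1 + (0 + r + 1) + m - (0 + s + 1 + (0 + r + 1)) = m := by omega
    have a4 : 0 + s + 1 + (0 + r + 1) - 1 = s + r + 1 := by omega
    have a5 : 0 + s + 1 + (0 + r + 1) - (0 + s + 1) = r + 1 := by omega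
    rw [a1, a2, a3, a4, a5]
    simp only [Nat.zero_add, Nat.add_sub_cancel]
    ring
  have e3' := congrArg (Nat.cast (R := ZMod 2)) e3
  have h2z : (2 : ZMod 2) = 0 := by decide
  push_cast at e3'
  rw [h2z, zero_mul, add_zero] at e3'
  have e4 : (∑ y, if (¬ ∃ x, γ.Touched S x ∧ γ.Touched R x) ∧ γ.Touched R y then
        ((γ.contractDeg S d (γ.cBot S) : ℕ) * (d y : ℕ) : ZMod 2) else 0) = 0 :=
    Finset.sum_eq_zero fun y _ => if_neg fun h => h.1 ht
  rw [e4]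
  push_cast
  linear_combination e1 + e2 + e3'

open Classical in
-- Two operations of degree `-1` anticommute, which accounts for the minus sign. The exponent `n` is
-- the Koszul sign for the exchange of the two new vertices.
theorem contractSign_disjoint (hS : S.Nonempty) (hR : R.Nonempty) (hSR : Disjoint S R)
    (hd : ∀ x, ¬ (γ.Touched S x ∧ γ.Touched R x)) {n : ℕ} (hn : (n : ZMod 2) =
      (γ.contractDeg S d (γ.cBot S) : ℕ) * (γ.contractDeg R d (γ.cBot R) : ℕ)) :
    γ.contractSign S d * (γ.contract S).contractSign (γ.resC S R) (γ.contractDeg S d)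
      = - ((-1) ^ n * (γ.contractSign R d *
        (γ.contract R).contractSign (γ.resC R S) (γ.contractDeg R d))) := by
  obtain ⟨n1, h1, h1'⟩ := γ.contractSign_eq S d
  obtain ⟨n2, h2, h2'⟩ := γ.contractSign_contract d hSR
  obtain ⟨n3, h3, h3'⟩ := γ.contractSign_eq R d
  obtain ⟨n4, h4, h4'⟩ := γ.contractSign_contract d hSR.symm
  rw [h1, h2, h3, h4, ← pow_add, ← pow_add, ← pow_add,
    ← neg_one_mul ((-1 : ℤ) ^ (n + (n3 + n4))), ← pow_succ']
  apply neg_one_pow_eq_of_cast_eq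
  have hne : ¬ ∃ x, γ.Touched S x ∧ γ.Touched R x := fun ⟨x, hx⟩ => hd x hx
  have hne' : ¬ ∃ x, γ.Touched R x ∧ γ.Touched S x := fun ⟨x, hx⟩ => hd x hx.symm
  have e1 := disjoint_pairs (γ.Touched S) (γ.Touched R) (fun v => Odd (d v)) hd
  have e2 := disjoint_pairs (fun e => e ∈ S) (fun e => e ∈ R) (fun _ => True)
    (fun x hx => Finset.disjoint_left.1 hSR hx.1 hx.2)
  have hD : ∀ U : Finset γ.E, (∑ x, if γ.Touched U x ∧ Odd (d x) then 1 else 0 : ZMod 2)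
      = (∑ x, if γ.Touched U x then (d x : ZMod 2) else 0) := fun U =>
    Finset.sum_congr rfl fun x _ => by
      rw [← ZMod.ite_odd]
      by_cases h : γ.Touched U x <;> simp [h]
  have hc : ∀ U : Finset γ.E, (∑ x, if x ∈ U ∧ True then 1 else 0 : ZMod 2) = U.card := fun U => by
    simp
  have hdeg : ∀ U : Finset γ.E, U.Nonempty → ((γ.contractDeg U d (γ.cBot U) : ℕ) : ZMod 2)
      = (∑ x, if γ.Touched U x then (d x : ZMod 2) else 0) + (U.card + 1) := fun U hU => by
    rw [contractDeg_cBot, card_sub_E, γ.sum_sub_ite U _ d (fun _ _ => rfl)]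
    obtain ⟨u, hu⟩ := Nat.exists_eq_add_of_lt hU.card_pos
    rw [hu]
    have : ∀ m, m + (0 + u + 1) - 1 = m + u := fun m => by omega
    rw [this]
    have h2z : (2 : ZMod 2) = 0 := by decide
    push_cast
    rw [zero_add, add_assoc (u : ZMod 2), one_add_one_eq_two, h2z, add_zero]
  rw [hD, hD] at e1
  rw [hc, hc] at e2
  have hb : ∀ U U' : Finset γ.E, (∑ y, if (¬ ∃ x, γ.Touched U' x ∧ γ.Touched U x) ∧ γ.Touched U y then
        ((γ.contractDeg U' d (γ.cBot U') : ℕ) * (d y : ℕ) : ZMod 2) else 0)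
      = if (¬ ∃ x, γ.Touched U' x ∧ γ.Touched U x) then (γ.contractDeg U' d (γ.cBot U') : ℕ) *
        (∑ x, if γ.Touched U x then (d x : ZMod 2) else 0) else 0 := fun U U' => by
    by_cases h : ∃ x, γ.Touched U' x ∧ γ.Touched U x
    · simp [h]
    · rw [if_pos h, Finset.mul_sum]
      refine Finset.sum_congr rfl fun y _ => ?_
      by_cases h' : γ.Touched U y <;> simp [h, h']
  push_cast
  rw [h1', h2', h3', h4', hn, hb, hb, if_pos hne, if_pos hne', hdeg S hS, hdeg R hR]
  have h5 := Finset.card_le_univ (S ∪ R)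
  rw [Finset.card_union_of_disjoint hSR] at h5
  obtain ⟨s, hs⟩ := Nat.exists_eq_add_of_lt hS.card_pos
  obtain ⟨r, hr⟩ := Nat.exists_eq_add_of_lt hR.card_pos
  obtain ⟨m, hm⟩ := Nat.exists_eq_add_of_le h5
  rw [hs, hr] at hm e2 ⊢
  rw [hm]
  have a1 : 0 + s + 1 + (0 + r + 1) + m - (0 + s + 1) = r + 1 + m := by omega
  have a2 : r + 1 + m - (0 + r + 1) = m := by omega
  have a3 : 0 + s + 1 + (0 + r + 1) + m - (0 + r + 1) = s + 1 + m := by omega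
  have a4 : s + 1 + m - (0 + s + 1) = m := by omega
  rw [a1, a2, a3, a4]
  simp only [Nat.zero_add, Nat.add_sub_cancel] at e2 ⊢
  push_cast at e2 ⊢
  generalize (∑ x, if γ.Touched S x then (d x : ZMod 2) else 0) = DS at *
  generalize (∑ x, if γ.Touched R x then (d x : ZMod 2) else 0) = DR at *
  have h2z : (2 : ZMod 2) = 0 := by decide
  generalize (∑ x, ∑ y, if ¬γ.Touched R x ∧ γ.Touched R y ∧ x < y ∧ Odd (d x) ∧ Odd (d y) then
    (1 : ZMod 2) else 0) = B1 at *
  generalize (∑ x, ∑ y, if ¬γ.Touched R x ∧ ¬γ.Touched R y ∧ ¬γ.Touched S x ∧ γ.Touched S y ∧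
    x < y ∧ Odd (d x) ∧ Odd (d y) then (1 : ZMod 2) else 0) = B2 at *
  generalize (∑ x, ∑ y, if x ∉ R ∧ y ∈ R ∧ x < y ∧ True ∧ True then (1 : ZMod 2) else 0) = C1 at *
  generalize (∑ x, ∑ y, if x ∉ R ∧ y ∉ R ∧ x ∉ S ∧ y ∈ S ∧ x < y ∧ True ∧ True then
    (1 : ZMod 2) else 0) = C2 at *
  -- The multiple of `h2z` discards what occurs an even number of times.
  linear_combination e1 + e2 - (B1 + B2 + C1 + C2 + r * DS + 2 * DS + r + 2) * h2z

end MGraph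

/-! ### Contraction of two subgraphs without a common vertex -/

namespace MGraph

variable {X : Type} (γ : MGraph X) (S R : Finset γ.E)

/-- The contraction of `S` and of `R`, as a subquotient. -/
def twiceSQ : SubQuotient ((γ.contract S).contract (γ.resC S R)) γ :=
  ((γ.contract S).contractSQ (γ.resC S R)).trans (γ.contractSQ S)

/-- The contraction of `S` and of `R` on the vertices. -/
def twiceProj (x : γ.V) : ((γ.contract S).contract (γ.resC S R)).V :=
  (γ.contract S).cproj (γ.resC S R) (γ.cproj S x)

theorem twiceSQ_cell (v : ((γ.contract S).contract (γ.resC S R)).V) (x : γ.V) :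
    (γ.twiceSQ S R).cell v x ↔ γ.twiceProj S R x = v :=
  ⟨fun ⟨_, h, h'⟩ => (congrArg _ h').trans h, fun h => ⟨_, h, rfl⟩⟩

theorem twiceSQ_emb_strictMono : StrictMono (γ.twiceSQ S R).emb := fun _ _ h => h

variable {S R}

theorem range_twiceSQ_emb : Set.range (γ.twiceSQ S R).emb = {e | e ∉ S ∧ e ∉ R} := by
  ext e
  constructor
  · rintro ⟨e', rfl⟩
    exact ⟨γ.cEVal_notMem S _, fun h => (γ.contract S).cEVal_notMem _ e' ((γ.mem_resC S).2 h)⟩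
  · rintro ⟨h1, h2⟩
    exact ⟨(γ.contract S).cE _ (γ.cE S e h1) (fun h => h2 ((γ.mem_resC S).1 h)), rfl⟩

theorem twiceProj_surjective (hS : S.Nonempty) (hR : R.Nonempty) (hSR : Disjoint S R) :
    Function.Surjective (γ.twiceProj S R) := by
  refine Function.Surjective.comp (g := (γ.contract S).cproj (γ.resC S R)) ?_ ?_
  · refine (γ.contract S).cproj_surjective _ ?_
    obtain ⟨e, he⟩ := hR
    exact ⟨γ.cE S e (fun h => Finset.disjoint_left.1 hSR h he), (γ.mem_resC S).2 he⟩
  · exact γ.cproj_surjective S hS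

theorem twiceProj_of_right (hSR : Disjoint S R) {x : γ.V} (hx : γ.Touched R x) :
    γ.twiceProj S R x = (γ.contract S).cBot (γ.resC S R) :=
  (γ.contract S).cproj_of_touched _ ((γ.contract_touched S hSR).2 ⟨x, rfl, hx⟩)

theorem twiceProj_of_left {x : γ.V} (hx : γ.Touched S x) :
    γ.twiceProj S R x = (γ.contract S).cproj (γ.resC S R) (γ.cBot S) :=
  congrArg _ (γ.cproj_of_touched S hx)

theorem twiceProj_of_not (hSR : Disjoint S R) {x : γ.V} (hx : ¬ γ.Touched S x)
    (hx' : ¬ γ.Touched R x) : γ.twiceProj S R x = (γ.contract S).cCoe (γ.resC S R) (γ.cCoe S x hx)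
      (fun h => hx' ((γ.contract_touched_cCoe S hSR).1 h)) := by
  unfold twiceProj
  rw [γ.cproj_of_not_touched S hx]
  exact (γ.contract S).cproj_of_not_touched _ _

theorem not_touched_cBot (hSR : Disjoint S R) (hd : ∀ x, ¬ (γ.Touched S x ∧ γ.Touched R x)) :
    ¬ (γ.contract S).Touched (γ.resC S R) (γ.cBot S) := fun h =>
  let ⟨x, hx⟩ := (γ.contract_touched_cBot S hSR).1 h
  hd x hx

/-- The description of the fibres is symmetric in `S` and `R`. The two orders of contraction
therefore have the same fibres, and their vertex sets are identified by
`Function.Surjective.exists_equiv`. -/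
theorem twiceProj_eq_iff (hSR : Disjoint S R) (hd : ∀ x, ¬ (γ.Touched S x ∧ γ.Touched R x))
    (x y : γ.V) : γ.twiceProj S R x = γ.twiceProj S R y ↔
      x = y ∨ (γ.Touched S x ∧ γ.Touched S y) ∨ (γ.Touched R x ∧ γ.Touched R y) := by
  have hb := γ.not_touched_cBot hSR hd
  have hx := hd x
  have hy := hd y
  have key : ∀ {x}, γ.Touched S x → γ.twiceProj S R x = (γ.contract S).cCoe _ (γ.cBot S) hb :=
    fun h => (γ.twiceProj_of_left h).trans ((γ.contract S).cproj_of_not_touched _ hb)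
  have n1 := fun z (hz : ¬ γ.Touched S z) => (γ.cBot_ne_cCoe S (x := z) (h := hz))
  have n2 := fun z hz => ((γ.contract S).cBot_ne_cCoe (γ.resC S R) (x := z) (h := hz))
  by_cases h1 : γ.Touched S x
  · have h1' : ¬ γ.Touched R x := fun h => hx ⟨h1, h⟩
    rw [key h1]
    by_cases h2 : γ.Touched S y
    · simp [key h2, h1, h2]
    · have hne : x ≠ y := fun h => h2 (h ▸ h1)
      by_cases h3 : γ.Touched R y
      · simp [γ.twiceProj_of_right hSR h3, h1, h2, h1', hne, (n2 _ _).symm]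
      · simp [γ.twiceProj_of_not hSR h2 h3, h1, h2, h1', hne, (γ.contract S).cCoe_inj, n1]
  · by_cases h1' : γ.Touched R x
    · rw [γ.twiceProj_of_right hSR h1']
      by_cases h2 : γ.Touched S y
      · have hne : x ≠ y := fun h => h1 (h ▸ h2)
        have h3 : ¬ γ.Touched R y := fun h => hy ⟨h2, h⟩
        simp [key h2, h1, h3, hne, n2]
      · by_cases h3 : γ.Touched R y
        · simp [γ.twiceProj_of_right hSR h3, h3, h1']
        · have hne : x ≠ y := fun h => h3 (h ▸ h1')
          simp [γ.twiceProj_of_not hSR h2 h3, h1, h3, hne, n2]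
    · rw [γ.twiceProj_of_not hSR h1 h1']
      by_cases h2 : γ.Touched S y
      · have hne : x ≠ y := fun h => h1 (h ▸ h2)
        simp [key h2, h1, h1', hne, (γ.contract S).cCoe_inj, (n1 _ _).symm]
      · by_cases h3 : γ.Touched R y
        · have hne : x ≠ y := fun h => h1' (h ▸ h3)
          simp [γ.twiceProj_of_right hSR h3, h1, h1', hne, (n2 _ _).symm]
        · simp [γ.twiceProj_of_not hSR h2 h3, h1, h1', (γ.contract S).cCoe_inj, γ.cCoe_inj S]

end MGraph

namespace WeakModularOperad

variable {k : Type*} [Field k] {W : WeakModularOperad k} {X : Type}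

open ModularCollection

section

variable {γ : MGraph X} (d : γ.V → ℕ) (a : W.toModularCollection.Labels γ d) (S R : Finset γ.E)

/-- The degrees of the labels after contraction of `S` and of `R`. -/
abbrev twiceDeg : ((γ.contract S).contract (γ.resC S R)).V → ℕ :=
  (γ.contract S).contractDeg (γ.resC S R) (γ.contractDeg S d)

/-- The labels after contraction of `S` and of `R`. -/
abbrev twiceLabels : W.toModularCollection.Labels ((γ.contract S).contract (γ.resC S R))
    (twiceDeg d S R) :=
  contractLabels W.μ (γ.contract S) (γ.resC S R) (γ.contractDeg S d) (contractLabels W.μ γ S d a)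

theorem twiceLabels_old (x : γ.V) (hx : ¬ γ.Touched S x)
    (hx' : ¬ (γ.contract S).Touched (γ.resC S R) (γ.cCoe S x hx)) :
    SameLabel (Subtype.val : γ.Flag x → γ.H) (a x)
      ((γ.twiceSQ S R).flag ((γ.contract S).cCoe (γ.resC S R) (γ.cCoe S x hx) hx'))
      (twiceLabels d a S R ((γ.contract S).cCoe (γ.resC S R) (γ.cCoe S x hx) hx')) := by
  unfold MGraph.twiceSQ
  rw [SubQuotient.trans_flag]
  exact (contractLabels_cCoe W.μ γ S d a x hx).trans
    ((contractLabels_cCoe W.μ (γ.contract S) (γ.resC S R) _ (contractLabels W.μ γ S d a)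
      (γ.cCoe S x hx) hx').comp (γ.contractSQ S).ι)

theorem twiceLabels_left (hx' : ¬ (γ.contract S).Touched (γ.resC S R) (γ.cBot S)) :
    SameLabel (γ.subSQ S).leg (W.μ (γ.sub S) (fun v => d (γ.sVal S v)) (subLabels γ S d a))
      ((γ.twiceSQ S R).flag ((γ.contract S).cCoe (γ.resC S R) (γ.cBot S) hx'))
      (twiceLabels d a S R ((γ.contract S).cCoe (γ.resC S R) (γ.cBot S) hx')) := by
  unfold MGraph.twiceSQ
  rw [SubQuotient.trans_flag]
  exact (contractLabels_cBot W.μ γ S d a).trans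
    ((contractLabels_cCoe W.μ (γ.contract S) (γ.resC S R) _ (contractLabels W.μ γ S d a)
      (γ.cBot S) hx').comp (γ.contractSQ S).ι)

theorem twiceLabels_right :
    SameLabel (((γ.contract S).subSQ (γ.resC S R)).trans (γ.contractSQ S)).leg
      (W.μ ((γ.contract S).sub (γ.resC S R))
        (fun v => γ.contractDeg S d ((γ.contract S).sVal (γ.resC S R) v))
        (subLabels (γ.contract S) (γ.resC S R) (γ.contractDeg S d) (contractLabels W.μ γ S d a)))
      ((γ.twiceSQ S R).flag ((γ.contract S).cBot (γ.resC S R)))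
      (twiceLabels d a S R ((γ.contract S).cBot (γ.resC S R))) := by
  unfold MGraph.twiceSQ
  rw [SubQuotient.trans_flag]
  exact (contractLabels_cBot W.μ (γ.contract S) (γ.resC S R) _
    (contractLabels W.μ γ S d a)).comp (γ.contractSQ S).ι

/-- The term of the square of the differential that contracts `S` and then `R`. -/
def squareTerm (φ : W.Cochain X) : k :=
  γ.contractSign S d • (γ.contract S).contractSign (γ.resC S R) (γ.contractDeg S d) •
    φ ((γ.contract S).contract (γ.resC S R)) (twiceDeg d S R) (twiceLabels d a S R)

variable {S R}

/-- The two double contractions are isomorphic, but in each of them the vertex that was created last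
comes first. The isomorphism thus exchanges the two new vertices, and its Koszul sign is the one in
`contractSign_disjoint`, which leaves a minus sign. -/
theorem squareTerm_swap {g : ℕ} {D : ℤ} {φ : W.Cochain X} (hφ : φ ∈ W.ft g X D)
    (hγ : γ.IsModular) (hS : γ.IsConnectedSubset S) (hR : γ.IsConnectedSubset R)
    (hSR : Disjoint S R) (hd : ∀ x, ¬ (γ.Touched S x ∧ γ.Touched R x)) :
    squareTerm d a S R φ + squareTerm d a R S φ = 0 := by
  classical
  have hd' : ∀ x, ¬ (γ.Touched R x ∧ γ.Touched S x) := fun x h => hd x h.symm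
  have hbS := γ.not_touched_cBot hSR hd
  have hbR := γ.not_touched_cBot hSR.symm hd'
  obtain ⟨F, hF⟩ := (γ.twiceProj_surjective hS.1 hR.1 hSR).exists_equiv
    (γ.twiceProj_surjective hR.1 hS.1 hSR.symm) (fun x y => by
      rw [γ.twiceProj_eq_iff hSR hd, γ.twiceProj_eq_iff hSR.symm hd']; tauto)
  have hF1 : F ((γ.contract S).cBot _) = (γ.contract R).cCoe _ (γ.cBot R) hbR := by
    obtain ⟨e, he⟩ := hR.1
    rw [← γ.twiceProj_of_right hSR (γ.touched_of_mem he false), hF, γ.twiceProj_of_left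
      (γ.touched_of_mem he false)]
    exact (γ.contract R).cproj_of_not_touched _ hbR
  have hF2 : F ((γ.contract S).cCoe _ (γ.cBot S) hbS) = (γ.contract R).cBot _ := by
    obtain ⟨e, he⟩ := hS.1
    rw [← (γ.contract S).cproj_of_not_touched _ hbS,
      ← γ.twiceProj_of_left (γ.touched_of_mem he false), hF,
      γ.twiceProj_of_right hSR.symm (γ.touched_of_mem he false)]
  have hF3 : ∀ x (h1 : ¬ γ.Touched S x) (h2 : ¬ γ.Touched R x),
      F ((γ.contract S).cCoe _ (γ.cCoe S x h1) (fun h => h2 ((γ.contract_touched_cCoe S hSR).1 h)))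
        = (γ.contract R).cCoe _ (γ.cCoe R x h2)
          (fun h => h1 ((γ.contract_touched_cCoe R hSR.symm).1 h)) := fun x h1 h2 => by
    rw [← γ.twiceProj_of_not hSR h1 h2, hF, γ.twiceProj_of_not hSR.symm h2 h1]
  have hcases : ∀ v, v = (γ.contract S).cBot (γ.resC S R) ∨
      v = (γ.contract S).cCoe _ (γ.cBot S) hbS ∨ ∃ (x : γ.V) (h1 : ¬ γ.Touched S x) (h2 : ¬ γ.Touched R x),
        v = (γ.contract S).cCoe (γ.resC S R) (γ.cCoe S x h1) (fun h => h2 ((γ.contract_touched_cCoe S hSR).1 h)) := by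
    intro v
    rcases (γ.contract S).contract_cases _ v with rfl | ⟨u, hu, rfl⟩
    · exact Or.inl rfl
    · rcases γ.contract_cases S u with rfl | ⟨x, hx, rfl⟩
      · exact Or.inr (Or.inl rfl)
      · exact Or.inr (Or.inr ⟨x, hx, fun h => hu ((γ.contract_touched_cCoe S hSR).2 h), rfl⟩)
  obtain ⟨f, h1, h2, h3⟩ := ft_apply_eq hφ (γ.twiceSQ S R) (γ.twiceSQ R S) F
    (fun v x h => by
      rw [MGraph.twiceSQ_cell] at h ⊢
      rw [← h, hF])
    (by rw [γ.range_twiceSQ_emb, γ.range_twiceSQ_emb]; ext; exact and_comm)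
    (fun _ => rfl) (twiceLabels d a S R) (twiceLabels d a R S) (fun v => by
      rcases hcases v with rfl | rfl | ⟨x, hx, hx', rfl⟩
      · rw [hF1]
        exact ((sub_contract_same d a hγ hR hSR hd).trans (twiceLabels_right d a S R)).symm.trans
          (twiceLabels_left d a R S hbR)
      · rw [hF2]
        exact (twiceLabels_left d a S R hbS).symm.trans
          ((sub_contract_same d a hγ hS hSR.symm hd').trans (twiceLabels_right d a R S))
      · rw [hF3 x hx hx']
        exact (twiceLabels_old d a S R x hx _).symm.trans (twiceLabels_old d a R S x hx' _))
  obtain ⟨n, hn, hn'⟩ := f.vertexSign_eq (twiceDeg d S R)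
  have he : f.edgeSign Finset.univ = 1 := f.edgeSign_eq_one _
    (onE_strictMono _ _ f h2 (γ.twiceSQ_emb_strictMono S R) (γ.twiceSQ_emb_strictMono R S))
  have hdegS : twiceDeg d S R ((γ.contract S).cCoe _ (γ.cBot S) hbS)
      = γ.contractDeg S d (γ.cBot S) := rfl
  have hdegR : twiceDeg d S R ((γ.contract S).cBot (γ.resC S R))
      = γ.contractDeg R d (γ.cBot R) :=
    (((sub_contract_same d a hγ hR hSR hd).trans (twiceLabels_right d a S R)).degree_eq).symm
  -- The pair of the two new vertices is the only possible inversion. All other vertices keep the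
  -- order that they have in `γ` and come after both new ones.
  have hn2 : (n : ZMod 2) =
      (γ.contractDeg S d (γ.cBot S) : ℕ) * (γ.contractDeg R d (γ.cBot R) : ℕ) := by
    rw [hn', Finset.sum_eq_single ((γ.contract S).cBot (γ.resC S R)),
      Finset.sum_eq_single ((γ.contract S).cCoe _ (γ.cBot S) hbS), h1, hF1, hF2, hdegS, hdegR,
      ← ZMod.ite_odd, ← ZMod.ite_odd]
    · have h5 := (γ.contract S).cBot_lt_cCoe (γ.resC S R) (h := hbS)
      have h6 := (γ.contract R).cBot_lt_cCoe (γ.resC R S) (h := hbR)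
      simp only [h5, h6, true_and]
      by_cases h7 : Odd (γ.contractDeg S d (γ.cBot S)) <;>
        by_cases h8 : Odd (γ.contractDeg R d (γ.cBot R)) <;> simp [h7, h8]
    · intro v _ hv
      rw [if_neg]
      rintro ⟨-, h6, -⟩
      rcases hcases v with rfl | rfl | ⟨x, hx, hx', rfl⟩
      · exact lt_irrefl _ h6
      · exact hv rfl
      · rw [h1, hF1, hF3] at h6
        exact γ.not_lt_cBot _ _ (((γ.contract R).cCoe_lt_cCoe _).1 h6)
    · simp
    · intro u _ hu
      refine Finset.sum_eq_zero fun v _ => ?_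
      rw [if_neg]
      rintro ⟨h5, h6, -⟩
      rw [h1] at h6
      rcases hcases u with rfl | rfl | ⟨x, hx, hx', rfl⟩
      · exact hu rfl
      · rw [hF2] at h6
        exact (γ.contract R).not_lt_cBot _ _ h6
      · rcases hcases v with rfl | rfl | ⟨y, hy, hy', rfl⟩
        · exact (γ.contract S).not_lt_cBot _ _ h5
        · exact γ.not_lt_cBot _ _ (((γ.contract S).cCoe_lt_cCoe _).1 h5)
        · rw [hF3, hF3] at h6
          have h7 := (γ.cCoe_lt_cCoe R).1 (((γ.contract R).cCoe_lt_cCoe _).1 h6)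
          have h8 := (γ.cCoe_lt_cCoe S).1 (((γ.contract S).cCoe_lt_cCoe _).1 h5)
          exact lt_asymm h7 h8
    · simp
  have hsign := γ.contractSign_disjoint d hS.1 hR.1 hSR hd hn2
  unfold squareTerm
  rw [h3, he, hn, smul_smul, smul_smul, smul_smul, hsign, ← add_smul]
  convert zero_smul ℤ _ using 2
  ring

end

end WeakModularOperad

/-! ### Contraction of nested subgraphs and the square of the differential -/

namespace MGraph

variable {X : Type} (γ : MGraph X) {S R : Finset γ.E}

open Classical in
theorem twiceProj_eq_iff_union (hSR : Disjoint S R)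
    (ht : (γ.contract S).Touched (γ.resC S R) (γ.cBot S)) (x y : γ.V) :
    γ.cproj (S ∪ R) x = γ.cproj (S ∪ R) y ↔ γ.twiceProj S R x = γ.twiceProj S R y := by
  have key : ∀ {x}, γ.Touched S x ∨ γ.Touched R x →
      γ.twiceProj S R x = (γ.contract S).cBot (γ.resC S R) := fun h =>
    h.elim (fun h => (γ.twiceProj_of_left h).trans ((γ.contract S).cproj_of_touched _ ht))
      (γ.twiceProj_of_right hSR)
  have n1 := fun z hz => ((γ.contract S).cBot_ne_cCoe (γ.resC S R) (x := z) (h := hz))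
  have n2 := fun z hz => (γ.cBot_ne_cCoe (S ∪ R) (x := z) (h := hz))
  by_cases hx : γ.Touched S x ∨ γ.Touched R x <;> by_cases hy : γ.Touched S y ∨ γ.Touched R y
  · rw [key hx, key hy, γ.cproj_of_touched _ ((γ.touched_union S).2 hx),
      γ.cproj_of_touched _ ((γ.touched_union S).2 hy)]
    simp
  · have hy' := not_or.1 hy
    rw [key hx, γ.twiceProj_of_not hSR hy'.1 hy'.2, γ.cproj_of_touched _ ((γ.touched_union S).2 hx),
      γ.cproj_of_not_touched _ (fun h => hy ((γ.touched_union S).1 h))]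
    simp [n1, n2]
  · have hx' := not_or.1 hx
    rw [key hy, γ.twiceProj_of_not hSR hx'.1 hx'.2, γ.cproj_of_touched _ ((γ.touched_union S).2 hy),
      γ.cproj_of_not_touched _ (fun h => hx ((γ.touched_union S).1 h))]
    simp [(n1 _ _).symm, (n2 _ _).symm]
  · have hx' := not_or.1 hx
    have hy' := not_or.1 hy
    rw [γ.twiceProj_of_not hSR hx'.1 hx'.2, γ.twiceProj_of_not hSR hy'.1 hy'.2,
      γ.cproj_of_not_touched _ (fun h => hx ((γ.touched_union S).1 h)),
      γ.cproj_of_not_touched _ (fun h => hy ((γ.touched_union S).1 h))]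
    simp [(γ.contract S).cCoe_inj, γ.cCoe_inj]

/-- The degrees of the labels of a contraction whose new vertex has a label of degree `i`. -/
def botDeg (T : Finset γ.E) (d : γ.V → ℕ) (i : ℕ) : (γ.contract T).V → ℕ :=
  WithBot.recBotCoe i (fun v => d v.1)

end MGraph

namespace ModularCollection

variable {k : Type*} [Field k] {P : ModularCollection k} {X : Type}

/-- The labels of a contraction with a given label at the new vertex. -/
def botLabels (γ : MGraph X) (T : Finset γ.E) (d : γ.V → ℕ) (a : P.Labels γ d) {i : ℕ}
    (x : P.A (γ.sub T).totalGenus (γ.SubLeg T) i) : P.Labels (γ.contract T) (γ.botDeg T d i) :=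
  WithBot.recBotCoe
    (C := fun v => P.A ((γ.contract T).genus v) ((γ.contract T).Flag v) (γ.botDeg T d i v))
    (P.map (γ.newFlag T) x) (fun v => P.map (γ.oldFlag T v).symm (a v.1))

theorem botLabels_cCoe (γ : MGraph X) (T : Finset γ.E) (d : γ.V → ℕ) (a : P.Labels γ d) {i : ℕ}
    (y : P.A (γ.sub T).totalGenus (γ.SubLeg T) i) (x : γ.V) (hx : ¬ γ.Touched T x) :
    SameLabel (Subtype.val : γ.Flag x → γ.H) (a x) ((γ.contractSQ T).flag (γ.cCoe T x hx))
      (botLabels γ T d a y (γ.cCoe T x hx)) :=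
  SameLabel.map (g := γ.genus x) (γ.oldFlag T ⟨x, hx⟩).symm (a x) (fun y => by
    have : ∀ h, (γ.contractSQ T).flag (γ.cCoe T x hx) h
        = (γ.oldFlag T ⟨x, hx⟩ h).1 := fun h =>
      congrFun (γ.contractSQ_ι T) h.1
    refine (this _).trans ?_
    exact congrArg Subtype.val ((γ.oldFlag T ⟨x, hx⟩).apply_symm_apply y))

theorem botLabels_cBot (γ : MGraph X) (T : Finset γ.E) (d : γ.V → ℕ) (a : P.Labels γ d) {i : ℕ}
    (y : P.A (γ.sub T).totalGenus (γ.SubLeg T) i) :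
    SameLabel (γ.subSQ T).leg y ((γ.contractSQ T).flag (γ.cBot T))
      (botLabels γ T d a y (γ.cBot T)) :=
  SameLabel.map (g := (γ.sub T).totalGenus) (γ.newFlag T) y (fun y => congrFun (γ.contractSQ_ι T) y.1)

theorem botLabels_eq_update (γ : MGraph X) (T : Finset γ.E) (d : γ.V → ℕ)
    [DecidableEq (γ.contract T).V] (a : P.Labels γ d) {i : ℕ}
    (y : P.A (γ.sub T).totalGenus (γ.SubLeg T) i) :
    botLabels γ T d a y = Function.update (botLabels γ T d a (0 : P.A _ _ i)) (γ.cBot T)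
      (botLabels γ T d a y (γ.cBot T)) := by
  funext u
  rcases γ.contract_cases T u with rfl | ⟨x, hx, rfl⟩
  · rw [Function.update_self]
  · rw [Function.update_of_ne (γ.cBot_ne_cCoe T).symm]
    rfl

end ModularCollection

namespace WeakModularOperad

variable {k : Type*} [Field k] {W : WeakModularOperad k} {X : Type}

open ModularCollection

/-- A linear function of the label of the new vertex of a contraction. -/
theorem exists_functional {g : ℕ} {D : ℤ} {φ : W.Cochain X} (hφ : φ ∈ W.ft g X D) (γ : MGraph X)
    (T : Finset γ.E) (d : γ.V → ℕ) (a : W.toModularCollection.Labels γ d) :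
    ∃ L : (DirectSum (ℕ × ℕ) fun p => W.A p.1 (γ.SubLeg T) p.2) →+ k,
      ∀ (g' i : ℕ) (hg : g' = (γ.sub T).totalGenus) (x : W.A g' (γ.SubLeg T) i),
        L (DirectSum.of (fun p : ℕ × ℕ => W.A p.1 (γ.SubLeg T) p.2) (g', i) x)
          = φ (γ.contract T) (γ.botDeg T d i)
            (botLabels γ T d a (W.toModularCollection.transport hg (Equiv.refl _) rfl x)) := by
  classical
  choose m hm using fun i => hφ.1 (γ.contract T) (γ.botDeg T d i)
  let f : ∀ i, W.A (γ.sub T).totalGenus (γ.SubLeg T) i →+ k := fun i =>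
    { toFun := fun x => φ (γ.contract T) (γ.botDeg T d i) (botLabels γ T d a x)
      map_zero' := by
        rw [hm]
        refine (m i).map_coord_zero (γ.cBot T) ?_
        exact map_zero (W.map (γ.newFlag T))
      map_add' := fun x y => by
        have h : botLabels γ T d a (x + y) (γ.cBot T)
            = botLabels γ T d a x (γ.cBot T) + botLabels γ T d a y (γ.cBot T) :=
          map_add (W.map (γ.newFlag T)) x y
        rw [hm, hm, hm, botLabels_eq_update, h, MultilinearMap.map_update_add,
          ← botLabels_eq_update, ← botLabels_eq_update] }
  -- The quadratic relation lives in the direct sum over all genera and degrees. The functional is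
  -- extended by zero to the other genera so that it can be applied to the relation as a whole.
  let L : ∀ p : ℕ × ℕ, W.A p.1 (γ.SubLeg T) p.2 →+ k := fun p =>
    if h : p.1 = (γ.sub T).totalGenus then (h ▸ f p.2 : W.A p.1 (γ.SubLeg T) p.2 →+ k) else 0
  refine ⟨DirectSum.toAddMonoid L, ?_⟩
  rintro g' i rfl x
  rw [DirectSum.toAddMonoid_of]
  have h1 : L ((γ.sub T).totalGenus, i) = f i := dif_pos rfl
  rw [h1]
  change φ _ _ _ = φ _ _ _
  congr 1
  exact congrArg _ (W.map_refl _ _ _ x).symm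

section

variable {γ : MGraph X} (d : γ.V → ℕ) (a : W.toModularCollection.Labels γ d) {S R : Finset γ.E}

open Classical in
/-- The contraction of nested subgraphs. -/
theorem squareTerm_nested {g : ℕ} {D : ℤ} {φ : W.Cochain X} (hφ : φ ∈ W.ft g X D)
    (hγ : γ.IsModular) (hS : γ.IsConnectedSubset S) (hR : R.Nonempty) (hSR : Disjoint S R)
    (hT : γ.IsConnectedSubset (S ∪ R))
    {L : (DirectSum (ℕ × ℕ) fun p => W.A p.1 (γ.SubLeg (S ∪ R)) p.2) →+ k}
    (hL : ∀ (g' i : ℕ) (hg : g' = (γ.sub (S ∪ R)).totalGenus) (x : W.A g' (γ.SubLeg (S ∪ R)) i),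
        L (DirectSum.of (fun p : ℕ × ℕ => W.A p.1 (γ.SubLeg (S ∪ R)) p.2) (g', i) x)
          = φ (γ.contract (S ∪ R)) (γ.botDeg (S ∪ R) d i)
            (botLabels γ (S ∪ R) d a (W.toModularCollection.transport hg (Equiv.refl _) rfl x))) :
    squareTerm d a S R φ = (γ.contractSign (S ∪ R) d * (-1) ^ (Fintype.card γ.E - (S ∪ R).card)) •
      L ((γ.sub (S ∪ R)).contractSign (γ.resS (S ∪ R) S) (fun v => d (γ.sVal (S ∪ R) v)) •
        DirectSum.of (fun p : ℕ × ℕ => W.A p.1 (γ.SubLeg (S ∪ R)) p.2)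
        (((γ.sub (S ∪ R)).contract (γ.resS (S ∪ R) S)).totalGenus,
          ∑ v, (γ.sub (S ∪ R)).contractDeg (γ.resS (S ∪ R) S) (fun v => d (γ.sVal (S ∪ R) v)) v
            + Fintype.card ((γ.sub (S ∪ R)).contract (γ.resS (S ∪ R) S)).E - 1)
        (W.μ ((γ.sub (S ∪ R)).contract (γ.resS (S ∪ R) S))
          ((γ.sub (S ∪ R)).contractDeg (γ.resS (S ∪ R) S) (fun v => d (γ.sVal (S ∪ R) v)))
          (contractLabels W.μ (γ.sub (S ∪ R)) (γ.resS (S ∪ R) S) (fun v => d (γ.sVal (S ∪ R) v))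
            (subLabels γ (S ∪ R) d a)))) := by
  obtain ⟨-, hbot⟩ := (γ.contract_connected_touching S hSR hS).2 ⟨hT, hR⟩
  have hconn := (γ.sub_isConnectedSubset (S ∪ R) (S' := γ.resS (S ∪ R) S)
    (fun e => γ.mem_resS (S ∪ R)) Finset.subset_union_left).2 hS
  have hg := (γ.sub (S ∪ R)).totalGenus_contract _ (γ.sub_connected _ hT) hconn
  rw [map_zsmul, hL _ _ hg, smul_smul, ← γ.contractSign_nested d hS.1 hR hSR
    ((γ.contract_touched_cBot S hSR).1 hbot), mul_smul]
  unfold squareTerm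
  congr 2
  have hsurj := γ.twiceProj_surjective hS.1 hR hSR
  obtain ⟨F, hF⟩ := Function.Surjective.exists_equiv (γ.cproj_surjective (S ∪ R) hT.1)
    hsurj (γ.twiceProj_eq_iff_union hSR hbot)
  have hF1 : F (γ.cBot (S ∪ R)) = (γ.contract S).cBot (γ.resC S R) := by
    obtain ⟨e, he⟩ := hR
    rw [← γ.twiceProj_of_right hSR (γ.touched_of_mem he false), ← hF, γ.cproj_of_touched]
    exact γ.touched_of_mem (Finset.mem_union_right _ he) false
  have hF2 : ∀ x (h : ¬ γ.Touched (S ∪ R) x) (h1 : ¬ γ.Touched S x) (h2 : ¬ γ.Touched R x),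
      F (γ.cCoe (S ∪ R) x h) = (γ.contract S).cCoe _ (γ.cCoe S x h1)
        (fun h => h2 ((γ.contract_touched_cCoe S hSR).1 h)) := fun x h h1 h2 => by
    rw [← γ.twiceProj_of_not hSR h1 h2, ← hF, γ.cproj_of_not_touched]
  have hn : ∀ {x}, ¬ γ.Touched (S ∪ R) x → ¬ γ.Touched S x ∧ ¬ γ.Touched R x := fun h =>
    not_or.1 (fun h' => h ((γ.touched_union S).2 h'))
  obtain ⟨f, h1, h2, h3⟩ := ft_apply_eq hφ (γ.contractSQ (S ∪ R)) (γ.twiceSQ S R) F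
    (fun v x h => by
      rw [MGraph.twiceSQ_cell, ← hF]
      exact congrArg F h)
    (by
      rw [γ.range_contractSQ_emb, γ.range_twiceSQ_emb]
      ext; simp)
    (fun _ => rfl) (botLabels γ (S ∪ R) d a (W.toModularCollection.transport hg (Equiv.refl _) rfl
      (W.μ ((γ.sub (S ∪ R)).contract (γ.resS (S ∪ R) S))
          ((γ.sub (S ∪ R)).contractDeg (γ.resS (S ∪ R) S) (fun v => d (γ.sVal (S ∪ R) v)))
          (contractLabels W.μ (γ.sub (S ∪ R)) (γ.resS (S ∪ R) S) (fun v => d (γ.sVal (S ∪ R) v))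
            (subLabels γ (S ∪ R) d a))))) (twiceLabels d a S R) (fun v => by
      rcases γ.contract_cases _ v with rfl | ⟨x, hx, rfl⟩
      · rw [hF1]
        refine (botLabels_cBot γ (S ∪ R) d a _).symm.trans (SameLabel.trans ?_
          ((contract_sub_same d a hγ hS hSR hR hT).trans (twiceLabels_right d a S R)))
        exact SameLabel.symm ⟨Equiv.refl _, fun _ => rfl, Rel.cast hg rfl _⟩
      · rw [hF2 x hx (hn hx).1 (hn hx).2]
        exact (botLabels_cCoe γ (S ∪ R) d a _ x hx).symm.trans (twiceLabels_old d a S R x (hn hx).1 _))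
  have he : f.edgeSign Finset.univ = 1 := f.edgeSign_eq_one _
    (onE_strictMono _ _ f h2 (fun _ _ h => h) (γ.twiceSQ_emb_strictMono S R))
  have hv : ∀ d', f.vertexSign d' = 1 := fun d' => f.vertexSign_eq_one d' (fun u v h _ _ => by
    rw [h1]
    rcases γ.contract_cases _ v with rfl | ⟨y, hy, rfl⟩
    · exact absurd h (γ.not_lt_cBot _ _)
    · rw [hF2 y hy (hn hy).1 (hn hy).2]
      rcases γ.contract_cases _ u with rfl | ⟨x, hx, rfl⟩
      · rw [hF1]; exact (γ.contract S).cBot_lt_cCoe _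
      · rw [hF2 x hx (hn hx).1 (hn hx).2]
        exact ((γ.contract S).cCoe_lt_cCoe _).2 ((γ.cCoe_lt_cCoe S).2
          ((γ.cCoe_lt_cCoe (S ∪ R)).1 h)))
  rw [h3, he, hv, one_mul, one_smul]

end

open Classical in
-- Edge sets of `γ / S` are traded for edge sets `R` of `γ` that are disjoint from `S`. This makes
-- the index set symmetric enough to exchange `S` and `R` or to form their union.
theorem differential_differential_apply {γ : MGraph X} (hγ : γ.IsModular) (d : γ.V → ℕ)
    (a : W.toModularCollection.Labels γ d) (φ : W.Cochain X) :
    W.differential X (W.differential X φ) γ d a =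
      ∑ p ∈ Finset.univ.filter (fun p : Finset γ.E × Finset γ.E => γ.IsConnectedSubset p.1 ∧
        Disjoint p.1 p.2 ∧ (γ.contract p.1).IsConnectedSubset (γ.resC p.1 p.2)),
        squareTerm d a p.1 p.2 φ := by
  change ∑ S ∈ _, _ • (∑ R' ∈ _, _) = _
  rw [Finset.sum_filter, Finset.sum_filter, Fintype.sum_prod_type]
  refine Finset.sum_congr rfl fun S _ => ?_
  by_cases hS : γ.IsConnectedSubset S
  swap
  · rw [if_neg (fun h => hS h.2)]
    exact (Finset.sum_eq_zero fun R _ => if_neg fun h => hS h.1).symm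
  rw [if_pos ⟨hγ, hS⟩, ← Finset.sum_filter, Finset.smul_sum]
  symm
  refine Finset.sum_bij (fun R _ => γ.resC S R) (fun R hR => ?_) (fun R hR R' hR' h => ?_)
    (fun R' hR' => ?_) (fun R _ => rfl)
  · obtain ⟨-, -, -, h⟩ := Finset.mem_filter.1 hR
    exact Finset.mem_filter.2 ⟨Finset.mem_univ _, γ.contract_isModular S hγ hS, h⟩
  · obtain ⟨-, -, hd, -⟩ := Finset.mem_filter.1 hR
    obtain ⟨-, -, hd', -⟩ := Finset.mem_filter.1 hR'
    ext e
    by_cases he : e ∈ S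
    · simp [Finset.disjoint_left.1 hd he, Finset.disjoint_left.1 hd' he]
    · have h1 := γ.mem_resC S (R := R) (e := γ.cE S e he)
      have h2 := γ.mem_resC S (R := R') (e := γ.cE S e he)
      rw [h] at h1
      exact h1.symm.trans h2
  · obtain ⟨-, -, h⟩ := Finset.mem_filter.1 hR'
    have h1 : γ.resC S (R'.image (γ.cEVal S)) = R' := by
      ext e
      rw [MGraph.mem_resC, Finset.mem_image]
      constructor
      · rintro ⟨e', he', h'⟩
        rwa [← (γ.contractSQ S).emb_injective h']
      · exact fun he => ⟨e, he, rfl⟩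
    refine ⟨R'.image (γ.cEVal S), Finset.mem_filter.2 ⟨Finset.mem_univ _, hS, ?_, ?_⟩, h1⟩
    · rw [Finset.disjoint_left]
      rintro e he he'
      obtain ⟨e', -, rfl⟩ := Finset.mem_image.1 he'
      exact γ.cEVal_notMem S e' he
    · simpa only [h1] using h

/-- If `R` misses the vertex created from `S`, then `S` and `R` have no common vertex and the terms
for `(S, R)` and `(R, S)` cancel. The other pairs are grouped by `T = S ∪ R`. The group of `T` is a
linear functional applied to the quadratic relation of the subgraph `T`, hence zero. -/
theorem differential_differential {g : ℕ} {D : ℤ} {φ : W.Cochain X} (hφ : φ ∈ W.ft g X D) :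
    W.differential X (W.differential X φ) = 0 := by
  classical
  funext γ d a
  by_cases hγ : γ.IsModular
  swap
  · exact Finset.sum_eq_zero fun S hS => absurd (Finset.mem_filter.1 hS).2.1 hγ
  rw [differential_differential_apply hγ, ← Finset.sum_filter_add_sum_filter_not _
    (fun p : Finset γ.E × Finset γ.E => (γ.contract p.1).Touched (γ.resC p.1 p.2) (γ.cBot p.1))]
  have h2 : ∑ p ∈ (Finset.univ.filter (fun p : Finset γ.E × Finset γ.E => γ.IsConnectedSubset p.1 ∧
      Disjoint p.1 p.2 ∧ (γ.contract p.1).IsConnectedSubset (γ.resC p.1 p.2))).filter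
      (fun p => ¬ (γ.contract p.1).Touched (γ.resC p.1 p.2) (γ.cBot p.1)),
      squareTerm d a p.1 p.2 φ = 0 := by
    have key : ∀ p : Finset γ.E × Finset γ.E, p ∈ (Finset.univ.filter
        (fun p : Finset γ.E × Finset γ.E => γ.IsConnectedSubset p.1 ∧
        Disjoint p.1 p.2 ∧ (γ.contract p.1).IsConnectedSubset (γ.resC p.1 p.2))).filter
        (fun p => ¬ (γ.contract p.1).Touched (γ.resC p.1 p.2) (γ.cBot p.1)) ↔
        γ.IsConnectedSubset p.1 ∧ γ.IsConnectedSubset p.2 ∧ Disjoint p.1 p.2 ∧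
        ∀ x, ¬ (γ.Touched p.1 x ∧ γ.Touched p.2 x) := fun p => by
      simp only [Finset.mem_filter, Finset.mem_univ, true_and]
      constructor
      · rintro ⟨⟨h1, h2, h3⟩, h4⟩
        obtain ⟨h5, h6⟩ := (γ.contract_connected_not_touching _ h2).1 ⟨h3, h4⟩
        exact ⟨h1, h5, h2, h6⟩
      · rintro ⟨h1, h2, h3, h4⟩
        obtain ⟨h5, h6⟩ := (γ.contract_connected_not_touching _ h3).2 ⟨h2, h4⟩
        exact ⟨⟨h1, h3, h5⟩, h6⟩
    refine Finset.sum_involution (fun p _ => p.swap) (fun p hp => ?_) (fun p hp _ h => ?_)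
      (fun p hp => ?_) (fun _ _ => rfl)
    · obtain ⟨h1, h2, h3, h4⟩ := (key p).1 hp
      exact squareTerm_swap d a hφ hγ h1 h2 h3 h4
    · obtain ⟨h1, h2, h3, h4⟩ := (key p).1 hp
      have h5 : p.2 = p.1 := congrArg Prod.fst h
      rw [h5, disjoint_self] at h3
      exact h1.1.ne_empty h3
    · obtain ⟨h1, h2, h3, h4⟩ := (key p).1 hp
      exact (key _).2 ⟨h2, h1, h3.symm, fun x h => h4 x h.symm⟩
  rw [h2, add_zero, ← Finset.sum_fiberwise _ (fun p => p.1 ∪ p.2)]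
  refine Finset.sum_eq_zero fun T _ => ?_
  have key : ∀ p : Finset γ.E × Finset γ.E, p ∈ ((Finset.univ.filter
      (fun p : Finset γ.E × Finset γ.E => γ.IsConnectedSubset p.1 ∧
      Disjoint p.1 p.2 ∧ (γ.contract p.1).IsConnectedSubset (γ.resC p.1 p.2))).filter
      (fun p => (γ.contract p.1).Touched (γ.resC p.1 p.2) (γ.cBot p.1))).filter
      (fun p => p.1 ∪ p.2 = T) ↔
      γ.IsConnectedSubset p.1 ∧ p.2.Nonempty ∧ Disjoint p.1 p.2 ∧ γ.IsConnectedSubset T ∧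
        p.1 ∪ p.2 = T := fun p => by
    simp only [Finset.mem_filter, Finset.mem_univ, true_and]
    constructor
    · rintro ⟨⟨⟨h1, h2, h3⟩, h4⟩, h5⟩
      obtain ⟨h6, h7⟩ := (γ.contract_connected_touching _ h2 h1).1 ⟨h3, h4⟩
      exact ⟨h1, h7, h2, h5 ▸ h6, h5⟩
    · rintro ⟨h1, h2, h3, h4, rfl⟩
      obtain ⟨h5, h6⟩ := (γ.contract_connected_touching _ h3 h1).2 ⟨h4, h2⟩
      exact ⟨⟨⟨h1, h3, h5⟩, h6⟩, rfl⟩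
  by_cases hT : γ.IsConnectedSubset T
  swap
  · exact Finset.sum_eq_zero fun p hp => absurd ((key p).1 hp).2.2.2.1 hT
  obtain ⟨L, hL⟩ := exists_functional hφ γ T d a
  have hrel := W.relation (γ.sub T) (γ.sub_isModular T hγ hT) (fun v => d (γ.sVal T v))
    (subLabels γ T d a)
  -- The sign in front of `L` is that of `contractSign_nested`; it is constant in the group of `T`.
  have hrel' := congrArg (fun x => (γ.contractSign T d * (-1) ^ (Fintype.card γ.E - T.card)) • L x) hrel
  simp only [map_zero, smul_zero, map_sum, Finset.smul_sum] at hrel'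
  rw [← hrel']
  refine Finset.sum_bij (fun p _ => γ.resS T p.1) (fun p hp => ?_) (fun p hp p' hp' h => ?_)
    (fun S' hS' => ?_) (fun p hp => ?_)
  · obtain ⟨h1, ⟨e, he⟩, h3, h4, h5⟩ := (key p).1 hp
    have hsub : p.1 ⊆ T := h5 ▸ Finset.subset_union_left
    refine Finset.mem_filter.2 ⟨Finset.mem_univ _, (γ.sub_isConnectedSubset T
      (fun e => γ.mem_resS T) hsub).2 h1, fun h => ?_⟩
    have heT : e ∈ T := h5 ▸ Finset.mem_union_right _ he
    have h6 := γ.mem_resS T (R := p.1) (e := γ.sE T e heT)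
    rw [h] at h6
    exact Finset.disjoint_left.1 h3 (h6.1 (Finset.mem_univ _)) he
  · obtain ⟨h1, -, h3, h4, h5⟩ := (key p).1 hp
    obtain ⟨h1', -, h3', h4', h5'⟩ := (key p').1 hp'
    have h6 : p.1 = p'.1 := by
      ext e
      by_cases he : e ∈ T
      · have a1 := γ.mem_resS T (R := p.1) (e := γ.sE T e he)
        have a2 := γ.mem_resS T (R := p'.1) (e := γ.sE T e he)
        rw [h] at a1
        exact a1.symm.trans a2
      · exact ⟨fun h => absurd (h5 ▸ Finset.mem_union_left _ h) he,
          fun h => absurd (h5' ▸ Finset.mem_union_left _ h) he⟩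
    refine Prod.ext h6 ?_
    have a3 : p.2 = T \ p.1 := by
      rw [← h5, Finset.union_sdiff_cancel_left h3]
    have a4 : p'.2 = T \ p'.1 := by
      rw [← h5', Finset.union_sdiff_cancel_left h3']
    rw [a3, a4, h6]
  · obtain ⟨-, h1, h2⟩ := Finset.mem_filter.1 hS'
    have hS : γ.resS T (S'.image (γ.sEVal T)) = S' := by
      ext e
      rw [MGraph.mem_resS, Finset.mem_image]
      constructor
      · rintro ⟨e', he', h'⟩
        rwa [← (γ.subSQ T).emb_injective h']
      · exact fun he => ⟨e, he, rfl⟩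
    have hsub : S'.image (γ.sEVal T) ⊆ T := by
      intro e he
      obtain ⟨e', -, rfl⟩ := Finset.mem_image.1 he
      exact γ.sEVal_mem T e'
    refine ⟨(S'.image (γ.sEVal T), T \ S'.image (γ.sEVal T)), (key _).2 ⟨?_, ?_,
      Finset.disjoint_sdiff, hT, Finset.union_sdiff_of_subset hsub⟩, hS⟩
    · rw [← γ.sub_isConnectedSubset T (fun e => γ.mem_resS T) hsub, hS]
      exact h1
    · rw [Finset.sdiff_nonempty]
      intro h
      refine h2 (Finset.eq_univ_iff_forall.2 fun e => ?_)
      obtain ⟨e', he', h'⟩ := Finset.mem_image.1 (h (γ.sEVal_mem T e))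
      rwa [← (γ.subSQ T).emb_injective h']
  · obtain ⟨h1, h2, h3, h4, rfl⟩ := (key p).1 hp
    exact squareTerm_nested d a hφ hγ h1 h2 h3 h4 hL

end WeakModularOperad

/-! ### Trivalent graphs and Whitehead moves -/

namespace MGraph

variable {X : Type} (G : MGraph X)

/-- The half-edge `h` is a neighbour of the edge `e` at its end `c`. -/
def Adj (e : G.E) (c : Bool) (h : G.H) : Prop :=
  G.vert h = G.vert (Sum.inl (e, c)) ∧ h ≠ Sum.inl (e, c)

/-- The edge `e` joins two different vertices. -/
def NonLoop (e : G.E) : Prop := ∀ c, G.vert (Sum.inl (e, c)) ≠ G.vert (Sum.inl (e, !c))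

variable {G}

theorem NonLoop.ne {e : G.E} (he : G.NonLoop e) {c : Bool} {h : G.H} (hh : G.Adj e c h) (c' : Bool) :
    h ≠ Sum.inl (e, c') := by
  rcases Bool.eq_or_eq_not c' c with rfl | rfl
  · exact hh.2
  · rintro rfl; exact he c hh.1.symm

theorem NonLoop.ne' {e : G.E} (he : G.NonLoop e) {c : Bool} {q r : G.H} (hq : G.Adj e c q)
    (hr : G.Adj e (!c) r) : q ≠ r := by
  rintro rfl; exact he c (hq.1.symm.trans hr.1)

theorem isForest_singleton {e : G.E} : G.IsForest {e} ↔ G.NonLoop e := by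
  have hj : ∀ u v, G.Joined ∅ u v ↔ u = v := fun u v =>
    ⟨fun h => Joined.rec_on (r := Eq) (fun _ => rfl) (fun _ _ _ => Eq.trans)
      (fun e he => absurd he (Finset.notMem_empty e)) h, fun h => h ▸ Joined.refl _ _ _⟩
  simp only [IsForest, Finset.mem_singleton, forall_eq, Finset.erase_singleton, hj, NonLoop,
    Bool.forall_bool, Bool.not_false, Bool.not_true]
  exact ⟨fun h => ⟨h, fun h' => h h'.symm⟩, fun h => h.1⟩

theorem isForest_empty : G.IsForest ∅ := fun e he => absurd he (Finset.notMem_empty e)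

theorem rewire_rewire (τ τ' : Equiv.Perm G.H) :
    (G.rewire τ).rewire τ' = G.rewire (τ'.trans τ) := rfl

section

variable [DecidableEq G.H] {e : G.E} {c : Bool} {q r s : G.H}

theorem rewire_vert_end (he : G.NonLoop e) (hq : G.Adj e c q) (hr : G.Adj e (!c) r) (c' : Bool) :
    (G.rewire (Equiv.swap q r)).vert (Sum.inl (e, c')) = G.vert (Sum.inl (e, c')) :=
  congrArg G.vert (Equiv.swap_apply_of_ne_of_ne (he.ne hq c').symm (he.ne hr c').symm)

theorem rewire_nonLoop (he : G.NonLoop e) (hq : G.Adj e c q) (hr : G.Adj e (!c) r) :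
    (G.rewire (Equiv.swap q r)).NonLoop e := fun c' => by
  rw [rewire_vert_end he hq hr, rewire_vert_end he hq hr]
  exact he c'

theorem rewire_adj_left (he : G.NonLoop e) (hq : G.Adj e c q) (hr : G.Adj e (!c) r) :
    (G.rewire (Equiv.swap q r)).Adj e c r :=
  ⟨((congrArg G.vert (Equiv.swap_apply_right q r)).trans hq.1).trans
    (rewire_vert_end he hq hr c).symm, he.ne hr c⟩

theorem rewire_adj_right (he : G.NonLoop e) (hq : G.Adj e c q) (hr : G.Adj e (!c) r) :
    (G.rewire (Equiv.swap q r)).Adj e (!c) q :=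
  ⟨((congrArg G.vert (Equiv.swap_apply_left q r)).trans hr.1).trans
    (rewire_vert_end he hq hr (!c)).symm, he.ne hq _⟩

theorem rewire_adj_of_ne (he : G.NonLoop e) (hq : G.Adj e c q) (hr : G.Adj e (!c) r) {c' : Bool}
    (hs : G.Adj e c' s) (h1 : s ≠ q) (h2 : s ≠ r) : (G.rewire (Equiv.swap q r)).Adj e c' s :=
  ⟨((congrArg G.vert (Equiv.swap_apply_of_ne_of_ne h1 h2)).trans hs.1).trans
    (rewire_vert_end he hq hr c').symm, hs.2⟩

theorem rewire_swap_swap : (G.rewire (Equiv.swap q r)).rewire (Equiv.swap r q : Equiv.Perm G.H) = G := by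
  rw [rewire_rewire, Equiv.swap_comm r q]
  have : (Equiv.swap q r).trans (Equiv.swap q r) = Equiv.refl _ := by
    ext1 h; exact Equiv.swap_apply_self q r h
  rw [this]; rfl

/-- Only `q` and `r` change their vertex, and they move from one end of `e` to the other. As `e`
keeps its ends, connectedness survives the move. -/
theorem rewire_joined (he : G.NonLoop e) (hq : G.Adj e c q) (hr : G.Adj e (!c) r) (h : G.H) :
    (G.rewire (Equiv.swap q r)).Joined Finset.univ
      ((G.rewire (Equiv.swap q r)).vert h) (G.vert h) := by
  have hj : ∀ c', (G.rewire (Equiv.swap q r)).Joined Finset.univ (G.vert (Sum.inl (e, c')))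
      (G.vert (Sum.inl (e, !c'))) := fun c' => by
    rw [← rewire_vert_end he hq hr, ← rewire_vert_end he hq hr]
    exact joined_edge (γ := G.rewire (Equiv.swap q r)) (Finset.mem_univ e) c' (!c')
  by_cases h1 : h = q
  · subst h1
    rw [(rewire_adj_right he hq hr).1, rewire_vert_end he hq hr, hq.1]
    simpa using hj (!c)
  · by_cases h2 : h = r
    · subst h2
      rw [(rewire_adj_left he hq hr).1, rewire_vert_end he hq hr, hr.1]
      exact hj c
    · have : (G.rewire (Equiv.swap q r)).vert h = G.vert h :=
        congrArg G.vert (Equiv.swap_apply_of_ne_of_ne h1 h2)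
      rw [this]; exact Joined.refl _ _ _

theorem rewire_isTrivalent (he : G.NonLoop e) (hq : G.Adj e c q) (hr : G.Adj e (!c) r)
    (hG : G.IsTrivalent) : (G.rewire (Equiv.swap q r)).IsTrivalent where
  connected := ⟨hG.connected.1, fun u v =>
    Joined.rec_on (γ := G) (r := fun u v => (G.rewire (Equiv.swap q r)).Joined Finset.univ u v)
      (fun u => Joined.refl (G.rewire (Equiv.swap q r)) _ u) (fun _ _ _ => Joined.trans)
      (fun f _ c' => (rewire_joined he hq hr (Sum.inl (f, c'))).symm.trans
        ((joined_edge (γ := G.rewire (Equiv.swap q r)) (Finset.mem_univ f) c' (!c')).trans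
          (rewire_joined he hq hr (Sum.inl (f, !c'))))) (hG.connected.2 u v)⟩
  genus_zero := hG.genus_zero
  trivalent v := by
    rw [← hG.trivalent v]
    exact Nat.card_congr ((Equiv.swap q r).subtypeEquiv (fun _ => Iff.rfl))

theorem rewire_isTrivalent_iff (he : G.NonLoop e) (hq : G.Adj e c q) (hr : G.Adj e (!c) r) :
    (G.rewire (Equiv.swap q r)).IsTrivalent ↔ G.IsTrivalent := by
  refine ⟨fun h => ?_, rewire_isTrivalent he hq hr⟩
  let i : DecidableEq (G.rewire (Equiv.swap q r)).H := ‹DecidableEq G.H›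
  rw [← rewire_swap_swap (G := G) (q := q) (r := r)]
  exact rewire_isTrivalent (G := G.rewire (Equiv.swap q r)) (rewire_nonLoop he hq hr)
    (rewire_adj_left he hq hr) (rewire_adj_right he hq hr) h

/-- Exchanging complementary neighbours of an edge gives isomorphic graphs. -/
theorem exists_rewire_iso (he : G.NonLoop e) {q' r' : G.H} (hq : G.Adj e c q) (hr : G.Adj e (!c) r)
    (hq' : G.Adj e c q') (hr' : G.Adj e (!c) r') (hqq : q ≠ q') (hrr : r ≠ r')
    (hl : ∀ h, G.Adj e c h → h = q ∨ h = q') (hl' : ∀ h, G.Adj e (!c) h → h = r ∨ h = r')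
    (hg : ∀ v, G.genus v = 0) :
    ∃ f : GIso (G.rewire (Equiv.swap q r)) (G.rewire (Equiv.swap q' r')) (Equiv.refl X),
      f.onE = Equiv.refl G.E := by
  classical
  -- Both moves split the four neighbours of `e` into the same two pairs, but with the pairs at
  -- opposite ends. The isomorphism flips `e` and exchanges its two end vertices.
  let ends : Equiv.Perm (G.E × Bool) :=
    { toFun := fun p => (p.1, if p.1 = e then !p.2 else p.2)
      invFun := fun p => (p.1, if p.1 = e then !p.2 else p.2)
      left_inv := fun p => by
        by_cases h : p.1 = e
        · obtain ⟨p1, p2⟩ := p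
          simp only at h
          simp [h]
        · simp [h]
      right_inv := fun p => by
        by_cases h : p.1 = e
        · obtain ⟨p1, p2⟩ := p
          simp only at h
          simp [h]
        · simp [h] }
  refine ⟨⟨Equiv.swap (G.vert (Sum.inl (e, c))) (G.vert (Sum.inl (e, !c))), Equiv.refl _, ends,
    fun p => rfl, fun (h : G.H) => ?_, fun v => (hg _).trans (hg _).symm⟩, rfl⟩
  change G.vert (Equiv.swap q' r' (Sum.map ends (Equiv.refl X) h))
    = Equiv.swap _ _ (G.vert (Equiv.swap q r h))
  by_cases h1 : ∃ c', h = Sum.inl (e, c')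
  · obtain ⟨c', rfl⟩ := h1
    have h2 : Sum.map ends (Equiv.refl X) (Sum.inl (e, c')) = Sum.inl (e, !c') := by simp [ends]
    rw [h2, Equiv.swap_apply_of_ne_of_ne (he.ne hq c').symm (he.ne hr c').symm,
      Equiv.swap_apply_of_ne_of_ne (he.ne hq' (!c')).symm (he.ne hr' (!c')).symm]
    rcases Bool.eq_or_eq_not c' c with rfl | rfl
    · rw [Equiv.swap_apply_left]
    · rw [Equiv.swap_apply_right, Bool.not_not]
  · have h2 : Sum.map ends (Equiv.refl X) h = h := by
      rcases h with ⟨f, c'⟩ | x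
      · have : f ≠ e := fun h => h1 ⟨c', h ▸ rfl⟩
        simp [ends, this]
      · rfl
    rw [h2]
    have n1 := he.ne' hq hr
    have n2 := he.ne' hq' hr'
    have n3 := he.ne' hq hr'
    have n4 := he.ne' hq' hr
    by_cases a1 : h = q
    · subst a1
      rw [Equiv.swap_apply_left, Equiv.swap_apply_of_ne_of_ne hqq n3, hr.1, hq.1,
        Equiv.swap_apply_right]
    by_cases a2 : h = r
    · subst a2
      rw [Equiv.swap_apply_right, Equiv.swap_apply_of_ne_of_ne n4.symm hrr, hr.1, hq.1,
        Equiv.swap_apply_left]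
    rw [Equiv.swap_apply_of_ne_of_ne a1 a2]
    by_cases a3 : h = q'
    · subst a3
      rw [Equiv.swap_apply_left, hr'.1, hq'.1, Equiv.swap_apply_left]
    by_cases a4 : h = r'
    · subst a4
      rw [Equiv.swap_apply_right, hr'.1, hq'.1, Equiv.swap_apply_right]
    rw [Equiv.swap_apply_of_ne_of_ne a3 a4, Equiv.swap_apply_of_ne_of_ne]
    · intro h3
      exact (hl h ⟨h3, fun h => h1 ⟨c, h⟩⟩).elim a1 a3
    · intro h3
      exact (hl' h ⟨h3, fun h => h1 ⟨!c, h⟩⟩).elim a2 a4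

end

/-- In a trivalent graph, an edge has two neighbours at each end. -/
theorem IsTrivalent.exists_third (hG : G.IsTrivalent) {v : G.V} {a : G.H} (ha : G.vert a = v)
    {b : G.H} (hb : G.vert b = v) (hab : a ≠ b) :
    ∃ t, G.vert t = v ∧ t ≠ a ∧ t ≠ b ∧ ∀ h, G.vert h = v → h = a ∨ h = b ∨ h = t := by
  have h3 := hG.trivalent v
  have : Finite (G.Flag v) := Nat.finite_of_card_ne_zero (by omega)
  have := Fintype.ofFinite (G.Flag v)
  classical
  rw [Nat.card_eq_fintype_card, ← Finset.card_univ] at h3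
  have h4 : (Finset.univ \ {⟨a, ha⟩, ⟨b, hb⟩} : Finset (G.Flag v)).card = 1 := by
    rw [Finset.card_sdiff_of_subset (Finset.subset_univ _), h3, Finset.card_pair (by simpa using hab)]
  obtain ⟨⟨t, ht⟩, h5⟩ := Finset.card_eq_one.1 h4
  have h6 : ∀ h : G.Flag v, h ≠ ⟨a, ha⟩ ∧ h ≠ ⟨b, hb⟩ ↔ h = ⟨t, ht⟩ := fun h => by
    have := Finset.ext_iff.1 h5 h
    simpa using this
  have h7 := (h6 ⟨t, ht⟩).2 rfl
  refine ⟨t, ht, by simpa using h7.1, by simpa using h7.2, fun h hh => ?_⟩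
  by_contra hcon
  push Not at hcon
  have := (h6 ⟨h, hh⟩).1 ⟨by simpa using hcon.1, by simpa using hcon.2.1⟩
  exact hcon.2.2 (by simpa using this)

theorem IsTrivalent.exists_second (hG : G.IsTrivalent) {e : G.E} {c : Bool} {q : G.H}
    (hq : G.Adj e c q) : ∃ q', G.Adj e c q' ∧ q ≠ q' ∧ ∀ h, G.Adj e c h → h = q ∨ h = q' := by
  obtain ⟨t, h1, h2, h3, h4⟩ := hG.exists_third rfl hq.1 hq.2.symm
  refine ⟨t, ⟨h1, h2⟩, h3.symm, fun h hh => ?_⟩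
  rcases h4 h hh.1 with h5 | h5 | h5
  · exact absurd h5 hh.2
  · exact Or.inl h5
  · exact Or.inr h5

theorem IsTrivalent.exists_adj (hG : G.IsTrivalent) (e : G.E) (c : Bool) : ∃ q, G.Adj e c q := by
  have h3 := hG.trivalent (G.vert (Sum.inl (e, c)))
  have : Finite (G.Flag (G.vert (Sum.inl (e, c)))) := Nat.finite_of_card_ne_zero (by omega)
  have : Nontrivial (G.Flag (G.vert (Sum.inl (e, c)))) :=
    Finite.one_lt_card_iff_nontrivial.1 (by omega)
  obtain ⟨⟨q, hq⟩, hne⟩ := exists_ne (⟨Sum.inl (e, c), rfl⟩ : G.Flag (G.vert (Sum.inl (e, c))))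
  exact ⟨q, hq, fun h => hne (Subtype.ext h)⟩

namespace GIso

variable {Y : Type} {G' : MGraph Y} {σ : X ≃ Y} (f : GIso G G' σ)

theorem nonLoop {e : G.E} (he : G.NonLoop e) : G'.NonLoop (f.onE e) := fun c h => by
  have key : ∀ c, ∃ c', f.onH (Sum.inl (e, c')) = Sum.inl (f.onE e, c) := by
    intro c
    have h1 := f.onEnds_not e false
    have h2 : f.onEnds (e, false) = (f.onE e, (f.onEnds (e, false)).2) :=
      Prod.ext (f.onEnds_fst _) rfl
    rcases Bool.eq_or_eq_not c (f.onEnds (e, false)).2 with h | h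
    · exact ⟨false, congrArg Sum.inl (h2.trans (by rw [h]))⟩
    · exact ⟨true, congrArg Sum.inl (h1.trans (by rw [h]))⟩
  obtain ⟨c1, h1⟩ := key c
  obtain ⟨c2, h2⟩ := key (!c)
  rw [← h1, ← h2, f.vert_onH, f.vert_onH] at h
  have h3 := f.onV.injective h
  rcases Bool.eq_or_eq_not c2 c1 with h4 | h4
  · rw [h4, h1] at h2
    simp at h2
  · rw [h4] at h3; exact he _ h3

theorem isTrivalent (f : GIso G G' σ) (h : G.IsTrivalent) : G'.IsTrivalent := by
  refine ⟨f.connected h.connected, fun v => ?_, fun v => ?_⟩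
  · rw [← f.onV.apply_symm_apply v, f.genus_comm, h.genus_zero]
  · rw [← f.onV.apply_symm_apply v, ← Nat.card_congr (f.onFlag _), h.trivalent]

/-- The ends of an edge correspond to each other. -/
def onEnd (e : G.E) : Bool ≃ Bool where
  toFun c := (f.onEnds (e, c)).2
  invFun c := (f.onEnds.symm (f.onE e, c)).2
  left_inv c := by
    have : (f.onE e, (f.onEnds (e, c)).2) = f.onEnds (e, c) :=
      Prod.ext (f.onEnds_fst (e, c)).symm rfl
    simp only [this, Equiv.symm_apply_apply]
  right_inv c := by
    have h1 : (e, (f.onEnds.symm (f.onE e, c)).2) = f.onEnds.symm (f.onE e, c) := by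
      refine Prod.ext (f.onE.injective ?_) rfl
      have := f.onEnds_fst (f.onEnds.symm (f.onE e, c))
      rw [Equiv.apply_symm_apply] at this
      exact this
    simp only [h1, Equiv.apply_symm_apply]

theorem onH_end (e : G.E) (c : Bool) : f.onH (Sum.inl (e, c)) = Sum.inl (f.onE e, f.onEnd e c) :=
  congrArg Sum.inl (Prod.ext (f.onEnds_fst (e, c)) rfl)

theorem onEnd_not (e : G.E) (c : Bool) : f.onEnd e (!c) = !(f.onEnd e c) :=
  congrArg Prod.snd (f.onEnds_not e c)

theorem adj_iff {e : G.E} {c : Bool} {h : G.H} :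
    G'.Adj (f.onE e) (f.onEnd e c) (f.onH h) ↔ G.Adj e c h := by
  unfold Adj
  rw [← f.onH_end, f.vert_onH, f.vert_onH, f.onV.apply_eq_iff_eq, Ne, f.onH.apply_eq_iff_eq]

/-- The isomorphism of rewired graphs. -/
def rewire [DecidableEq G.H] [DecidableEq G'.H] (q r : G.H) :
    GIso (G.rewire (Equiv.swap q r)) (G'.rewire (Equiv.swap (f.onH q) (f.onH r))) σ where
  onV := f.onV
  onE := f.onE
  onEnds := f.onEnds
  onEnds_fst := f.onEnds_fst
  vert_comm h := by
    change G'.vert (Equiv.swap (f.onH q) (f.onH r) (f.onH h)) = f.onV (G.vert (Equiv.swap q r h))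
    rw [← f.vert_onH]
    congr 1
    exact (f.onH.injective.swap_apply q r h).symm ▸ rfl
  genus_comm := f.genus_comm

end GIso

end MGraph

namespace MGraph

variable {X : Type}

open Classical in
/-- The neighbours of an edge at one of its ends. -/
def nb [Fintype X] (G : MGraph X) (e : G.E) (c : Bool) : Finset G.H :=
  Finset.univ.filter (G.Adj e c)

theorem mem_nb [Fintype X] {G : MGraph X} {e : G.E} {c : Bool} {h : G.H} :
    h ∈ G.nb e c ↔ G.Adj e c h := by simp [nb]

/-- The graph with the given vertices and edges that is determined by a map from half-edges to
vertices. -/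
def ofVert (G : MGraph X) (v : G.H → G.V) : MGraph X := { G with vert := v, genus := fun _ => 0 }

end MGraph

/-! ### The Laplace operator along an edge and the Jacobi relation -/

namespace LieGraph

open MGraph

variable {k : Type*} [Field k] {X : Type}

/-- Functions of graphs with a distinguished edge that are compatible with isomorphisms. -/
def EdgeInvariant (c : ∀ G : MGraph X, G.E → k) : Prop :=
  ∀ (G G' : MGraph X) (f : G.GIso G' (Equiv.refl X)) (e : G.E), c G' (f.onE e) = c G e

open Classical in
/-- The sum of the differences of the values of `c` at `G` and at its neighbours along `e`. -/
def laplace [Fintype X] (c : ∀ G : MGraph X, G.E → k) (G : MGraph X) (e : G.E) : k :=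
  if G.NonLoop e then ∑ b : Bool, ∑ q ∈ G.nb e b, ∑ r ∈ G.nb e (!b),
    (c G e - c (G.rewire (Equiv.swap q r)) e) else 0

theorem laplace_invariant [Fintype X] {c : ∀ G : MGraph X, G.E → k} (hc : EdgeInvariant c) :
    EdgeInvariant (laplace c) := by
  classical
  intro G G' f e
  by_cases he : G.NonLoop e
  · rw [laplace, laplace, if_pos he, if_pos (f.nonLoop he), ← Equiv.sum_comp (f.onEnd e)]
    have hnb : ∀ b, G'.nb (f.onE e) (f.onEnd e b) = (G.nb e b).map f.onH.toEmbedding := fun b => by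
      ext h
      obtain ⟨h, rfl⟩ := f.onH.surjective h
      rw [mem_nb, f.adj_iff, Finset.mem_map_equiv, Equiv.symm_apply_apply, mem_nb]
    refine Finset.sum_congr rfl fun b _ => ?_
    rw [← f.onEnd_not, hnb, hnb, Finset.sum_map]
    refine Finset.sum_congr rfl fun q _ => ?_
    rw [Finset.sum_map]
    refine Finset.sum_congr rfl fun r _ => ?_
    have h1 := hc _ _ f e
    have h2 := hc _ _ (f.rewire q r) e
    rw [h1]
    exact congrArg _ h2
  · rw [laplace, laplace, if_neg he, if_neg]
    intro h
    have := f.symm.nonLoop h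
    exact he (by simpa [GIso.symm] using this)

open Classical in
-- There are two choices for the end, two for the neighbour there and two for the neighbour at the
-- other end, hence 8 summands. The 8 moves realize only the two other positions of the edge, each
-- of them 4 times up to isomorphism by `exists_rewire_iso`.
theorem laplace_eq [Fintype X] {c : ∀ G : MGraph X, G.E → k} (hc : EdgeInvariant c) {G : MGraph X}
    (hG : G.IsTrivalent) {e : G.E} (he : G.NonLoop e) {b : Bool} {q r s : G.H} (hq : G.Adj e b q)
    (hr : G.Adj e (!b) r) (hs : G.Adj e (!b) s) (hrs : r ≠ s) :
    laplace c G e = 8 * c G e - 4 * c (G.rewire (Equiv.swap q r)) e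
      - 4 * c (G.rewire (Equiv.swap q s)) e := by
  obtain ⟨q', hq', hqq, hl⟩ := hG.exists_second hq
  obtain ⟨s', hs', hrs', hl'⟩ := hG.exists_second hr
  obtain rfl : s = s' := (hl' s hs).resolve_left hrs.symm
  have h1 : G.nb e b = {q, q'} := by
    ext h
    rw [mem_nb, Finset.mem_insert, Finset.mem_singleton]
    exact ⟨hl h, by rintro (rfl | rfl) <;> assumption⟩
  have h2 : G.nb e (!b) = {r, s} := by
    ext h
    rw [mem_nb, Finset.mem_insert, Finset.mem_singleton]
    exact ⟨hl' h, by rintro (rfl | rfl) <;> assumption⟩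
  have key : ∀ r s, G.Adj e (!b) r → G.Adj e (!b) s → r ≠ s →
      (∀ h, G.Adj e (!b) h → h = r ∨ h = s) →
      c (G.rewire (Equiv.swap q' s)) e = c (G.rewire (Equiv.swap q r)) e := by
    intro r s hr hs hrs hl'
    obtain ⟨f, hf⟩ := exists_rewire_iso he hq hr hq' hs hqq hrs hl hl' hG.genus_zero
    have := hc _ _ f e
    rw [hf] at this
    exact this
  have e1 := key r s hr hs hrs hl'
  have e2 := key s r hs hr hrs.symm (fun h hh => (hl' h hh).symm)
  have hsum : ∀ F : Bool → k, ∑ x, F x = F b + F (!b) := fun F => by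
    cases b <;> simp [add_comm]
  have sc : ∀ q r : G.H, c (G.rewire (Equiv.swap r q)) e = c (G.rewire (Equiv.swap q r)) e :=
    fun q r => by rw [Equiv.swap_comm]
  rw [laplace, if_pos he, hsum, Bool.not_not, h1, h2]
  simp only [Finset.sum_pair hqq, Finset.sum_pair hrs, sc q, sc q', e1, e2]
  ring

open Classical in
-- The half-edges `r` and `s` lie at the same vertex, so exchanging them does not change the
-- incidence map. The graphs are equal and not just isomorphic.
theorem rewire_rewire_neighbour {G : MGraph X} {e : G.E} {b : Bool} {q r s : G.H}
    (hr : G.Adj e (!b) r) (hs : G.Adj e (!b) s) (hrs : r ≠ s) (hqr : q ≠ r) (hqs : q ≠ s) :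
    (G.rewire (Equiv.swap q r)).rewire (Equiv.swap r s : Equiv.Perm G.H)
      = G.rewire (Equiv.swap q s) := by
  have : ∀ v v' : G.H → G.V, v = v' → ({ G with vert := v } : MGraph X) = { G with vert := v' } := by
    rintro v _ rfl; rfl
  refine this _ _ (funext fun (h : G.H) => ?_)
  change G.vert (Equiv.swap q r (Equiv.swap r s h)) = G.vert (Equiv.swap q s h)
  by_cases h1 : h = r
  · subst h1
    rw [Equiv.swap_apply_left, Equiv.swap_apply_of_ne_of_ne hqs.symm hrs.symm,
      Equiv.swap_apply_of_ne_of_ne hqr.symm hrs, hr.1, hs.1]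
  by_cases h2 : h = s
  · subst h2; simp
  by_cases h3 : h = q
  · subst h3
    rw [Equiv.swap_apply_of_ne_of_ne h1 h2, Equiv.swap_apply_left, Equiv.swap_apply_left, hr.1, hs.1]
  rw [Equiv.swap_apply_of_ne_of_ne h1 h2, Equiv.swap_apply_of_ne_of_ne h3 h1,
    Equiv.swap_apply_of_ne_of_ne h3 h2]

open Classical in
/-- The Jacobi relation. -/
theorem laplace_jacobi [Fintype X] {c : ∀ G : MGraph X, G.E → k} (hc : EdgeInvariant c) {G : MGraph X}
    (hG : G.IsTrivalent) {e : G.E} (he : G.NonLoop e) {b : Bool} {q r s : G.H} (hq : G.Adj e b q)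
    (hr : G.Adj e (!b) r) (hs : G.Adj e (!b) s) (hrs : r ≠ s) :
    laplace c G e + laplace c (G.rewire (Equiv.swap q r)) e
      + laplace c (G.rewire (Equiv.swap q s)) e = 0 := by
  have hqr := he.ne' hq hr
  have hqs := he.ne' hq hs
  have e0 := laplace_eq hc hG he hq hr hs hrs
  have e1 := laplace_eq hc (rewire_isTrivalent he hq hr hG) (rewire_nonLoop he hq hr)
    (rewire_adj_left he hq hr) (rewire_adj_right he hq hr) (rewire_adj_of_ne he hq hr hs hqs.symm
      hrs.symm) hqs
  have e2 := laplace_eq hc (rewire_isTrivalent he hq hs hG) (rewire_nonLoop he hq hs)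
    (rewire_adj_left he hq hs) (rewire_adj_right he hq hs) (rewire_adj_of_ne he hq hs hr hqr.symm
      hrs) hqr
  have a1 : (G.rewire (Equiv.swap q r)).rewire (Equiv.swap r q : Equiv.Perm G.H) = G :=
    rewire_swap_swap
  have a2 : (G.rewire (Equiv.swap q s)).rewire (Equiv.swap s q : Equiv.Perm G.H) = G :=
    rewire_swap_swap
  have a3 := rewire_rewire_neighbour (q := q) hr hs hrs hqr hqs
  have a4 := rewire_rewire_neighbour (q := q) hs hr hrs.symm hqs hqr
  have cc : ∀ (G1 G2 : MGraph X) (h : G1 = G2) (e1 : G1.E) (e2 : G2.E), e1 ≍ e2 → c G1 e1 = c G2 e2 := by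
    rintro G1 _ rfl e1 e2 h
    rw [eq_of_heq h]
  have b1 := cc _ _ a1 e e HEq.rfl
  have b2 := cc _ _ a2 e e HEq.rfl
  have b3 := cc _ _ a3 e e HEq.rfl
  have b4 := cc _ _ a4 e e HEq.rfl
  have e1' : laplace c (G.rewire (Equiv.swap q r)) e = 8 * c (G.rewire (Equiv.swap q r)) e
    - 4 * c G e - 4 * c (G.rewire (Equiv.swap q s)) e := by
    rw [← b1, ← b3]; exact e1
  have e2' : laplace c (G.rewire (Equiv.swap q s)) e = 8 * c (G.rewire (Equiv.swap q s)) e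
    - 4 * c G e - 4 * c (G.rewire (Equiv.swap q r)) e := by
    rw [← b2, ← b4]; exact e2
  rw [e0, e1', e2']
  ring

open Classical in
-- By the Jacobi relation the values at the two other positions add up to `-c`, so that `8c - 4(-c)
-- = 12c`. At graphs that are not trivalent both sides vanish, because moves neither create nor
-- destroy trivalence.
theorem laplace_eq_of_jacobi [Fintype X] {c : ∀ G : MGraph X, G.E → k} (hc : EdgeInvariant c)
    (hj : ∀ (G : MGraph X) (e : G.E) (q r s : G.H), G.IsTrivalent → G.NonLoop e → G.Adj e false q →
      G.Adj e true r → G.Adj e true s → r ≠ s →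
      c G e + c (G.rewire (Equiv.swap q r)) e + c (G.rewire (Equiv.swap q s)) e = 0)
    (h0 : ∀ G e, c G e ≠ 0 → G.IsTrivalent ∧ G.NonLoop e) (G : MGraph X) (e : G.E) :
    laplace c G e = 12 * c G e := by
  by_cases he : G.NonLoop e
  swap
  · have : c G e = 0 := by by_contra h; exact he (h0 G e h).2
    rw [laplace, if_neg he, this, mul_zero]
  by_cases hG : G.IsTrivalent
  · obtain ⟨q, hq⟩ := hG.exists_adj e false
    obtain ⟨r, hr⟩ := hG.exists_adj e true
    obtain ⟨s, hs, hrs, -⟩ := hG.exists_second hr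
    rw [laplace_eq hc hG he hq hr hs hrs]
    linear_combination (-4 : k) * hj G e q r s hG he hq hr hs hrs
  · have h1 : ∀ G e, ¬ G.IsTrivalent → c G e = 0 := fun G e hG => by
      by_contra h; exact hG (h0 G e h).1
    rw [h1 G e hG, mul_zero, laplace, if_pos he]
    refine Finset.sum_eq_zero fun b _ => Finset.sum_eq_zero fun q hq => Finset.sum_eq_zero fun r hr => ?_
    rw [mem_nb] at hq hr
    have h2 : c (G.rewire (Equiv.swap q r)) e = 0 :=
      h1 _ _ (fun h => hG ((rewire_isTrivalent_iff he hq hr).1 h))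
    exact (congrArg₂ _ (h1 G e hG) h2).trans (sub_zero 0)

/-- The sum of `laplace c` over all graphs with given vertices and edges is zero. -/
theorem sum_laplace [Fintype X] (c : ∀ G : MGraph X, G.E → k) (G : MGraph X)
    [Fintype (G.H → G.V)] (e : G.E) :
    ∑ v : G.H → G.V, laplace c (G.ofVert v) e = 0 := by
  classical
  have key : ∀ b : Bool, ∑ p ∈ (Finset.univ : Finset ((G.H → G.V) × G.H × G.H)).filter
      (fun p => (G.ofVert p.1).NonLoop e ∧ (G.ofVert p.1).Adj e b p.2.1 ∧
        (G.ofVert p.1).Adj e (!b) p.2.2),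
      (c (G.ofVert p.1) e - c ((G.ofVert p.1).rewire (Equiv.swap p.2.1 p.2.2 : Equiv.Perm G.H)) e) = 0 := by
    intro b
    rw [Finset.sum_sub_distrib, sub_eq_zero]
    have hi : ∀ (v : G.H → G.V) q r, (v ∘ Equiv.swap q r) ∘ Equiv.swap r q = v := fun v q r => by
      funext h
      change v (Equiv.swap q r (Equiv.swap r q h)) = v h
      rw [Equiv.swap_comm r q, Equiv.swap_apply_self]
    -- A move is undone by the move with the roles of `q` and `r` exchanged. This involution matches
    -- the positive with the negative terms.
    refine Finset.sum_nbij' (fun p => (p.1 ∘ Equiv.swap p.2.1 p.2.2, p.2.2, p.2.1))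
      (fun p => (p.1 ∘ Equiv.swap p.2.1 p.2.2, p.2.2, p.2.1)) ?_ ?_ ?_ ?_ ?_
    · rintro ⟨v, q, r⟩ hp
      obtain ⟨-, h1, h2, h3⟩ := Finset.mem_filter.1 hp
      exact Finset.mem_filter.2 ⟨Finset.mem_univ _,
        rewire_nonLoop (G := G.ofVert v) (q := q) (r := r) h1 h2 h3,
        rewire_adj_left (G := G.ofVert v) (q := q) (r := r) h1 h2 h3,
        rewire_adj_right (G := G.ofVert v) (q := q) (r := r) h1 h2 h3⟩
    · rintro ⟨v, q, r⟩ hp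
      obtain ⟨-, h1, h2, h3⟩ := Finset.mem_filter.1 hp
      exact Finset.mem_filter.2 ⟨Finset.mem_univ _,
        rewire_nonLoop (G := G.ofVert v) (q := q) (r := r) h1 h2 h3,
        rewire_adj_left (G := G.ofVert v) (q := q) (r := r) h1 h2 h3,
        rewire_adj_right (G := G.ofVert v) (q := q) (r := r) h1 h2 h3⟩
    · rintro ⟨v, q, r⟩ -
      simp only [hi]
    · rintro ⟨v, q, r⟩ -
      simp only [hi]
    · rintro ⟨v, q, r⟩ -
      change _ = c (G.ofVert ((v ∘ Equiv.swap q r) ∘ Equiv.swap r q)) e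
      rw [hi]
  have h2 := Finset.sum_congr (rfl : (Finset.univ : Finset Bool) = _) (fun b _ => key b)
  rw [Finset.sum_const_zero] at h2
  rw [← h2]
  simp only [Finset.sum_filter, Fintype.sum_prod_type]
  rw [Finset.sum_comm]
  refine Finset.sum_congr (by congr!) fun v _ => ?_
  by_cases he : (G.ofVert v).NonLoop e
  · refine (if_pos he : laplace c (G.ofVert v) e = _).trans ?_
    refine Finset.sum_congr rfl fun b _ => ?_
    refine (Finset.sum_filter _ _).trans ?_
    refine Finset.sum_congr (by congr!) fun q _ => ?_
    by_cases hq : (G.ofVert v).Adj e b q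
    · rw [if_pos hq]
      refine (Finset.sum_filter _ _).trans ?_
      refine Finset.sum_congr (by congr!) fun r _ => ?_
      by_cases hr : (G.ofVert v).Adj e (!b) r
      · rw [if_pos hr, if_pos ⟨he, hq, hr⟩]
        congr!
      · rw [if_neg hr, if_neg (fun h => hr h.2.2)]
    · rw [if_neg hq]
      exact (Finset.sum_eq_zero fun r _ => if_neg fun h => hq h.2.1).symm
  · refine (if_neg he : laplace c (G.ofVert v) e = _).trans ?_
    exact (Finset.sum_eq_zero fun b _ => Finset.sum_eq_zero fun q _ => Finset.sum_eq_zero fun r _ =>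
      if_neg fun h => he h.1).symm

end LieGraph

/-! ### Moving legs by Whitehead moves -/

namespace MGraph

variable {X Y : Type}

open Classical in
/-- Predicates of graphs that are invariant under isomorphisms and under Whitehead moves. -/
structure MoveClosed (Z : MGraph X → Prop) : Prop where
  iso : ∀ {G G' : MGraph X}, GIso G G' (Equiv.refl X) → Z G → Z G'
  move : ∀ {G : MGraph X} {e : G.E} {c : Bool} {q r : G.H}, G.NonLoop e → G.Adj e c q →
    G.Adj e (!c) r → Z G → Z (G.rewire (Equiv.swap q r))

/-- There is a path of length `n` from `x` to `v`. -/
def Near (G : MGraph X) (v : G.V) : ℕ → G.V → Prop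
  | 0, x => x = v
  | n + 1, x => ∃ e c, G.vert (Sum.inl (e, c)) = x ∧ G.Near v n (G.vert (Sum.inl (e, !c)))

theorem exists_near {G : MGraph X} (hG : G.Connected) (v x : G.V) : ∃ n, G.Near v n x := by
  have h := hG.2 x v
  induction h using Relation.ReflTransGen.head_induction_on with
  | refl => exact ⟨0, rfl⟩
  | head h _ ih =>
    obtain ⟨e, -, c, h1, rfl⟩ := h
    obtain ⟨n, hn⟩ := ih
    exact ⟨n + 1, e, c, h1, hn⟩

/-- Two legs can be moved to the same vertex. -/
theorem MoveClosed.exists_cherry {Z : MGraph X → Prop} (hZ : MoveClosed Z) {x y : X} (hxy : x ≠ y)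
    (n : ℕ) : ∀ G : MGraph X, G.IsTrivalent → Z G → G.Near (G.vert (Sum.inr y)) n (G.vert (Sum.inr x)) →
    ∃ G' : MGraph X, G'.IsTrivalent ∧ Z G' ∧ Fintype.card G'.V = Fintype.card G.V ∧
      G'.totalGenus = G.totalGenus ∧ G'.vert (Sum.inr x) = G'.vert (Sum.inr y) := by
  classical
  induction n using Nat.strong_induction_on with
  | _ n ih =>
  intro G hG hZG hn
  -- It may be assumed that the path is a shortest one. In particular its first edge is not a loop
  -- and the path does not return to the vertices that it has left.
  by_cases hmin : ∃ j < n, G.Near (G.vert (Sum.inr y)) j (G.vert (Sum.inr x))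
  · obtain ⟨j, hj, hj'⟩ := hmin
    exact ih j hj G hG hZG hj'
  push Not at hmin
  rcases n with _ | m
  · exact ⟨G, hG, hZG, rfl, rfl, hn⟩
  obtain ⟨e, c, h1, h2⟩ := hn
  have he : G.NonLoop e := by
    have : G.vert (Sum.inl (e, c)) ≠ G.vert (Sum.inl (e, !c)) := fun h =>
      hmin m (Nat.lt_succ_self m) (by rwa [← h, h1] at h2)
    intro c'
    rcases Bool.eq_or_eq_not c' c with rfl | rfl
    · exact this
    · rw [Bool.not_not]; exact this.symm
  have hx : G.Adj e c (Sum.inr x) := ⟨h1.symm, by simp⟩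
  -- The leg `x` is carried across the first edge `e` in exchange for a half-edge `t` that is not on
  -- the path. This shortens the path by one.
  suffices h : ∃ t, G.Adj e (!c) t ∧ t ≠ Sum.inr y ∧
      (G.rewire (Equiv.swap (Sum.inr x) t)).Near (G.vert (Sum.inr y)) m (G.vert (Sum.inl (e, !c))) by
    obtain ⟨t, h3, h4, h5⟩ := h
    have hy : (G.rewire (Equiv.swap (Sum.inr x) t)).vert (Sum.inr y) = G.vert (Sum.inr y) :=
      congrArg G.vert (Equiv.swap_apply_of_ne_of_ne (fun h => hxy.symm (Sum.inr_injective h)) h4.symm)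
    have hx' : (G.rewire (Equiv.swap (Sum.inr x) t)).vert (Sum.inr x) = G.vert (Sum.inl (e, !c)) :=
      (congrArg G.vert (Equiv.swap_apply_left _ _)).trans h3.1
    obtain ⟨G', a1, a2, a3, a4, a5⟩ := ih m (Nat.lt_succ_self m) (G.rewire (Equiv.swap (Sum.inr x) t))
      (rewire_isTrivalent he hx h3 hG) (hZ.move he hx h3 hZG) (by rw [hx', hy]; exact h5)
    exact ⟨G', a1, a2, a3, a4, a5⟩
  rcases m with _ | m
  · obtain ⟨t, t1, t2, t3, -⟩ := hG.exists_third (a := Sum.inl (e, !c)) (b := Sum.inr y) rfl h2.symm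
      (by simp)
    exact ⟨t, ⟨t1, t2⟩, t3, h2⟩
  · obtain ⟨e2, c2, h3, h4⟩ := h2
    have hne : (Sum.inl (e, !c) : G.H) ≠ Sum.inl (e2, c2) := by
      intro h
      simp only [Sum.inl.injEq, Prod.mk.injEq] at h
      obtain ⟨rfl, rfl⟩ := h
      rw [Bool.not_not, h1] at h4
      exact hmin m (by omega) h4
    obtain ⟨t, t1, t2, t3, -⟩ := hG.exists_third (a := Sum.inl (e, !c)) (b := Sum.inl (e2, c2)) rfl h3 hne
    -- By minimality no path of length at most `m` starts at the far end of `e`. The rest of the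
    -- path hence does not use `t`, and it survives the move.
    have hfar : ∀ j ≤ m, ¬ G.Near (G.vert (Sum.inr y)) j (G.vert (Sum.inl (e, !c))) := fun j hj h =>
      hmin (j + 1) (by omega) ⟨e, c, h1, h⟩
    have hty : t ≠ Sum.inr y := by
      rintro rfl
      exact hfar 0 (Nat.zero_le _) t1.symm
    have hv : ∀ (f : G.E) c', (Sum.inl (f, c') : G.H) ≠ t →
        (G.rewire (Equiv.swap (Sum.inr x) t)).vert (Sum.inl (f, c')) = G.vert (Sum.inl (f, c')) :=
      fun f c' h => congrArg G.vert (Equiv.swap_apply_of_ne_of_ne Sum.inl_ne_inr h)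
    have hnear : ∀ j ≤ m, ∀ z, G.Near (G.vert (Sum.inr y)) j z →
        (G.rewire (Equiv.swap (Sum.inr x) t)).Near (G.vert (Sum.inr y)) j z := by
      intro j
      induction j with
      | zero => exact fun _ z hz => hz
      | succ j ihj =>
        rintro hj z ⟨f, c', f1, f2⟩
        refine ⟨f, c', ?_, ?_⟩
        · rw [hv]
          · exact f1
          · rintro rfl
            exact hfar (j + 1) hj (t1 ▸ ⟨f, c', rfl, f2⟩)
        · rw [hv]
          · exact ihj (by omega) _ f2
          · rintro rfl
            exact hfar j (by omega) (t1 ▸ f2)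
    refine ⟨t, ⟨t1, t2⟩, hty, e2, c2, ?_, ?_⟩
    · rw [hv _ _ t3.symm]; exact h3
    · rw [hv]
      · exact hnear m le_rfl _ h4
      · rintro rfl
        exact hfar m le_rfl (t1 ▸ h4)

/-! ### Extensions of graphs -/

section Plug

variable (H : MGraph Y) {V E : Type} [Fintype V] [Fintype E] [LinearOrder V] [LinearOrder E]
  (i : H.V → V) (K : (E × Bool) ⊕ X → V ⊕ H.H)

/-- A graph each of whose half-edges either replaces a half-edge of `H` or has a given vertex. -/
def plug : MGraph X where
  V := V
  E := E
  vert h := Sum.elim id (i ∘ H.vert) (K h)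
  genus _ := 0

variable {H i K} {j : H.H → (E × Bool) ⊕ X} (hj : ∀ h h', K h' = Sum.inr h ↔ h' = j h)

include hj

theorem plug_vert (h : H.H) : (H.plug i K).vert (j h) = i (H.vert h) :=
  congrArg (Sum.elim id (i ∘ H.vert)) ((hj h _).2 rfl)

omit [Fintype V] [Fintype E] [LinearOrder V] [LinearOrder E] in
theorem plug_injective : Function.Injective j := fun h h' hh => by
  have := (hj h _).2 rfl
  rw [hh, (hj h' _).2 rfl] at this
  exact (Sum.inr_injective this).symm

/-- A move of `H` is a move of every graph that is obtained from `H` by adding vertices and edges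
outside. Predicates closed under moves can therefore be pulled back to smaller graphs, as in
`MoveClosed.glue` and `MoveClosed.attach`. -/
theorem plug_rewire {_ : DecidableEq H.H} {_ : DecidableEq ((E × Bool) ⊕ X)} (q r : H.H) :
    (H.rewire (Equiv.swap q r)).plug i K = (H.plug i K).rewire (Equiv.swap (j q) (j r) : Equiv.Perm ((E × Bool) ⊕ X)) := by
  have : ∀ v v' : (E × Bool) ⊕ X → V, v = v' →
      (⟨V, E, v, fun _ => 0⟩ : MGraph X) = ⟨V, E, v', fun _ => 0⟩ := by rintro v _ rfl; rfl
  refine this _ _ (funext fun h' => ?_)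
  rcases hK : K h' with v | h
  · have hne : ∀ q, h' ≠ j q := fun q hq => by
      rw [(hj q h').2 hq] at hK; cases hK
    have h1 : (H.plug i K).vert (Equiv.swap (j q) (j r) h') = v := by
      rw [Equiv.swap_apply_of_ne_of_ne (hne q) (hne r)]
      exact congrArg (Sum.elim id (i ∘ H.vert)) hK
    exact (h1.trans rfl).symm
  · obtain rfl := (hj h h').1 hK
    have h1 : (H.plug i K).vert (Equiv.swap (j q) (j r) (j h)) = i (H.vert (Equiv.swap q r h)) := by
      rw [(plug_injective hj).swap_apply, plug_vert hj]
    exact h1.symm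

theorem plug_adj {e : H.E} {e' : E} (he : ∀ c, j (Sum.inl (e, c)) = Sum.inl (e', c)) {c : Bool}
    {q : H.H} (hq : H.Adj e c q) : (H.plug i K).Adj e' c (j q) := by
  refine ⟨?_, fun h => hq.2 (plug_injective hj (h.trans (he c).symm))⟩
  have := plug_vert (i := i) hj (Sum.inl (e, c))
  rw [he] at this
  exact ((plug_vert hj q).trans (congrArg i hq.1)).trans this.symm

theorem plug_nonLoop (hi : Function.Injective i) {e : H.E} {e' : E}
    (he : ∀ c, j (Sum.inl (e, c)) = Sum.inl (e', c)) (h : H.NonLoop e) : (H.plug i K).NonLoop e' := by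
  intro c h'
  have h1 := plug_vert (i := i) hj (Sum.inl (e, c))
  have h2 := plug_vert (i := i) hj (Sum.inl (e, !c))
  rw [he] at h1 h2
  exact h c (hi (h1.symm.trans (h'.trans h2)))

theorem plug_card_flag (hi : Function.Injective i) (v : H.V) (hv : ∀ h', K h' ≠ Sum.inl (i v)) :
    Nat.card ((H.plug i K).Flag (i v)) = Nat.card (H.Flag v) := by
  symm
  refine Nat.card_congr (Equiv.ofBijective
    (fun h => ⟨j h.1, (plug_vert hj h.1).trans (congrArg i h.2)⟩) ⟨fun h h' hh => ?_, ?_⟩)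
  · exact Subtype.ext (plug_injective hj (congrArg Subtype.val hh))
  · rintro ⟨h', hh'⟩
    rcases hK : K h' with w | h
    · have : Sum.elim id (i ∘ H.vert) (K h') = i v := hh'
      rw [hK] at this
      exact absurd (hK.trans (congrArg Sum.inl this)) (hv h')
    · obtain rfl := (hj h h').1 hK
      exact ⟨⟨h, hi ((plug_vert hj h).symm.trans hh')⟩, rfl⟩

end Plug

end MGraph

namespace MGraph

variable {X Y : Type}

/-- An isomorphism given by its actions on the ends of all edges. -/
def GIso.ofEnds {G : MGraph X} {G' : MGraph Y} {σ : X ≃ Y} (onV : G.V ≃ G'.V) (onE : G.E ≃ G'.E)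
    (onEnd : G.E → Bool ≃ Bool)
    (h1 : ∀ e c, G'.vert (Sum.inl (onE e, onEnd e c)) = onV (G.vert (Sum.inl (e, c))))
    (h2 : ∀ x, G'.vert (Sum.inr (σ x)) = onV (G.vert (Sum.inr x)))
    (h3 : ∀ v, G'.genus (onV v) = G.genus v) : GIso G G' σ where
  onV := onV
  onE := onE
  onEnds := Equiv.prodShear onE onEnd
  onEnds_fst _ := rfl
  vert_comm h := by
    rcases h with ⟨e, c⟩ | x
    · exact h1 e c
    · exact h2 x
  genus_comm := h3

/-- Join the legs labelled by `false` and `true`. -/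
def glue (H : MGraph (X ⊕ Bool)) : MGraph X :=
  H.plug (V := H.V) (E := WithBot H.E) id
    (Sum.elim (fun p => WithBot.recBotCoe (Sum.inr (Sum.inr (Sum.inr p.2)))
      (fun e => Sum.inr (Sum.inl (e, p.2))) p.1) (fun x => Sum.inr (Sum.inr (Sum.inl x))))

/-- The half-edges of `glue H`. -/
def glueHalf (H : MGraph (X ⊕ Bool)) : H.H → (WithBot H.E × Bool) ⊕ X :=
  Sum.elim (fun p => Sum.inl ((p.1 : WithBot H.E), p.2))
    (Sum.elim Sum.inr (fun c => Sum.inl (⊥, c)))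

theorem glueHalf_spec (H : MGraph (X ⊕ Bool)) (h : H.H) (h' : (WithBot H.E × Bool) ⊕ X) :
    (Sum.elim (fun p => WithBot.recBotCoe (Sum.inr (Sum.inr (Sum.inr p.2)))
      (fun e => Sum.inr (Sum.inl (e, p.2))) p.1) (fun x => Sum.inr (Sum.inr (Sum.inl x))) h' :
        H.V ⊕ H.H) = Sum.inr h ↔ h' = H.glueHalf h := by
  rcases h' with ⟨e, c⟩ | x
  · induction e using WithBot.recBotCoe with
    | bot => rcases h with ⟨e, c'⟩ | x | c' <;> simp [glueHalf]
    | coe e => rcases h with ⟨e, c'⟩ | x | c' <;> simp [glueHalf]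
  · rcases h with ⟨e, c'⟩ | x | c' <;> simp [glueHalf]

theorem glue_iso {H H' : MGraph (X ⊕ Bool)} (f : GIso H H' (Equiv.refl _)) :
    Nonempty (GIso H.glue H'.glue (Equiv.refl X)) := by
  refine ⟨GIso.ofEnds (G := H.glue) (G' := H'.glue) f.onV (Equiv.optionCongr f.onE)
    (fun e => WithBot.recBotCoe (Equiv.refl _) f.onEnd e) (fun e c => ?_) (fun x => ?_)
    (fun _ => rfl)⟩
  · induction e using WithBot.recBotCoe with
    | bot => exact f.vert_onH (Sum.inr (Sum.inr c))
    | coe e => exact (congrArg H'.vert (f.onH_end e c).symm).trans (f.vert_onH (Sum.inl (e, c)))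
  · exact f.vert_onH (Sum.inr (Sum.inl x))

theorem MoveClosed.glue {Z : MGraph X → Prop} (hZ : MoveClosed Z) :
    MoveClosed (fun H : MGraph (X ⊕ Bool) => Z H.glue) where
  iso f h := hZ.iso (glue_iso f).some h
  move {H e c q r} he hq hr h := by
    classical
    have hj := glueHalf_spec H
    have he' : ∀ c, H.glueHalf (Sum.inl (e, c)) = Sum.inl ((e : WithBot H.E), c) := fun c => rfl
    have := hZ.move (G := H.glue) (e := (e : WithBot H.E)) (plug_nonLoop hj Function.injective_id he' he)
      (plug_adj hj he' hq) (plug_adj hj he' hr) h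
    refine (congrArg Z ?_).mpr this
    exact plug_rewire (i := id) hj q r

theorem glue_isTrivalent {H : MGraph (X ⊕ Bool)} (hH : H.IsTrivalent) : H.glue.IsTrivalent where
  connected := ⟨hH.connected.1, fun u v => Joined.rec_on (γ := H)
    (r := fun u v => H.glue.Joined Finset.univ u v) (fun u => Joined.refl H.glue _ u)
    (fun _ _ _ => Joined.trans)
    (fun e _ c => joined_edge (γ := H.glue) (Finset.mem_univ (e : WithBot H.E)) c (!c))
    (hH.connected.2 u v)⟩
  genus_zero _ := rfl
  trivalent v := by
    rw [← hH.trivalent v]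
    refine plug_card_flag (glueHalf_spec H) Function.injective_id v (fun h' => ?_)
    rcases h' with ⟨e, c⟩ | x
    · induction e using WithBot.recBotCoe <;> simp
    · simp

theorem glue_totalGenus {H : MGraph (X ⊕ Bool)} (hH : H.IsTrivalent) :
    H.glue.totalGenus = H.totalGenus + 1 := by
  have h1 : Fintype.card H.glue.E = Fintype.card H.E + 1 := Fintype.card_option (α := H.E)
  have h2 := H.card_V_le hH.connected
  have h3 : Fintype.card H.glue.V = Fintype.card H.V := rfl
  have h4 : ∑ v, H.glue.genus v = 0 := Finset.sum_eq_zero fun _ _ => rfl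
  have h5 : ∑ v, H.genus v = 0 := Finset.sum_eq_zero fun v _ => hH.genus_zero v
  simp only [totalGenus, h1, h3, h4, h5]
  omega

/-- Cut an edge into two legs. -/
def cut (G : MGraph X) (e : G.E) : MGraph (X ⊕ Bool) where
  V := G.V
  E := {f // f ≠ e}
  vert := Sum.elim (fun p => G.vert (Sum.inl (p.1.1, p.2)))
    (Sum.elim (fun x => G.vert (Sum.inr x)) (fun c => G.vert (Sum.inl (e, c))))
  genus := G.genus

theorem glue_cut_iso (G : MGraph X) (hG : ∀ v, G.genus v = 0) (e : G.E) :
    Nonempty (GIso (G.cut e).glue G (Equiv.refl X)) := by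
  refine ⟨GIso.ofEnds (G := (G.cut e).glue) (G' := G) (Equiv.refl _) (Equiv.optionSubtypeNe e)
    (fun _ => Equiv.refl _) (fun f c => ?_) (fun x => rfl) (fun v => hG v)⟩
  induction f using WithBot.recBotCoe with
  | bot => rfl
  | coe f => rfl

theorem IsTrivalent.cut {G : MGraph X} (hG : G.IsTrivalent) {e : G.E}
    (he : ∀ u v, G.Joined (Finset.univ \ {e}) u v) : (G.cut e).IsTrivalent where
  connected := ⟨hG.connected.1, fun u v => Joined.rec_on (γ := G)
    (r := fun u v => (G.cut e).Joined Finset.univ u v) (fun u => Joined.refl (G.cut e) _ u)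
    (fun _ _ _ => Joined.trans)
    (fun f hf c => joined_edge (γ := G.cut e) (Finset.mem_univ (⟨f, by simpa using hf⟩ : {f // f ≠ e}))
      c (!c)) (he u v)⟩
  genus_zero := hG.genus_zero
  trivalent v := by
    obtain ⟨f⟩ := G.glue_cut_iso hG.genus_zero e
    have h1 := f.symm.isTrivalent hG
    rw [← h1.trivalent v]
    symm
    refine plug_card_flag (glueHalf_spec (G.cut e)) Function.injective_id v (fun h' => ?_)
    rcases h' with ⟨e, c⟩ | x
    · induction e using WithBot.recBotCoe <;> simp
    · simp

/-- A trivalent graph of positive genus is obtained by joining two legs. -/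
theorem IsTrivalent.exists_glue {G : MGraph X} (hG : G.IsTrivalent) {g : ℕ}
    (hg : G.totalGenus = g + 1) : ∃ H : MGraph (X ⊕ Bool), H.IsTrivalent ∧ H.totalGenus = g ∧
      Nonempty (GIso H.glue G (Equiv.refl X)) := by
  classical
  obtain ⟨F, hF1, hF2⟩ := G.exists_spanning hG.connected
  have h5 : ∑ v, G.genus v = 0 := Finset.sum_eq_zero fun v _ => hG.genus_zero v
  -- If the spanning tree contained all edges, the genus would be zero. Cutting an edge outside of
  -- it keeps the graph connected.
  obtain ⟨e, he⟩ : ∃ e, e ∉ F := by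
    by_contra hcon
    push Not at hcon
    have : F = Finset.univ := Finset.eq_univ_iff_forall.2 hcon
    rw [this, Finset.card_univ] at hF1
    simp only [totalGenus] at hg
    omega
  have hcut := hG.cut (e := e) fun u v => (hF2 u v).mono (fun f hf => by
    simpa using fun h : f = e => he (h ▸ hf))
  obtain ⟨f⟩ := G.glue_cut_iso hG.genus_zero e
  refine ⟨G.cut e, hcut, ?_, ⟨f⟩⟩
  have := glue_totalGenus hcut
  rw [f.totalGenus_eq, hg] at this
  omega

/-! ### Vertices with two legs -/

section Attach

variable {x0 y0 : X}

open Classical in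
/-- Replace one leg by an edge to a vertex with two legs. -/
def attach (H : MGraph (Option {x : X // x ≠ x0 ∧ x ≠ y0})) : MGraph X :=
  H.plug (V := WithBot H.V) (E := WithBot H.E) WithBot.some
    (Sum.elim (fun p => WithBot.recBotCoe (if p.2 then Sum.inr (Sum.inr none) else Sum.inl ⊥)
      (fun e => Sum.inr (Sum.inl (e, p.2))) p.1)
      (fun x => if h : x ≠ x0 ∧ x ≠ y0 then Sum.inr (Sum.inr (some ⟨x, h⟩)) else Sum.inl ⊥))

/-- The half-edges of `attach H`. -/
def attachHalf (H : MGraph (Option {x : X // x ≠ x0 ∧ x ≠ y0})) : H.H → (WithBot H.E × Bool) ⊕ X :=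
  Sum.elim (fun p => Sum.inl ((p.1 : WithBot H.E), p.2))
    (fun y => y.elim (Sum.inl (⊥, true)) (fun x => Sum.inr x.1))

open Classical in
theorem attachHalf_spec (H : MGraph (Option {x : X // x ≠ x0 ∧ x ≠ y0})) (h : H.H)
    (h' : (WithBot H.E × Bool) ⊕ X) :
    (Sum.elim (fun p => WithBot.recBotCoe (if p.2 then Sum.inr (Sum.inr none) else Sum.inl ⊥)
      (fun e => Sum.inr (Sum.inl (e, p.2))) p.1)
      (fun x => if h : x ≠ x0 ∧ x ≠ y0 then Sum.inr (Sum.inr (some ⟨x, h⟩)) else Sum.inl ⊥) h' :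
        WithBot H.V ⊕ H.H) = Sum.inr h ↔ h' = H.attachHalf h := by
  rcases h' with ⟨e, c⟩ | x
  · induction e using WithBot.recBotCoe with
    | bot => cases c <;> rcases h with ⟨e, c'⟩ | _ | x <;> simp [attachHalf]
    | coe e => rcases h with ⟨e, c'⟩ | _ | x <;> simp [attachHalf]
  · by_cases hx : x ≠ x0 ∧ x ≠ y0
    · rcases h with ⟨e, c'⟩ | _ | x
      · simp [attachHalf, hx]
      · simp [attachHalf, hx]
      · simp [attachHalf, hx, Subtype.ext_iff]
    · rcases h with ⟨e, c'⟩ | _ | x'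
      · simp [attachHalf, hx]
      · simp [attachHalf, hx]
      · have : x ≠ x'.1 := fun h => hx (h ▸ x'.2)
        simp [attachHalf, hx, this]

theorem attach_vert_leg (H : MGraph (Option {x : X // x ≠ x0 ∧ x ≠ y0})) {x : X}
    (hx : x ≠ x0 ∧ x ≠ y0) : H.attach.vert (Sum.inr x) = WithBot.some (H.vert (Sum.inr (some ⟨x, hx⟩))) :=
  plug_vert (attachHalf_spec H) (Sum.inr (some ⟨x, hx⟩))

theorem attach_vert_leg' (H : MGraph (Option {x : X // x ≠ x0 ∧ x ≠ y0})) {x : X}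
    (hx : ¬ (x ≠ x0 ∧ x ≠ y0)) : H.attach.vert (Sum.inr x) = (⊥ : WithBot H.V) := by
  classical
  exact congrArg (Sum.elim id (WithBot.some ∘ H.vert)) (dif_neg hx)

theorem attach_iso {H H' : MGraph (Option {x : X // x ≠ x0 ∧ x ≠ y0})}
    (f : GIso H H' (Equiv.refl _)) : Nonempty (GIso H.attach H'.attach (Equiv.refl X)) := by
  refine ⟨GIso.ofEnds (G := H.attach) (G' := H'.attach) (Equiv.optionCongr f.onV)
    (Equiv.optionCongr f.onE)
    (fun e => WithBot.recBotCoe (Equiv.refl _) f.onEnd e) (fun e c => ?_) (fun x => ?_)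
    (fun _ => rfl)⟩
  · induction e using WithBot.recBotCoe with
    | bot =>
      cases c
      · rfl
      · exact congrArg WithBot.some (f.vert_onH (Sum.inr none))
    | coe e =>
      have := (congrArg H'.vert (f.onH_end e c).symm).trans (f.vert_onH (Sum.inl (e, c)))
      exact congrArg WithBot.some this
  · by_cases hx : x ≠ x0 ∧ x ≠ y0
    · exact (attach_vert_leg H' hx).trans ((congrArg WithBot.some
        (f.vert_onH (Sum.inr (some ⟨x, hx⟩)))).trans
          (congrArg (Equiv.optionCongr f.onV) (attach_vert_leg H hx).symm))
    · exact (attach_vert_leg' H' hx).trans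
        (congrArg (Equiv.optionCongr f.onV) (attach_vert_leg' H hx).symm)

theorem MoveClosed.attach {Z : MGraph X → Prop} (hZ : MoveClosed Z) :
    MoveClosed (fun H : MGraph (Option {x : X // x ≠ x0 ∧ x ≠ y0}) => Z H.attach) where
  iso f h := hZ.iso (attach_iso f).some h
  move {H e c q r} he hq hr h := by
    classical
    have hj := attachHalf_spec H
    have he' : ∀ c, H.attachHalf (Sum.inl (e, c)) = Sum.inl ((e : WithBot H.E), c) := fun c => rfl
    have := hZ.move (G := H.attach) (e := (e : WithBot H.E)) (plug_nonLoop hj WithBot.coe_injective he' he)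
      (plug_adj hj he' hq) (plug_adj hj he' hr) h
    refine (congrArg Z ?_).mpr this
    exact plug_rewire (i := WithBot.some) hj q r

/-- In a connected trivalent graph with at least four legs, a vertex with two legs can be
removed. -/
theorem IsTrivalent.exists_attach {G : MGraph X} (hG : G.IsTrivalent) (hxy : x0 ≠ y0)
    (h0 : G.vert (Sum.inr x0) = G.vert (Sum.inr y0)) (h1 : 1 < Fintype.card G.V) :
    ∃ H : MGraph (Option {x : X // x ≠ x0 ∧ x ≠ y0}), H.IsTrivalent ∧
      H.totalGenus = G.totalGenus ∧ Fintype.card H.V + 1 = Fintype.card G.V ∧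
      Nonempty (GIso H.attach G (Equiv.refl X)) := by
  classical
  obtain ⟨t, t1, t2, t3, t4⟩ := hG.exists_third rfl h0.symm
    (fun h => hxy (Sum.inr_injective h) : (Sum.inr x0 : G.H) ≠ Sum.inr y0)
  set v0 := G.vert (Sum.inr x0) with hv0
  -- If the third half-edge at `v0` were a leg as well, then `v0` would be isolated from all other
  -- vertices, and a connected graph would have only this vertex.
  obtain ⟨e, c, rfl⟩ : ∃ e c, t = Sum.inl (e, c) := by
    rcases t with ⟨e, c⟩ | x
    · exact ⟨e, c, rfl⟩
    exfalso
    have hj : ∀ u v, G.Joined Finset.univ u v → (u = v0 ↔ v = v0) := fun u v h =>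
      Joined.rec_on (r := fun u v => u = v0 ↔ v = v0) (fun _ => Iff.rfl)
        (fun _ _ _ => Iff.trans) (fun e _ c => by
          have : ∀ c, ¬ G.vert (Sum.inl (e, c)) = v0 := fun c h => by
            rcases t4 _ h with h | h | h <;> cases h
          exact ⟨fun h => absurd h (this _), fun h => absurd h (this _)⟩) h
    have : Subsingleton G.V := ⟨fun u v => by
      rw [((hj v0 u (hG.connected.2 _ _)).1 rfl), ((hj v0 v (hG.connected.2 _ _)).1 rfl)]⟩
    have := Fintype.card_le_one_iff_subsingleton.2 this
    omega
  have hne : G.vert (Sum.inl (e, !c)) ≠ v0 := fun h => by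
    rcases t4 _ h with h | h | h <;> simp at h
  have hleg : ∀ x : {x : X // x ≠ x0 ∧ x ≠ y0}, G.vert (Sum.inr x.1) ≠ v0 := fun x h => by
    rcases t4 _ h with h | h | h
    · exact x.2.1 (Sum.inr_injective h)
    · exact x.2.2 (Sum.inr_injective h)
    · cases h
  have hedge : ∀ f : {f // f ≠ e}, ∀ c', G.vert (Sum.inl (f.1, c')) ≠ v0 := fun f c' h => by
    rcases t4 _ h with h | h | h
    · cases h
    · cases h
    · exact f.2 (congrArg Prod.fst (Sum.inl_injective h))
  let H : MGraph (Option {x : X // x ≠ x0 ∧ x ≠ y0}) :=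
    { V := {v // v ≠ v0}
      E := {f // f ≠ e}
      vert := Sum.elim (fun p => ⟨_, hedge p.1 p.2⟩)
        (fun y => y.elim ⟨_, hne⟩ (fun x => ⟨_, hleg x⟩))
      genus := fun _ => 0 }
  let F : GIso H.attach G (Equiv.refl X) :=
    GIso.ofEnds (G := H.attach) (G' := G) (Equiv.optionSubtypeNe v0) (Equiv.optionSubtypeNe e)
      (fun e => WithBot.recBotCoe (Equiv.swap false c) (fun _ => Equiv.refl _) e)
      (fun f c' => by
        induction f using WithBot.recBotCoe with
        | bot =>
          cases c'
          · exact (congrArg (fun c' => G.vert (Sum.inl (e, c')))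
              (Equiv.swap_apply_left false c)).trans t1
          · refine (congrArg (fun c' => G.vert (Sum.inl (e, c'))) ?_ :
              _ = G.vert (Sum.inl (e, !c)))
            cases c <;> rfl
        | coe f => rfl)
      (fun x => by
        by_cases hx : x ≠ x0 ∧ x ≠ y0
        · exact congrArg (Equiv.optionSubtypeNe v0) (attach_vert_leg H hx).symm
        · refine Eq.trans ?_ (congrArg (Equiv.optionSubtypeNe v0) (attach_vert_leg' H hx).symm)
          have : G.vert (Sum.inr x) = v0 := by
            by_cases h : x = x0
            · rw [h]
            · have : x = y0 := by
                by_contra h'; exact hx ⟨h, h'⟩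
              rw [this, ← h0]
          exact this)
      (fun v => hG.genus_zero _)
  have hcV : Fintype.card H.V + 1 = Fintype.card G.V := by
    have : Fintype.card H.attach.V = Fintype.card H.V + 1 := Fintype.card_option (α := H.V)
    rw [← this]; exact Fintype.card_congr F.onV
  have hcE : Fintype.card H.E + 1 = Fintype.card G.E := by
    have : Fintype.card H.attach.E = Fintype.card H.E + 1 := Fintype.card_option (α := H.E)
    rw [← this]; exact Fintype.card_congr F.onE
  refine ⟨H, ⟨⟨⟨⟨_, hne⟩⟩, ?_⟩, fun _ => rfl, fun v => ?_⟩, ?_, hcV, ⟨F⟩⟩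
  · let π : G.V → H.V := fun v => if h : v = v0 then ⟨_, hne⟩ else ⟨v, h⟩
    have hπ : ∀ (v : G.V) (h : v ≠ v0), π v = ⟨v, h⟩ := fun v h => dif_neg h
    have key : ∀ u v, G.Joined Finset.univ u v → H.Joined Finset.univ (π u) (π v) := fun u v h =>
      Joined.rec_on (r := fun u v => H.Joined Finset.univ (π u) (π v)) (fun _ => Joined.refl H _ _)
        (fun _ _ _ => Joined.trans) (fun f _ c' => by
          by_cases hf : f = e
          · subst hf
            have h1 : π (G.vert (Sum.inl (f, c))) = ⟨_, hne⟩ := dif_pos t1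
            have h2 : π (G.vert (Sum.inl (f, !c))) = ⟨_, hne⟩ := hπ _ hne
            have h3 : ∀ c', π (G.vert (Sum.inl (f, c'))) = ⟨_, hne⟩ := fun c' => by
              rcases Bool.eq_or_eq_not c' c with rfl | rfl
              · exact h1
              · exact h2
            rw [h3, h3]; exact Joined.refl H _ _
          · rw [hπ _ (hedge ⟨f, hf⟩ c'), hπ _ (hedge ⟨f, hf⟩ (!c'))]
            exact joined_edge (γ := H) (Finset.mem_univ (⟨f, hf⟩ : {f // f ≠ e})) c' (!c')) h
    intro u v
    have := key u.1 v.1 (hG.connected.2 _ _)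
    rwa [hπ _ u.2, hπ _ v.2] at this
  · rw [← (F.symm.isTrivalent hG).trivalent (WithBot.some v)]
    symm
    refine plug_card_flag (attachHalf_spec H) WithBot.coe_injective v (fun h' => ?_)
    rcases h' with ⟨f, c'⟩ | x
    · induction f using WithBot.recBotCoe with
      | bot => cases c' <;> simp
      | coe f => simp
    · by_cases hx : x ≠ x0 ∧ x ≠ y0 <;> simp [hx]
  · have h2 := G.card_V_le hG.connected
    have h5 : ∑ v, G.genus v = 0 := Finset.sum_eq_zero fun v _ => hG.genus_zero v
    have h6 : ∑ v, H.genus v = 0 := Finset.sum_eq_zero fun v _ => rfl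
    simp only [totalGenus, h5, h6]
    omega

end Attach

/-! ### Connectedness under moves -/

/-- From `3|V| = 2|E| + |X|` and the formula for the genus. The numbers of vertices and edges depend
only on the type, so all trivalent graphs of one type are attachments of the same set of half-edges
to the same set of vertices. -/
theorem IsTrivalent.card_V [Finite X] {G : MGraph X} (hG : G.IsTrivalent) :
    Fintype.card G.V + 2 = 2 * G.totalGenus + Nat.card X := by
  have h1 := G.sum_card_flag
  simp only [hG.trivalent, Finset.sum_const, Finset.card_univ, smul_eq_mul] at h1
  have h2 := G.card_V_le hG.connected
  have h5 : ∑ v, G.genus v = 0 := Finset.sum_eq_zero fun v _ => hG.genus_zero v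
  simp only [totalGenus, h5]
  omega

theorem IsTrivalent.card_E [Finite X] {G : MGraph X} (hG : G.IsTrivalent) :
    Fintype.card G.E + 3 = 3 * G.totalGenus + Nat.card X := by
  have h0 := hG.card_V
  have h1 := G.sum_card_flag
  simp only [hG.trivalent, Finset.sum_const, Finset.card_univ, smul_eq_mul] at h1
  omega

/-- By induction on the number of vertices. Two chosen legs are moved to a common vertex in both
graphs, this vertex is removed from both, and the induction hypothesis connects the remaining trees.
A tree with one vertex is determined by its legs. -/
theorem moves_connected_zero (n : ℕ) : ∀ {X : Type} [Finite X] {Z : MGraph X → Prop},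
    MoveClosed Z → ∀ {G G' : MGraph X}, G.IsTrivalent → G'.IsTrivalent → G.totalGenus = 0 →
    G'.totalGenus = 0 → Fintype.card G.V = n + 1 → Z G → Z G' := by
  induction n with
  | zero =>
    intro X _ Z hZ G G' hG hG' hg hg' hn h
    have c1 := hG.card_V
    have c2 := hG'.card_V
    have c3 := hG.card_E
    have c4 := hG'.card_E
    have := Fintype.card_eq_zero_iff.1 (by omega : Fintype.card G.E = 0)
    have := Fintype.card_eq_zero_iff.1 (by omega : Fintype.card G'.E = 0)
    have hs := Fintype.card_le_one_iff_subsingleton.1 (by omega : Fintype.card G'.V ≤ 1)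
    refine hZ.iso (GIso.ofEnds (Fintype.equivOfCardEq (by omega)) (Equiv.equivOfIsEmpty _ _)
      (fun _ => Equiv.refl _) (fun e => isEmptyElim e) (fun x => Subsingleton.elim _ _)
      (fun v => (hG'.genus_zero _).trans (hG.genus_zero _).symm)) h
  | succ n ih =>
    intro X _ Z hZ G G' hG hG' hg hg' hn h
    have c1 := hG.card_V
    have c2 := hG'.card_V
    obtain ⟨x0, y0, hxy⟩ : ∃ x y : X, x ≠ y :=
      (Finite.one_lt_card_iff_nontrivial.1 (by omega : 1 < Nat.card X)).exists_pair_ne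
    obtain ⟨m, hm⟩ := exists_near hG.connected (G.vert (Sum.inr y0)) (G.vert (Sum.inr x0))
    obtain ⟨G1, a1, a2, a3, a4, a5⟩ := hZ.exists_cherry hxy m G hG h hm
    obtain ⟨H, b1, b2, b3, ⟨f⟩⟩ := a1.exists_attach hxy a5 (by omega)
    -- The moves that prepare `G'` have to be undone at the end. As moves are reversible, this
    -- predicate is closed as well, and it records the way back to `G'`.
    have hZ' : MoveClosed (fun G1 => Z G1 → Z G') := 
      ⟨fun f h h' => h (hZ.iso f.symm h'), fun {G1 e c q r} he hq hr h h' => h (by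
        classical
        have := hZ.move (rewire_nonLoop he hq hr) (rewire_adj_left he hq hr)
          (rewire_adj_right he hq hr) h'
        exact (congrArg Z (rewire_swap_swap (G := G1) (q := q) (r := r))).mp this)⟩
    obtain ⟨m', hm'⟩ := exists_near hG'.connected (G'.vert (Sum.inr y0)) (G'.vert (Sum.inr x0))
    obtain ⟨G2, a1', a2', a3', a4', a5'⟩ := hZ'.exists_cherry hxy m' G' hG' id hm'
    obtain ⟨H', b1', b2', b3', ⟨f'⟩⟩ := a1'.exists_attach hxy a5' (by omega)
    refine a2' (hZ.iso f' ?_)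
    exact ih hZ.attach b1 b1' (by omega) (by omega) (by omega) (hZ.iso f.symm a2)

/-- Trivalent graphs of the same genus are connected by moves. -/
theorem moves_connected (g : ℕ) : ∀ {X : Type} [Finite X] {Z : MGraph X → Prop}, MoveClosed Z →
    ∀ {G G' : MGraph X}, G.IsTrivalent → G'.IsTrivalent → G.totalGenus = g → G'.totalGenus = g →
    Z G → Z G' := by
  induction g with
  | zero =>
    intro X _ Z hZ G G' hG hG' hg hg' h
    have : 0 < Fintype.card G.V := Fintype.card_pos_iff.2 hG.connected.1
    exact moves_connected_zero (Fintype.card G.V - 1) hZ hG hG' hg hg' (by omega) h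
  | succ g ih =>
    intro X _ Z hZ G G' hG hG' hg hg' h
    obtain ⟨H, h1, h2, ⟨f⟩⟩ := hG.exists_glue hg
    obtain ⟨H', h1', h2', ⟨f'⟩⟩ := hG'.exists_glue hg'
    exact hZ.iso f' (ih hZ.glue h1 h1' h2 h2' (hZ.iso f.symm h))

end MGraph

/-! ### Lie graph homology in degree zero -/

namespace LieGraph

open MGraph

variable {k : Type*} [Field k] {X : Type}

variable (k) in
/-- Invariant functions of trivalent graphs of genus `g`. -/
def invariants (g : ℕ) (X : Type) : Submodule k (MGraph X → k) where
  carrier := {w | (∀ G, w G ≠ 0 → G.IsTrivalent ∧ G.totalGenus = g) ∧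
    ∀ G G' : MGraph X, G.GIso G' (Equiv.refl X) → w G' = w G}
  zero_mem' := ⟨fun _ h => absurd rfl h, fun _ _ _ => rfl⟩
  add_mem' := by
    rintro w w' ⟨h1, h2⟩ ⟨h1', h2'⟩
    refine ⟨fun G h => ?_, fun G G' f => congrArg₂ (· + ·) (h2 G G' f) (h2' G G' f)⟩
    by_cases h0 : w G = 0
    · exact h1' G (by simpa [h0] using h)
    · exact h1 G h0
  smul_mem' := by
    rintro c w ⟨h1, h2⟩
    exact ⟨fun G h => h1 G (fun h0 => h (by simp [h0])), fun G G' f => congrArg (c • ·) (h2 G G' f)⟩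

open Classical in
/-- Functions of graphs, as functions of graphs with the empty set of distinguished edges. -/
def toChain : (MGraph X → k) →ₗ[k] Chain k X where
  toFun w G Φ := if Φ = ∅ then w G else 0
  map_add' w w' := by
    funext G Φ
    by_cases h : Φ = ∅ <;> simp [h]
  map_smul' c w := by
    funext G Φ
    by_cases h : Φ = ∅ <;> simp [h]

theorem toChain_empty (w : MGraph X → k) (G : MGraph X) : toChain w G ∅ = w G := by simp [toChain]

theorem toChain_of_ne (w : MGraph X → k) {G : MGraph X} {Φ : Finset G.E} (h : Φ ≠ ∅) :
    toChain w G Φ = 0 := if_neg h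

theorem edgeSign_of_subsingleton {Y : Type} {G : MGraph X} {G' : MGraph Y} {σ : X ≃ Y}
    (f : G.GIso G' σ) {Φ : Finset G.E} (h : Φ.card ≤ 1) : f.edgeSign Φ = 1 := by
  have : IsEmpty {p : G.E × G.E // p.1 ∈ Φ ∧ p.2 ∈ Φ ∧ p.1 < p.2 ∧ f.onE p.2 < f.onE p.1} :=
    ⟨fun p => p.2.2.2.1.ne (Finset.card_le_one.1 h _ p.2.1 _ p.2.2.1)⟩
  simp [GIso.edgeSign]

/-- Without distinguished edges there is neither a sign nor a Jacobi relation, so invariant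
functions are chains of degree zero. Conversely, `exists_toChain` shows that every chain of degree
zero has this form. -/
theorem toChain_mem {g : ℕ} {w : MGraph X → k} (hw : w ∈ invariants k g X) :
    toChain w ∈ chains k g X 0 := by
  refine ⟨fun G Φ h => ?_, fun G G' f Φ => ?_, fun G Φ hG hΦ e he => ?_⟩
  · by_cases h0 : Φ = ∅
    · subst h0
      rw [toChain_empty] at h
      exact ⟨(hw.1 G h).1, (hw.1 G h).2, isForest_empty, rfl⟩
    · exact absurd (toChain_of_ne w h0) h
  · by_cases h0 : Φ = ∅
    · subst h0
      rw [Finset.map_empty, toChain_empty, toChain_empty, edgeSign_of_subsingleton f (by simp),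
        one_smul, hw.2 G G' f]
    · rw [toChain_of_ne w h0, toChain_of_ne w (by simpa using h0), smul_zero]
  · intro q r s _ _ _ _ _ _ _
    have h0 : Φ ≠ ∅ := Finset.ne_empty_of_mem he
    rw [toChain_of_ne w h0]
    exact (congrArg₂ _ (congrArg₂ _ rfl (if_neg h0)) (if_neg h0)).trans (by simp)

theorem exists_toChain {g : ℕ} {ψ : Chain k X} (h : ψ ∈ chains k g X 0) :
    (fun G => ψ G ∅) ∈ invariants k g X ∧ toChain (fun G => ψ G ∅) = ψ := by
  refine ⟨⟨fun G h0 => ⟨(h.1 G _ h0).1, (h.1 G _ h0).2.1⟩, fun G G' f => ?_⟩, ?_⟩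
  · have := h.2.1 G G' f ∅
    rwa [Finset.map_empty, edgeSign_of_subsingleton f (by simp), one_smul] at this
  · funext G Φ
    by_cases h0 : Φ = ∅
    · subst h0; rw [toChain_empty]
    · rw [toChain_of_ne _ h0]
      by_contra hcon
      exact h0 (Finset.card_eq_zero.1 (h.1 G Φ (Ne.symm hcon)).2.2.2)

theorem chains_zero_le_cycles {g : ℕ} {ψ : Chain k X} (h : ψ ∈ chains k g X 0) :
    ψ ∈ cycles k g X 0 := by
  refine ⟨h, ?_⟩
  funext G Φ
  refine Finset.sum_eq_zero fun e he => ?_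
  have : ψ G (insert e Φ) = 0 := by
    by_contra hcon
    have := (h.1 G _ hcon).2.2.2
    rw [Finset.card_eq_zero] at this
    exact Finset.insert_ne_empty _ _ this
  convert smul_zero _

/-! ### The sum over all gluings -/

open Classical in
/-- The sum over all graphs with the vertices and the edges of a given graph. -/
def total [Fintype X] (G : MGraph X) : (MGraph X → k) →ₗ[k] k where
  toFun w := ∑ v : G.H → G.V, w (G.ofVert v)
  map_add' w w' := by simp [Finset.sum_add_distrib]
  map_smul' c w := by simp [Finset.mul_sum]

theorem boundary_empty (χ : Chain k X) (G : MGraph X) : boundary k X χ G ∅ = ∑ e, χ G {e} := by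
  classical
  change ∑ e ∈ Finset.univ \ ∅, _ = _
  refine Finset.sum_congr (by simp) fun e _ => ?_
  rw [Finset.filter_empty, Finset.card_empty, pow_zero, one_smul]
  congr 1

variable [CharZero k]

/-- A chain of degree one satisfies the Jacobi relation, so 12 times it is its own Laplacian along
the distinguished edge, and the sum of the latter over all attachments cancels. Dividing by 12 uses
the characteristic. -/
theorem total_boundary [Fintype X] {g : ℕ} {χ : Chain k X} (hχ : χ ∈ chains k g X 1)
    (G : MGraph X) : total G (fun G => boundary k X χ G ∅) = 0 := by
  classical
  let c : ∀ G : MGraph X, G.E → k := fun G e => χ G {e}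
  have h1 : EdgeInvariant c := fun G G' f e => by
    have := hχ.2.1 G G' f {e}
    rwa [Finset.map_singleton, edgeSign_of_subsingleton f (by simp), one_smul] at this
  have h2 : ∀ G e, c G e ≠ 0 → G.IsTrivalent ∧ G.NonLoop e := fun G e h =>
    ⟨(hχ.1 G _ h).1, isForest_singleton.1 (hχ.1 G _ h).2.2.1⟩
  have h3 := laplace_eq_of_jacobi h1 (fun G e q r s hG he hq hr hs hrs => by
    convert hχ.2.2 G {e} hG (isForest_singleton.2 he) e (Finset.mem_singleton_self e) q r s
      hq.1 hq.2 hr.1 hr.2 hs.1 hs.2 hrs using 4 <;> rfl) h2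
  have h4 : ∀ e, ∑ v : G.H → G.V, c (G.ofVert v) e = 0 := fun e => by
    have := ((Finset.mul_sum _ _ _).trans
      (Finset.sum_congr rfl fun v _ => (h3 (G.ofVert v) e).symm)).trans (sum_laplace c G e)
    exact (mul_eq_zero.1 this).resolve_left (by norm_num)
  have key : ∑ v : G.H → G.V, ∑ e : G.E, c (G.ofVert v) e = 0 := by
    rw [Finset.sum_comm]
    exact Finset.sum_eq_zero fun e _ => h4 e
  refine Eq.trans (Finset.sum_congr rfl fun v _ => ?_) key
  exact boundary_empty χ (G.ofVert v)

theorem exists_ofVert {G G' : MGraph X} (hV : Fintype.card G.V = Fintype.card G'.V)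
    (hE : Fintype.card G.E = Fintype.card G'.E) (hg : ∀ v, G'.genus v = 0) :
    ∃ v, Nonempty (GIso (G.ofVert v) G' (Equiv.refl X)) := by
  have eV := Fintype.equivOfCardEq hV
  have eE := Fintype.equivOfCardEq hE
  refine ⟨fun h => eV.symm (G'.vert (Sum.map (Prod.map eE id) id h)),
    ⟨GIso.ofEnds (G := G.ofVert _) eV eE (fun _ => Equiv.refl _) (fun e c => ?_) (fun x => ?_)
      (fun v => hg _)⟩⟩
  · exact (eV.apply_symm_apply _).symm
  · exact (eV.apply_symm_apply _).symm

theorem exists_ofVert' [Finite X] {G G' : MGraph X} (hG : G.IsTrivalent) (hG' : G'.IsTrivalent)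
    (h : G.totalGenus = G'.totalGenus) :
    ∃ v, Nonempty (GIso (G.ofVert v) G' (Equiv.refl X)) := by
  have h1 := hG.card_V
  have h2 := hG'.card_V
  have h3 := hG.card_E
  have h4 := hG'.card_E
  exact exists_ofVert (by omega) (by omega) hG'.genus_zero

/-- Boundaries cannot have values that are natural numbers. -/
theorem toChain_not_mem_boundaries [Finite X] {g : ℕ} {w : MGraph X → k}
    (hw : w ∈ invariants k g X) (hN : ∀ G, ∃ n : ℕ, w G = n) {G : MGraph X} (hG : w G ≠ 0) :
    toChain w ∉ boundaries k g X 0 := by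
  classical
  have := Fintype.ofFinite X
  rintro ⟨χ, h1, h2⟩
  have h3 := total_boundary h1 G
  rw [h2] at h3
  choose N hN using hN
  obtain ⟨v, ⟨f⟩⟩ := exists_ofVert' (hw.1 G hG).1 (hw.1 G hG).1 rfl
  have h4 : ∑ v : G.H → G.V, N (G.ofVert v) = 0 := by
    have : total G w = 0 := by
      rw [← h3]; congr 1
    have h5 : ∑ v : G.H → G.V, w (G.ofVert v) = 0 := this
    simp only [hN] at h5
    exact_mod_cast h5
  have h5 := Finset.sum_eq_zero_iff.1 h4 v (Finset.mem_univ v)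
  rw [hw.2 _ _ f, hN, h5, Nat.cast_zero] at hG
  exact hG rfl

/-! ### The Laplace operator -/

/-- The sum of `laplace` over all edges. -/
def laplacian [Fintype X] (w : MGraph X → k) : MGraph X → k :=
  fun G => ∑ e, laplace (fun G _ => w G) G e

omit [CharZero k] in
theorem laplace_support [Fintype X] {g : ℕ} {w : MGraph X → k} (hw : w ∈ invariants k g X)
    {G : MGraph X} {e : G.E} (h : laplace (fun G _ => w G) G e ≠ 0) :
    G.IsTrivalent ∧ G.totalGenus = g ∧ G.NonLoop e := by
  classical
  by_cases he : G.NonLoop e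
  swap
  · rw [laplace, if_neg he] at h
    exact absurd rfl h
  by_contra hcon
  have h1 : ∀ G, ¬ (G.IsTrivalent ∧ G.totalGenus = g) → w G = 0 := fun G hG => by
    by_contra h; exact hG (hw.1 G h)
  rw [laplace, if_pos he] at h
  refine h (Finset.sum_eq_zero fun b _ =>
    Finset.sum_eq_zero fun q hq => Finset.sum_eq_zero fun r hr => ?_)
  rw [mem_nb] at hq hr
  have : w (G.rewire (Equiv.swap q r)) = 0 :=
    h1 _ (fun h => hcon ⟨(rewire_isTrivalent_iff he hq hr).1 h.1, h.2, he⟩)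
  exact (congrArg₂ (· - ·) (h1 G fun h => hcon ⟨h.1, h.2, he⟩) this).trans (sub_zero 0)

omit [CharZero k] in
theorem laplacian_mem [Fintype X] {g : ℕ} {w : MGraph X → k} (hw : w ∈ invariants k g X) :
    laplacian w ∈ invariants k g X := by
  refine ⟨fun G h => ?_, fun G G' f => ?_⟩
  · obtain ⟨e, -, he⟩ := Finset.exists_ne_zero_of_sum_ne_zero h
    exact ⟨(laplace_support hw he).1, (laplace_support hw he).2.1⟩
  · unfold laplacian
    rw [← Equiv.sum_comp f.onE]
    exact Finset.sum_congr rfl fun e _ =>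
      laplace_invariant (c := fun G _ => w G) (fun G G' f _ => hw.2 G G' f) G G' f e

omit [CharZero k] in
-- By `laplace_jacobi`, the edge Laplacian of an invariant is a chain of degree one when it is read
-- as a function of a graph with one distinguished edge. Its boundary is the sum over all edges.
theorem laplacian_boundary [Fintype X] {g : ℕ} {w : MGraph X → k} (hw : w ∈ invariants k g X) :
    toChain (laplacian w) ∈ boundaries k g X 0 := by
  classical
  have hE : EdgeInvariant (k := k) (fun (G : MGraph X) _ => w G) := fun G G' f _ => hw.2 G G' f
  let P : Chain k X := fun G Φ => ∑ e, if Φ = {e} then laplace (fun G _ => w G) G e else 0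
  have hP1 : ∀ G e, P G {e} = laplace (fun G _ => w G) G e := fun G e => by
    simp [P]
  have hP2 : ∀ G Φ, (∀ e, Φ ≠ {e}) → P G Φ = 0 := fun G Φ h =>
    Finset.sum_eq_zero fun e _ => if_neg (h e)
  refine ⟨P, ⟨fun G Φ h => ?_, fun G G' f Φ => ?_, fun G Φ hG hΦ e he => ?_⟩, ?_⟩
  · by_cases h0 : ∃ e, Φ = {e}
    · obtain ⟨e, rfl⟩ := h0
      rw [hP1] at h
      have := laplace_support hw h
      exact ⟨this.1, this.2.1, isForest_singleton.2 this.2.2, rfl⟩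
    · push Not at h0
      exact absurd (hP2 G Φ h0) h
  · by_cases h0 : ∃ e, Φ = {e}
    · obtain ⟨e, rfl⟩ := h0
      rw [Finset.map_singleton, edgeSign_of_subsingleton f (by simp), one_smul]
      exact (hP1 _ _).trans ((laplace_invariant hE G G' f e).trans (hP1 G e).symm)
    · push Not at h0
      rw [hP2 G Φ h0, smul_zero]
      refine hP2 _ _ fun e h => h0 (f.onE.symm e) (Finset.map_injective f.onE.toEmbedding ?_)
      rw [h, Finset.map_singleton]
      simp
  · intro q r s hq hq' hr hr' hs hs' hrs
    by_cases h0 : Φ = {e}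
    · subst h0
      rw [hP1]
      have h1 := hP1 (G.rewire (Equiv.swap q r)) e
      have h2 := hP1 (G.rewire (Equiv.swap q s)) e
      have h3 := laplace_jacobi hE hG (isForest_singleton.1 hΦ) (b := false) ⟨hq, hq'⟩ ⟨hr, hr'⟩
        ⟨hs, hs'⟩ hrs
      refine Eq.trans ?_ h3
      congr! 2
    · have h1 : ∀ e', Φ ≠ {e'} := fun e' h => by
        subst h
        rw [Finset.mem_singleton] at he
        exact h0 (by rw [he])
      have h2 := hP2 (G.rewire (Equiv.swap q r)) Φ h1
      have h3 := hP2 (G.rewire (Equiv.swap q s)) Φ h1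
      rw [hP2 G Φ h1]
      refine (congrArg₂ _ (congrArg₂ _ rfl ?_) ?_).trans (by simp : (0 : k) + 0 + 0 = 0)
      · exact h2
      · exact h3
  · funext G Φ
    by_cases h0 : Φ = ∅
    · subst h0
      rw [toChain_empty, boundary_empty]
      exact Finset.sum_congr rfl fun e _ => hP1 G e
    · rw [toChain_of_ne _ h0]
      refine Finset.sum_eq_zero fun e he => ?_
      have h1 : P G (insert e Φ) = 0 := by
        refine hP2 _ _ fun e' h => ?_
        obtain ⟨f, hf⟩ := Finset.nonempty_iff_ne_empty.2 h0
        have h1 : e = e' := Finset.mem_singleton.1 (h ▸ Finset.mem_insert_self _ _)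
        have h2 : f = e' := Finset.mem_singleton.1 (h ▸ Finset.mem_insert_of_mem hf)
        rw [h1, ← h2] at he
        exact (Finset.mem_sdiff.1 he).2 hf
      convert smul_zero _

/-- Invariants whose Laplacian vanishes are constant. -/
theorem eq_of_laplacian_eq_zero [Fintype X] {g : ℕ} {w : MGraph X → k} (hw : w ∈ invariants k g X)
    (h0 : laplacian w = 0) {G G' : MGraph X} (hG : G.IsTrivalent) (hG' : G'.IsTrivalent)
    (hg : G.totalGenus = g) (hg' : G'.totalGenus = g) : w G = w G' := by
  classical
  -- The field `k` has no order. Composing with `ℚ`-linear functionals `k → ℚ`, which separate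
  -- points, makes the maximum principle available.
  rw [← sub_eq_zero, ← Module.forall_dual_apply_eq_zero_iff ℚ]
  intro l
  rw [map_sub, sub_eq_zero]
  have hfin : (Set.univ : Set (G.H → G.V)).Finite := Set.finite_univ
  obtain ⟨v0, ⟨f0⟩⟩ := exists_ofVert' hG hG rfl
  let A : Finset (G.H → G.V) := Finset.univ.filter fun v =>
    (G.ofVert v).IsTrivalent ∧ (G.ofVert v).totalGenus = g
  have hA : A.Nonempty := ⟨v0, Finset.mem_filter.2 ⟨Finset.mem_univ _,
    f0.symm.isTrivalent hG, f0.totalGenus_eq.trans hg⟩⟩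
  obtain ⟨v, hv, hmax⟩ := A.exists_max_image (fun v => l (w (G.ofVert v))) hA
  rw [Finset.mem_filter] at hv
  have hmax' : ∀ G1 : MGraph X, G1.IsTrivalent → G1.totalGenus = g → l (w G1) ≤ l (w (G.ofVert v)) := by
    intro G1 h1 h2
    obtain ⟨v1, ⟨f1⟩⟩ := exists_ofVert' hG h1 (hg.trans h2.symm)
    rw [hw.2 _ _ f1]
    exact hmax v1 (Finset.mem_filter.2 ⟨Finset.mem_univ _,
      f1.symm.isTrivalent h1, f1.totalGenus_eq.trans h2⟩)
  let Z : MGraph X → Prop := fun G1 => G1.IsTrivalent ∧ G1.totalGenus = g ∧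
    l (w G1) = l (w (G.ofVert v))
  have hZ : MoveClosed Z := by
    refine ⟨fun f h => ⟨f.isTrivalent h.1, f.totalGenus_eq.symm.trans h.2.1, ?_⟩, ?_⟩
    · rw [hw.2 _ _ f]; exact h.2.2
    · rintro G1 e c q r he hq hr ⟨h1, h2, h3⟩
      -- At a graph with maximal value, all differences in the Laplacian are nonnegative and their
      -- sum is zero. Each of them vanishes, so every move leads to a graph with maximal value
      -- again.
      have hsum := congrArg l (congrFun h0 G1)
      rw [Pi.zero_apply, map_zero, laplacian, map_sum] at hsum
      have hle : ∀ e, G1.NonLoop e → ∀ c q r, G1.Adj e c q → G1.Adj e (!c) r →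
          0 ≤ l (w G1 - w (G1.rewire (Equiv.swap q r))) := fun e he c q r hq hr => by
        rw [map_sub, sub_nonneg, h3]
        exact hmax' _ (rewire_isTrivalent he hq hr h1) h2
      have hl : ∀ e, 0 ≤ l (laplace (fun G _ => w G) G1 e) := fun e => by
        by_cases he : G1.NonLoop e
        · rw [laplace, if_pos he, map_sum]
          refine Finset.sum_nonneg fun b _ => ?_
          rw [map_sum]
          refine Finset.sum_nonneg fun q hq => ?_
          rw [map_sum]
          refine Finset.sum_nonneg fun r hr => ?_
          rw [mem_nb] at hq hr
          convert hle e he b q r hq hr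
        · rw [laplace, if_neg he, map_zero]
      have h4 := (Finset.sum_eq_zero_iff_of_nonneg fun e _ => hl e).1 hsum e (Finset.mem_univ e)
      rw [laplace, if_pos he, map_sum] at h4
      have h5 := (Finset.sum_eq_zero_iff_of_nonneg fun b _ => by
        rw [map_sum]
        refine Finset.sum_nonneg fun q hq => ?_
        rw [map_sum]
        refine Finset.sum_nonneg fun r hr => ?_
        rw [mem_nb] at hq hr
        convert hle e he b q r hq hr).1 h4 c (Finset.mem_univ c)
      rw [map_sum] at h5
      have h6 := (Finset.sum_eq_zero_iff_of_nonneg fun q hq => by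
        rw [map_sum]
        refine Finset.sum_nonneg fun r hr => ?_
        rw [mem_nb] at hq hr
        convert hle e he c q r hq hr).1 h5 q (mem_nb.2 hq)
      rw [map_sum] at h6
      have h7 := (Finset.sum_eq_zero_iff_of_nonneg fun r hr => by
        rw [mem_nb] at hr
        convert hle e he c q r hq hr).1 h6 r (mem_nb.2 hr)
      refine ⟨rewire_isTrivalent he hq hr h1, h2, ?_⟩
      rw [map_sub, sub_eq_zero] at h7
      rw [← h3, h7]
  have hall : ∀ G1 : MGraph X, G1.IsTrivalent → G1.totalGenus = g → Z G1 := fun G1 h1 h2 =>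
    moves_connected g hZ hv.2.1 h1 hv.2.2 h2 ⟨hv.2.1, hv.2.2, rfl⟩
  rw [(hall G hG hg).2.2, (hall G' hG' hg').2.2]

open Classical in
variable (k) in
/-- The function with value one at all trivalent graphs of genus `g`. -/
def one (g : ℕ) (X : Type) : MGraph X → k := fun G => if G.IsTrivalent ∧ G.totalGenus = g then 1 else 0

omit [CharZero k] in
theorem one_mem (g : ℕ) (X : Type) : one k g X ∈ invariants k g X := by
  classical
  refine ⟨fun G h => ?_, fun G G' f => ?_⟩
  · by_contra hcon; exact h (if_neg hcon)
  · have : (G'.IsTrivalent ∧ G'.totalGenus = g) ↔ (G.IsTrivalent ∧ G.totalGenus = g) :=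
      ⟨fun h => ⟨f.symm.isTrivalent h.1, f.totalGenus_eq.trans h.2⟩,
        fun h => ⟨f.isTrivalent h.1, f.totalGenus_eq.symm.trans h.2⟩⟩
    simp only [one, this]

omit [CharZero k] in
theorem one_apply {g : ℕ} {G : MGraph X} (h : G.IsTrivalent) (h' : G.totalGenus = g) :
    one k g X G = 1 := if_pos ⟨h, h'⟩

/-- Lie graph homology in degree zero is spanned by the class of `one`. -/
theorem exists_sub_smul_one [Finite X] {g : ℕ} {w : MGraph X → k} (hw : w ∈ invariants k g X) :
    ∃ c : k, toChain (w - c • one k g X) ∈ boundaries k g X 0 := by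
  classical
  have := Fintype.ofFinite X
  by_cases hex : ∃ G : MGraph X, G.IsTrivalent ∧ G.totalGenus = g
  swap
  · have : w = 0 := funext fun G => by
      by_contra h; exact hex ⟨G, hw.1 G h⟩
    exact ⟨0, by simp [this]⟩
  obtain ⟨G, hG, hg⟩ := hex
  let I := invariants k g X
  let M : I →ₗ[k] I :=
    { toFun := fun w => ⟨laplacian w.1, laplacian_mem w.2⟩
      map_add' := fun w w' => by
        refine Subtype.ext (funext fun G => ?_)
        change laplacian (w.1 + w'.1) G = laplacian w.1 G + laplacian w'.1 G
        simp only [laplacian, ← Finset.sum_add_distrib]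
        refine Finset.sum_congr rfl fun e _ => ?_
        by_cases he : G.NonLoop e
        · simp only [laplace, if_pos he, ← Finset.sum_add_distrib]
          refine Finset.sum_congr rfl fun b _ => Finset.sum_congr rfl fun q _ =>
            Finset.sum_congr rfl fun r _ => ?_
          change (w.1 G + w'.1 G) - (w.1 _ + w'.1 _) = _
          ring
        · simp only [laplace, if_neg he, add_zero]
      map_smul' := fun c w => by
        refine Subtype.ext (funext fun G => ?_)
        change laplacian (c • w.1) G = c * laplacian w.1 G
        simp only [laplacian, Finset.mul_sum]
        refine Finset.sum_congr rfl fun e _ => ?_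
        by_cases he : G.NonLoop e
        · simp only [laplace, if_pos he, Finset.mul_sum]
          refine Finset.sum_congr rfl fun b _ => Finset.sum_congr rfl fun q _ =>
            Finset.sum_congr rfl fun r _ => ?_
          change c * w.1 G - c * w.1 _ = _
          ring
        · simp only [laplace, if_neg he, mul_zero] }
  -- Invariants are determined by their values at the finitely many attachments of the half-edges of
  -- `G`, so they form a finite-dimensional space.
  let R : I →ₗ[k] ((G.H → G.V) → k) :=
    { toFun := fun w v => w.1 (G.ofVert v)
      map_add' := fun _ _ => rfl
      map_smul' := fun _ _ => rfl }
  have hR : Function.Injective R := by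
    rw [injective_iff_map_eq_zero]
    intro w hw
    refine Subtype.ext (funext fun G1 => ?_)
    by_contra hcon
    have h1 := w.2.1 G1 hcon
    obtain ⟨v1, ⟨f1⟩⟩ := exists_ofVert' hG h1.1 (hg.trans h1.2.symm)
    exact hcon ((w.2.2 _ _ f1).trans (congrFun hw v1))
  have : FiniteDimensional k I := Module.Finite.of_injective R hR
  let o : I := ⟨one k g X, one_mem g X⟩
  let τ : I →ₗ[k] k := (total G).comp I.subtype
  have hτM : LinearMap.range M ≤ LinearMap.ker τ := by
    rintro _ ⟨w, rfl⟩
    obtain ⟨χ, h1, h2⟩ := laplacian_boundary w.2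
    have h3 := total_boundary h1 G
    rw [h2] at h3
    refine Eq.trans ?_ h3
    change total G (laplacian w.1) = _
    congr 1
  have hτ : τ o ≠ 0 := by
    obtain ⟨v, ⟨f⟩⟩ := exists_ofVert' hG hG rfl
    have h1 : τ o = ((∑ v : G.H → G.V,
        if (G.ofVert v).IsTrivalent ∧ (G.ofVert v).totalGenus = g then 1 else 0 : ℕ) : k) := by
      push_cast
      rfl
    rw [h1, Nat.cast_ne_zero]
    intro h
    have := Finset.sum_eq_zero_iff.1 h v (Finset.mem_univ v)
    rw [if_pos ⟨f.symm.isTrivalent hG, f.totalGenus_eq.trans hg⟩] at this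
    exact one_ne_zero this
  have hker : LinearMap.ker M ≤ Submodule.span k {o} := by
    intro w hw
    rw [Submodule.mem_span_singleton]
    refine ⟨w.1 G, Subtype.ext (funext fun G1 => ?_)⟩
    change w.1 G * one k g X G1 = w.1 G1
    by_cases h1 : G1.IsTrivalent ∧ G1.totalGenus = g
    · rw [one_apply h1.1 h1.2, mul_one]
      exact eq_of_laplacian_eq_zero w.2 (congrArg Subtype.val hw) hG h1.1 hg h1.2
    · rw [one, if_neg h1, mul_zero]
      by_contra hcon
      exact h1 (w.2.1 G1 (Ne.symm hcon))
  -- The kernel of `M` is at most one-dimensional, so the range of `M` has codimension at most one.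
  -- It lies in the kernel of the nonzero functional `τ`, which has codimension one, hence the two
  -- agree.
  have hd1 := LinearMap.finrank_range_add_finrank_ker M
  have hd2 := LinearMap.finrank_range_add_finrank_ker τ
  have hd3 : Module.finrank k (LinearMap.ker M) ≤ 1 :=
    (Submodule.finrank_mono hker).trans (finrank_span_singleton fun h => hτ (by rw [h, map_zero])).le
  have hd4 : Module.finrank k (LinearMap.range τ) = 1 := by
    rw [LinearMap.range_eq_top.2 (LinearMap.surjective (fun h => hτ (by rw [h]; rfl)))]
    simp
  have hd5 : LinearMap.range M = LinearMap.ker τ :=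
    Submodule.eq_of_le_of_finrank_le hτM (by omega)
  let w' : I := ⟨w, hw⟩
  refine ⟨τ w' / τ o, ?_⟩
  have h1 : w' - (τ w' / τ o) • o ∈ LinearMap.ker τ := by
    rw [LinearMap.mem_ker, map_sub, map_smul, smul_eq_mul, div_mul_cancel₀ _ hτ, sub_self]
  rw [← hd5] at h1
  obtain ⟨w1, h2⟩ := h1
  have h3 : w - (τ w' / τ o) • one k g X = laplacian w1.1 := (congrArg Subtype.val h2).symm
  rw [h3]
  exact laplacian_boundary w1.2

end LieGraph

/-! ### Tadpole graphs and grafting along a tadpole -/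

namespace MGraph

/-- The graph with one vertex of genus `g` and one edge. -/
abbrev tadpoleGraph (g : ℕ) (X : Type) : MGraph X where
  V := Unit
  E := Unit
  vert _ := ()
  genus _ := g

theorem tadpoleGraph_totalGenus (g : ℕ) (X : Type) : (tadpoleGraph g X).totalGenus = g + 1 := by
  simp [totalGenus, tadpoleGraph]
  omega

/-- The half-edges of a tadpole graph. -/
def tadpoleFlag (g : ℕ) (X : Type) : X ⊕ Bool ≃ (tadpoleGraph g X).Flag () where
  toFun := Sum.elim (fun x => ⟨Sum.inr x, rfl⟩) (fun b => ⟨Sum.inl ((), b), rfl⟩)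
  invFun h := Sum.elim (fun p => Sum.inr p.2) Sum.inl h.1
  left_inv h := by rcases h with x | b <;> rfl
  right_inv h := by rcases h with ⟨⟨e, b⟩ | x, h⟩ <;> rfl

theorem tadpoleGraph_isModular {g : ℕ} {X : Type} [Finite X] (h : 1 ≤ 2 * g + Nat.card X) :
    (tadpoleGraph g X).IsModular := by
  refine ⟨‹_›, ⟨⟨()⟩, fun _ _ => Joined.refl (tadpoleGraph g X) _ _⟩, fun v => ?_⟩
  have : Nat.card ((tadpoleGraph g X).Flag v) = Nat.card X + 2 := by
    rw [← Nat.card_congr (tadpoleFlag g X), Nat.card_sum]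
    simp
  rw [this]
  change 3 ≤ 2 * g + _
  omega

end MGraph

namespace LieGraph

open MGraph

variable {k : Type*} [Field k] {X Y : Type}

/-- The sum in `graft` is a `finsum`, which would be zero by default if infinitely many terms were
nonzero. This shows that the default never occurs here. -/
theorem finite_cut {δ G : MGraph X} : Finite (Cut δ G) := by
  refine Finite.of_injective (fun c : Cut δ G => (c.edge, c.flip, c.part)) ?_
  rintro ⟨⟩ ⟨⟩ h
  simp only [Prod.mk.injEq] at h
  obtain ⟨rfl, rfl, rfl⟩ := h
  rfl

/-- The cut of `glue H` along its new edge. -/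
def glueCut (g : ℕ) (H : MGraph (X ⊕ Bool)) : Cut (tadpoleGraph g X) H.glue where
  edge _ := (⊥ : WithBot H.E)
  edge_injective _ _ _ := rfl
  flip _ := false
  part _ := ()
  part_edge _ _ _ := rfl
  part_end _ _ := rfl
  part_leg _ := rfl

theorem glueCut_piece (g : ℕ) (H : MGraph (X ⊕ Bool)) (hH : ∀ v, H.genus v = 0) :
    Nonempty (GIso H ((glueCut g H).piece ()) (tadpoleFlag g X)) := by
  let fE : H.E ≃ ((glueCut g H).piece ()).E := Equiv.ofBijective
    (fun e => (⟨(e : WithBot H.E), fun _ => WithBot.bot_ne_coe, rfl⟩ :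
      {f : WithBot H.E // (∀ e, (glueCut g H).edge e ≠ f) ∧ () = ()})) (by
    refine ⟨fun e f h => WithBot.coe_injective (congrArg Subtype.val h), ?_⟩
    rintro ⟨f, hf, -⟩
    induction f using WithBot.recBotCoe with
    | bot => exact absurd rfl (hf ())
    | coe f => exact ⟨f, rfl⟩)
  refine ⟨GIso.ofEnds (G := H) (G' := (glueCut g H).piece ())
    (show H.V ≃ {u : H.V // () = ()} from (Equiv.subtypeUnivEquiv fun _ => rfl).symm) fE
    (fun _ => Equiv.refl _) (fun e c => rfl) (fun x => ?_) (fun v => (hH v).symm)⟩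
  rcases x with x | b
  · rfl
  · cases b <;> rfl

variable [CharZero k]

omit [CharZero k] in
-- With no distinguished edges all signs in `graft` are trivial. The number `n` counts the cuts of
-- `G` at one edge into a connected trivalent piece of genus `g`.
theorem graft_tadpole (g : ℕ) (c : k) (G : MGraph X) : ∃ n : ℕ,
    graft (tadpoleGraph g X) (fun v => c • toChain (one k g ((tadpoleGraph g X).Flag v))) G ∅ = c * n ∧
      ∀ z : Cut (tadpoleGraph g X) G, (z.piece ()).IsTrivalent → (z.piece ()).totalGenus = g → n ≠ 0 := by
  classical
  have := finite_cut (δ := tadpoleGraph g X) (G := G)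
  have := Fintype.ofFinite (Cut (tadpoleGraph g X) G)
  refine ⟨∑ z : Cut (tadpoleGraph g X) G,
    if (z.piece ()).IsTrivalent ∧ (z.piece ()).totalGenus = g then 1 else 0, ?_, fun z h1 h2 h => ?_⟩
  · rw [graft, finsum_eq_sum_of_fintype, Nat.cast_sum, Finset.mul_sum]
    refine Finset.sum_congr rfl fun z _ => ?_
    rw [if_pos fun _ => Finset.notMem_empty _]
    have h0 : IsEmpty {p : G.E × G.E // p.1 ∈ (∅ : Finset G.E) ∧ p.2 ∈ (∅ : Finset G.E) ∧ p.1 < p.2 ∧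
      z.part (G.vert (Sum.inl (p.2, false))) < z.part (G.vert (Sum.inl (p.1, false)))} :=
      ⟨fun p => absurd p.2.1 (Finset.notMem_empty _)⟩
    rw [Nat.card_of_isEmpty, pow_zero, one_smul, Fintype.prod_subsingleton _ ()]
    change c * toChain _ _ _ = _
    have h1 : (Finset.univ.filter (fun f : (z.piece ()).E => f.1 ∈ (∅ : Finset G.E))) = ∅ :=
      Finset.filter_eq_empty_iff.2 fun f _ => Finset.notMem_empty _
    refine congrArg (c * ·) ?_
    refine ((congrArg (toChain _ _) h1).trans (toChain_empty _ _)).trans ?_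
    simp only [one]
    push_cast
    rfl
  · have := Finset.sum_eq_zero_iff.1 h z (Finset.mem_univ z)
    rw [if_pos ⟨h1, h2⟩] at this
    exact one_ne_zero this

omit [CharZero k] in
theorem Represents.eq {g : ℕ} {i : ℕ} {ψ ψ' : Chain k X} {c c' : Homology k g X i}
    (h : Represents ψ c) (h' : Represents ψ' c') : c = c' ↔ ψ - ψ' ∈ boundaries k g X i := by
  obtain ⟨h1, rfl⟩ := h
  obtain ⟨h2, rfl⟩ := h'
  rw [Submodule.Quotient.eq]
  rfl

omit [CharZero k] in
theorem exists_represents {g : ℕ} (c : Homology k g X 0) :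
    ∃ w ∈ invariants k g X, Represents (toChain w) c := by
  obtain ⟨⟨ψ, h⟩, rfl⟩ := Submodule.Quotient.mk_surjective _ c
  obtain ⟨h1, h2⟩ := exists_toChain h.1
  refine ⟨_, h1, ?_, ?_⟩
  · rw [h2]; exact h
  · congr 1
    exact Subtype.ext h2

omit [CharZero k] in
theorem Represents.smul {g : ℕ} {i : ℕ} {ψ : Chain k X} {c : Homology k g X i}
    (h : Represents ψ c) (s : k) : Represents (s • ψ) (s • c) := by
  obtain ⟨h1, rfl⟩ := h
  exact ⟨Submodule.smul_mem _ s h1, rfl⟩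

omit [CharZero k] in
-- Relabelling the legs preserves trivalence and genus. This is the reason why relabellings act
-- trivially on homology of degree zero.
theorem mapChain_one (g : ℕ) (σ : X ≃ Y) : mapChain σ (toChain (one k g X)) = toChain (one k g Y) := by
  classical
  have f : ∀ G : MGraph Y, GIso (G.relabel σ) G σ := fun G =>
    GIso.ofEnds (G := G.relabel σ) (Equiv.refl _) (Equiv.refl _) (fun _ => Equiv.refl _)
      (fun _ _ => rfl) (fun _ => rfl) (fun _ => rfl)
  funext G Φ
  have h2 : one k g X (G.relabel σ) = one k g Y G := by
    have : ((G.relabel σ).IsTrivalent ∧ (G.relabel σ).totalGenus = g) ↔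
        (G.IsTrivalent ∧ G.totalGenus = g) :=
      ⟨fun h => ⟨(f G).isTrivalent h.1, (f G).totalGenus_eq.symm.trans h.2⟩,
        fun h => ⟨(f G).symm.isTrivalent h.1, (f G).totalGenus_eq.trans h.2⟩⟩
    simp only [one, this]
  by_cases h : Φ = ∅
  · subst h
    exact (toChain_empty _ (G.relabel σ)).trans (h2.trans (toChain_empty _ G).symm)
  · exact (toChain_of_ne _ (G := G.relabel σ) h).trans (toChain_of_ne _ h).symm

end LieGraph

/-! ### Generators of the labels of degree zero -/

namespace WeakModularOperad

open MGraph LieGraph ModularCollection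

variable {k : Type*} [Field k]

/-- Natural generators of the spaces of labels of degree zero, with their coordinates. -/
structure Generators (W : WeakModularOperad k) where
  u : ∀ (g : ℕ) (X : Type), W.A g X 0
  t : ∀ (g : ℕ) (X : Type), W.A g X 0 →ₗ[k] k
  map_u : ∀ (g : ℕ) (X Y : Type) (σ : X ≃ Y), W.map σ (u g X) = u g Y
  eq_smul : ∀ (g : ℕ) (X : Type) [Finite X] (a : W.A g X 0), a = t g X a • u g X
  t_u : ∀ (g : ℕ) (X : Type), u g X ≠ 0 → t g X (u g X) = 1
  tadpole : ∀ (g : ℕ) (X : Type), (tadpoleGraph g X).IsModular → Rel (Equiv.refl X)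
    (W.μ (tadpoleGraph g X) (fun _ => 0) (fun v => u g ((tadpoleGraph g X).Flag v))) (u (g + 1) X)
  u_eq_zero : ∀ (g : ℕ) (X : Type) [Finite X], u (g + 1) X = 0 → u g (X ⊕ Bool) = 0

variable {W : WeakModularOperad k}

theorem degree_tadpole : ∑ _ : Unit, 0 + Fintype.card Unit - 1 = 0 := by simp

section

variable (iso : ∀ (g : ℕ) (X : Type) (i : ℕ), W.A g X i ≃ₗ[k] LieGraph.Homology k g X i)

open Classical in
/-- The generators. -/
def generator : ∀ (g : ℕ) (X : Type), W.A g X 0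
  | 0, X => (iso 0 X 0).symm
      (Submodule.Quotient.mk ⟨toChain (one k 0 X), chains_zero_le_cycles (toChain_mem (one_mem 0 X))⟩)
  | g + 1, X => if (tadpoleGraph g X).IsModular then
      W.toModularCollection.transport (tadpoleGraph_totalGenus g X) (Equiv.refl X) degree_tadpole
        (W.μ (tadpoleGraph g X) (fun _ => 0) (fun v => generator g ((tadpoleGraph g X).Flag v)))
      -- This case occurs only for infinite `X`, or for `g = 0` and empty `X`. In the latter case
      -- there are no trivalent graphs of genus one without legs.
      else 0

theorem generator_succ {g : ℕ} {X : Type} (h : (tadpoleGraph g X).IsModular) : Rel (Equiv.refl X)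
    (W.μ (tadpoleGraph g X) (fun _ => 0) (fun v => generator iso g ((tadpoleGraph g X).Flag v)))
    (generator iso (g + 1) X) :=
  ⟨tadpoleGraph_totalGenus g X, degree_tadpole, if_pos h⟩

theorem represents_rel {X : Type} {g g' i i' : ℕ} {a : W.A g X i} {b : W.A g' X i'}
    (h : Rel (Equiv.refl X) a b) {ψ : Chain k X} (h' : Represents ψ (iso g X i a)) :
    Represents ψ (iso g' X i' b) := by
  obtain ⟨rfl, rfl, rfl⟩ := h
  have : W.toModularCollection.transport rfl (Equiv.refl X) rfl a = a := W.map_refl _ _ _ a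
  rw [this]; exact h'

/-- By induction on the genus. A relabelling extends to an isomorphism of tadpole graphs which
preserves the orders, so equivariance gives no sign. -/
theorem generator_map
    (hmap : ∀ (g : ℕ) (X Y : Type) (i : ℕ) (σ : X ≃ Y) (a : W.A g X i) (ψ : LieGraph.Chain k X),
      LieGraph.Represents ψ (iso g X i a) →
        LieGraph.Represents (LieGraph.mapChain σ ψ) (iso g Y i (W.map σ a))) (g : ℕ) :
    ∀ (X Y : Type) (σ : X ≃ Y), W.map σ (generator iso g X) = generator iso g Y := by
  induction g with
  | zero =>
    intro X Y σ
    have h : ∀ X, Represents (toChain (one k 0 X)) (iso 0 X 0 (generator iso 0 X)) := fun X =>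
      ⟨chains_zero_le_cycles (toChain_mem (one_mem 0 X)), ((iso 0 X 0).apply_symm_apply _).symm⟩
    have h1 := hmap 0 X Y 0 σ _ _ (h X)
    rw [mapChain_one] at h1
    refine (iso 0 Y 0).injective ((h1.eq (h Y)).2 ?_)
    rw [sub_self]; exact Submodule.zero_mem _
  | succ g ih =>
    intro X Y σ
    let f : GIso (tadpoleGraph g X) (tadpoleGraph g Y) σ :=
      GIso.ofEnds (Equiv.refl _) (Equiv.refl _) (fun _ => Equiv.refl _)
        (fun _ _ => rfl) (fun _ => rfl) (fun _ => rfl)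
    by_cases hX : (tadpoleGraph g X).IsModular
    · have hY := f.isModular hX
      have h1 := W.equivariant _ _ σ f hX ⟨()⟩ (fun _ => 0) (fun _ => 0) (fun _ => rfl)
        (fun v => generator iso g _) (fun v => generator iso g _)
        (fun v => (ih _ _ (f.onFlag v)).symm) f.totalGenus_eq (by simp)
      rw [f.vertexSign_eq_one _ (fun _ _ _ h => absurd h (by simp)),
        f.edgeSign_eq_one _ (fun _ _ h => h), mul_one, one_smul] at h1
      have h2 : Rel σ (W.μ (tadpoleGraph g X) (fun _ => 0)
          (fun v => generator iso g ((tadpoleGraph g X).Flag v)))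
          (W.μ (tadpoleGraph g Y) (fun _ => 0)
          (fun v => generator iso g ((tadpoleGraph g Y).Flag v))) := ⟨_, _, h1⟩
      have h3 := ((generator_succ iso hX).symm.trans h2).trans (generator_succ iso hY)
      exact (Rel.map σ _).eq h3
    · have hY : ¬ (tadpoleGraph g Y).IsModular := fun h => hX (f.symm.isModular h)
      simp only [generator, if_neg hX, if_neg hY, map_zero]

variable [CharZero k]

/-- By induction, the generator of genus `g + 1` is represented by `c` times a function with values
in natural numbers. It is homologous to some `c' • one`. If `c'` were zero, this function would be a
boundary, although it does not vanish at the graph obtained by joining two legs of a graph of genus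
`g`. -/
theorem generator_represents
    (hgraft : ∀ (X : Type) (δ : MGraph X), δ.IsModular → Fintype.card δ.E = 1 →
      ∀ (d : δ.V → ℕ) (a : W.toModularCollection.Labels δ d)
        (ψ : ∀ v, LieGraph.Chain k (δ.Flag v)),
        (∀ v, LieGraph.Represents (ψ v) (iso _ _ _ (a v))) →
          LieGraph.Represents (LieGraph.graft δ ψ) (iso _ _ _ (W.μ δ d a))) (g : ℕ) :
    ∀ (X : Type) [Finite X], ∃ c : k, c ≠ 0 ∧
      Represents (c • toChain (one k g X)) (iso g X 0 (generator iso g X)) := by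
  induction g with
  | zero =>
    intro X _
    refine ⟨1, one_ne_zero, ?_⟩
    rw [one_smul]
    exact ⟨chains_zero_le_cycles (toChain_mem (one_mem 0 X)), ((iso 0 X 0).apply_symm_apply _).symm⟩
  | succ g ih =>
    intro X _
    by_cases hG : ∃ G : MGraph X, G.IsTrivalent ∧ G.totalGenus = g + 1
    swap
    -- Without trivalent graphs of this type all chains of degree zero vanish, and any nonzero
    -- scalar will do.
    · have h0 : ∀ w ∈ invariants k (g + 1) X, w = 0 := fun w hw => funext fun G => by
        by_contra h; exact hG ⟨G, hw.1 G h⟩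
      obtain ⟨w, hw, hw'⟩ := exists_represents (iso (g + 1) X 0 (generator iso (g + 1) X))
      refine ⟨1, one_ne_zero, ?_⟩
      rw [h0 _ (one_mem _ _), map_zero, smul_zero]
      rwa [h0 w hw, map_zero] at hw'
    obtain ⟨G, hG, hg⟩ := hG
    obtain ⟨H, hH, hHg, -⟩ := hG.exists_glue hg
    have hmod : (tadpoleGraph g X).IsModular := tadpoleGraph_isModular (by
      have h1 := hG.card_V
      have h2 : 0 < Fintype.card G.V := Fintype.card_pos_iff.2 hG.connected.1
      omega)
    have := Finite.of_equiv _ (tadpoleFlag g X)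
    obtain ⟨c, hc, h1⟩ := ih ((tadpoleGraph g X).Flag ())
    have h2 := hgraft X _ hmod rfl (fun _ => 0) (fun v => generator iso g _)
      (fun v => c • toChain (one k g ((tadpoleGraph g X).Flag v))) (fun _ => h1)
    have h3 := represents_rel iso (generator_succ iso hmod) h2
    obtain ⟨h4, h5⟩ := exists_toChain h2.1.1
    have hn := fun G : MGraph X => graft_tadpole (k := k) g c G
    choose n hn hn' using hn
    obtain ⟨c', h6⟩ := exists_sub_smul_one h4
    refine ⟨c', ?_, ?_⟩
    · rintro rfl
      rw [zero_smul, sub_zero] at h6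
      have h7 : (fun G => (n G : k)) = c⁻¹ • fun G =>
          graft (tadpoleGraph g X) (fun v => c • toChain (one k g ((tadpoleGraph g X).Flag v))) G ∅ := by
        funext G
        change _ = c⁻¹ * graft _ _ G ∅
        rw [hn, inv_mul_cancel_left₀ hc]
      have h8 : (fun G => (n G : k)) ∈ invariants k (g + 1) X := by
        rw [h7]
        rw [tadpoleGraph_totalGenus] at h4
        exact Submodule.smul_mem _ _ h4
      obtain ⟨f⟩ := glueCut_piece g H hH.genus_zero
      refine toChain_not_mem_boundaries h8 (fun G => ⟨n G, rfl⟩) (G := H.glue)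
        (Nat.cast_ne_zero.2 (hn' _ (glueCut g H) (f.isTrivalent hH) (f.totalGenus_eq.symm.trans hHg))) ?_
      rw [h7, map_smul]
      rw [tadpoleGraph_totalGenus] at h6
      exact Submodule.smul_mem _ _ h6
    · have h7 : Represents (c' • toChain (one k (g + 1) X)) (Submodule.Quotient.mk ⟨c' • toChain
          (one k (g + 1) X), Submodule.smul_mem _ _ (chains_zero_le_cycles (toChain_mem
            (one_mem (g + 1) X)))⟩ : Homology k (g + 1) X 0) := ⟨_, rfl⟩
      rw [(h3.eq h7).2]
      · exact h7
      · rw [map_sub, map_smul, h5, tadpoleGraph_totalGenus] at h6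
        exact h6

end

theorem exists_generators [CharZero k] (hW : W.ExtendsLieGraphHomology) : Nonempty W.Generators := by
  classical
  obtain ⟨iso, hmap, hgraft⟩ := hW
  have hrep := generator_represents iso hgraft
  have ht : ∀ (g : ℕ) (X : Type), ∃ t : W.A g X 0 →ₗ[k] k, generator iso g X ≠ 0 →
      t (generator iso g X) = 1 := fun g X => by
    by_cases h : generator iso g X = 0
    · exact ⟨0, fun h' => absurd h h'⟩
    · obtain ⟨t, ht⟩ := Module.Projective.exists_dual_eq_one k h
      exact ⟨t, fun _ => ht⟩
  choose t ht using ht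
  have hspan : ∀ (g : ℕ) (X : Type) [Finite X] (a : W.A g X 0), ∃ s : k, a = s • generator iso g X := by
    intro g X _ a
    obtain ⟨c, hc, h1⟩ := hrep g X
    obtain ⟨w, hw, h2⟩ := exists_represents (iso g X 0 a)
    obtain ⟨s, h3⟩ := exists_sub_smul_one hw
    refine ⟨s / c, (iso g X 0).injective ?_⟩
    rw [map_smul, (h2.eq (h1.smul (s / c))).2]
    rwa [smul_smul, div_mul_cancel₀ _ hc, ← map_smul, ← map_sub]
  refine ⟨⟨generator iso, t, generator_map iso hmap, fun g X _ a => ?_, ht,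
    fun g X => generator_succ iso, fun g X _ h => ?_⟩⟩
  · obtain ⟨s, rfl⟩ := hspan g X a
    by_cases h : generator iso g X = 0
    · rw [h, smul_zero, smul_zero]
    · rw [map_smul, ht g X h, smul_eq_mul, mul_one]
  -- If the generator with the two extra legs is nonzero, there is a trivalent graph `H` with these
  -- legs. Joining them gives a graph at which `one` is nonzero, so the generator of the next genus
  -- is not a boundary.
  · by_contra hne
    obtain ⟨c, hc, h1⟩ := hrep g (X ⊕ Bool)
    obtain ⟨c', hc', h2⟩ := hrep (g + 1) X
    have h3 : one k g (X ⊕ Bool) ≠ 0 := by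
      intro h3
      apply hne
      refine (iso _ _ _).injective ?_
      rw [map_zero]
      rw [h3, map_zero, smul_zero] at h1
      exact (h1.eq (⟨Submodule.zero_mem _, rfl⟩ : Represents (0 : Chain k (X ⊕ Bool)) 0)).2
        (by rw [sub_zero]; exact Submodule.zero_mem _)
    obtain ⟨H, hH⟩ : ∃ H, one k g (X ⊕ Bool) H ≠ 0 := by
      by_contra hcon
      push Not at hcon
      exact h3 (funext hcon)
    obtain ⟨hH, hg⟩ := (one_mem g (X ⊕ Bool)).1 H hH
    rw [h, map_zero] at h2
    have h4 := (h2.eq (⟨Submodule.zero_mem _, rfl⟩ : Represents (0 : Chain k X) 0)).1 rfl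
    rw [sub_zero] at h4
    have h5 := Submodule.smul_mem _ c'⁻¹ h4
    rw [smul_smul, inv_mul_cancel₀ hc', one_smul] at h5
    refine toChain_not_mem_boundaries (one_mem (g + 1) X) (fun G => ?_) (G := H.glue) ?_ h5
    · by_cases h : G.IsTrivalent ∧ G.totalGenus = g + 1
      · exact ⟨1, by rw [one_apply h.1 h.2, Nat.cast_one]⟩
      · exact ⟨0, by rw [one, if_neg h, Nat.cast_zero]⟩
    · rw [one_apply (glue_isTrivalent hH) (by rw [glue_totalGenus hH, hg])]
      exact one_ne_zero

end WeakModularOperad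

/-! ### Adding a tadpole to a graph -/

namespace MGraph

variable {X Y : Type}

/-- Replace a unit of the genus of a vertex by a tadpole. -/
abbrev addTadpole (γ : MGraph X) (v : γ.V) : MGraph X where
  V := γ.V
  E := WithBot γ.E
  vert := Sum.elim (fun p => WithBot.recBotCoe v (fun e => γ.vert (Sum.inl (e, p.2))) p.1)
    (fun x => γ.vert (Sum.inr x))
  genus := Function.update γ.genus v (γ.genus v - 1)

variable (γ : MGraph X) (v : γ.V)

/-- A graph, as a contraction of the graph with a tadpole added. -/
def addSQ : SubQuotient γ (γ.addTadpole v) where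
  cell w x := w = x
  emb := WithBot.some
  ends p := ((p.1 : WithBot γ.E), p.2)
  leg := Sum.inr
  ends_fst _ := rfl
  injective := by
    rintro (⟨e, c⟩ | x) (⟨e', c'⟩ | x') h <;> simp at h ⊢ <;> exact h
  vert_mem h := by rcases h with p | x <;> rfl
  disjoint _ _ _ h h' := h.trans h'.symm

theorem addTadpole_vert (h : γ.H) : (γ.addTadpole v).vert ((γ.addSQ v).ι h) = γ.vert h := by
  rcases h with p | x <;> rfl

theorem addSQ_cases (z : (γ.addTadpole v).H) :
    (∃ c, z = Sum.inl ((⊥ : WithBot γ.E), c)) ∨ ∃ h, z = (γ.addSQ v).ι h := by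
  rcases z with ⟨e, c⟩ | x
  · induction e using WithBot.recBotCoe with
    | bot => exact Or.inl ⟨c, rfl⟩
    | coe e => exact Or.inr ⟨Sum.inl (e, c), rfl⟩
  · exact Or.inr ⟨Sum.inr x, rfl⟩

/-- The half-edges at the other vertices. -/
def addFlag {w : γ.V} (hw : w ≠ v) : γ.Flag w ≃ (γ.addTadpole v).Flag w :=
  Equiv.ofBijective (fun h => ⟨(γ.addSQ v).ι h.1, (γ.addTadpole_vert v h.1).trans h.2⟩) (by
    refine ⟨fun h h' hh => Subtype.ext ((γ.addSQ v).ι_injective (congrArg Subtype.val hh)), ?_⟩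
    rintro ⟨z, hz⟩
    rcases γ.addSQ_cases v z with ⟨c, rfl⟩ | ⟨h, rfl⟩
    · exact absurd hz.symm hw
    · exact ⟨⟨h, (γ.addTadpole_vert v h).symm.trans hz⟩, rfl⟩)

/-- The half-edges at the vertex with the new tadpole. -/
def addFlagSelf : γ.Flag v ⊕ Bool ≃ (γ.addTadpole v).Flag v :=
  Equiv.ofBijective (Sum.elim
    (fun h => ⟨(γ.addSQ v).ι h.1, (γ.addTadpole_vert v h.1).trans h.2⟩)
    (fun c => ⟨Sum.inl ((⊥ : WithBot γ.E), c), rfl⟩)) (by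
    constructor
    · have hne : ∀ (h : γ.H) c, (γ.addSQ v).ι h ≠ Sum.inl ((⊥ : WithBot γ.E), c) := by
        rintro (⟨e, c'⟩ | x) c h
        · exact absurd (congrArg Prod.fst (Sum.inl_injective h)) WithBot.coe_ne_bot
        · cases h
      rintro (h | c) (h' | c') hh
      · exact congrArg Sum.inl (Subtype.ext ((γ.addSQ v).ι_injective (congrArg Subtype.val hh)))
      · exact absurd (congrArg Subtype.val hh) (hne _ _)
      · exact absurd (congrArg Subtype.val hh).symm (hne _ _)
      · exact congrArg Sum.inr (congrArg Prod.snd (Sum.inl_injective (congrArg Subtype.val hh)))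
    · rintro ⟨z, hz⟩
      rcases γ.addSQ_cases v z with ⟨c, rfl⟩ | ⟨h, rfl⟩
      · exact ⟨Sum.inr c, rfl⟩
      · exact ⟨Sum.inl ⟨h, (γ.addTadpole_vert v h).symm.trans hz⟩, rfl⟩)

variable {γ v}

theorem addTadpole_genus_self : (γ.addTadpole v).genus v = γ.genus v - 1 := Function.update_self _ _ _

theorem addTadpole_genus_of_ne {w : γ.V} (hw : w ≠ v) : (γ.addTadpole v).genus w = γ.genus w :=
  Function.update_of_ne hw _ _

theorem addTadpole_totalGenus (hγ : γ.Connected) (hv : 0 < γ.genus v) :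
    (γ.addTadpole v).totalGenus = γ.totalGenus := by
  have h1 : Fintype.card (γ.addTadpole v).E = Fintype.card γ.E + 1 :=
    Fintype.card_option (α := γ.E)
  have h2 := γ.card_V_le hγ
  have h3 : ∑ w, (γ.addTadpole v).genus w + 1 = ∑ w, γ.genus w := by
    rw [← Finset.add_sum_erase _ _ (Finset.mem_univ v), addTadpole_genus_self,
      Finset.sum_congr rfl fun w hw => addTadpole_genus_of_ne (Finset.ne_of_mem_erase hw),
      ← Finset.add_sum_erase (f := γ.genus) _ (Finset.mem_univ v)]
    omega
  have h4 : Fintype.card (γ.addTadpole v).V = Fintype.card γ.V := rfl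
  unfold totalGenus
  rw [h1, h4]
  omega

theorem addTadpole_connected : (γ.addTadpole v).Connected ↔ γ.Connected := by
  refine and_congr_right fun _ => forall₂_congr fun u w => ⟨fun h => ?_, fun h => ?_⟩
  · refine Joined.rec_on (γ := γ.addTadpole v) (r := fun u w => γ.Joined Finset.univ u w)
      (fun u => Joined.refl γ _ u) (fun _ _ _ => Joined.trans) (fun e _ c => ?_) h
    induction e using WithBot.recBotCoe with
    | bot => exact Joined.refl γ _ _
    | coe e => exact joined_edge (γ := γ) (Finset.mem_univ e) c (!c)
  · exact Joined.rec_on (γ := γ) (r := fun u w => (γ.addTadpole v).Joined Finset.univ u w)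
      (fun u => Joined.refl (γ.addTadpole v) _ u) (fun _ _ _ => Joined.trans)
      (fun e _ c => joined_edge (γ := γ.addTadpole v) (Finset.mem_univ (e : WithBot γ.E)) c (!c)) h

theorem addTadpole_isModular (hv : 0 < γ.genus v) : (γ.addTadpole v).IsModular ↔ γ.IsModular := by
  have key : ∀ (_ : Finite X) (w : γ.V),
      2 * (γ.addTadpole v).genus w + Nat.card ((γ.addTadpole v).Flag w)
        = 2 * γ.genus w + Nat.card (γ.Flag w) := by
    intro _ w
    by_cases hw : w = v
    · subst hw
      have := γ.finite_flag w
      rw [← Nat.card_congr (γ.addFlagSelf w), Nat.card_sum, addTadpole_genus_self]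
      simp
      omega
    · rw [← Nat.card_congr (γ.addFlag v hw), addTadpole_genus_of_ne hw]
  constructor
  · intro h
    exact ⟨h.finite_legs, addTadpole_connected.1 h.connected,
      fun w => (key h.finite_legs w) ▸ h.stable w⟩
  · intro h
    exact ⟨h.finite_legs, addTadpole_connected.2 h.connected,
      fun w => (key h.finite_legs w).symm ▸ h.stable w⟩

/-- The isomorphism of graphs with tadpoles. -/
def GIso.addTadpole {γ' : MGraph Y} {σ : X ≃ Y} (f : GIso γ γ' σ) (v : γ.V) :
    GIso (γ.addTadpole v) (γ'.addTadpole (f.onV v)) σ :=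
  GIso.ofEnds (G := γ.addTadpole v) (G' := γ'.addTadpole (f.onV v)) f.onV (Equiv.optionCongr f.onE)
    (fun e => WithBot.recBotCoe (Equiv.refl _) f.onEnd e)
    (fun e c => by
      induction e using WithBot.recBotCoe with
      | bot => rfl
      | coe e => exact (congrArg γ'.vert (f.onH_end e c).symm).trans (f.vert_onH (Sum.inl (e, c))))
    (fun x => f.vert_onH (Sum.inr x))
    (fun w => by
      by_cases hw : w = v
      · rw [hw]
        exact addTadpole_genus_self.trans
          ((congrArg (· - 1) (f.genus_comm v)).trans addTadpole_genus_self.symm)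
      · have h1 := addTadpole_genus_of_ne (γ := γ) hw
        have h2 := addTadpole_genus_of_ne (γ := γ') fun h => hw (f.onV.injective h)
        exact h2.trans ((f.genus_comm w).trans h1.symm))

theorem GIso.addTadpole_onH {γ' : MGraph Y} {σ : X ≃ Y} (f : GIso γ γ' σ) (h : γ.H) :
    (f.addTadpole v).onH ((γ.addSQ v).ι h) = (γ'.addSQ (f.onV v)).ι (f.onH h) := by
  rcases h with ⟨e, c⟩ | x
  · exact ((f.addTadpole v).onH_end (e : WithBot γ.E) c).trans
      (congrArg (γ'.addSQ (f.onV v)).ι (f.onH_end e c)).symm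
  · rfl

/-- The new edge is the first one in both orders and is mapped to the new edge, so it takes part in
no inversion. -/
theorem GIso.addTadpole_edgeSign {γ' : MGraph Y} {σ : X ≃ Y} (f : GIso γ γ' σ) :
    (f.addTadpole v).edgeSign Finset.univ = f.edgeSign Finset.univ := by
  unfold GIso.edgeSign
  congr 1
  symm
  refine Nat.card_congr (Equiv.ofBijective (fun p => ⟨((p.1.1 : WithBot γ.E), (p.1.2 : WithBot γ.E)),
    Finset.mem_univ _, Finset.mem_univ _, WithBot.coe_lt_coe.2 p.2.2.2.1,
    WithBot.coe_lt_coe.2 p.2.2.2.2⟩) ⟨fun p q h => ?_, ?_⟩)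
  · have := congrArg Subtype.val h
    simp only [Prod.mk.injEq, WithBot.coe_inj] at this
    exact Subtype.ext (Prod.ext this.1 this.2)
  · rintro ⟨⟨e, f'⟩, -, -, h1, h2⟩
    induction f' using WithBot.recBotCoe with
    | bot => exact absurd h1 (WithBot.not_lt_bot _)
    | coe f' =>
      induction e using WithBot.recBotCoe with
      | bot => exact absurd h2 (WithBot.not_lt_bot (α := γ'.E) _)
      | coe e => exact ⟨⟨(e, f'), Finset.mem_univ _, Finset.mem_univ _, WithBot.coe_lt_coe.1 h1,
          WithBot.coe_lt_coe.1 h2⟩, rfl⟩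

theorem GIso.isEgg {γ' : MGraph Y} {σ : X ≃ Y} (f : GIso γ γ' σ) {d : γ.V → ℕ} {d' : γ'.V → ℕ}
    (hd : ∀ v, d' (f.onV v) = d v) {v : γ.V} (h : γ.IsEgg d v) : γ'.IsEgg d' (f.onV v) := by
  refine ⟨(hd v).trans h.1, h.2.imp (fun h => by rwa [f.genus_comm]) ?_⟩
  rintro ⟨e, he⟩
  refine ⟨f.onE e, fun c => ?_⟩
  obtain ⟨c, rfl⟩ := (f.onEnd e).surjective c
  rw [← f.onH_end, f.vert_onH, he]

end MGraph

namespace ModularCollection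

variable {k : Type*} [Field k] {P : ModularCollection k}

/-- `map`, along an equality of genera. -/
def castMap {g g' : ℕ} {X Y : Type} {i : ℕ} (h : g = g') (σ : X ≃ Y) : P.A g X i →ₗ[k] P.A g' Y i :=
  h ▸ P.map σ

theorem castMap_rel {g g' : ℕ} {X Y : Type} {i : ℕ} (h : g = g') (σ : X ≃ Y) (a : P.A g X i) :
    Rel σ a (castMap h σ a) := by
  subst h; exact ⟨rfl, rfl, rfl⟩

end ModularCollection

namespace WeakModularOperad

open MGraph ModularCollection

variable {k : Type*} [Field k] {W : WeakModularOperad k}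

namespace Generators

variable (U : W.Generators)

/-- The generator in degree zero, and zero in other degrees. -/
def unit (g : ℕ) (Y : Type) : ∀ i, W.A g Y i
  | 0 => U.u g Y
  | _ + 1 => 0

/-- The coordinate in degree zero. -/
def coef {g : ℕ} {Y : Type} : ∀ {i}, W.A g Y i →ₗ[k] k
  | 0 => U.t g Y
  | _ + 1 => 0

/-- The label is a given multiple of the generator. -/
def IsMul {g : ℕ} {Y : Type} {i : ℕ} (s : k) (a : W.A g Y i) : Prop := a = s • U.unit g Y i

variable {U}

theorem isMul_coef {g : ℕ} {Y : Type} [Finite Y] {i : ℕ} (hi : i = 0) (a : W.A g Y i) :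
    U.IsMul (U.coef a) a := by
  subst hi; exact U.eq_smul g Y a

theorem unit_rel {g g' : ℕ} {Y Y' : Type} {i i' : ℕ} (hg : g = g') (hi : i = i') (σ : Y ≃ Y') :
    Rel σ (U.unit g Y i) (U.unit g' Y' i') := by
  subst hg; subst hi
  refine ⟨rfl, rfl, ?_⟩
  cases i with
  | zero => exact (U.map_u g Y Y' σ).symm
  | succ i => exact (map_zero (W.map σ)).symm

theorem IsMul.of_rel {g g' : ℕ} {Y Y' : Type} {i i' : ℕ} {σ : Y ≃ Y'} {s : k} {a : W.A g Y i}
    {b : W.A g' Y' i'} (ha : U.IsMul s a) (h : Rel σ a b) : U.IsMul s b := by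
  rw [IsMul] at ha
  subst ha
  obtain ⟨hg, hi, h'⟩ := h
  exact Rel.eq ⟨hg, hi, h'⟩ ((unit_rel hg hi σ).smul s)

theorem IsMul.of_same {Z : Type} {g g' : ℕ} {Y Y' : Type} {i i' : ℕ} {j : Y → Z} {j' : Y' → Z}
    {s : k} {a : W.A g Y i} {b : W.A g' Y' i'} (ha : U.IsMul s a) (h : SameLabel j a j' b) :
    U.IsMul s b := ha.of_rel h.choose_spec.2

theorem IsMul.same {Z : Type} {g g' : ℕ} {Y Y' : Type} {i i' : ℕ} {j : Y → Z} {j' : Y' → Z}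
    {s : k} {a : W.A g Y i} {b : W.A g' Y' i'} (ha : U.IsMul s a) (hb : U.IsMul s b)
    (hg : g = g') (hi : i = i') (hj : Function.Injective j) (hj' : Function.Injective j')
    (h : Set.range j = Set.range j') : SameLabel j a j' b := by
  obtain ⟨σ, hσ⟩ := SubQuotient.exists_equiv hj hj' h
  rw [ha, hb]
  exact ⟨σ, hσ, (unit_rel hg hi σ).smul s⟩

/-- If the generator of the larger genus is nonzero, the coordinate of `a` is exactly `s`. If it is
zero, the coordinate is arbitrary, but then `u_eq_zero` says that the generator with two more legs
is zero too and both sides vanish. -/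
theorem isMul_coef_unit {g g' : ℕ} {Y Y' : Type} [Finite Y] {i i' : ℕ} (hi : i = 0) (hi' : i' = 0)
    (hg : g = g' + 1) (e : Y ⊕ Bool ≃ Y') {s : k} {a : W.A g Y i} (ha : U.IsMul s a) :
    U.IsMul s (U.coef a • U.unit g' Y' i') := by
  subst hi; subst hi'; subst hg
  rw [IsMul] at ha
  subst ha
  change U.t _ _ (s • U.u _ _) • U.u _ _ = s • U.u _ _
  by_cases h : U.u (g' + 1) Y = 0
  · rw [← U.map_u g' _ _ e, U.u_eq_zero g' Y h, map_zero, smul_zero, smul_zero]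
  · rw [map_smul, U.t_u _ _ h, smul_eq_mul, mul_one]

variable (U) {X : Type}

/-- The labels of the graph with a tadpole. -/
def addMap (γ : MGraph X) (v : γ.V) (d : γ.V → ℕ) (w : γ.V) :
    W.A (γ.genus w) (γ.Flag w) (d w) →ₗ[k]
      W.A ((γ.addTadpole v).genus w) ((γ.addTadpole v).Flag w) (d w) :=
  if h : w = v then (LinearMap.toSpanSingleton k _ (U.unit _ _ (d w))).comp U.coef
    else castMap (Function.update_of_ne h _ _).symm (γ.addFlag v h)

/-- The labels of the graph with a tadpole. -/
def addLabels (γ : MGraph X) (v : γ.V) (d : γ.V → ℕ) (a : W.toModularCollection.Labels γ d) :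
    W.toModularCollection.Labels (γ.addTadpole v) d := fun w => U.addMap γ v d w (a w)

variable {U} {γ : MGraph X} {v : γ.V} {d : γ.V → ℕ} (a : W.toModularCollection.Labels γ d)

theorem addLabels_same {w : γ.V} (hw : w ≠ v) : SameLabel ((γ.addSQ v).flag w) (a w)
    (Subtype.val : (γ.addTadpole v).Flag w → _) (U.addLabels γ v d a w) := by
  have : U.addMap γ v d w = castMap (Function.update_of_ne hw _ _).symm (γ.addFlag v hw) := dif_neg hw
  rw [addLabels, this]
  exact ⟨γ.addFlag v hw, fun _ => rfl, castMap_rel _ _ _⟩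

variable {a} in
theorem addLabels_isMul [Finite X] (hd : d v = 0) (hv : 0 < γ.genus v) {s : k}
    (ha : U.IsMul s (a v)) : U.IsMul s (U.addLabels γ v d a v) := by
  have : U.addMap γ v d v = (LinearMap.toSpanSingleton k _ (U.unit _ _ (d v))).comp U.coef :=
    dif_pos rfl
  rw [addLabels, this]
  have := γ.finite_flag v
  refine isMul_coef_unit hd hd ?_ (γ.addFlagSelf v) ha
  rw [addTadpole_genus_self]
  omega

/-- At the vertex `v` both labels are the same multiple of generators, and generators are preserved
by every bijection. At the other vertices nothing has changed. -/
theorem addLabels_match [Finite X] {Y : Type} {γ' : MGraph Y} {σ : X ≃ Y} (f : GIso γ γ' σ)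
    {d' : γ'.V → ℕ} {hd : ∀ v, d' (f.onV v) = d v} {a' : W.toModularCollection.Labels γ' d'}
    (h : W.toModularCollection.LabelsMatch f hd a a') (h0 : d v = 0) (hv : 0 < γ.genus v) :
    W.toModularCollection.LabelsMatch (f.addTadpole v) hd (U.addLabels γ v d a)
      (U.addLabels γ' (f.onV v) d' a') := by
  intro w
  have key : Rel ((f.addTadpole v).onFlag w) (U.addLabels γ v d a w)
      (U.addLabels γ' (f.onV v) d' a' (f.onV w)) := by
    by_cases hw : w = v
    · have := γ.finite_flag v
      have := Finite.of_equiv _ σ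
      have h1 := isMul_coef (U := U) h0 (a v)
      have h2 := addLabels_isMul h0 hv h1
      have h3 := addLabels_isMul (U := U) (a := a') (v := f.onV v) ((hd v).trans h0)
        (by rwa [f.genus_comm]) (h1.of_same (h.same v))
      rw [hw, h2, h3]
      exact (unit_rel ((f.addTadpole v).genus_comm v).symm (hd v).symm _).smul _
    · have hw' : f.onV w ≠ f.onV v := fun h => hw (f.onV.injective h)
      have h1 := ((addLabels_same (U := U) a hw).symm.comp (f.addTadpole v).onH)
      have h2 := ((h.same w).comp (γ'.addSQ (f.onV v)).ι).trans (addLabels_same (U := U) a' hw')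
      have h3 : (f.addTadpole v).onH ∘ (γ.addSQ v).flag w
          = (γ'.addSQ (f.onV v)).ι ∘ f.onH ∘ Subtype.val :=
        funext fun h => f.addTadpole_onH h.1
      rw [h3] at h1
      exact (h1.trans h2).rel Subtype.val_injective _ fun _ => rfl
  obtain ⟨_, _, h⟩ := key
  exact h

/-! ### The homotopy -/

variable (U) in
/-- The homotopy, without a normalization. -/
def addSum (φ : W.Cochain X) : W.Cochain X := fun γ d a =>
  ∑ v, if d v = 0 ∧ 0 < γ.genus v then φ (γ.addTadpole v) d (U.addLabels γ v d a) else 0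

variable (U) in
/-- The homotopy, normalized by the number of eggs. -/
def homotopy (φ : W.Cochain X) : W.Cochain X := fun γ d a =>
  (Nat.card {v // γ.IsEgg d v} : k)⁻¹ * U.addSum φ γ d a

theorem homotopy_mem_ft [Finite X] {g : ℕ} {D : ℤ} {φ : W.Cochain X} (hφ : φ ∈ W.ft g X (D + 1)) :
    U.homotopy φ ∈ W.ft g X D := by
  refine ⟨fun γ d => ?_, fun γ d a ha => ?_, fun γ γ' f d d' hd a a' h => ?_⟩
  · choose m hm using fun v => hφ.1 (γ.addTadpole v) d
    refine ⟨(Nat.card {v // γ.IsEgg d v} : k)⁻¹ • ∑ v, if d v = 0 ∧ 0 < γ.genus v then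
      (m v).compLinearMap (U.addMap γ v d) else 0, fun a => ?_⟩
    rw [smul_apply, sum_apply, homotopy, addSum, smul_eq_mul]
    refine congrArg _ (Finset.sum_congr rfl fun v _ => ?_)
    by_cases hv : d v = 0 ∧ 0 < γ.genus v
    · rw [if_pos hv, if_pos hv, hm]; rfl
    · rw [if_neg hv, if_neg hv]; rfl
  · obtain ⟨v, -, hv⟩ := Finset.exists_ne_zero_of_sum_ne_zero (right_ne_zero_of_mul ha)
    by_cases h : d v = 0 ∧ 0 < γ.genus v
    swap
    · exact absurd (if_neg h) hv
    rw [if_pos h] at hv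
    obtain ⟨h1, h2, h3⟩ := hφ.2.1 _ _ _ hv
    have h1' := (addTadpole_isModular h.2).1 h1
    refine ⟨h1', by rw [← h2, addTadpole_totalGenus h1'.connected h.2], ?_⟩
    have h4 : Fintype.card (γ.addTadpole v).E = Fintype.card γ.E + 1 :=
      Fintype.card_option (α := γ.E)
    rw [h4] at h3
    push_cast at h3
    linarith
  · have h1 : Nat.card {v // γ'.IsEgg d' v} = Nat.card {v // γ.IsEgg d v} := by
      refine (Nat.card_congr (f.onV.subtypeEquiv fun v => ⟨f.isEgg hd, fun h => ?_⟩)).symm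
      have := f.symm.isEgg (d' := d) (fun v => by
        rw [← hd]; exact congrArg d' (f.onV.apply_symm_apply v)) h
      simpa [GIso.symm] using this
    rw [homotopy, homotopy, h1, ← mul_smul_comm]
    refine congrArg _ ?_
    rw [addSum, addSum, ← Equiv.sum_comp f.onV, Finset.smul_sum]
    refine Finset.sum_congr rfl fun v _ => ?_
    rw [hd, f.genus_comm]
    by_cases hv : d v = 0 ∧ 0 < γ.genus v
    · rw [if_pos hv, if_pos hv, hφ.2.2 _ _ (f.addTadpole v) d d' hd _ _
        (addLabels_match a f h hv.1 hv.2), f.addTadpole_edgeSign]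
      rfl
    · rw [if_neg hv, if_neg hv, smul_zero]

/-- The homotopy only adds tadpoles at vertices of degree zero and positive genus, and these are
already eggs. -/
theorem homotopy_mem [Finite X] {g : ℕ} {D : ℤ} {φ : W.Cochain X} (hφ : φ ∈ W.ft g X (D + 1)) :
    U.homotopy φ ∈ W.eggs g X D := by
  refine ⟨homotopy_mem_ft hφ, fun γ d a h => ?_⟩
  refine (congrArg _ (Finset.sum_eq_zero fun v _ => if_neg fun hv => ?_)).trans (mul_zero _)
  exact h ⟨v, hv.1, Or.inl hv.2⟩

end Generators

end WeakModularOperad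

namespace SubQuotient

variable {X Y Z : Type} {β β' : MGraph Y} {γ : MGraph X} (b : SubQuotient β γ)
  (b' : SubQuotient β' γ)

/-- Multiples of generators depend only on the set of half-edges at a vertex, so this equality is
what is needed to compare labels of degree zero in two subquotients. -/
theorem range_flag_eq (fV : β.V ≃ β'.V) (hV : ∀ v x, b.cell v x → b'.cell (fV v) x)
    (hE : Set.range b.emb = Set.range b'.emb) (hσ : ∀ y, b'.leg y = b.leg y) (v : β.V) :
    Set.range (b.flag v) = Set.range (b'.flag (fV v)) := by
  have hends : ∀ q, q ∈ Set.range b.ends ↔ q ∈ Set.range b'.ends := fun q => by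
    rw [mem_range_ends, mem_range_ends, hE]
  have key : ∀ h h', b.ι h = b'.ι h' → b'.vert_mem h' = b'.vert_mem h' → β'.vert h' = fV (β.vert h) :=
    fun h h' hh _ => b'.disjoint _ _ _ (b'.vert_mem h')
      (by have := hV _ _ (b.vert_mem h); change b'.cell _ (γ.vert (b.ι h)) at this; rwa [hh] at this)
  ext z
  constructor
  · rintro ⟨⟨h, rfl⟩, rfl⟩
    obtain ⟨h', hh⟩ : ∃ h', b.ι h = b'.ι h' := by
      rcases h with p | y
      · obtain ⟨q, hq⟩ := (hends _).1 ⟨p, rfl⟩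
        exact ⟨Sum.inl q, congrArg Sum.inl hq.symm⟩
      · exact ⟨Sum.inr y, (hσ y).symm⟩
    exact ⟨⟨h', key h h' hh rfl⟩, hh.symm⟩
  · rintro ⟨⟨h', hv⟩, rfl⟩
    obtain ⟨h, hh⟩ : ∃ h, b.ι h = b'.ι h' := by
      rcases h' with p | y
      · obtain ⟨q, hq⟩ := (hends _).2 ⟨p, rfl⟩
        exact ⟨Sum.inl q, congrArg Sum.inl hq⟩
      · exact ⟨Sum.inr y, (hσ y).symm⟩
    exact ⟨⟨h, fV.injective ((key h h' hh rfl).symm.trans hv)⟩, hh⟩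

end SubQuotient

/-! ### Contraction of a tadpole -/

namespace MGraph

variable {X : Type} (γ : MGraph X) {e : γ.E} {x₀ : γ.V} (he : γ.IsTadpoleAt e x₀)

section

include he

theorem touched_tadpole {x : γ.V} : γ.Touched {e} x ↔ x = x₀ := by
  constructor
  · rintro ⟨f, hf, c, rfl⟩
    rw [Finset.mem_singleton.1 hf]; exact he c
  · rintro rfl
    exact ⟨e, Finset.mem_singleton_self e, false, he false⟩

theorem isConnectedSubset_tadpole : γ.IsConnectedSubset {e} :=
  ⟨⟨e, Finset.mem_singleton_self e⟩, fun u v hu hv => by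
    rw [(γ.touched_tadpole he).1 hu, (γ.touched_tadpole he).1 hv]; exact Joined.refl γ _ _⟩

theorem cproj_tadpole : γ.cproj {e} x₀ = γ.cBot {e} :=
  γ.cproj_of_touched _ ((γ.touched_tadpole he).2 rfl)

theorem cproj_of_ne_tadpole {x : γ.V} (hx : x ≠ x₀) :
    γ.cproj {e} x = γ.cCoe {e} x (fun h => hx ((γ.touched_tadpole he).1 h)) :=
  γ.cproj_of_not_touched _ _

/-- A tadpole touches only one vertex, so its contraction does not identify vertices. It just
increases the genus of this vertex by one and removes the edge. -/
theorem cproj_tadpole_bijective : Function.Bijective (γ.cproj {e}) := by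
  refine ⟨fun x y h => ?_, γ.cproj_surjective _ ⟨e, Finset.mem_singleton_self e⟩⟩
  by_cases hy : y = x₀
  · rw [hy, γ.cproj_tadpole he, cproj_eq_cBot, γ.touched_tadpole he] at h
    rw [h, hy]
  · rw [γ.cproj_of_ne_tadpole he hy, cproj_eq_cCoe] at h
    exact h

theorem sum_sub_tadpole (F : γ.V → ℕ) : ∑ v : (γ.sub {e}).V, F (γ.sVal {e} v) = F x₀ := by
  classical
  rw [γ.sum_sub_ite {e} _ F (fun _ _ => rfl)]
  simp [γ.touched_tadpole he]

theorem contractDeg_tadpole (d : γ.V → ℕ) (x : γ.V) : γ.contractDeg {e} d (γ.cproj {e} x) = d x := by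
  by_cases hx : x = x₀
  · rw [hx, γ.cproj_tadpole he, contractDeg_cBot, γ.sum_sub_tadpole he, card_sub_E,
      Finset.card_singleton, Nat.add_sub_cancel]
  · rw [γ.cproj_of_ne_tadpole he hx, contractDeg_cCoe]

theorem genus_tadpole : (γ.contract {e}).genus (γ.cproj {e} x₀) = γ.genus x₀ + 1 := by
  have h1 : ∑ v : (γ.sub {e}).V, (γ.sub {e}).genus v = γ.genus x₀ := γ.sum_sub_tadpole he γ.genus
  have h2 : Fintype.card (γ.sub {e}).V = 1 := by
    have := γ.sum_sub_tadpole he (fun _ => 1)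
    simpa using this
  rw [γ.cproj_tadpole he, genus_cBot]
  unfold totalGenus
  rw [h1, h2, card_sub_E, Finset.card_singleton]
  omega

theorem genus_of_ne_tadpole {x : γ.V} (hx : x ≠ x₀) :
    (γ.contract {e}).genus (γ.cproj {e} x) = γ.genus x := by
  rw [γ.cproj_of_ne_tadpole he hx, genus_cCoe]

/-- The only touched vertex has even degree and the factor `|S| - 1` is zero. What remains is moving
`e` past the edges that precede it. -/
theorem contractSign_tadpole {d : γ.V → ℕ} (hd : d x₀ = 0) :
    γ.contractSign {e} d = (-1) ^ Nat.card {f : γ.E // f < e} := by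
  have h1 : IsEmpty {p : γ.V × γ.V // ¬ γ.Touched {e} p.1 ∧ γ.Touched {e} p.2 ∧ p.1 < p.2 ∧
      Odd (d p.1) ∧ Odd (d p.2)} := ⟨fun p => by
    have := p.2.2.2.2.2
    rw [(γ.touched_tadpole he).1 p.2.2.1, hd] at this
    exact absurd this (by simp)⟩
  rw [contractSign, Nat.card_of_isEmpty, Finset.card_singleton, Nat.sub_self, mul_zero, zero_add,
    add_zero]
  congr 1
  refine Nat.card_congr ⟨fun p => ⟨p.1.1, p.2.2.2.trans_eq (Finset.mem_singleton.1 p.2.2.1)⟩,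
    fun f => ⟨(f.1, e), fun h => f.2.ne (Finset.mem_singleton.1 h), Finset.mem_singleton_self e, f.2⟩,
    fun p => ?_, fun _ => rfl⟩
  exact Subtype.ext (Prod.ext rfl (Finset.mem_singleton.1 p.2.2.1).symm)

/-- The contraction moves `x₀` to the first place, but its degree is zero and does not matter for
Koszul signs. All other vertices keep their order. -/
theorem lt_of_odd_tadpole {d : γ.V → ℕ} (hd : d x₀ = 0) {x y : γ.V} (h : x < y) (hx : Odd (d x))
    (hy : Odd (d y)) : γ.cproj {e} x < γ.cproj {e} y := by
  have hne : ∀ {z}, Odd (d z) → z ≠ x₀ := by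
    rintro z hz rfl
    rw [hd] at hz
    exact absurd hz (by simp)
  rw [γ.cproj_of_ne_tadpole he (hne hx), γ.cproj_of_ne_tadpole he (hne hy)]
  exact (γ.cCoe_lt_cCoe {e}).2 h

theorem lt_of_cproj_lt_tadpole {d : γ.V → ℕ} (hd : d x₀ = 0) {x y : γ.V}
    (h : γ.cproj {e} x < γ.cproj {e} y) (hx : Odd (d x)) (hy : Odd (d y)) : x < y := by
  have hne : ∀ {z}, Odd (d z) → z ≠ x₀ := by
    rintro z hz rfl
    rw [hd] at hz
    exact absurd hz (by simp)
  rw [γ.cproj_of_ne_tadpole he (hne hx), γ.cproj_of_ne_tadpole he (hne hy)] at h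
  exact (γ.cCoe_lt_cCoe {e}).1 h

end

/-- The contraction of a graph with a tadpole added, before and after the addition. -/
def addContractSQ (S : Finset γ.E) (v : γ.V) :
    SubQuotient ((γ.contract S).addTadpole (γ.cproj S v)) (γ.addTadpole v) where
  cell u x := γ.cproj S x = u
  emb := WithBot.map (γ.cEVal S)
  ends p := (WithBot.map (γ.cEVal S) p.1, p.2)
  leg := Sum.inr
  ends_fst _ := rfl
  injective := by
    have h : Function.Injective (WithBot.map (γ.cEVal S)) :=
      Option.map_injective (γ.contractSQ S).emb_injective
    rintro (⟨e, c⟩ | x) (⟨e', c'⟩ | x') hh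
    · have := Sum.inl_injective hh
      rw [Prod.mk.injEq] at this
      exact congrArg Sum.inl (Prod.ext (h this.1) this.2)
    · cases hh
    · cases hh
    · exact congrArg Sum.inr (Sum.inr_injective hh)
  vert_mem h := by
    rcases h with ⟨e, c⟩ | x
    · induction e using WithBot.recBotCoe <;> rfl
    · rfl
  disjoint _ _ _ h h' := h.symm.trans h'

/-- The addition of a tadpole to the contraction of a tadpole. -/
def contractAddSQ :
    SubQuotient ((γ.contract {e}).addTadpole (γ.cproj {e} x₀)) γ where
  cell u x := γ.cproj {e} x = u
  emb := WithBot.recBotCoe e (γ.cEVal {e})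
  ends p := (WithBot.recBotCoe e (γ.cEVal {e}) p.1, p.2)
  leg := Sum.inr
  ends_fst _ := rfl
  injective := by
    have h : Function.Injective (WithBot.recBotCoe e (γ.cEVal {e}) : WithBot _ → γ.E) := by
      intro f f' h
      induction f using WithBot.recBotCoe with
      | bot =>
        induction f' using WithBot.recBotCoe with
        | bot => rfl
        | coe f' => exact absurd (Finset.mem_singleton.2 h.symm) (γ.cEVal_notMem {e} f')
      | coe f =>
        induction f' using WithBot.recBotCoe with
        | bot => exact absurd (Finset.mem_singleton.2 h) (γ.cEVal_notMem {e} f)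
        | coe f' => exact congrArg WithBot.some ((γ.contractSQ {e}).emb_injective h)
    rintro (⟨e, c⟩ | x) (⟨e', c'⟩ | x') hh
    · have := Sum.inl_injective hh
      rw [Prod.mk.injEq] at this
      exact congrArg Sum.inl (Prod.ext (h this.1) this.2)
    · cases hh
    · cases hh
    · exact congrArg Sum.inr (Sum.inr_injective hh)
  vert_mem h := by
    rcases h with ⟨f, c⟩ | x
    · induction f using WithBot.recBotCoe with
      | bot => exact congrArg (γ.cproj {e}) (he c)
      | coe f => rfl
    · rfl
  disjoint _ _ _ h h' := h.symm.trans h'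

end MGraph

namespace WeakModularOperad

open MGraph ModularCollection

variable {k : Type*} [Field k] {W : WeakModularOperad k}

namespace Generators

variable {U : W.Generators} {X : Type}

/-- A relaxed form of `ft_apply_eq`. Labels may also agree by being the same multiple of generators,
because these are invariant under all bijections. Only the order of the vertices of odd degree has
to be preserved. -/
theorem ft_apply_eq_of_isMul {g : ℕ} {D : ℤ} {φ : W.Cochain X} (hφ : φ ∈ W.ft g X D) {Z : Type}
    {β β' : MGraph X} {γ : MGraph Z} (b : SubQuotient β γ) (b' : SubQuotient β' γ)
    (fV : β.V ≃ β'.V) (hV : ∀ v x, b.cell v x → b'.cell (fV v) x)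
    (hE : Set.range b.emb = Set.range b'.emb) (hσ : ∀ y, b'.leg y = b.leg y)
    {d : β.V → ℕ} {d' : β'.V → ℕ} (a : W.toModularCollection.Labels β d)
    (a' : W.toModularCollection.Labels β' d') (hd : ∀ v, d' (fV v) = d v)
    (hg : ∀ v, β'.genus (fV v) = β.genus v)
    (ha : ∀ v, SameLabel (b.flag v) (a v) (b'.flag (fV v)) (a' (fV v)) ∨
      ∃ s, U.IsMul s (a v) ∧ U.IsMul s (a' (fV v)))
    (hmono : ∀ u v, u < v → Odd (d u) → Odd (d v) → fV u < fV v) :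
    ∃ f : MGraph.GIso β β' (Equiv.refl X), (∀ e, b'.emb (f.onE e) = b.emb e) ∧
      φ β' d' a' = f.edgeSign Finset.univ • φ β d a := by
  obtain ⟨f, h1, h2, h3⟩ := ft_apply_eq hφ b b' fV hV hE hσ a a' (fun v =>
    (ha v).elim id fun ⟨s, h, h'⟩ => h.same h' (hg v).symm (hd v).symm (b.flag_injective v)
      (b'.flag_injective _) (b.range_flag_eq b' fV hV hE hσ v))
  rw [f.vertexSign_eq_one d (fun u v h hu hv => by rw [h1]; exact hmono u v h hu hv), one_mul] at h3
  exact ⟨f, h2, h3⟩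

variable {γ : MGraph X} {d : γ.V → ℕ} {a : W.toModularCollection.Labels γ d}

/-- The operation of a tadpole graph preserves coordinates. -/
theorem contractLabels_isMul_tadpole {e : γ.E} {x₀ : γ.V} (he : γ.IsTadpoleAt e x₀)
    (hγ : γ.IsModular) (h0 : d x₀ = 0) {s : k} (ha : U.IsMul s (a x₀)) :
    U.IsMul s (contractLabels W.μ γ {e} d a (γ.cBot {e})) := by
  refine IsMul.of_same ?_ (contractLabels_cBot W.μ γ {e} d a)
  have hx := (γ.touched_tadpole he).2 rfl
  let f : GIso (tadpoleGraph (γ.genus x₀) (γ.SubLeg {e})) (γ.sub {e}) (Equiv.refl _) :=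
    GIso.ofEnds (G' := γ.sub {e})
      (Equiv.ofBijective (fun _ => γ.sV {e} x₀ hx) ⟨fun _ _ _ => rfl, fun v =>
        ⟨(), γ.sVal_injective {e} ((γ.touched_tadpole he).1 (γ.sVal_touched {e} v)).symm⟩⟩)
      (Equiv.ofBijective (fun _ => γ.sE {e} e (Finset.mem_singleton_self e)) ⟨fun _ _ _ => rfl,
        fun f => ⟨(), (γ.subSQ {e}).emb_injective (Finset.mem_singleton.1 (γ.sEVal_mem {e} f)).symm⟩⟩)
      (fun _ => Equiv.refl _) (fun _ c => γ.sVal_injective {e} (he c))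
      (fun l => γ.sVal_injective {e} ((γ.touched_tadpole he).1 (γ.sVal_touched {e} _))) (fun _ => rfl)
  have hmod := f.symm.isModular (γ.sub_isModular {e} hγ (γ.isConnectedSubset_tadpole he))
  have h1 := W.equivariant _ _ _ f hmod ⟨()⟩ (fun _ => 0) (fun v => d (γ.sVal {e} v)) (fun _ => h0)
    (fun v => s • U.unit _ _ 0) (subLabels γ {e} d a) (fun v => by
      have h2 : subLabels γ {e} d a (f.onV v) = s • U.unit _ _ _ :=
        ha.of_same (subLabels_same γ {e} d a x₀ hx)
      rw [h2]
      obtain ⟨_, _, h⟩ := (unit_rel (U := U) (f.genus_comm v).symm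
        (h0.symm : 0 = d (γ.sVal {e} (f.onV v))) (f.onFlag v)).smul s
      exact h) f.totalGenus_eq (by
        change ∑ _ : Unit, 0 + Fintype.card Unit - 1 = _
        rw [γ.sum_sub_tadpole he, card_sub_E, Finset.card_singleton, h0]
        simp)
  rw [f.vertexSign_eq_one _ (fun _ _ _ h => absurd h (by simp)),
    f.edgeSign_eq_one _ (fun _ _ h => absurd h (lt_irrefl _)), mul_one, one_smul,
    MultilinearMap.map_smul_univ, Fintype.prod_subsingleton _ ()] at h1
  have h2 := ((U.tadpole (γ.genus x₀) (γ.SubLeg {e}) hmod).smul s).symm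
  have h3 : U.IsMul s (s • U.u (γ.genus x₀ + 1) (γ.SubLeg {e})) := rfl
  exact (h3.of_rel h2).of_rel ⟨_, _, h1⟩

theorem contractLabels_isMul {e : γ.E} {x₀ : γ.V} (he : γ.IsTadpoleAt e x₀)
    (hγ : γ.IsModular) (h0 : d x₀ = 0) {s : k} {x : γ.V} (ha : U.IsMul s (a x)) :
    U.IsMul s (contractLabels W.μ γ {e} d a (γ.cproj {e} x)) := by
  by_cases hx : x = x₀
  · subst hx
    rw [γ.cproj_tadpole he]
    exact contractLabels_isMul_tadpole he hγ h0 ha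
  · rw [γ.cproj_of_ne_tadpole he hx]
    exact ha.of_same (contractLabels_cCoe W.μ γ {e} d a x _)

theorem contractLabels_same {e : γ.E} {x₀ : γ.V} (he : γ.IsTadpoleAt e x₀) {x : γ.V} (hx : x ≠ x₀) :
    SameLabel (Subtype.val : γ.Flag x → γ.H) (a x) ((γ.contractSQ {e}).flag (γ.cproj {e} x))
      (contractLabels W.μ γ {e} d a (γ.cproj {e} x)) := by
  rw [γ.cproj_of_ne_tadpole he hx]
  exact contractLabels_cCoe W.μ γ {e} d a x _

variable [Finite X]

theorem addLabels_isMul' {v x : γ.V} (h0 : d v = 0) (hv : 0 < γ.genus v) {s : k}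
    (ha : U.IsMul s (a x)) : U.IsMul s (U.addLabels γ v d a x) := by
  by_cases hx : x = v
  · subst hx; exact addLabels_isMul h0 hv ha
  · exact ha.of_same (addLabels_same a hx)

omit [Finite X] in
theorem bot_isTadpoleAt (v : γ.V) : (γ.addTadpole v).IsTadpoleAt (⊥ : WithBot γ.E) v := fun _ => rfl

variable {g : ℕ} {D : ℤ} {φ : W.Cochain X} (hφ : φ ∈ W.ft g X D)

include hφ

/-- The contraction of the new tadpole. -/
theorem contract_addTadpole (hγ : γ.IsModular) {v : γ.V} (h0 : d v = 0) (hv : 0 < γ.genus v) :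
    φ ((γ.addTadpole v).contract {(⊥ : WithBot γ.E)})
      ((γ.addTadpole v).contractDeg {(⊥ : WithBot γ.E)} d)
      (contractLabels W.μ (γ.addTadpole v) {(⊥ : WithBot γ.E)} d (U.addLabels γ v d a)) = φ γ d a := by
  have he := bot_isTadpoleAt (γ := γ) v
  have hmod := (addTadpole_isModular hv).2 hγ
  obtain ⟨f, h1, h2⟩ := ft_apply_eq_of_isMul (U := U) hφ (γ.addSQ v)
    ((γ.addTadpole v).contractSQ {(⊥ : WithBot γ.E)})
    (Equiv.ofBijective _ ((γ.addTadpole v).cproj_tadpole_bijective he))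
    (by rintro u x rfl; rfl)
    (by
      rw [range_contractSQ_emb]
      ext e
      induction e using WithBot.recBotCoe with
      | bot => simp [addSQ]
      | coe e => simp [addSQ])
    (fun _ => rfl) a (contractLabels W.μ (γ.addTadpole v) {(⊥ : WithBot γ.E)} d (U.addLabels γ v d a))
    (fun x => (γ.addTadpole v).contractDeg_tadpole he d x)
    (fun x => by
      by_cases hx : x = v
      · rw [hx]
        refine ((γ.addTadpole v).genus_tadpole he).trans ?_
        rw [addTadpole_genus_self]
        omega
      · exact ((γ.addTadpole v).genus_of_ne_tadpole he hx).trans (addTadpole_genus_of_ne hx))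
    (fun x => by
      by_cases hx : d x = 0
      · right
        have := γ.finite_flag x
        exact ⟨_, isMul_coef hx (a x), contractLabels_isMul he hmod h0
          (addLabels_isMul' h0 hv (isMul_coef hx (a x)))⟩
      · left
        have hx' : x ≠ v := fun h => hx (h ▸ h0)
        exact (addLabels_same (U := U) a hx').trans (contractLabels_same he hx'))
    (fun x y h hx hy => (γ.addTadpole v).lt_of_odd_tadpole he h0 h hx hy)
  rw [h2, f.edgeSign_eq_one _ (onE_strictMono (γ.addSQ v) _ f h1 (fun _ _ h => WithBot.coe_lt_coe.2 h)
    (fun _ _ h => h)), one_smul]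

/-- The contraction of another tadpole commutes with the addition of a tadpole. -/
theorem contract_addTadpole_of_ne (hγ : γ.IsModular) {v : γ.V} (h0 : d v = 0) (hv : 0 < γ.genus v)
    {e : γ.E} {x₀ : γ.V} (he : γ.IsTadpoleAt e x₀) (hx₀ : d x₀ = 0) :
    φ ((γ.addTadpole v).contract {(e : WithBot γ.E)})
      ((γ.addTadpole v).contractDeg {(e : WithBot γ.E)} d)
      (contractLabels W.μ (γ.addTadpole v) {(e : WithBot γ.E)} d (U.addLabels γ v d a))
    = φ ((γ.contract {e}).addTadpole (γ.cproj {e} v)) (γ.contractDeg {e} d)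
      (U.addLabels (γ.contract {e}) (γ.cproj {e} v) (γ.contractDeg {e} d)
        (contractLabels W.μ γ {e} d a)) := by
  have he' : (γ.addTadpole v).IsTadpoleAt (e : WithBot γ.E) x₀ := he
  have hmod := (addTadpole_isModular hv).2 hγ
  have hbij := (γ.addTadpole v).cproj_tadpole_bijective he'
  have hbij' := γ.cproj_tadpole_bijective he
  have hv0 : γ.contractDeg {e} d (γ.cproj {e} v) = 0 := (γ.contractDeg_tadpole he d v).trans h0
  have hvg : 0 < (γ.contract {e}).genus (γ.cproj {e} v) := by
    by_cases hx : v = x₀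
    · rw [hx, γ.genus_tadpole he]; omega
    · rwa [γ.genus_of_ne_tadpole he hx]
  let fV : ((γ.addTadpole v).contract {(e : WithBot γ.E)}).V ≃ (γ.contract {e}).V :=
    (Equiv.ofBijective _ hbij).symm.trans (Equiv.ofBijective _ hbij')
  have hfV : ∀ x : γ.V, fV ((γ.addTadpole v).cproj {(e : WithBot γ.E)} x) = γ.cproj {e} x := fun x =>
    congrArg (γ.cproj {e}) ((Equiv.ofBijective _ hbij).symm_apply_apply x)
  have hfin : Finite X := inferInstance
  obtain ⟨f, h1, h2⟩ := ft_apply_eq_of_isMul (U := U) hφ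
    ((γ.addTadpole v).contractSQ {(e : WithBot γ.E)}) (γ.addContractSQ {e} v) fV
    (by rintro u x rfl; exact (hfV x).symm)
    (by
      rw [range_contractSQ_emb]
      ext f
      induction f using WithBot.recBotCoe with
      | bot => simpa using ⟨⊥, rfl⟩
      | coe f =>
        constructor
        · intro hf
          have hf' : f ∉ ({e} : Finset γ.E) := fun h => hf (by simpa using h)
          exact ⟨((γ.cE {e} f hf' : (γ.contract {e}).E) : WithBot _), rfl⟩
        · rintro ⟨f', hf'⟩ hf
          induction f' using WithBot.recBotCoe with
          | bot => cases hf'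
          | coe f' =>
            have h3 : γ.cEVal {e} f' = f := WithBot.coe_inj.1 hf'
            refine γ.cEVal_notMem {e} f' ?_
            rw [h3]; simpa using hf)
    (fun _ => rfl)
    (contractLabels W.μ (γ.addTadpole v) {(e : WithBot γ.E)} d (U.addLabels γ v d a))
    (U.addLabels (γ.contract {e}) (γ.cproj {e} v) (γ.contractDeg {e} d) (contractLabels W.μ γ {e} d a))
    (fun u => by
      obtain ⟨x, rfl⟩ := hbij.2 u
      rw [hfV, (γ.addTadpole v).contractDeg_tadpole he', γ.contractDeg_tadpole he])
    (fun u => by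
      obtain ⟨x, rfl⟩ := hbij.2 u
      rw [hfV]
      by_cases hx : x = v
      · rw [hx]
        refine addTadpole_genus_self.trans ?_
        by_cases hx' : v = x₀
        · subst hx'
          rw [γ.genus_tadpole he]
          refine Eq.trans ?_ ((γ.addTadpole v).genus_tadpole he').symm
          rw [addTadpole_genus_self]
          omega
        · rw [γ.genus_of_ne_tadpole he hx']
          exact (((γ.addTadpole v).genus_of_ne_tadpole he' hx').trans addTadpole_genus_self).symm
      · refine (addTadpole_genus_of_ne fun h => hx (hbij'.1 h)).trans ?_
        by_cases hx' : x = x₀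
        · subst hx'
          rw [γ.genus_tadpole he]
          refine Eq.trans ?_ ((γ.addTadpole v).genus_tadpole he').symm
          rw [addTadpole_genus_of_ne (γ := γ) hx]
        · rw [γ.genus_of_ne_tadpole he hx']
          exact (((γ.addTadpole v).genus_of_ne_tadpole he' hx').trans
            (addTadpole_genus_of_ne hx)).symm)
    (fun u => by
      obtain ⟨x, rfl⟩ := hbij.2 u
      rw [hfV]
      by_cases hx : d x = 0
      · right
        have := γ.finite_flag x
        exact ⟨_, contractLabels_isMul he' hmod hx₀ (addLabels_isMul' h0 hv (isMul_coef hx (a x))),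
          addLabels_isMul' hv0 hvg (contractLabels_isMul he hγ hx₀ (isMul_coef hx (a x)))⟩
      · left
        have hx' : x ≠ v := fun h => hx (h ▸ h0)
        have hx'' : x ≠ x₀ := fun h => hx (h ▸ hx₀)
        have h3 := (addLabels_same (U := U) a hx').trans
          (contractLabels_same (W := W) (a := U.addLabels γ v d a) he' hx'')
        have h4 := (contractLabels_same (W := W) (a := a) he hx'').comp (γ.addSQ v).ι
        have h5 := (addLabels_same (U := U) (v := γ.cproj {e} v) (contractLabels W.μ γ {e} d a)
          (w := γ.cproj {e} x) fun h => hx' (hbij'.1 h)).comp (γ.addContractSQ {e} v).ι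
        have h6 : (γ.addSQ v).ι ∘ (γ.contractSQ {e}).flag (γ.cproj {e} x)
            = (γ.addContractSQ {e} v).ι ∘ ((γ.contract {e}).addSQ (γ.cproj {e} v)).flag
              (γ.cproj {e} x) := by
          funext h
          obtain ⟨h | h, -⟩ := h <;> rfl
        rw [h6] at h4
        exact (h3.symm.trans h4).trans h5)
    (fun u w h hu hw => by
      obtain ⟨x, rfl⟩ := hbij.2 u
      obtain ⟨y, rfl⟩ := hbij.2 w
      rw [(γ.addTadpole v).contractDeg_tadpole he'] at hu hw
      rw [hfV, hfV]
      exact γ.lt_of_odd_tadpole he hx₀ ((γ.addTadpole v).lt_of_cproj_lt_tadpole he' hx₀ h hu hw) hu hw)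
  rw [h2, f.edgeSign_eq_one _ (onE_strictMono _ (γ.addContractSQ {e} v) f h1 (fun _ _ h => h)
    (fun e e' h => ?_)), one_smul]
  induction e' using WithBot.recBotCoe with
  | bot => exact absurd h (WithBot.not_lt_bot (α := (γ.contract {_}).E) _)
  | coe e' =>
    induction e using WithBot.recBotCoe with
    | bot => exact WithBot.bot_lt_coe _
    | coe e => exact WithBot.coe_lt_coe.2 (WithBot.coe_lt_coe.1 h : e < e')

/-- The addition of a tadpole after the contraction of a tadpole at the same vertex. -/
theorem addTadpole_contract (hγ : γ.IsModular) {e : γ.E} {x₀ : γ.V} (he : γ.IsTadpoleAt e x₀)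
    (hx₀ : d x₀ = 0) :
    φ ((γ.contract {e}).addTadpole (γ.cproj {e} x₀)) (γ.contractDeg {e} d)
      (U.addLabels (γ.contract {e}) (γ.cproj {e} x₀) (γ.contractDeg {e} d)
        (contractLabels W.μ γ {e} d a)) = γ.contractSign {e} d • φ γ d a := by
  have hbij := γ.cproj_tadpole_bijective he
  have hv0 : γ.contractDeg {e} d (γ.cproj {e} x₀) = 0 := (γ.contractDeg_tadpole he d x₀).trans hx₀
  have hvg : 0 < (γ.contract {e}).genus (γ.cproj {e} x₀) := by
    rw [γ.genus_tadpole he]; omega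
  obtain ⟨f, h1, h2⟩ := ft_apply_eq_of_isMul (U := U) hφ (SubQuotient.refl γ) (γ.contractAddSQ he)
    (Equiv.ofBijective _ hbij) (by rintro u x rfl; rfl)
    (by
      refine (Set.range_id).trans (Set.range_eq_univ.2 fun f => ?_).symm
      by_cases hf : f = e
      · exact ⟨(⊥ : WithBot _), hf.symm⟩
      · exact ⟨((γ.cE {e} f (fun h => hf (Finset.mem_singleton.1 h)) : (γ.contract {e}).E) :
          WithBot _), rfl⟩)
    (fun _ => rfl) a
    (U.addLabels (γ.contract {e}) (γ.cproj {e} x₀) (γ.contractDeg {e} d) (contractLabels W.μ γ {e} d a))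
    (fun x => γ.contractDeg_tadpole he d x)
    (fun x => by
      by_cases hx : x = x₀
      · rw [hx]
        refine addTadpole_genus_self.trans ?_
        rw [γ.genus_tadpole he, Nat.add_sub_cancel]
      · exact (addTadpole_genus_of_ne fun h => hx (hbij.1 h)).trans (γ.genus_of_ne_tadpole he hx))
    (fun x => by
      by_cases hx : d x = 0
      · right
        have := γ.finite_flag x
        exact ⟨_, isMul_coef hx (a x), addLabels_isMul' hv0 hvg
          (contractLabels_isMul he hγ hx₀ (isMul_coef hx (a x)))⟩
      · left
        have hx' : x ≠ x₀ := fun h => hx (h ▸ hx₀)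
        have h4 := contractLabels_same (W := W) (a := a) he hx'
        have h5 := (addLabels_same (U := U) (v := γ.cproj {e} x₀) (contractLabels W.μ γ {e} d a)
          (w := γ.cproj {e} x) fun h => hx' (hbij.1 h)).comp (γ.contractAddSQ he).ι
        have h6 : (γ.contractSQ {e}).flag (γ.cproj {e} x)
            = (γ.contractAddSQ he).ι ∘ ((γ.contract {e}).addSQ (γ.cproj {e} x₀)).flag
              (γ.cproj {e} x) := by
          funext h
          obtain ⟨h | h, -⟩ := h <;> rfl
        rw [h6] at h4
        rw [SubQuotient.refl_flag]
        exact h4.trans h5)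
    (fun x y h hx hy => γ.lt_of_odd_tadpole he hx₀ h hx hy)
  rw [h2, γ.contractSign_tadpole he hx₀]
  congr 1
  unfold GIso.edgeSign
  congr 1
  -- The isomorphism moves `e` to the first place and keeps the order of the other edges. Its
  -- inversions are the pairs `(f', e)` with `f' < e`, which are also counted by the sign of the
  -- contraction of `e`.
  have hbot : ∀ f', f' = e → f.onE f' = (⊥ : WithBot _) := fun f' hf' =>
    (γ.contractAddSQ he).emb_injective ((h1 f').trans hf')
  have hcoe : ∀ f' (hf' : f' ≠ e), f.onE f' = ((γ.cE {e} f' (fun h => hf' (Finset.mem_singleton.1 h)) :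
      (γ.contract {e}).E) : WithBot _) := fun f' hf' =>
    (γ.contractAddSQ he).emb_injective (h1 f')
  have hp : ∀ p : γ.E × γ.E, p.1 < p.2 → f.onE p.2 < f.onE p.1 → p.2 = e := by
    intro p hp hp'
    by_contra hne
    rw [hcoe _ hne] at hp'
    by_cases h : p.1 = e
    · rw [hbot _ h] at hp'
      exact WithBot.not_lt_bot (α := (γ.contract {e}).E) _ hp'
    · rw [hcoe _ h] at hp'
      exact absurd hp (not_lt.2 (WithBot.coe_lt_coe.1 hp').le)
  refine Nat.card_congr ⟨fun p => ⟨p.1.1, p.2.2.2.1.trans_eq (hp p.1 p.2.2.2.1 p.2.2.2.2)⟩,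
    fun f' => ⟨(f'.1, e), Finset.mem_univ _, Finset.mem_univ _, f'.2, ?_⟩, fun p => ?_, fun _ => rfl⟩
  · change f.onE e < f.onE f'.1
    rw [hbot e rfl, hcoe _ f'.2.ne]
    exact WithBot.bot_lt_coe _
  · exact Subtype.ext (Prod.ext rfl (hp p.1 p.2.2.2.1 p.2.2.2.2).symm)

end Generators

end WeakModularOperad

/-! ### Parallel edges and the subcomplex of graphs with an egg -/

theorem odd_card_inversions_swap {α : Type*} [Fintype α] [LinearOrder α] {a b : α} (h : a ≠ b) :
    Odd (Nat.card {p : α × α // p.1 < p.2 ∧ Equiv.swap a b p.2 < Equiv.swap a b p.1}) := by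
  classical
  wlog hab : a < b generalizing a b
  · rw [Equiv.swap_comm]
    exact this h.symm ((lt_or_gt_of_ne h).resolve_left hab)
  rw [Nat.card_eq_fintype_card, Fintype.card_subtype, ← ZMod.natCast_eq_one_iff_odd,
    Finset.card_eq_sum_ones, Nat.cast_sum]
  have hmem : (a, b) ∈ Finset.univ.filter
      (fun p : α × α => p.1 < p.2 ∧ Equiv.swap a b p.2 < Equiv.swap a b p.1) := by
    simp [hab]
  rw [← Finset.add_sum_erase _ _ hmem]
  have : ∑ x ∈ (Finset.univ.filter (fun p : α × α =>
      p.1 < p.2 ∧ Equiv.swap a b p.2 < Equiv.swap a b p.1)).erase (a, b), ((1 : ℕ) : ZMod 2) = 0 := by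
    -- Apart from `(a, b)` itself, the inversions are paired by applying the transposition to both
    -- entries and exchanging them.
    refine Finset.sum_involution (fun p _ => (Equiv.swap a b p.2, Equiv.swap a b p.1))
      (fun _ _ => by decide) (fun p hp _ hfix => ?_) (fun p hp => ?_) (fun p _ => by simp)
    · obtain ⟨hne, hp⟩ := Finset.mem_erase.1 hp
      obtain ⟨-, hp, -⟩ := Finset.mem_filter.1 hp
      have h1 : Equiv.swap a b p.2 = p.1 := congrArg Prod.fst hfix
      by_cases h2 : p.2 = a
      · rw [h2, Equiv.swap_apply_left] at h1
        rw [← h1, h2] at hp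
        exact absurd hp hab.not_gt
      · by_cases h3 : p.2 = b
        · rw [h3, Equiv.swap_apply_right] at h1
          exact hne (Prod.ext h1.symm h3)
        · rw [Equiv.swap_apply_of_ne_of_ne h2 h3] at h1
          exact hp.ne' h1
    · obtain ⟨hne, hp⟩ := Finset.mem_erase.1 hp
      obtain ⟨-, hp, hp'⟩ := Finset.mem_filter.1 hp
      refine Finset.mem_erase.2 ⟨fun h0 => hne ?_, Finset.mem_filter.2 ⟨Finset.mem_univ _, hp', ?_⟩⟩
      · have h1 : Equiv.swap a b p.2 = a := congrArg Prod.fst h0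
        have h2 : Equiv.swap a b p.1 = b := congrArg Prod.snd h0
        rw [Equiv.swap_apply_eq_iff] at h1 h2
        exact Prod.ext (by simpa using h2) (by simpa using h1)
      · simpa using hp
  rw [this]
  simp

namespace WeakModularOperad

open MGraph ModularCollection

variable {k : Type*} [Field k] {W : WeakModularOperad k}

namespace Generators

variable (U : W.Generators) {X : Type}

include U in
/-- The exchange of two parallel edges between vertices of degree zero changes the sign. -/
theorem eq_zero_of_parallel [CharZero k] [Finite X] {g : ℕ} {D : ℤ} {φ : W.Cochain X}
    (hφ : φ ∈ W.ft g X D) {γ : MGraph X} {d : γ.V → ℕ} (a : W.toModularCollection.Labels γ d)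
    {e f : γ.E} (hef : e ≠ f) (s : Bool)
    (h : ∀ c, γ.vert (Sum.inl (f, xor c s)) = γ.vert (Sum.inl (e, c)))
    (h0 : ∀ c, d (γ.vert (Sum.inl (e, c))) = 0) : φ γ d a = 0 := by
  classical
  have h' : ∀ c, γ.vert (Sum.inl (e, xor c s)) = γ.vert (Sum.inl (f, c)) := fun c => by
    rw [← h, Bool.xor_assoc, Bool.xor_self, Bool.xor_false]
  let x : Bool ≃ Bool := ⟨fun c => xor c s, fun c => xor c s, fun c => by simp, fun c => by simp⟩
  let F : GIso γ γ (Equiv.refl X) := GIso.ofEnds (Equiv.refl _) (Equiv.swap e f)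
    (fun e' => if e' = e ∨ e' = f then x else Equiv.refl _)
    (fun e' c => by
      by_cases h1 : e' = e
      · subst h1
        rw [Equiv.swap_apply_left, if_pos (Or.inl rfl)]; exact h c
      · by_cases h2 : e' = f
        · subst h2
          rw [Equiv.swap_apply_right, if_pos (Or.inr rfl)]; exact h' c
        · rw [Equiv.swap_apply_of_ne_of_ne h1 h2, if_neg (by tauto)]; rfl)
    (fun _ => rfl) (fun _ => rfl)
  have hm : W.toModularCollection.LabelsMatch F (d' := d) (fun _ => rfl) a a := by
    intro v
    have key : Rel (F.onFlag v) (a v) (a v) := by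
      -- Labels of degree zero are invariant under all bijections of the half-edges. At the other
      -- vertices the isomorphism fixes every half-edge, since both ends of the two edges have
      -- degree zero.
      by_cases hv : d v = 0
      · have := γ.finite_flag v
        have h1 := isMul_coef (U := U) hv (a v)
        have h2 := (unit_rel (U := U) (rfl : γ.genus v = γ.genus v) (rfl : d v = d v)
          (F.onFlag v)).smul (U.coef (a v))
        exact Eq.subst (motive := fun b => Rel (F.onFlag v) b b) h1.symm h2
      · have h1 : F.onFlag v = Equiv.refl _ := by
          ext ⟨z, hz⟩
          rcases z with ⟨e', c⟩ | y
          · have h1 : e' ≠ e := by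
              rintro rfl
              exact hv (by rw [← hz]; exact h0 c)
            have h2 : e' ≠ f := by
              rintro rfl
              exact hv (by rw [← hz, ← h' c]; exact h0 _)
            refine (F.onFlag_val v _).trans ?_
            refine congrArg Sum.inl (Prod.ext (Equiv.swap_apply_of_ne_of_ne h1 h2) ?_)
            change (if e' = e ∨ e' = f then x else Equiv.refl _) c = c
            rw [if_neg (by tauto)]; rfl
          · rfl
        rw [h1]
        exact Rel.refl _
    obtain ⟨_, _, h1⟩ := key
    exact h1
  have h1 := hφ.2.2 γ γ F d d (fun _ => rfl) a a hm
  have h2 : F.edgeSign Finset.univ = -1 := by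
    refine Odd.neg_one_pow ?_
    have := odd_card_inversions_swap hef
    rw [Nat.card_congr (Equiv.subtypeEquivRight fun p => ?_)]
    · exact this
    · exact ⟨fun h => ⟨h.2.2.1, h.2.2.2⟩, fun h => ⟨Finset.mem_univ _, Finset.mem_univ _, h.1, h.2⟩⟩
  rw [h2, F.vertexSign_eq_one d (fun _ _ h _ _ => h), one_mul, neg_smul, one_smul] at h1
  exact self_eq_neg.1 h1

include U in
/-- Graphs with an egg span a subcomplex. -/
theorem differential_mem_eggs [CharZero k] [Finite X] {g : ℕ} {D : ℤ} {φ : W.Cochain X}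
    (hφ : φ ∈ W.eggs g X D) : W.differential X φ ∈ W.eggs g X (D + 1) := by
  classical
  have hdφ := differential_mem_ft hφ.1
  refine ⟨hdφ, fun γ d a hegg => ?_⟩
  by_contra hne
  obtain ⟨S, hS, hterm⟩ := Finset.exists_ne_zero_of_sum_ne_zero hne
  obtain ⟨-, hγ, hS⟩ := Finset.mem_filter.1 hS
  have hterm : φ (γ.contract S) (γ.contractDeg S d) (contractLabels W.μ γ S d a) ≠ 0 :=
    fun h => hterm (by rw [h, smul_zero])
  have hv : ∃ v, (γ.contract S).IsEgg (γ.contractDeg S d) v := by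
    by_contra h
    exact hterm (hφ.2 _ _ _ h)
  obtain ⟨v, hv0, hv⟩ := hv
  -- If the egg is an old vertex, then it is also an egg of `γ`: its genus and degree are the same,
  -- and a tadpole there comes from a tadpole of `γ`. So the egg is the new vertex.
  rcases γ.contract_cases S v with rfl | ⟨x, hx, rfl⟩
  swap
  · refine hegg ⟨x, hv0, hv.imp id ?_⟩
    rintro ⟨f, hf⟩
    refine ⟨γ.cEVal S f, fun c => ?_⟩
    have := hf c
    rwa [contract_vert_inl, cproj_eq_cCoe] at this
  rw [contractDeg_cBot, card_sub_E] at hv0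
  -- The label of the new vertex has degree `∑ d + |S| - 1 = 0`, so a single edge is contracted and
  -- its ends have labels of degree zero.
  obtain ⟨e, rfl⟩ : ∃ e, S = {e} := by
    have := hS.1.card_pos
    exact Finset.card_eq_one.1 (by omega)
  rw [Finset.card_singleton, Nat.add_sub_cancel, Finset.sum_eq_zero_iff] at hv0
  have hd : ∀ c, d (γ.vert (Sum.inl (e, c))) = 0 := fun c =>
    hv0 (γ.sV {e} _ (γ.touched_of_mem (Finset.mem_singleton_self e) c)) (Finset.mem_univ _)
  have hg : ∀ c, γ.genus (γ.vert (Sum.inl (e, c))) = 0 := fun c => by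
    by_contra h
    exact hegg ⟨_, hd c, Or.inl (Nat.pos_of_ne_zero h)⟩
  have ht : ∀ f c, ¬ γ.IsTadpoleAt f (γ.vert (Sum.inl (e, c))) := fun f c h =>
    hegg ⟨_, hd c, Or.inr ⟨f, h⟩⟩
  have hne : γ.vert (Sum.inl (e, false)) ≠ γ.vert (Sum.inl (e, true)) := fun h =>
    ht e false (by rintro (_ | _); exacts [rfl, h.symm])
  -- Neither end of `e` is an egg, so both have genus zero and `e` is not a loop. The new vertex
  -- then has genus zero, and its tadpole can only come from an edge parallel to `e`. In this case
  -- it is the whole value of the differential at `γ` that vanishes by antisymmetry, not each single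
  -- term.
  rcases hv with hv | ⟨f, hf⟩
  · rw [genus_cBot] at hv
    have h1 : ∑ v, (γ.sub {e}).genus v = 0 := by
      refine Finset.sum_eq_zero fun v _ => ?_
      obtain ⟨f, hf, c, hv⟩ := γ.sVal_touched {e} v
      rw [Finset.mem_singleton] at hf
      subst hf
      change γ.genus (γ.sVal {f} v) = 0
      rw [← hv, hg]
    have h2 : 1 < Fintype.card (γ.sub {e}).V := Fintype.one_lt_card_iff.2
      ⟨γ.sV {e} _ (γ.touched_of_mem (Finset.mem_singleton_self e) false),
        γ.sV {e} _ (γ.touched_of_mem (Finset.mem_singleton_self e) true),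
        fun h => hne (congrArg (γ.sVal {e}) h)⟩
    unfold totalGenus at hv
    rw [h1, card_sub_E, Finset.card_singleton] at hv
    omega
  · have hf' : ∀ c, ∃ c', γ.vert (Sum.inl (e, c')) = γ.vert (Sum.inl (γ.cEVal {e} f, c)) := fun c => by
      have := hf c
      rw [contract_vert_inl, cproj_eq_cBot] at this
      obtain ⟨e', he', c', h⟩ := this
      rw [Finset.mem_singleton] at he'
      subst he'
      exact ⟨c', h⟩
    obtain ⟨c₀, h₀⟩ := hf' false
    obtain ⟨c₁, h₁⟩ := hf' true
    have hc : c₁ = !c₀ := by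
      by_contra h
      have h : c₁ = c₀ := by cases c₀ <;> cases c₁ <;> simp_all
      refine ht (γ.cEVal {e} f) c₀ ?_
      rintro (_ | _)
      exacts [h₀.symm, h ▸ h₁.symm]
    subst hc
    refine ‹W.differential X φ γ d a ≠ 0› (U.eq_zero_of_parallel hdφ a (e := e) (f := γ.cEVal {e} f)
      (fun h => γ.cEVal_notMem {e} f (Finset.mem_singleton.2 h.symm)) c₀ ?_ hd)
    intro c
    cases c <;> cases c₀ <;> first | exact h₀.symm | exact h₁.symm

end Generators

end WeakModularOperad

/-! ### The weight filtration -/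

namespace MGraph

variable {X : Type} (γ : MGraph X)

/-- The weight that filters the Feynman transform. The contraction of a connected subgraph decreases
it, unless the subgraph is a tadpole at a vertex of degree zero. -/
def weight (d : γ.V → ℕ) : ℤ :=
  Fintype.card γ.V - ∑ v, (d v : ℤ) - ∑ v, if d v = 0 then 0 else (γ.genus v : ℤ)

/-- Let `m` be the number of touched vertices. If the new label has positive degree, the genus of
the subgraph now counts, and the weight drops by at least `(m - 1) + (|S| - 1) + (|S| + 1 - m) =
2|S| - 1 > 0`. If the new label has degree zero, then `S` is one edge with ends of degree zero and
the weight drops by `m - 1`, which is zero only for a tadpole. -/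
theorem weight_contract {S : Finset γ.E} (hS : γ.IsConnectedSubset S) (d : γ.V → ℕ) :
    (γ.contract S).weight (γ.contractDeg S d) < γ.weight d ∨
      ∃ e x, S = {e} ∧ γ.IsTadpoleAt e x ∧ d x = 0 := by
  classical
  have hV := γ.card_contract_V_add S
  have hG := (γ.sub S).totalGenus_cast (γ.sub_connected S hS)
  rw [card_sub_E] at hG
  have hpos := hS.1.card_pos
  have hs1 := γ.sum_sub_ite S (fun v => (d (γ.sVal S v) : ℤ)) (fun v => (d v : ℤ)) (fun _ _ => rfl)
  have hs2 := γ.sum_sub_ite S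
    (fun v => if d (γ.sVal S v) = 0 then 0 else ((γ.sub S).genus v : ℤ))
    (fun v => if d v = 0 then 0 else (γ.genus v : ℤ)) (fun _ _ => rfl)
  have hc1 := γ.sum_contract_ite S (fun v => (γ.contractDeg S d v : ℤ)) (fun v => (d v : ℤ))
    (fun _ _ => rfl)
  have hc2 := γ.sum_contract_ite S
    (fun v => if γ.contractDeg S d v = 0 then 0 else ((γ.contract S).genus v : ℤ))
    (fun v => if d v = 0 then 0 else (γ.genus v : ℤ)) (fun _ _ => rfl)
  have split : ∀ F : γ.V → ℤ, ∑ x, F x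
      = (∑ x, if γ.Touched S x then F x else 0) + ∑ x, if γ.Touched S x then 0 else F x := fun F => by
    rw [← Finset.sum_add_distrib]
    refine Finset.sum_congr rfl fun x _ => ?_
    split_ifs <;> simp
  have h1 := split fun v => (d v : ℤ)
  have h2 := split fun v => if d v = 0 then 0 else (γ.genus v : ℤ)
  have hle : ∑ v, (if d (γ.sVal S v) = 0 then 0 else ((γ.sub S).genus v : ℤ))
      ≤ ∑ v, ((γ.sub S).genus v : ℤ) := Finset.sum_le_sum fun v _ => by
    split_ifs
    · positivity
    · exact le_rfl
  have hm : 0 < Fintype.card (γ.sub S).V := Fintype.card_pos_iff.2 (γ.sub_connected S hS).1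
  by_cases h0 : γ.contractDeg S d (γ.cBot S) = 0
  · have h0' := h0
    rw [contractDeg_cBot, card_sub_E] at h0'
    obtain ⟨e, rfl⟩ : ∃ e, S = {e} := Finset.card_eq_one.1 (by omega)
    have hd0 : ∑ v : (γ.sub {e}).V, d (γ.sVal {e} v) = 0 := by omega
    have hd : ∀ v, d (γ.sVal {e} v) = 0 := fun v =>
      Finset.sum_eq_zero_iff.1 hd0 v (Finset.mem_univ _)
    by_cases hone : Fintype.card (γ.sub {e}).V = 1
    · right
      have hx : ∀ c, γ.Touched {e} (γ.vert (Sum.inl (e, c))) :=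
        γ.touched_of_mem (Finset.mem_singleton_self e)
      have hsub := (Fintype.card_le_one_iff_subsingleton).1 hone.le
      exact ⟨e, γ.vert (Sum.inl (e, false)), rfl,
        fun c => congrArg (γ.sVal {e}) (Subsingleton.elim (γ.sV {e} _ (hx c)) (γ.sV {e} _ (hx false))),
        hd (γ.sV {e} _ (hx false))⟩
    · left
      rw [if_pos h0] at hc2
      rw [h0] at hc1
      simp only [hd, if_pos, Finset.sum_const_zero, Nat.cast_zero] at hs1 hs2
      rw [Nat.cast_zero] at hc1
      unfold weight
      have hm' : 1 < Fintype.card (γ.sub {e}).V := by omega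
      zify at hV hm'
      linarith
  · left
    rw [if_neg h0, genus_cBot] at hc2
    rw [contractDeg_cBot, card_sub_E] at hc1
    unfold weight
    have h3 : ((∑ v : (γ.sub S).V, d (γ.sVal S v) + S.card - 1 : ℕ) : ℤ)
        = ∑ v, (d (γ.sVal S v) : ℤ) + S.card - 1 := by
      push_cast [Nat.cast_sub (show 1 ≤ ∑ v : (γ.sub S).V, d (γ.sVal S v) + S.card by omega)]
      rfl
    rw [h3] at hc1
    zify at hV hpos
    linarith

/-- The genus of a vertex of degree zero does not enter the weight, so the homotopy respects the
filtration. -/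
theorem addTadpole_weight {d : γ.V → ℕ} {v : γ.V} (hd : d v = 0) :
    (γ.addTadpole v).weight d = γ.weight d := by
  unfold weight
  congr 1
  refine Finset.sum_congr rfl fun w _ => ?_
  by_cases hw : d w = 0
  · exact (if_pos hw).trans (if_pos hw).symm
  · rw [addTadpole_genus_of_ne (γ := γ) (v := v) (w := w) fun h => hw (by rw [h, hd])]

theorem weight_le (hγ : γ.Connected) (d : γ.V → ℕ) : γ.weight d ≤ Fintype.card γ.E + 1 := by
  have h1 := γ.card_V_le hγ
  have h2 : 0 ≤ ∑ v, (d v : ℤ) := Finset.sum_nonneg fun _ _ => by positivity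
  have h3 : 0 ≤ ∑ v, if d v = 0 then 0 else (γ.genus v : ℤ) :=
    Finset.sum_nonneg fun _ _ => by split_ifs <;> positivity
  unfold weight
  zify at h1
  linarith

/-- Together with `weight_le`, this bounds the weight on both sides for graphs of given genus and
total degree, so that the filtration is finite there. -/
theorem le_weight (hγ : γ.Connected) (d : γ.V → ℕ) :
    -(∑ v, (d v : ℤ)) - γ.totalGenus ≤ γ.weight d := by
  have h1 : (Fintype.card γ.V : ℤ) ≤ Fintype.card γ.E + 1 := by exact_mod_cast γ.card_V_le hγ
  have h2 := γ.totalGenus_cast hγ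
  have h3 : ∑ v, (if d v = 0 then 0 else (γ.genus v : ℤ)) ≤ ∑ v, (γ.genus v : ℤ) :=
    Finset.sum_le_sum fun _ _ => by split_ifs <;> simp
  have h4 : (0 : ℤ) ≤ Fintype.card γ.V := by positivity
  unfold weight
  linarith

/-- The tadpoles at vertices of degree zero. -/
def eggTadpoles (d : γ.V → ℕ) : Set γ.E :=
  {e | γ.IsTadpoleAt e (γ.vert (Sum.inl (e, false))) ∧ d (γ.vert (Sum.inl (e, false))) = 0}

theorem mem_eggTadpoles {d : γ.V → ℕ} {e : γ.E} {x : γ.V} (he : γ.IsTadpoleAt e x) (hx : d x = 0) :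
    e ∈ γ.eggTadpoles d := by
  have := he false
  subst this
  exact ⟨he, hx⟩

variable {γ} in
-- The vertex `x₀` has a tadpole before the contraction and positive genus afterwards, so both times
-- only its degree decides. In particular the number of eggs by which the homotopy is normalized
-- does not change.
theorem IsTadpoleAt.isEgg_contract_iff {e : γ.E} {x₀ : γ.V} (he : γ.IsTadpoleAt e x₀) {d : γ.V → ℕ}
    (x : γ.V) : (γ.contract {e}).IsEgg (γ.contractDeg {e} d) (γ.cproj {e} x) ↔ γ.IsEgg d x := by
  unfold IsEgg
  rw [γ.contractDeg_tadpole he]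
  refine and_congr_right fun _ => ?_
  by_cases hx : x = x₀
  · refine iff_of_true (Or.inl ?_) (Or.inr ⟨e, hx ▸ he⟩)
    rw [hx, γ.genus_tadpole he]
    omega
  · rw [γ.genus_of_ne_tadpole he hx]
    refine or_congr_right ⟨?_, ?_⟩
    · rintro ⟨f, hf⟩
      refine ⟨γ.cEVal {e} f, fun c => ?_⟩
      have := hf c
      rw [contract_vert_inl] at this
      exact (γ.cproj_tadpole_bijective he).1 this
    · rintro ⟨f, hf⟩
      have hfe : f ∉ ({e} : Finset γ.E) := fun h => by
        rw [Finset.mem_singleton] at h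
        subst h
        exact hx ((hf false).symm.trans (he false))
      refine ⟨γ.cE {e} f hfe, fun c => ?_⟩
      rw [contract_vert_cE, hf]

variable {γ} in
theorem IsTadpoleAt.card_eggs_contract {e : γ.E} {x₀ : γ.V} (he : γ.IsTadpoleAt e x₀) (d : γ.V → ℕ) :
    Nat.card {v // (γ.contract {e}).IsEgg (γ.contractDeg {e} d) v} = Nat.card {v // γ.IsEgg d v} :=
  (Nat.card_congr ((Equiv.ofBijective _ (γ.cproj_tadpole_bijective he)).subtypeEquiv
    fun x => (he.isEgg_contract_iff x).symm)).symm

end MGraph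

namespace WeakModularOperad

open MGraph ModularCollection

variable {k : Type*} [Field k] {W : WeakModularOperad k} {X : Type}

open Classical in
/-- The terms of the differential that do not decrease the weight. -/
theorem differential_leading {ψ : W.Cochain X} {p : ℤ}
    (hψ : ∀ γ d a, γ.weight d < p → ψ γ d a = 0) {γ : MGraph X} (hγ : γ.IsModular) {d : γ.V → ℕ}
    (a : W.toModularCollection.Labels γ d) (hw : γ.weight d ≤ p) :
    W.differential X ψ γ d a = ∑ e, if e ∈ γ.eggTadpoles d then
      γ.contractSign {e} d • ψ (γ.contract {e}) (γ.contractDeg {e} d)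
        (contractLabels W.μ γ {e} d a) else 0 := by
  rw [← Finset.sum_filter]
  let s : γ.E ↪ Finset γ.E := ⟨fun e => {e}, Finset.singleton_injective⟩
  refine Eq.trans (Finset.sum_subset (s₁ := (Finset.univ.filter (· ∈ γ.eggTadpoles d)).map s)
    (fun S hS => ?_) (fun S hS hS' => ?_)).symm (Finset.sum_map _ s _)
  · obtain ⟨e, he, rfl⟩ := Finset.mem_map.1 hS
    exact Finset.mem_filter.2 ⟨Finset.mem_univ _, hγ,
      γ.isConnectedSubset_tadpole (Finset.mem_filter.1 he).2.1⟩
  · obtain ⟨-, -, hS⟩ := Finset.mem_filter.1 hS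
    rcases γ.weight_contract hS d with h | ⟨e, x, rfl, he, hx⟩
    · rw [hψ _ _ _ (h.trans_le hw), smul_zero]
    · exact absurd (Finset.mem_map.2 ⟨e, Finset.mem_filter.2 ⟨Finset.mem_univ _,
        γ.mem_eggTadpoles he hx⟩, rfl⟩) hS'

end WeakModularOperad

theorem WithBot.natCard_lt_coe {α : Type*} [Finite α] [Preorder α] (e : α) :
    Nat.card {f : WithBot α // f < e} = Nat.card {f : α // f < e} + 1 := by
  rw [← Finite.card_option]
  refine (Nat.card_congr (Equiv.ofBijective (fun o : Option {f : α // f < e} =>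
    (o.elim ⟨⊥, WithBot.bot_lt_coe e⟩ fun f => ⟨f.1, WithBot.coe_lt_coe.2 f.2⟩ :
      {f : WithBot α // f < e})) ⟨?_, ?_⟩)).symm
  · rintro (_ | f) (_ | f') h
    · rfl
    · cases congrArg Subtype.val h
    · cases congrArg Subtype.val h
    · exact congrArg some (Subtype.ext (WithBot.coe_inj.1 (congrArg Subtype.val h)))
  · rintro ⟨f, hf⟩
    induction f using WithBot.recBotCoe with
    | bot => exact ⟨none, rfl⟩
    | coe f => exact ⟨some ⟨f, WithBot.coe_lt_coe.1 hf⟩, rfl⟩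

/-! ### The homotopy at the lowest weight and acyclicity -/

namespace WeakModularOperad

open MGraph ModularCollection

variable {k : Type*} [Field k] {W : WeakModularOperad k} {X : Type}

namespace Generators

variable {U : W.Generators} {γ : MGraph X} {d : γ.V → ℕ} {a : W.toModularCollection.Labels γ d}
  [Finite X] {g : ℕ} {D : ℤ} {φ : W.Cochain X} (hφ : φ ∈ W.ft g X D)

include hφ

/-- Where the genus is already positive in `γ`, adding a tadpole commutes with the contraction of
`e`. The contraction admits one more place only if `x₀` has genus zero, and adding a tadpole there
gives back `γ`. -/
theorem addSum_contract (hγ : γ.IsModular) {e : γ.E} {x₀ : γ.V} (he : γ.IsTadpoleAt e x₀)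
    (hx₀ : d x₀ = 0) :
    U.addSum φ (γ.contract {e}) (γ.contractDeg {e} d) (contractLabels W.μ γ {e} d a)
      = (∑ v, if d v = 0 ∧ 0 < γ.genus v then
          φ ((γ.addTadpole v).contract {(e : WithBot γ.E)})
            ((γ.addTadpole v).contractDeg {(e : WithBot γ.E)} d)
            (contractLabels W.μ (γ.addTadpole v) {(e : WithBot γ.E)} d (U.addLabels γ v d a)) else 0)
        + if γ.genus x₀ = 0 then γ.contractSign {e} d • φ γ d a else 0 := by
  have key : ∀ v, (if γ.contractDeg {e} d (γ.cproj {e} v) = 0 ∧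
        0 < (γ.contract {e}).genus (γ.cproj {e} v) then
        φ ((γ.contract {e}).addTadpole (γ.cproj {e} v)) (γ.contractDeg {e} d)
          (U.addLabels (γ.contract {e}) (γ.cproj {e} v) (γ.contractDeg {e} d)
            (contractLabels W.μ γ {e} d a)) else 0)
      = (if d v = 0 ∧ 0 < γ.genus v then
          φ ((γ.addTadpole v).contract {(e : WithBot γ.E)})
            ((γ.addTadpole v).contractDeg {(e : WithBot γ.E)} d)
            (contractLabels W.μ (γ.addTadpole v) {(e : WithBot γ.E)} d (U.addLabels γ v d a)) else 0)
        + if v = x₀ then (if γ.genus x₀ = 0 then γ.contractSign {e} d • φ γ d a else 0) else 0 := by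
    intro v
    rw [γ.contractDeg_tadpole he]
    by_cases hv : v = x₀
    · subst hv
      rw [if_pos (⟨hx₀, by rw [γ.genus_tadpole he]; omega⟩ : d v = 0 ∧ _), if_pos rfl]
      by_cases h0 : γ.genus v = 0
      · rw [if_neg (by omega), if_pos h0, zero_add, addTadpole_contract hφ hγ he hx₀]
      · rw [if_pos ⟨hx₀, Nat.pos_of_ne_zero h0⟩, if_neg h0, add_zero,
          contract_addTadpole_of_ne hφ hγ hx₀ (Nat.pos_of_ne_zero h0) he hx₀]
    · rw [γ.genus_of_ne_tadpole he hv, if_neg hv, add_zero]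
      by_cases h : d v = 0 ∧ 0 < γ.genus v
      · rw [if_pos h, if_pos h, contract_addTadpole_of_ne hφ hγ h.1 h.2 he hx₀]
      · rw [if_neg h, if_neg h]
  rw [addSum, ← Equiv.sum_comp (Equiv.ofBijective _ (γ.cproj_tadpole_bijective he))]
  refine (Finset.sum_congr rfl fun v _ => key v).trans ?_
  rw [Finset.sum_add_distrib, Finset.sum_ite_eq' Finset.univ x₀, if_pos (Finset.mem_univ _)]

open Classical in
/-- The leading terms of the differential at a graph with a new tadpole. -/
theorem sum_contract_addTadpole {p : ℤ} (hp : ∀ γ d a, γ.weight d < p → φ γ d a = 0)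
    (hd : W.differential X φ = 0) (hγ : γ.IsModular) (hw : γ.weight d ≤ p) {v : γ.V} (h0 : d v = 0)
    (hv : 0 < γ.genus v) :
    (∑ e, if e ∈ γ.eggTadpoles d then γ.contractSign {e} d •
      φ ((γ.addTadpole v).contract {(e : WithBot γ.E)})
        ((γ.addTadpole v).contractDeg {(e : WithBot γ.E)} d)
        (contractLabels W.μ (γ.addTadpole v) {(e : WithBot γ.E)} d (U.addLabels γ v d a)) else 0)
      = φ γ d a := by
  have h1 := differential_leading hp ((addTadpole_isModular hv).2 hγ) (U.addLabels γ v d a)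
    ((γ.addTadpole_weight h0).trans_le hw)
  rw [hd] at h1
  have hbot : (γ.addTadpole v).contractSign {(⊥ : WithBot γ.E)} d = 1 := by
    rw [(γ.addTadpole v).contractSign_tadpole (bot_isTadpoleAt v) h0]
    have : IsEmpty {f : WithBot γ.E // f < ⊥} := ⟨fun f => WithBot.not_lt_bot _ f.2⟩
    exact (congrArg _ Nat.card_of_isEmpty).trans (pow_zero _)
  -- The new tadpole is the first edge, so each old edge has one more predecessor and its sign
  -- changes, while the new tadpole itself has sign one. The cocycle condition thus expresses `φ` at
  -- `γ` by the contractions of the old tadpoles.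
  have hcoe : ∀ e x, γ.IsTadpoleAt e x → d x = 0 →
      (γ.addTadpole v).contractSign {(e : WithBot γ.E)} d = - γ.contractSign {e} d := by
    intro e x he hx
    rw [(γ.addTadpole v).contractSign_tadpole (e := (e : WithBot γ.E)) (x₀ := x) he hx,
      γ.contractSign_tadpole he hx]
    have h2 := WithBot.natCard_lt_coe e
    exact (congrArg _ h2).trans (by rw [pow_succ, mul_neg_one])
  have h2 := h1.trans (Fintype.sum_withBot (α := γ.E) _)
  rw [if_pos ⟨bot_isTadpoleAt v, h0⟩, hbot, one_smul, contract_addTadpole hφ hγ h0 hv] at h2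
  have h3 : ∀ e : γ.E, ((e : WithBot γ.E) ∈ (γ.addTadpole v).eggTadpoles d) ↔ e ∈ γ.eggTadpoles d :=
    fun e => Iff.rfl
  rw [← sub_eq_zero, ← neg_eq_zero]
  refine Eq.trans ?_ h2.symm
  rw [neg_sub, sub_eq_add_neg, ← Finset.sum_neg_distrib]
  congr 1
  refine Finset.sum_congr rfl fun e _ => ?_
  by_cases he : e ∈ γ.eggTadpoles d
  · rw [if_pos he]
    refine Eq.trans ?_ (if_pos ((h3 e).2 he)).symm
    rw [hcoe e _ he.1 he.2, neg_smul]
  · rw [if_neg he, neg_zero]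
    exact (if_neg fun h => he ((h3 e).1 h)).symm

omit [Finite X] hφ in
open Classical in
-- An egg has either positive genus, or genus zero and a tadpole. In the second case the tadpole is
-- unique by the hypothesis, so these eggs can be counted by their tadpoles.
theorem card_eggs (h : Set.InjOn (fun e => γ.vert (Sum.inl (e, false))) (γ.eggTadpoles d)) :
    Nat.card {v // γ.IsEgg d v} = (∑ v, if d v = 0 ∧ 0 < γ.genus v then 1 else 0)
      + ∑ e, if e ∈ γ.eggTadpoles d then
        (if γ.genus (γ.vert (Sum.inl (e, false))) = 0 then 1 else 0) else 0 := by
  have h1 : ∀ e, (if e ∈ γ.eggTadpoles d then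
      (if γ.genus (γ.vert (Sum.inl (e, false))) = 0 then 1 else 0) else 0)
      = if e ∈ γ.eggTadpoles d ∧ γ.genus (γ.vert (Sum.inl (e, false))) = 0 then 1 else 0 := fun e =>
    (ite_and _ _ _ _).symm
  rw [Finset.sum_congr rfl fun e _ => h1 e, ← Finset.card_filter, ← Finset.card_filter,
    ← Finset.card_image_of_injOn (s := Finset.univ.filter (fun e => e ∈ γ.eggTadpoles d ∧
      γ.genus (γ.vert (Sum.inl (e, false))) = 0)) (f := fun e => γ.vert (Sum.inl (e, false)))
      (fun e he f hf hef => h (Finset.mem_filter.1 he).2.1 (Finset.mem_filter.1 hf).2.1 hef),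
    ← Finset.card_union_of_disjoint, Nat.card_eq_fintype_card, Fintype.card_subtype]
  · congr 1
    ext v
    simp only [Finset.mem_filter, Finset.mem_univ, true_and, Finset.mem_union, Finset.mem_image]
    constructor
    · rintro ⟨h0, hv⟩
      by_cases hg : 0 < γ.genus v
      · exact Or.inl ⟨h0, hg⟩
      · obtain ⟨e, he⟩ := hv.resolve_left hg
        exact Or.inr ⟨e, ⟨γ.mem_eggTadpoles he h0, by rw [he false]; omega⟩, he false⟩
    · rintro (⟨h0, hg⟩ | ⟨e, ⟨he, -⟩, rfl⟩)
      · exact ⟨h0, Or.inl hg⟩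
      · exact ⟨he.2, Or.inr ⟨e, he.1⟩⟩
  · rw [Finset.disjoint_left]
    intro v hv hv'
    obtain ⟨e, he, rfl⟩ := Finset.mem_image.1 hv'
    exact absurd (Finset.mem_filter.1 hv).2.2 (by rw [(Finset.mem_filter.1 he).2.2]; omega)

omit hφ in
-- In lowest weight only tadpoles are contracted. For each vertex of degree zero and positive genus,
-- the terms that add a tadpole there and contract an old one sum to `φ` by the cocycle condition.
-- For each tadpole at a vertex of degree zero and genus zero, contracting it and adding it again
-- gives `φ` once more. The total is `φ` times the number of eggs, which the normalization cancels.
theorem differential_homotopy [CharZero k] (hφ : φ ∈ W.eggs g X (D + 1)) {p : ℤ}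
    (hp : ∀ γ d a, γ.weight d < p → φ γ d a = 0) (hd : W.differential X φ = 0) (hγ : γ.IsModular)
    (hw : γ.weight d ≤ p) : W.differential X (U.homotopy φ) γ d a = φ γ d a := by
  classical
  have hp' : ∀ γ d a, γ.weight d < p → U.homotopy φ γ d a = 0 := fun γ d a hw => by
    refine mul_eq_zero_of_right _ (Finset.sum_eq_zero fun v _ => ?_)
    split_ifs with h
    · exact hp _ _ _ ((γ.addTadpole_weight h.1).trans_lt hw)
    · rfl
  set N : k := (Nat.card {v // γ.IsEgg d v} : k) with hN
  have h1 : W.differential X (U.homotopy φ) γ d a = N⁻¹ *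
      ((∑ v, (if d v = 0 ∧ 0 < γ.genus v then (1 : k) else 0)) + ∑ e, if e ∈ γ.eggTadpoles d then
        (if γ.genus (γ.vert (Sum.inl (e, false))) = 0 then 1 else 0) else 0) * φ γ d a := by
    refine (differential_leading hp' hγ a hw).trans ?_
    have h2 : ∀ e, (if e ∈ γ.eggTadpoles d then γ.contractSign {e} d •
        U.homotopy φ (γ.contract {e}) (γ.contractDeg {e} d) (contractLabels W.μ γ {e} d a) else 0)
        = N⁻¹ * ((∑ v, if d v = 0 ∧ 0 < γ.genus v then (if e ∈ γ.eggTadpoles d then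
          γ.contractSign {e} d • φ ((γ.addTadpole v).contract {(e : WithBot γ.E)})
            ((γ.addTadpole v).contractDeg {(e : WithBot γ.E)} d)
            (contractLabels W.μ (γ.addTadpole v) {(e : WithBot γ.E)} d (U.addLabels γ v d a))
            else 0) else 0)
          + (if e ∈ γ.eggTadpoles d then
            (if γ.genus (γ.vert (Sum.inl (e, false))) = 0 then 1 else 0) else 0) * φ γ d a) := by
      intro e
      by_cases he : e ∈ γ.eggTadpoles d
      · simp only [if_pos he]
        rw [homotopy, he.1.card_eggs_contract, ← hN, ← mul_smul_comm,
          addSum_contract hφ.1 hγ he.1 he.2, smul_add, Finset.smul_sum]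
        congr 2
        · refine Finset.sum_congr rfl fun v _ => ?_
          split_ifs
          · rfl
          · exact smul_zero _
        · split_ifs
          · rw [smul_smul, one_mul]
            have : γ.contractSign {e} d * γ.contractSign {e} d = 1 := by
              unfold contractSign
              rw [← mul_pow, neg_one_mul, neg_neg, one_pow]
            rw [this, one_smul]
          · rw [smul_zero, zero_mul]
      · simp [if_neg he]
    rw [Finset.sum_congr rfl fun e _ => h2 e, ← Finset.mul_sum, Finset.sum_add_distrib,
      ← Finset.sum_mul, Finset.sum_comm, mul_assoc, add_mul]
    refine congrArg (N⁻¹ * ·) (congrArg (· + _) ?_)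
    rw [Finset.sum_mul]
    refine Finset.sum_congr rfl fun v _ => ?_
    by_cases hv : d v = 0 ∧ 0 < γ.genus v
    · simp only [if_pos hv]
      rw [one_mul]
      exact sum_contract_addTadpole hφ.1 hp hd hγ hw hv.1 hv.2
    · simp [if_neg hv]
  rw [h1]
  by_cases h0 : φ γ d a = 0
  · rw [h0, mul_zero]
  -- Two tadpoles at the same vertex of degree zero are parallel edges, and then `φ` vanishes at
  -- `γ`.
  have hinj : Set.InjOn (fun e => γ.vert (Sum.inl (e, false))) (γ.eggTadpoles d) := by
    intro e he f hf hef
    by_contra hne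
    refine h0 (U.eq_zero_of_parallel hφ.1 a hne false (fun c => ?_) fun c => ?_)
    · rw [Bool.xor_false, he.1 c, hf.1 c]
      exact hef.symm
    · rw [he.1 c, he.2]
  have hegg : ∃ v, γ.IsEgg d v := by
    by_contra h
    exact h0 (hφ.2 γ d a h)
  have hne : N ≠ 0 := by
    obtain ⟨v, hv⟩ := hegg
    have : Nonempty {v // γ.IsEgg d v} := ⟨⟨v, hv⟩⟩
    exact Nat.cast_ne_zero.2 Nat.card_pos.ne'
  have h3 := congrArg (Nat.cast : ℕ → k) (card_eggs hinj)
  push_cast at h3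
  rw [← h3, ← hN, inv_mul_cancel₀ hne, one_mul]

omit hφ in
/-- The subcomplex spanned by the graphs with an egg is acyclic. -/
theorem exists_differential_eq [CharZero k] (U : W.Generators) (hφ : φ ∈ W.eggs g X (D + 1))
    (hd : W.differential X φ = 0) : ∃ ξ ∈ W.eggs g X D, W.differential X ξ = φ := by
  -- The homotopy applied to the remaining error, which is again a cocycle, improves the
  -- approximation by one step of the filtration. For `n = 0` nothing has to be done, because in
  -- degree `D + 1` and genus `g` all weights are at least `-(D + 1) - g`.
  have key : ∀ n : ℕ, ∃ ξ ∈ W.eggs g X D,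
      ∀ γ d a, γ.weight d < -(D + 1) - g + n → (φ - W.differential X ξ) γ d a = 0 := by
    intro n
    induction n with
    | zero =>
      refine ⟨0, Submodule.zero_mem _, fun γ d a hw => ?_⟩
      rw [map_zero, sub_zero]
      by_contra h
      obtain ⟨h1, h2, h3⟩ := hφ.1.2.1 _ _ _ h
      have h4 := γ.le_weight h1.connected d
      rw [h2] at h4
      push_cast at hw
      have h5 : (0 : ℤ) ≤ Fintype.card γ.E := by positivity
      linarith
    | succ n ih =>
      obtain ⟨ξ, hξ, h⟩ := ih
      have hψ : φ - W.differential X ξ ∈ W.eggs g X (D + 1) :=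
        Submodule.sub_mem _ hφ (U.differential_mem_eggs hξ)
      have hdψ : W.differential X (φ - W.differential X ξ) = 0 := by
        rw [map_sub, hd, differential_differential hξ.1, sub_zero]
      have hh := U.homotopy_mem hψ.1
      refine ⟨ξ + U.homotopy (φ - W.differential X ξ), Submodule.add_mem _ hξ hh, fun γ d a hw => ?_⟩
      rw [map_add, ← sub_sub]
      by_cases hγ : γ.IsModular
      · have := differential_homotopy (U := U) (a := a) hψ h hdψ hγ
          (by push_cast at hw; linarith : γ.weight d ≤ _)
        rw [Pi.sub_apply, Pi.sub_apply, Pi.sub_apply, this, sub_self]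
      · have hmem := Submodule.sub_mem _ hψ (U.differential_mem_eggs hh)
        by_contra hne
        exact hγ (hmem.1.2.1 _ _ _ hne).1
  -- The error vanishes below weight `-(D + 1) - g + (2D + 4 + g) = D + 3`. A graph in degree `D +
  -- 1` has at most `D + 1` edges, hence weight at most `D + 2`.
  obtain ⟨ξ, hξ, h⟩ := key (2 * D + 4 + g).toNat
  refine ⟨ξ, hξ, (sub_eq_zero.1 ?_).symm⟩
  funext γ d a
  by_contra hne
  obtain ⟨h1, -, h3⟩ := (Submodule.sub_mem _ hφ (U.differential_mem_eggs hξ)).1.2.1 _ _ _ hne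
  refine hne (h γ d a ?_)
  have h4 := γ.weight_le h1.connected d
  have h5 : 0 ≤ ∑ v, (d v : ℤ) := Finset.sum_nonneg fun _ _ => by positivity
  have h6 := Int.self_le_toNat (2 * D + 4 + g)
  linarith

end Generators

end WeakModularOperad

theorem mainTheorem1 {k : Type*} [Field k] [CharZero k] (W : WeakModularOperad k)
    (hW : W.ExtendsLieGraphHomology) (g n : ℕ) :
    (∀ D : ℤ, ∀ φ ∈ W.ft g (Fin n) D, W.differential (Fin n) φ ∈ W.ft g (Fin n) (D + 1) ∧
      W.differential (Fin n) (W.differential (Fin n) φ) = 0) ∧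
    (∀ D : ℤ, ∀ φ ∈ W.eggs g (Fin n) D,
      W.differential (Fin n) φ ∈ W.eggs g (Fin n) (D + 1)) ∧
    (∀ D : ℤ, ∀ φ ∈ W.eggs g (Fin n) (D + 1), W.differential (Fin n) φ = 0 →
      ∃ ξ ∈ W.eggs g (Fin n) D, W.differential (Fin n) ξ = φ) := by
  obtain ⟨U⟩ := WeakModularOperad.exists_generators hW
  exact ⟨fun _ _ hφ => ⟨WeakModularOperad.differential_mem_ft hφ,
      WeakModularOperad.differential_differential hφ⟩,
    fun _ _ hφ => U.differential_mem_eggs hφ,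
    fun _ _ hφ hd => U.exists_differential_eq hφ hd⟩
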